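/- Let $n,m\ge 1$ be integers, $\mathbb{R}^{1+n}_+=\{(t,x): t>0,\ x\in\mathbb{R}^n\}$, $\partial_0=\partial_t$ and $\partial_i=\partial_{x_i}$ for $1\le i\le n$. Let $A=(A_{i,j}^{\alpha,\beta})_{0\le i,j\le n}^{1\le\alpha,\beta\le m}\in L^\infty(\mathbb{R}^{1+n}_+;\mathcal{L}(\mathbb{C}^{m(1+n)}))$ be a bounded measurable (possibly $t$-dependent) complex matrix function, write $A\xi\cdot\overline{\eta}=\sum_{i,j,\alpha,\beta}A_{i,j}^{\alpha,\beta}\xi_j^\beta\overline{\eta_i^\alpha}$, and assume the stronger Gårding inequality: for some $\lambda>0$, $$\int_{\mathbb{R}^{1+n}_+}\mathrm{Re}\,(A\nabla g\cdot\overline{\nabla g})\,dt\,dx\ \ge\ \lambda\sum_{i=0}^n\sum_{\alpha=1}^m\int_{\mathbb{R}^{1+n}_+}|\partial_i g^\alpha|^2\,dt\,dx\qquad\text{for all } g\in C^1_0(\mathbb{R}^{1+n};\mathbb{C}^m).$$ Let $\mathcal{E}=\dot H^1(\mathbb{R}^{1+n}_+;\mathbb{C}^m)$ be the space of $u\in L^2_{loc}(\mathbb{R}^{1+n}_+;\mathbb{C}^m)$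 with weak gradient $\nabla u\in L^2(\mathbb{R}^{1+n}_+)$. Each $u\in\mathcal{E}$ belongs, up to modification on null sets, to $C([0,\infty);L^2_{loc}(\mathbb{R}^n;\mathbb{C}^m))$; its trace $u|_{t=0}$ is denoted by $u_0$, and $\nabla u_0$ is the distributional (tangential) gradient of $u_0$ on $\mathbb{R}^n$. An energy solution of $\mathrm{div}\,A\nabla u=0$ is a $u\in\mathcal{E}$ that satisfies this system on $\mathbb{R}^{1+n}_+$ in the sense of distributions. Its conormal derivative $\partial_{\nu_A}u_0$ is the distribution on $\mathbb{R}^n$ (in $\dot H^{-1/2}(\mathbb{R}^n;\mathbb{C}^m)$) determined, in the sesquilinear pairing, by $$\int_{\mathbb{R}^{1+n}_+}A\nabla u\cdot\overline{\nabla\phi}\,dt\,dx=-\langle\partial_{\nu_A}u_0,\phi_0\rangle\qquad\text{for all }\phi\in\mathcal{E}.$$ Let $1<p<\infty$ and $p'=p/(p-1)$. Let $\dot W^{-1,p'}(\mathbb{R}^n)$ be the dual of $\dot W^{1,p}(\mathbb{R}^n)=\{f\in L^1_{loc}:\nabla f\in L^p\}$ with $\|f\|_{\dot W^{1,p}}=\|\nabla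 f\|_p$, regarded as a space of distributions (and similarly for vector-valued functions). The $L^p$ and $\dot W^{-1,p'}$ norms of a distribution that does not belong to the space are $+\infty$. Let $A^*$ be the pointwise adjoint of $A$. Then the following are equivalent: 1. There exists $C_p<\infty$ such that $\|\nabla u_0\|_{p}\le C_p\|\partial_{\nu_A}u_0\|_{p}$ for every energy solution $u\in\mathcal{E}$ of $\mathrm{div}\,A\nabla u=0$. 2. There exists $C_{p'}<\infty$ such that $\|\nabla w_0\|_{\dot W^{-1,p'}}\le C_{p'}\|\partial_{\nu_{A^*}}w_0\|_{\dot W^{-1,p'}}$ for every energy solution $w\in\mathcal{E}$ of $\mathrm{div}\,A^*\nabla w=0$. -/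

import Mathlib

open MeasureTheory Filter Topology Set
open scoped ENNReal NNReal Distributions Matrix ComplexConjugate

/-! ### Half-space, directions, gradients -/

/-- The boundary `ℝⁿ`. -/
abbrev Bdry (n : ℕ) : Type := EuclideanSpace ℝ (Fin n)

/-- The space `ℝ^{1+n}`, with points `(t, x)` (with the product Lebesgue measure). -/
abbrev Full (n : ℕ) : Type := ℝ × EuclideanSpace ℝ (Fin n)

/-- The open upper half-space `ℝ^{1+n}_+ = {(t, x) : t > 0}`. -/
def halfSpace (n : ℕ) : TopologicalSpace.Opens (Full n) :=
  ⟨{z | 0 < z.1}, isOpen_lt continuous_const continuous_fst⟩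

/-- The coordinate directions of `ℝ^{1+n}`: number `0` is the `t`-direction, and the
numbers `1, …, n` are the `x`-directions. -/
noncomputable def fullDir (n : ℕ) : Fin (n + 1) → Full n :=
  Fin.cons ((1 : ℝ), (0 : Bdry n)) fun j => ((0 : ℝ), EuclideanSpace.single j (1 : ℝ))

/-- The coordinate directions of `ℝⁿ`. -/
noncomputable def bdryDir (n : ℕ) : Fin n → Bdry n := fun j => EuclideanSpace.single j (1 : ℝ)

/-- The classical gradient of a vector valued function `φ` along a family `e` of directions;
its `(α, i)` entry is the derivative of the component `φ^α` in the direction `e i`. -/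
noncomputable def classicalGrad {V ι κ : Type*} [NormedAddCommGroup V] [NormedSpace ℝ V]
    [Fintype ι] [Fintype κ] (e : κ → V) (φ : V → EuclideanSpace ℂ ι) (z : V) :
    EuclideanSpace ℂ (ι × κ) :=
  WithLp.toLp 2 fun a => (fderiv ℝ φ z (e a.2)) a.1

/-- `M ξ · conj η = ∑_{a, b} M_{a b} ξ_b conj(η_a)`; here an index is a pair `(α, i)` of a
component `α` and a direction `i`. -/
noncomputable def sesqForm {κ : Type*} [Fintype κ] (M : Matrix κ κ ℂ)
    (ξ η : EuclideanSpace ℂ κ) : ℂ :=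
  ∑ a, ∑ b, M a b * ξ b * conj (η a)

/-- The (matrix valued) coefficients of a system of `m` equations on `ℝ^{1+n}_+`: the entry
with indices `(α, i)`, `(β, j)` is `A_{i,j}^{α,β}`. -/
abbrev Coeff (n m : ℕ) : Type :=
  Full n → Matrix (Fin m × Fin (n + 1)) (Fin m × Fin (n + 1)) ℂ

/-- The coefficients are measurable and essentially bounded on the upper half-space. -/
def IsBoundedMeasurable {n m : ℕ} (A : Coeff n m) : Prop :=
  ∀ a b, MemLp (fun z => A z a b) ∞ (volume.restrict (halfSpace n : Set (Full n)))

/-- The stronger Gårding inequality: integrals over the upper half-space, and test functions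
that are `C¹` with compact support in the whole of `ℝ^{1+n}`. -/
def StrongGarding {n m : ℕ} (A : Coeff n m) : Prop :=
  ∃ c : ℝ, 0 < c ∧ ∀ g : Full n → EuclideanSpace ℂ (Fin m),
    ContDiff ℝ 1 g → HasCompactSupport g →
      c * ∑ a : Fin m × Fin (n + 1),
          ∫ z in (halfSpace n : Set (Full n)), ‖classicalGrad (fullDir n) g z a‖ ^ 2 ≤
        ∫ z in (halfSpace n : Set (Full n)),
          (sesqForm (A z) (classicalGrad (fullDir n) g z) (classicalGrad (fullDir n) g z)).re

/-! ### The energy space and energy solutions -/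

/-- `u` belongs to the energy space `Ḣ¹(ℝ^{1+n}_+; ℂᵐ)` and `G` is its weak gradient:
`u` is locally square integrable in the open half-space and its distributional gradient `G`
is square integrable over the half-space. -/
structure IsEnergyFunction {n m : ℕ} (u : Full n → EuclideanSpace ℂ (Fin m))
    (G : Full n → EuclideanSpace ℂ (Fin m × Fin (n + 1))) : Prop where
  memLp_loc : ∀ K : Set (Full n), IsCompact K → K ⊆ (halfSpace n : Set (Full n)) →
    MemLp u 2 (volume.restrict K)
  memLp_grad : MemLp G 2 (volume.restrict (halfSpace n : Set (Full n)))
  weak_grad : ∀ (φ : 𝓓(halfSpace n, ℝ)) (α : Fin m) (i : Fin (n + 1)),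
    ∫ z in (halfSpace n : Set (Full n)), (fderiv ℝ φ z (fullDir n i)) • (u z α) =
      - ∫ z in (halfSpace n : Set (Full n)), (φ z) • (G z (α, i))

/-- `u`, with weak gradient `G`, is an energy solution of `div A ∇u = 0` in `ℝ^{1+n}_+`. -/
structure IsEnergySolution {n m : ℕ} (A : Coeff n m) (u : Full n → EuclideanSpace ℂ (Fin m))
    (G : Full n → EuclideanSpace ℂ (Fin m × Fin (n + 1))) : Prop where
  energy : IsEnergyFunction u G
  weak_sol : ∀ φ : 𝓓(halfSpace n, EuclideanSpace ℂ (Fin m)),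
    ∫ z in (halfSpace n : Set (Full n)),
      sesqForm (A z) (G z) (classicalGrad (fullDir n) φ z) = 0

/-- `f = u|_{t=0}`: up to modification on null sets, `t ↦ u(t, ·)` is continuous on `[0, ∞)`
with values in `L²_loc(ℝⁿ; ℂᵐ)`, and its value at `t = 0` is `f`. -/
def IsTrace {n m : ℕ} (u : Full n → EuclideanSpace ℂ (Fin m))
    (f : Bdry n → EuclideanSpace ℂ (Fin m)) : Prop :=
  ∃ U : ℝ → Bdry n → EuclideanSpace ℂ (Fin m),
    (∀ᵐ t ∂(volume.restrict (Ioi (0 : ℝ))), U t =ᵐ[volume] fun x => u (t, x)) ∧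
    (∀ t, 0 ≤ t → ∀ K : Set (Bdry n), IsCompact K → MemLp (U t) 2 (volume.restrict K)) ∧
    (∀ t, 0 ≤ t → ∀ K : Set (Bdry n), IsCompact K →
      Tendsto (fun s => eLpNorm (U s - U t) 2 (volume.restrict K)) (𝓝[Ici 0] t) (𝓝 0)) ∧
    U 0 = f

/-! ### Distributions on the boundary -/

/-- `ℂ^ι`-valued distributions on `ℝⁿ`, in the sesquilinear pairing: continuous conjugate
linear forms on the space of complex test functions. -/
abbrev BdryDistribution (n : ℕ) (ι : Type) [Fintype ι] : Type :=
  𝓓((⊤ : TopologicalSpace.Opens (Bdry n)), EuclideanSpace ℂ ι) →SL[starRingEnd ℂ] ℂ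

/-- The distribution `φ ↦ ∫ f · conj φ` of a locally integrable function `f` (and the zero
distribution if `f` is not locally integrable). -/
noncomputable def BdryDistribution.ofFun {n : ℕ} {ι : Type} [Fintype ι]
    (f : Bdry n → EuclideanSpace ℂ ι) : BdryDistribution n ι :=
  let B : EuclideanSpace ℂ ι →L[ℝ] EuclideanSpace ℂ ι →L[ℝ] ℂ :=
    (isBoundedBilinearMap_inner (𝕜 := ℂ) (E := EuclideanSpace ℂ ι)).toContinuousLinearMap
  let L : 𝓓((⊤ : TopologicalSpace.Opens (Bdry n)), EuclideanSpace ℂ ι) →L[ℝ] ℂ :=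
    TestFunction.integralAgainstBilinCLM B volume f
  { toFun := L
    map_add' := L.map_add
    map_smul' := by
      intro c φ
      by_cases hf : LocallyIntegrableOn f
          ((⊤ : TopologicalSpace.Opens (Bdry n)) : Set (Bdry n)) volume
      · simp only [L, TestFunction.integralAgainstBilinCLM_eq_integral hf]
        rw [smul_eq_mul, ← integral_const_mul]
        refine integral_congr_ae (Eventually.of_forall fun x => ?_)
        change inner ℂ (c • φ x) (f x) = conj c * inner ℂ (φ x) (f x)
        rw [inner_smul_left]
      · simp only [L, TestFunction.integralAgainstBilinCLM_eq_zero hf]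
        simp
    cont := L.continuous }

theorem BdryDistribution.ofFun_apply {n : ℕ} {ι : Type} [Fintype ι]
    {f : Bdry n → EuclideanSpace ℂ ι} (hf : LocallyIntegrable f volume)
    (φ : 𝓓((⊤ : TopologicalSpace.Opens (Bdry n)), EuclideanSpace ℂ ι)) :
    BdryDistribution.ofFun f φ = ∫ x, inner ℂ (φ x) (f x) := by
  have hf' : LocallyIntegrableOn f
      ((⊤ : TopologicalSpace.Opens (Bdry n)) : Set (Bdry n)) volume :=
    fun x _ => (hf x).filter_mono nhdsWithin_le_nhds
  exact TestFunction.integralAgainstBilinCLM_eq_integral hf'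

/-- The map `(v_{α, j}) ↦ (v_{α, j})_α`, for a fixed direction `j`. -/
noncomputable def columnCLM (ι : Type) [Fintype ι] {κ : Type} [Fintype κ] (j : κ) :
    EuclideanSpace ℂ (ι × κ) →L[ℂ] EuclideanSpace ℂ ι :=
  LinearMap.toContinuousLinearMap
    { toFun := fun v => WithLp.toLp 2 fun α => v (α, j)
      map_add' := fun _ _ => rfl
      map_smul' := fun _ _ => rfl }

/-- The divergence `(div φ)^α = ∑_j ∂_j φ^{α, j}` of test functions. -/
noncomputable def divTest (n : ℕ) (ι : Type) [Fintype ι] :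
    𝓓((⊤ : TopologicalSpace.Opens (Bdry n)), EuclideanSpace ℂ (ι × Fin n)) →L[ℂ]
      𝓓((⊤ : TopologicalSpace.Opens (Bdry n)), EuclideanSpace ℂ ι) :=
  ∑ j : Fin n,
    (TestFunction.lineDerivCLM ℂ (bdryDir n j)).comp
      (TestFunction.postcompCLM (columnCLM ι j))

/-- The distributional gradient: `⟨∇T, φ⟩ = -⟨T, div φ⟩`. -/
noncomputable def BdryDistribution.grad {n : ℕ} {ι : Type} [Fintype ι]
    (T : BdryDistribution n ι) : BdryDistribution n (ι × Fin n) :=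
  -(T.comp (divTest n ι))

/-- The `Lᵖ` norm of a distribution: the `Lᵖ` norm of `F` if the distribution is given by a
function `F ∈ Lᵖ`, and `∞` otherwise. -/
noncomputable def BdryDistribution.lpNorm {n : ℕ} {ι : Type} [Fintype ι] (p : ℝ)
    (T : BdryDistribution n ι) : ℝ≥0∞ :=
  ⨅ (F : Bdry n → EuclideanSpace ℂ ι)
    (_ : MemLp F (ENNReal.ofReal p) volume ∧ BdryDistribution.ofFun F = T),
    eLpNorm F (ENNReal.ofReal p) volume

/-- The norm of a distribution in `Ẇ^{-1,q}(ℝⁿ; ℂ^ι)`, for `1 < q < ∞`: its norm as a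
conjugate linear functional on the dense subspace of test functions of `Ẇ^{1,q'}(ℝⁿ; ℂ^ι)`,
where `q' = q / (q - 1)` and `‖φ‖_{Ẇ^{1,q'}} = ‖∇φ‖_{q'}`.  It is `∞` if the distribution
does not belong to `Ẇ^{-1,q}`, the dual of `Ẇ^{1,q'}`. -/
noncomputable def BdryDistribution.negSobolevNorm {n : ℕ} {ι : Type} [Fintype ι] (q : ℝ)
    (T : BdryDistribution n ι) : ℝ≥0∞ :=
  ⨆ (φ : 𝓓((⊤ : TopologicalSpace.Opens (Bdry n)), EuclideanSpace ℂ ι))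
    (_ : eLpNorm (classicalGrad (bdryDir n) φ) (ENNReal.ofReal q.conjExponent) volume ≤ 1),
    ‖T φ‖ₑ

/-- `T = ∂_{ν_A} u|_{t=0}`, for a function `u` with weak gradient `G`: one has
`∫ A ∇u · conj ∇φ = -⟨T, φ|_{t=0}⟩` for all `φ` in the energy space whose trace is a test
function.  Every test function is such a trace, so that this determines `T`; and the test
functions are dense in the trace space. -/
def IsConormalDerivative {n m : ℕ} (A : Coeff n m)
    (G : Full n → EuclideanSpace ℂ (Fin m × Fin (n + 1)))
    (T : BdryDistribution n (Fin m)) : Prop :=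
  ∀ (φ : Full n → EuclideanSpace ℂ (Fin m))
    (Φ : Full n → EuclideanSpace ℂ (Fin m × Fin (n + 1)))
    (g : 𝓓((⊤ : TopologicalSpace.Opens (Bdry n)), EuclideanSpace ℂ (Fin m))),
    IsEnergyFunction φ Φ → IsTrace φ g →
      ∫ z in (halfSpace n : Set (Full n)), sesqForm (A z) (G z) (Φ z) = - T g

/-! The two estimates are transposes of each other. Let u be an energy solution for A and w one for
the adjoint A*. The mutual energy ∫ A∇u · conj ∇w equals -⟨∂_{ν_A}u₀, w₀⟩, and it is also the
conjugate of ∫ A*∇w · conj ∇u = -⟨∂_{ν_{A*}}w₀, u₀⟩. Moreover each test field φ on the boundary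
gives a Neumann problem with datum div φ, solvable by Lax–Milgram in the energy space
(`exists_neumann_solution`). If u solves it for A, then ⟨∇w₀, φ⟩ = -⟨w₀, div φ⟩ is, up to
conjugation, the mutual energy of u and w; the same holds with the roles exchanged.

From (1) to (2) (`dual_estimate_of_estimate`): take ‖∇φ‖_p ≤ 1 and solve for A with datum div φ,
which is in Lᵖ. By (1), ∇u₀ is in Lᵖ, and the mutual energy is at most a constant times the
Ẇ^{-1,p'} norm of ∂_{ν_{A*}}w₀ times ‖∇u₀‖_p (`norm_pairing_le_of_negSobolev`).

From (2) to (1) (`estimate_of_dual_estimate`): take φ in L^{p'} and solve for A*. The datum div φ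
has Ẇ^{-1,p'} norm at most ‖φ‖_{p'}, so (2) bounds ∇w₀ in Ẇ^{-1,p'}. Hence w₀, or rather its
differences of translates, are bounded in L^{p'}, and the mutual energy is controlled by
‖∂_{ν_A}u₀‖_p ‖φ‖_{p'} (`exists_norm_pairing_le_of_memLp`). Riesz representation then produces ∇u₀
in Lᵖ.

The analytic core is the inequality ‖w‖_{p'} ≤ C ‖∇w‖_{Ẇ^{-1,p'}} for w in L²
(`exists_memLp_of_abs_integral_fderiv`), a form of the Lᵖ bound for second order Riesz transforms.
It is proved with a random walk P, a mean of squared averages of opposite translations: 1 - P is a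
discrete Laplacian -c ∑ Dᵢ², and Dᵢ² ∑ P^{2k} is a discrete Riesz transform. Its Lᵖ bound is uniform
in the step size and in the number of steps, since along the walk the integral of a convex Bellman
function of (Pᵏf, Pᵏg) drops at each step by a multiple of ∫ |DᵢPᵏf · DᵢPᵏg|. Refining the step
under diffusive scaling gives the inequality.

The remaining difficulty is that the conormal derivative is only tested against energy functions
whose trace is a test function, while general traces are merely locally square integrable. An energy
function u is therefore replaced by averages of χ(u - u(· + y)): differences are in L² even if u is
not, the cutoff χ then costs little, and horizontal mollification makes the trace smooth. Removing
mollification, cutoff and translation in this order recovers ∇u weakly, because translates going to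
infinity tend weakly to zero, and bounds survive (`norm_integral_inner_le_of_approx`). Traces,
density of test functions and closedness of the space of gradients (by a weighted Poincaré
inequality) are proved for real scalar functions and transferred through real coordinates. -/

open scoped ContDiff
open ENNReal (ofReal)
open TopologicalSpace (Opens)
set_option linter.unusedSectionVars false

/-- The upper half-space as a set. -/
local notation "ℍ[" n "]" => ((halfSpace n : Opens (Full n)) : Set (Full n))

/-- Lebesgue measure on the upper half-space. -/
local notation "volℍ[" n "]" => Measure.restrict volume ((halfSpace n : Opens (Full n)) : Set (Full n))

/-- Vectors with `m` components. -/
local notation "ℂᵛ[" m "]" => EuclideanSpace ℂ (Fin m)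

/-- Values of gradients of `m` functions on `ℝ^{1+n}`. -/
local notation "ℂᴳ[" m "," n "]" => EuclideanSpace ℂ (Fin m × Fin (n + 1))

/-- The directional derivative of a function. -/
local notation "𝐃[" f "," v "]" => fun z => fderiv ℝ f z v

/-- The `Lᵖ` norm as a real number. -/
local notation "𝐍[" f "," p "," μ "]" => ENNReal.toReal (eLpNorm f (ofReal p) μ)

/-! ### Dominated convergence and bounded functionals on Lᵖ. -/

section LpGeneral

/-- Dominated convergence in `Lᵖ`. -/
theorem tendsto_eLpNorm_sub_of_dominated {α ι E : Type*} [MeasurableSpace α] {μ : Measure α}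
    [NormedAddCommGroup E] {l : Filter ι} [l.IsCountablyGenerated] {p : ℝ} (hp : 0 < p)
    {F : ι → α → E} {f : α → E} {g : α → ℝ} (hF : ∀ i, AEStronglyMeasurable (F i) μ)
    (hf : AEStronglyMeasurable f μ) (hg : MemLp g (ofReal p) μ)
    (hb : ∀ i, ∀ᵐ x ∂μ, ‖F i x - f x‖ ≤ g x)
    (hlim : ∀ᵐ x ∂μ, Tendsto (fun i => F i x) l (𝓝 (f x))) :
    Tendsto (fun i => eLpNorm (F i - f) (ofReal p) μ) l (𝓝 0) := by
  have hp0 : ofReal p ≠ 0 := by simpa using hp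
  have key : Tendsto (fun i => ∫⁻ x, ‖(F i - f) x‖ₑ ^ p ∂μ) l (𝓝 (∫⁻ _, 0 ∂μ)) := by
    -- Sequences suffice for a countably generated filter. The generality is used below for
    -- unordered partial sums, indexed by finite sets of naturals.
    refine tendsto_of_seq_tendsto fun u hu => ?_
    refine tendsto_lintegral_of_dominated_convergence' (fun x => ‖g x‖ₑ ^ p) ?_ ?_ ?_ ?_
    · exact fun i => ((hF (u i)).sub hf).enorm.pow_const _
    · intro i
      filter_upwards [hb (u i)] with x hx
      refine ENNReal.rpow_le_rpow ?_ hp.le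
      rw [enorm_le_iff_norm_le]
      exact hx.trans (le_abs_self _)
    · have := lintegral_rpow_enorm_lt_top_of_eLpNorm_lt_top hp0 ENNReal.ofReal_ne_top hg.2
      rw [ENNReal.toReal_ofReal hp.le] at this
      exact this.ne
    · filter_upwards [hlim] with x hx
      have h1 : Tendsto (fun i => ‖(F (u i) - f) x‖ₑ) atTop (𝓝 0) := by
        have := ((hx.comp hu).sub_const (f x)).enorm
        simpa using this
      have := (ENNReal.continuous_rpow_const (y := p)).tendsto 0 |>.comp h1
      simpa [ENNReal.zero_rpow_of_pos hp, Function.comp_def] using this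
  have h2 := (ENNReal.continuous_rpow_const (y := 1 / p)).tendsto 0 |>.comp (by simpa using key)
  simp only [eLpNorm_eq_lintegral_rpow_enorm_toReal hp0 ENNReal.ofReal_ne_top,
    ENNReal.toReal_ofReal hp.le]
  simpa [ENNReal.zero_rpow_of_pos (inv_pos.2 hp), Function.comp_def] using h2

/-- A bounded linear functional on the `p`-integrable functions. -/
structure IsLpFunctional {α : Type*} [MeasurableSpace α] (μ : Measure α) (p C : ℝ)
    (Λ : (α → ℝ) → ℝ) : Prop where
  map_add : ∀ f g, MemLp f (ofReal p) μ → MemLp g (ofReal p) μ → Λ (f + g) = Λ f + Λ g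
  map_smul : ∀ (c : ℝ) f, MemLp f (ofReal p) μ → Λ (c • f) = c * Λ f
  bound : ∀ f, MemLp f (ofReal p) μ →
    |Λ f| ≤ C * 𝐍[f,p,μ]

namespace IsLpFunctional

variable {α : Type*} [MeasurableSpace α] {μ : Measure α} {p C : ℝ} {Λ : (α → ℝ) → ℝ}

theorem map_zero (h : IsLpFunctional μ p C Λ) : Λ 0 = 0 := by
  have := h.map_smul 0 0 MemLp.zero
  simpa using this

theorem map_sub (h : IsLpFunctional μ p C Λ) {f g : α → ℝ} (hf : MemLp f (ofReal p) μ)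
    (hg : MemLp g (ofReal p) μ) : Λ (f - g) = Λ f - Λ g := by
  have h1 := h.map_add f ((-1 : ℝ) • g) hf (hg.const_smul _)
  rw [h.map_smul _ _ hg] at h1
  rw [show f - g = f + (-1 : ℝ) • g by simp [sub_eq_add_neg], h1]; ring

theorem tendsto (h : IsLpFunctional μ p C Λ) {ι : Type*} {l : Filter ι} {F : ι → α → ℝ}
    {f : α → ℝ} (hF : ∀ i, MemLp (F i) (ofReal p) μ) (hf : MemLp f (ofReal p) μ)
    (hlim : Tendsto (fun i => eLpNorm (F i - f) (ofReal p) μ) l (𝓝 0)) :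
    Tendsto (fun i => Λ (F i)) l (𝓝 (Λ f)) := by
  rw [tendsto_iff_norm_sub_tendsto_zero]
  have h1 : Tendsto (fun i => C * 𝐍[F i - f,p,μ]) l (𝓝 0) := by
    have := ((ENNReal.tendsto_toReal ENNReal.zero_ne_top).comp hlim).const_mul C
    simpa [Function.comp_def] using this
  refine squeeze_zero (fun _ => norm_nonneg _) (fun i => ?_) h1
  rw [← h.map_sub (hF i) hf]
  exact h.bound _ ((hF i).sub hf)

theorem map_sum (h : IsLpFunctional μ p C Λ) {ι : Type*} (s : Finset ι) {F : ι → α → ℝ}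
    (hF : ∀ i, MemLp (F i) (ofReal p) μ) : Λ (∑ i ∈ s, F i) = ∑ i ∈ s, Λ (F i) := by
  classical
  induction s using Finset.induction_on with
  | empty => simpa using h.map_zero
  | insert i s hi ih =>
    rw [Finset.sum_insert hi, Finset.sum_insert hi, h.map_add _ _ (hF i), ih]
    exact memLp_finsetSum' s fun i _ => hF i

end IsLpFunctional

end LpGeneral

/-! ### Density of a functional with respect to a weight. -/

section Riesz

variable {α : Type*} [MeasurableSpace α] {μ : Measure α} {p C : ℝ} {Λ : (α → ℝ) → ℝ}

/-- Indicators of sets of infinite measure are not in Lᵖ; after multiplication by such a weight they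
are, so a functional becomes a finite signed measure. The weight is the p-th root of a positive
integrable function. -/
theorem exists_pos_memLp (μ : Measure α) [SigmaFinite μ] (hp : 0 < p) :
    ∃ w : α → ℝ, (∀ x, 0 < w x) ∧ Measurable w ∧ MemLp w (ofReal p) μ := by
  obtain ⟨δ, hδ, hm, hi⟩ := exists_pos_lintegral_lt_of_sigmaFinite μ one_ne_zero
  refine ⟨fun x => (δ x : ℝ) ^ (1 / p), fun x => Real.rpow_pos_of_pos (hδ x) _,
    (measurable_coe_nnreal_real.comp hm).pow_const _, ?_⟩
  refine ⟨((measurable_coe_nnreal_real.comp hm).pow_const _).aestronglyMeasurable, ?_⟩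
  rw [eLpNorm_lt_top_iff_lintegral_rpow_enorm_lt_top (by simpa using hp) ENNReal.ofReal_ne_top,
    ENNReal.toReal_ofReal hp.le]
  refine lt_of_le_of_lt (le_of_eq (lintegral_congr fun x => ?_)) (hi.trans ENNReal.one_lt_top)
  rw [Real.enorm_of_nonneg (by positivity), ENNReal.ofReal_rpow_of_nonneg (by positivity) hp.le,
    ← Real.rpow_mul (by positivity), one_div, inv_mul_cancel₀ hp.ne', Real.rpow_one]
  simp

/-- The signed measure `E ↦ Λ (1_E w)`. -/
theorem IsLpFunctional.exists_signedMeasure (h : IsLpFunctional μ p C Λ) (hp : 0 < p)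
    {w : α → ℝ} (hw : MemLp w (ofReal p) μ) :
    ∃ s : SignedMeasure α, ∀ E, MeasurableSet E → s E = Λ (E.indicator w) := by
  classical
  refine ⟨⟨fun E => if MeasurableSet E then Λ (E.indicator w) else 0, ?_, ?_, ?_⟩, ?_⟩
  · simp only [MeasurableSet.empty, if_true, indicator_empty]
    exact h.map_zero
  · intro E hE; simp [hE]
  · intro f hf hd
    simp only [hf, if_true, MeasurableSet.iUnion hf, HasSum]
    have h1 : ∀ t : Finset ℕ, ∑ i ∈ t, Λ ((f i).indicator w) = Λ ((⋃ i ∈ t, f i).indicator w) := by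
      intro t
      rw [← h.map_sum t fun i => hw.indicator (hf i)]
      congr 1
      rw [Finset.indicator_biUnion t f (fun i _ j _ hij => hd hij)]
      ext x; simp
    simp only [h1]
    have hmt : ∀ t : Finset ℕ, MeasurableSet (⋃ i ∈ t, f i) := fun t =>
      Finset.measurableSet_biUnion t fun i _ => hf i
    refine h.tendsto (fun t => hw.indicator (hmt t)) (hw.indicator (MeasurableSet.iUnion hf)) ?_
    refine tendsto_eLpNorm_sub_of_dominated hp (g := fun x => ‖w x‖)
      (fun t => (hw.indicator (hmt t)).1) (hw.indicator (MeasurableSet.iUnion hf)).1 hw.norm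
      (fun t => .of_forall fun x => ?_) (.of_forall fun x => ?_)
    · by_cases hx : x ∈ ⋃ i ∈ t, f i
      · have : x ∈ ⋃ i, f i := by
          simp only [mem_iUnion] at hx ⊢
          obtain ⟨i, _, hi⟩ := hx; exact ⟨i, hi⟩
        simp [indicator_of_mem hx, indicator_of_mem this]
      · rw [indicator_of_notMem hx, zero_sub, norm_neg]
        exact norm_indicator_le_norm_self _ _
    · refine tendsto_nhds_of_eventually_eq ?_
      by_cases hx : x ∈ ⋃ i, f i
      · obtain ⟨i, hi⟩ := mem_iUnion.1 hx
        filter_upwards [eventually_ge_atTop ({i} : Finset ℕ)] with t ht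
        rw [indicator_of_mem hx, indicator_of_mem]
        simp only [mem_iUnion]
        exact ⟨i, ht (by simp), hi⟩
      · refine .of_forall fun t => ?_
        rw [indicator_of_notMem hx, indicator_of_notMem]
        intro hx'; apply hx
        simp only [mem_iUnion] at hx' ⊢
        obtain ⟨i, _, hi⟩ := hx'; exact ⟨i, hi⟩
  · intro E hE
    change (if MeasurableSet E then Λ (E.indicator w) else 0) = _
    simp [hE]

/-- Functions are not identified almost everywhere in `IsLpFunctional`; the norm bound applied to f
- g forces the identification. -/
theorem IsLpFunctional.congr_ae (h : IsLpFunctional μ p C Λ) {f g : α → ℝ}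
    (hf : MemLp f (ofReal p) μ) (hfg : f =ᵐ[μ] g) : Λ f = Λ g := by
  have hg := hf.ae_eq hfg
  have h1 := h.bound _ (hf.sub hg)
  have h2 : eLpNorm (f - g) (ofReal p) μ = 0 := by
    rw [eLpNorm_congr_ae (g := 0) (by filter_upwards [hfg] with x hx; simp [hx])]; simp
  rw [h2, h.map_sub hf hg] at h1
  simp only [ENNReal.toReal_zero, mul_zero, abs_nonpos_iff] at h1
  linarith

/-- The density of a bounded functional with respect to a positive weight `w ∈ Lᵖ`. -/
theorem IsLpFunctional.exists_density [SigmaFinite μ] (h : IsLpFunctional μ p C Λ) (hp : 0 < p)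
    {w : α → ℝ} (hw : MemLp w (ofReal p) μ) :
    ∃ g : α → ℝ, Measurable g ∧ Integrable g μ ∧ ∀ (k : α → ℝ) (N : ℝ), Measurable k →
      (∀ x, |k x| ≤ N) → Λ (k * w) = ∫ x, k x * g x ∂μ := by
  obtain ⟨s, hs⟩ := h.exists_signedMeasure hp hw
  have hac : s ≪ᵥ μ.toENNRealVectorMeasure := by
    refine VectorMeasure.AbsolutelyContinuous.mk fun E hE h0 => ?_
    rw [Measure.toENNRealVectorMeasure_apply_measurable hE] at h0
    rw [hs E hE, h.congr_ae (hw.indicator hE) (g := 0) ?_, h.map_zero]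
    exact indicator_meas_zero h0
  have hrn := SignedMeasure.withDensityᵥ_rnDeriv_eq s μ hac
  have hint : Integrable (s.rnDeriv μ) μ := SignedMeasure.integrable_rnDeriv _ _
  refine ⟨s.rnDeriv μ, SignedMeasure.measurable_rnDeriv _ _, hint, ?_⟩
  set g := s.rnDeriv μ
  have hmul : ∀ (k : α → ℝ) (N : ℝ), Measurable k → (∀ x, |k x| ≤ N) →
      MemLp (k * w) (ofReal p) μ := by
    intro k N hk hN
    refine MemLp.of_le_mul hw (hk.aestronglyMeasurable.mul hw.1) (c := N) (.of_forall fun x => ?_)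
    rw [Pi.mul_apply, norm_mul]
    exact mul_le_mul_of_nonneg_right (hN x) (norm_nonneg _)
  -- Radon–Nikodym gives the formula on indicators, hence on simple functions. A bounded k is a
  -- pointwise limit of simple functions with the same bound, and both sides converge by domination,
  -- with N|g| on the right and a multiple of |w| on the left.
  have hsimple : ∀ k : SimpleFunc α ℝ, Λ (⇑k * w) = ∫ x, k x * g x ∂μ := by
    intro k
    induction k using SimpleFunc.induction with
    | @const c E hE =>
      have e1 : (⇑(SimpleFunc.piecewise E hE (SimpleFunc.const α c) (SimpleFunc.const α 0)) * w)
          = c • E.indicator w := by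
        ext x; by_cases hx : x ∈ E <;> simp [hx]
      rw [e1, h.map_smul _ _ (hw.indicator hE), ← hs E hE, ← hrn,
        withDensityᵥ_apply hint hE, ← integral_indicator hE, ← integral_const_mul]
      refine integral_congr_ae (.of_forall fun x => ?_)
      by_cases hx : x ∈ E <;> simp [hx]
    | @add f f' _ hf hf' =>
      obtain ⟨N, hN⟩ := f.exists_forall_norm_le
      obtain ⟨N', hN'⟩ := f'.exists_forall_norm_le
      have e1 : (⇑(f + f') * w) = ⇑f * w + ⇑f' * w := by ext x; simp [add_mul]
      rw [e1, h.map_add _ _ (hmul _ N f.measurable hN) (hmul _ N' f'.measurable hN'), hf, hf',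
        ← integral_add]
      · simp [add_mul]
      · exact hint.bdd_mul (c := N) f.measurable.aestronglyMeasurable (.of_forall hN)
      · exact hint.bdd_mul (c := N') f'.measurable.aestronglyMeasurable (.of_forall hN')
  intro k N hk hN
  have hks : StronglyMeasurable k := hk.stronglyMeasurable
  have hlim : ∀ x, Tendsto (fun n => hks.approxBounded N n x) atTop (𝓝 (k x)) := fun x =>
    StronglyMeasurable.tendsto_approxBounded_of_norm_le hks (hN x)
  by_cases hne : Nonempty α
  swap
  · have e0 : k * w = 0 := by ext x; exact (hne ⟨x⟩).elim
    have : IsEmpty α := not_nonempty_iff.1 hne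
    rw [e0, h.map_zero, Measure.eq_zero_of_isEmpty μ, integral_zero_measure]
  have hN0 : 0 ≤ N := (abs_nonneg _).trans (hN (Classical.choice hne))
  have hb : ∀ n x, ‖hks.approxBounded N n x‖ ≤ N := fun n x => hks.norm_approxBounded_le hN0 n x
  have t1 : Tendsto (fun n => Λ (⇑(hks.approxBounded N n) * w)) atTop (𝓝 (Λ (k * w))) := by
    refine h.tendsto (fun n => hmul _ N (SimpleFunc.measurable _) (hb n)) (hmul _ N hk hN) ?_
    refine tendsto_eLpNorm_sub_of_dominated hp (g := fun x => 2 * N * ‖w x‖)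
      (fun n => (hmul _ N (SimpleFunc.measurable _) (hb n)).1) (hmul _ N hk hN).1
      (hw.norm.const_mul _) (fun n => .of_forall fun x => ?_)
      (.of_forall fun x => ?_)
    · rw [Pi.mul_apply, Pi.mul_apply, ← sub_mul, norm_mul]
      refine mul_le_mul_of_nonneg_right ((norm_sub_le _ _).trans ?_) (norm_nonneg _)
      have := hb n x; have := hN x
      rw [← Real.norm_eq_abs] at this
      linarith
    · exact (hlim x).mul_const _
  have t2 : Tendsto (fun n => ∫ x, hks.approxBounded N n x * g x ∂μ) atTop
      (𝓝 (∫ x, k x * g x ∂μ)) := by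
    refine tendsto_integral_of_dominated_convergence (fun x => N * ‖g x‖) (fun n => ?_)
      (hint.norm.const_mul _) (fun n => .of_forall fun x => ?_)
      (.of_forall fun x => (hlim x).mul_const _)
    · exact (SimpleFunc.measurable _).aestronglyMeasurable.mul hint.1
    · rw [norm_mul]; exact mul_le_mul_of_nonneg_right (hb n x) (norm_nonneg _)
  simp only [hsimple] at t1
  exact tendsto_nhds_unique t1 t2

end Riesz

/-! ### Riesz representation in Lᵖ for 1 < p < ∞. -/

section Riesz2

variable {α : Type*} [MeasurableSpace α] {μ : Measure α} {p q C : ℝ} {Λ : (α → ℝ) → ℝ}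

theorem eLpNorm_toReal_rpow {f : α → ℝ} (hp : 0 < p) (hf : MemLp f (ofReal p) μ) :
    𝐍[f,p,μ] ^ p = ∫ x, |f x| ^ p ∂μ := by
  rw [hf.eLpNorm_eq_integral_rpow_norm (by simpa using hp) ENNReal.ofReal_ne_top,
    ENNReal.toReal_ofReal hp.le, ENNReal.toReal_ofReal (by positivity),
    ← Real.rpow_mul (by positivity), inv_mul_cancel₀ hp.ne', Real.rpow_one]
  rfl

/-- **Riesz representation**: a bounded functional on `Lᵖ`, `1 < p < ∞`, is given by a function
in `L^q`. -/
theorem IsLpFunctional.exists_repr [SigmaFinite μ] (h : IsLpFunctional μ p C Λ)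
    (hpq : p.HolderConjugate q) (hC : 0 ≤ C) : ∃ g : α → ℝ, Measurable g ∧ MemLp g (ofReal q) μ ∧
      eLpNorm g (ofReal q) μ ≤ ofReal C ∧
      ∀ f, MemLp f (ofReal p) μ → Λ f = ∫ x, f x * g x ∂μ := by
  have hp := hpq.pos
  have hq := hpq.symm.pos
  obtain ⟨w, hw0, hwm, hw⟩ := exists_pos_memLp μ hp
  obtain ⟨g0, hg0m, hg0i, hg0⟩ := h.exists_density hp hw
  set g : α → ℝ := fun x => g0 x / w x with hg
  have hgm : Measurable g := hg0m.div hwm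
  have hgw : ∀ x, w x * g x = g0 x := fun x => by simp only [hg]; field_simp [(hw0 x).ne']
  -- bounded multiples of the weight
  have hk : ∀ (f : α → ℝ) (N : ℝ), Measurable f → (∀ x, |f x| ≤ N * w x) →
      MemLp f (ofReal p) μ ∧ Integrable (fun x => f x * g x) μ ∧ Λ f = ∫ x, f x * g x ∂μ := by
    intro f N hf hN
    have hb : ∀ x, |f x / w x| ≤ N := fun x => by
      rw [abs_div, abs_of_pos (hw0 x), div_le_iff₀ (hw0 x)]; exact hN x
    have e : (fun x => f x / w x) * w = f := by ext x; simp [(hw0 x).ne']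
    have e2 : ∀ x, f x / w x * g0 x = f x * g x := fun x => by simp only [hg]; ring
    refine ⟨?_, ?_, ?_⟩
    · refine MemLp.of_le_mul hw hf.aestronglyMeasurable (c := N) (.of_forall fun x => ?_)
      rw [Real.norm_eq_abs, Real.norm_of_nonneg (hw0 x).le]; exact hN x
    · refine (hg0i.bdd_mul (c := N) (hf.div hwm).aestronglyMeasurable
        (.of_forall hb)).congr (.of_forall e2)
    · have := hg0 (fun x => f x / w x) N (hf.div hwm) hb
      rw [e] at this
      rw [this]
      exact integral_congr_ae (.of_forall e2)
  -- truncations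
  have hbound : ∀ n : ℕ, ∫⁻ x in {x | |g x| ≤ n ∧ 1 ≤ n * w x}, ‖g x‖ₑ ^ q ∂μ ≤ ofReal C ^ q := by
    -- On this truncation set both |g| and 1/w are at most n, so the extremal function below is
    -- bounded by a multiple of w and the density formula applies to it. The sets increase to the
    -- whole space.
    intro n
    set B : Set α := {x | |g x| ≤ n ∧ 1 ≤ n * w x} with hB
    have hBm : MeasurableSet B := by
      have h1 : MeasurableSet {x | |g x| ≤ n} := measurableSet_le hgm.abs measurable_const
      have h2 : MeasurableSet {x | 1 ≤ n * w x} :=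
        measurableSet_le measurable_const (measurable_const.mul hwm)
      exact h1.inter h2
    -- The extremal function in Hölder's inequality: fg = |g|^q = |f|^p on B. With I the integral of
    -- |g|^q over B, the bound on Λ reads I ≤ C I^{1/p}, whence I ≤ C^q independently of n.
    set f : α → ℝ := B.indicator fun x => SignType.sign (g x) * |g x| ^ (q - 1) with hf
    have hsm : Measurable fun x => ((SignType.sign (g x) : SignType) : ℝ) := by
      have : ∀ y : ℝ, ((SignType.sign y : SignType) : ℝ) =
          if 0 < y then 1 else if y < 0 then -1 else 0 := by
        intro y; rw [sign_apply]; split_ifs <;> simp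
      simp only [this]
      exact Measurable.ite (measurableSet_lt measurable_const hgm) measurable_const
        (Measurable.ite (measurableSet_lt hgm measurable_const) measurable_const measurable_const)
    have hfm : Measurable f := (hsm.mul (hgm.abs.pow_const _)).indicator hBm
    have hq1 : 0 < q - 1 := by linarith [hpq.symm.lt]
    have hfle : ∀ x, |f x| ≤ |g x| ^ (q - 1) ∧ (x ∈ B → |f x| = |g x| ^ (q - 1)) := by
      intro x
      have h0 : x ∈ B → |f x| = |g x| ^ (q - 1) := by
        intro hx
        simp only [hf, indicator_of_mem hx, abs_mul]
        rw [abs_of_nonneg (a := |g x| ^ (q - 1)) (by positivity)]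
        rcases lt_trichotomy (g x) 0 with h | h | h
        · simp [h]
        · simp [h, Real.zero_rpow hq1.ne']
        · simp [h]
      refine ⟨?_, h0⟩
      by_cases hx : x ∈ B
      · exact (h0 hx).le
      · simp only [hf, indicator_of_notMem hx, abs_zero]; positivity
    have hfN : ∀ x, |f x| ≤ ((n : ℝ) ^ (q - 1) * n) * w x := by
      intro x
      by_cases hx : x ∈ B
      · rw [(hfle x).2 hx]
        calc |g x| ^ (q - 1) ≤ (n : ℝ) ^ (q - 1) :=
              Real.rpow_le_rpow (abs_nonneg _) hx.1 hq1.le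
          _ ≤ (n : ℝ) ^ (q - 1) * (n * w x) := le_mul_of_one_le_right (by positivity) hx.2
          _ = _ := by ring
      · simp only [hf, indicator_of_notMem hx, abs_zero]
        have := (hw0 x).le; positivity
    obtain ⟨hfp, hfi, hfΛ⟩ := hk f _ hfm hfN
    have e1 : ∀ x, f x * g x = B.indicator (fun x => |g x| ^ q) x := by
      intro x
      by_cases hx : x ∈ B
      · simp only [hf, indicator_of_mem hx]
        rw [mul_right_comm, sign_mul_self]
        by_cases h0 : g x = 0
        · simp [h0, Real.zero_rpow hq.ne']
        · rw [← Real.rpow_one_add' (abs_nonneg _) (by linarith)]; congr 1; ring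
      · simp [hf, indicator_of_notMem hx]
    have e2 : ∀ x, |f x| ^ p = B.indicator (fun x => |g x| ^ q) x := by
      intro x
      by_cases hx : x ∈ B
      · rw [(hfle x).2 hx, indicator_of_mem hx, ← Real.rpow_mul (abs_nonneg _)]
        congr 1; exact hpq.symm.sub_one_mul_conj
      · simp [hf, indicator_of_notMem hx, Real.zero_rpow hp.ne']
    set I := ∫ x, B.indicator (fun x => |g x| ^ q) x ∂μ with hI
    have hI0 : 0 ≤ I := integral_nonneg fun x => indicator_nonneg (fun _ _ => by positivity) _
    have hΛ : Λ f = I := by rw [hfΛ]; exact integral_congr_ae (.of_forall e1)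
    have hN : 𝐍[f,p,μ] ^ p = I := by
      rw [eLpNorm_toReal_rpow hp hfp]; exact integral_congr_ae (.of_forall e2)
    have hle : I ≤ C ^ q := by
      have hb := h.bound f hfp
      rw [hΛ, abs_of_nonneg hI0] at hb
      set a := 𝐍[f,p,μ] with ha
      have ha0 : 0 ≤ a := ENNReal.toReal_nonneg
      rcases ha0.eq_or_lt with h0 | h0
      · rw [← h0, Real.zero_rpow hp.ne'] at hN; rw [← hN]; positivity
      · have : a ^ (p - 1) ≤ C := by
          rw [Real.rpow_sub h0, Real.rpow_one, div_le_iff₀ h0, hN]; exact hb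
        calc I = (a ^ (p - 1)) ^ q := by
              rw [← hN, ← Real.rpow_mul ha0]; congr 1; exact hpq.sub_one_mul_conj.symm
          _ ≤ C ^ q := Real.rpow_le_rpow (by positivity) this hq.le
    rw [← lintegral_indicator hBm, ENNReal.ofReal_rpow_of_nonneg hC hq.le]
    have hint : Integrable (B.indicator fun x => |g x| ^ q) μ := hfi.congr (.of_forall e1)
    refine le_trans (le_of_eq ?_) (ENNReal.ofReal_le_ofReal hle)
    rw [hI, ofReal_integral_eq_lintegral_ofReal hint
      (.of_forall fun x => indicator_nonneg (fun _ _ => by positivity) _)]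
    refine lintegral_congr fun x => ?_
    by_cases hx : x ∈ B
    · rw [indicator_of_mem hx, indicator_of_mem hx, ← ofReal_norm,
        ENNReal.ofReal_rpow_of_nonneg (norm_nonneg _) hq.le, Real.norm_eq_abs]
    · simp [indicator_of_notMem hx]
  have hgq : eLpNorm g (ofReal q) μ ≤ ofReal C := by
    rw [eLpNorm_eq_lintegral_rpow_enorm_toReal (by simpa using hq) ENNReal.ofReal_ne_top,
      ENNReal.toReal_ofReal hq.le, one_div, ENNReal.rpow_inv_le_iff hq]
    have hU : (⋃ n : ℕ, {x | |g x| ≤ n ∧ 1 ≤ n * w x}) = univ := by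
      refine eq_univ_of_forall fun x => mem_iUnion.2 ?_
      obtain ⟨n, hn⟩ := exists_nat_ge (max |g x| (1 / w x))
      refine ⟨n, (le_max_left _ _).trans hn, ?_⟩
      have := (le_max_right _ _).trans hn
      rwa [div_le_iff₀ (hw0 x)] at this
    rw [← setLIntegral_univ, ← hU, setLIntegral_iUnion_of_directed]
    · exact iSup_le hbound
    · refine Monotone.directed_le fun a b hab x hx => ?_
      have hab' : (a : ℝ) ≤ b := by exact_mod_cast hab
      exact ⟨hx.1.trans hab', hx.2.trans (mul_le_mul_of_nonneg_right hab' (hw0 x).le)⟩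
  have hgL : MemLp g (ofReal q) μ := ⟨hgm.aestronglyMeasurable, hgq.trans_lt ENNReal.ofReal_lt_top⟩
  refine ⟨g, hgm, hgL, hgq, ?_⟩
  suffices H : ∀ f, Measurable f → MemLp f (ofReal p) μ → Λ f = ∫ x, f x * g x ∂μ by
    intro f hf
    have hf' := hf.ae_eq hf.1.ae_eq_mk
    have := H (hf.1.mk f) hf.1.stronglyMeasurable_mk.measurable hf'
    rw [h.congr_ae hf hf.1.ae_eq_mk, this]
    refine integral_congr_ae ?_
    filter_upwards [hf.1.ae_eq_mk] with x hx; rw [hx]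
  intro f hfm hf
  -- Truncation relative to the weight, so that the formula already known for functions dominated by
  -- a multiple of w applies to each F n.
  set F : ℕ → α → ℝ := fun n => {x | |f x| ≤ n * w x}.indicator f with hF
  have hFm : ∀ n, MeasurableSet {x | |f x| ≤ n * w x} := fun n =>
    measurableSet_le hfm.abs (measurable_const.mul hwm)
  have hFlim : ∀ x, Tendsto (fun n => F n x) atTop (𝓝 (f x)) := by
    intro x
    refine tendsto_nhds_of_eventually_eq ?_
    obtain ⟨N, hN⟩ := exists_nat_ge (|f x| / w x)
    filter_upwards [eventually_ge_atTop N] with n hn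
    have hn' : (N : ℝ) ≤ n := by exact_mod_cast hn
    simp only [hF]; rw [indicator_of_mem]
    have := hN.trans hn'
    rwa [div_le_iff₀ (hw0 x)] at this
  have hFk : ∀ n, Λ (F n) = ∫ x, F n x * g x ∂μ := by
    intro n
    refine (hk (F n) n (hfm.indicator (hFm n)) fun x => ?_).2.2
    by_cases hx : x ∈ {x | |f x| ≤ n * w x}
    · simp only [hF, indicator_of_mem hx]; exact hx
    · simp only [hF, indicator_of_notMem hx, abs_zero]
      have := (hw0 x).le; positivity
  have hFle : ∀ n x, ‖F n x‖ ≤ ‖f x‖ := fun n x => norm_indicator_le_norm_self _ _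
  have t1 : Tendsto (fun n => Λ (F n)) atTop (𝓝 (Λ f)) := by
    refine h.tendsto (fun n => hf.indicator (hFm n)) hf ?_
    refine tendsto_eLpNorm_sub_of_dominated hp (g := fun x => 2 * ‖f x‖)
      (fun n => (hf.indicator (hFm n)).1) hf.1
      (hf.norm.const_mul _) (fun n => .of_forall fun x => ?_)
      (.of_forall hFlim)
    refine (norm_sub_le _ _).trans ?_
    have := hFle n x; linarith
  have : ENNReal.HolderConjugate (ofReal p) (ofReal q) := hpq.ennrealOfReal
  have t2 : Tendsto (fun n => ∫ x, F n x * g x ∂μ) atTop (𝓝 (∫ x, f x * g x ∂μ)) := by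
    refine tendsto_integral_of_dominated_convergence (fun x => ‖f x * g x‖) (fun n => ?_)
      (hf.integrable_mul hgL).norm (fun n => .of_forall fun x => ?_)
      (.of_forall fun x => (hFlim x).mul_const _)
    · exact (hf.indicator (hFm n)).1.mul hgm.aestronglyMeasurable
    · rw [norm_mul, norm_mul]; exact mul_le_mul_of_nonneg_right (hFle n x) (norm_nonneg _)
  simp only [hFk] at t1
  exact tendsto_nhds_unique t1 t2

end Riesz2

/-! ### Extension of functionals and Hölder's inequality. -/

section HahnBanach

variable {α : Type*} [MeasurableSpace α] {μ : Measure α} {p q C : ℝ}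

/-- The space of `p`-integrable functions (not up to null sets). -/
def memLpSubmodule (μ : Measure α) (p : ℝ≥0∞) : Submodule ℝ (α → ℝ) where
  carrier := {f | MemLp f p μ}
  add_mem' := fun hf hg => MemLp.add hf hg
  zero_mem' := MemLp.zero
  smul_mem' := fun c _ hf => MemLp.const_smul hf c

/-- A functional on a space of `p`-integrable functions that is bounded in the `Lᵖ` norm is given
by a function in `L^q`. -/
theorem exists_repr_of_submodule [SigmaFinite μ] (hpq : p.HolderConjugate q) (hC : 0 ≤ C)
    (D : Submodule ℝ (α → ℝ)) (hD : ∀ f ∈ D, MemLp f (ofReal p) μ) (T : D →ₗ[ℝ] ℝ)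
    (hT : ∀ f : D, |T f| ≤ C * 𝐍[(f : α → ℝ),p,μ]) :
    ∃ g : α → ℝ, Measurable g ∧ MemLp g (ofReal q) μ ∧ eLpNorm g (ofReal q) μ ≤ ofReal C ∧
      ∀ f : D, T f = ∫ x, (f : α → ℝ) x * g x ∂μ := by
  have h1p : 1 ≤ ofReal p := ENNReal.one_le_ofReal.2 hpq.lt.le
  set E := memLpSubmodule μ (ofReal p) with hE
  have hDE : D ≤ E := hD
  let f : E →ₗ.[ℝ] ℝ :=
    { domain := D.comap E.subtype
      toFun := T.comp ((E.subtype).restrict (p := D.comap E.subtype) (q := D) fun x hx => hx) }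
  let N : E → ℝ := fun x => C * 𝐍[(x : α → ℝ),p,μ]
  -- Hahn–Banach, dominated by C times the Lᵖ seminorm. The one-sided bound for the extension
  -- becomes two-sided on applying it to -a.
  obtain ⟨Λ, hΛ1, hΛ2⟩ := exists_extension_of_le_sublinear f N (fun c hc x => by
      simp only [N, Submodule.coe_smul, eLpNorm_const_smul, ENNReal.toReal_mul, toReal_enorm,
        Real.norm_eq_abs, abs_of_pos hc]
      ring)
    (fun x y => by
      simp only [N, Submodule.coe_add]
      rw [← mul_add, ← ENNReal.toReal_add x.2.2.ne y.2.2.ne]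
      refine mul_le_mul_of_nonneg_left (ENNReal.toReal_mono ?_ ?_) hC
      · exact ENNReal.add_ne_top.2 ⟨x.2.2.ne, y.2.2.ne⟩
      · exact eLpNorm_add_le x.2.1 y.2.1 h1p)
    (fun x => (le_abs_self _).trans (hT ⟨x.1.1, x.2⟩))
  classical
  have hL : IsLpFunctional μ p C fun k => if hk : MemLp k (ofReal p) μ then
      Λ ⟨k, hk⟩ else 0 := by
    refine ⟨fun a b ha hb => ?_, fun c a ha => ?_, fun a ha => ?_⟩
    · simp only [ha, hb, ha.add hb, dif_pos]
      rw [← map_add]; rfl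
    · simp only [ha, ha.const_smul c, dif_pos]
      rw [← smul_eq_mul, ← map_smul]; rfl
    · simp only [ha, dif_pos]
      rw [abs_le]
      have h1 := hΛ2 ⟨a, ha⟩
      have h2 := hΛ2 (-⟨a, ha⟩)
      simp only [N, map_neg, Submodule.coe_neg, eLpNorm_neg] at h1 h2
      constructor <;> linarith
  obtain ⟨g, hgm, hg1, hg2, hg3⟩ := hL.exists_repr hpq hC
  refine ⟨g, hgm, hg1, hg2, fun k => ?_⟩
  have hk : MemLp (k : α → ℝ) (ofReal p) μ := hD k k.2
  have := hg3 k hk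
  simp only [hk, dif_pos] at this
  rw [← this]
  exact (hΛ1 ⟨⟨k, hk⟩, k.2⟩).symm

theorem abs_integral_mul_le (hpq : p.HolderConjugate q) {f g : α → ℝ}
    (hf : MemLp f (ofReal p) μ) (hg : MemLp g (ofReal q) μ) :
    |∫ x, f x * g x ∂μ| ≤ 𝐍[f,p,μ] * 𝐍[g,q,μ] := by
  have hp := hpq.pos
  have hq := hpq.symm.pos
  have h1 := integral_mul_norm_le_Lp_mul_Lq hpq hf hg
  have e : ∀ {r : ℝ} {k : α → ℝ}, 0 < r → MemLp k (ofReal r) μ →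
      (∫ x, ‖k x‖ ^ r ∂μ) ^ (1 / r) = 𝐍[k,r,μ] := by
    intro r k hr hk
    have := eLpNorm_toReal_rpow hr hk
    simp only [Real.norm_eq_abs]
    rw [← this, ← Real.rpow_mul ENNReal.toReal_nonneg, mul_one_div_cancel hr.ne', Real.rpow_one]
  rw [e hp hf, e hq hg] at h1
  refine (abs_integral_le_integral_abs).trans ?_
  simpa [abs_mul] using h1

end HahnBanach

/-! ### Real test functions and norms by duality. -/

section TestFunctions

variable {V : Type*} [NormedAddCommGroup V] [NormedSpace ℝ V]

/-- Real test functions with support in `Ω`. -/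
def testFun (Ω : Set V) : Submodule ℝ (V → ℝ) where
  carrier := {φ | ContDiff ℝ ∞ φ ∧ HasCompactSupport φ ∧ tsupport φ ⊆ Ω}
  add_mem' := fun {a b} ha hb => ⟨ha.1.add hb.1, ha.2.1.add hb.2.1,
    (tsupport_add a b).trans (union_subset ha.2.2 hb.2.2)⟩
  zero_mem' := ⟨contDiff_const, HasCompactSupport.zero, by simp [tsupport]⟩
  smul_mem' := fun c φ h => ⟨h.1.const_smul c, h.2.1.smul_left (f := fun _ => c),
    (tsupport_smul_subset_right (fun _ => c) φ).trans h.2.2⟩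

theorem testFun_mono {Ω Ω' : Set V} (h : Ω ⊆ Ω') {φ : V → ℝ} (hφ : φ ∈ testFun Ω) :
    φ ∈ testFun Ω' := ⟨hφ.1, hφ.2.1, hφ.2.2.trans h⟩

variable {Ω : Set V} {φ ψ : V → ℝ}

theorem testFun_differentiable (hφ : φ ∈ testFun Ω) : Differentiable ℝ φ :=
  hφ.1.differentiable (by simp)

theorem testFun_continuous (hφ : φ ∈ testFun Ω) : Continuous φ := hφ.1.continuous

theorem testFun_fderiv (hφ : φ ∈ testFun Ω) (h : V) : 𝐃[φ,h] ∈ testFun Ω := by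
  refine ⟨(hφ.1.fderiv_right (m := ∞) (by simp)).clm_apply contDiff_const, hφ.2.1.fderiv_apply ℝ h,
    (tsupport_fderiv_apply_subset ℝ h).trans hφ.2.2⟩

theorem testFun_mul {χ : V → ℝ} (hχ : ContDiff ℝ ∞ χ) (hφ : φ ∈ testFun Ω) :
    (fun z => χ z * φ z) ∈ testFun Ω :=
  ⟨hχ.mul hφ.1, hφ.2.1.mul_left, (tsupport_mul_subset_right).trans hφ.2.2⟩

theorem testFun_eq_zero (hφ : φ ∈ testFun Ω) {z : V} (hz : z ∉ Ω) : φ z = 0 :=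
  image_eq_zero_of_notMem_tsupport fun h => hz (hφ.2.2 h)

theorem tsupport_comp_add_right (φ : V → ℝ) (y : V) :
    tsupport (fun z => φ (z + y)) = (fun z => z + y) ⁻¹' tsupport φ :=
  tsupport_comp_eq_preimage φ (Homeomorph.addRight y)

theorem testFun_translate (hφ : φ ∈ testFun Ω) (y : V) :
    (fun z => φ (z + y)) ∈ testFun ((fun z => z + y) ⁻¹' Ω) := by
  refine ⟨hφ.1.comp (contDiff_id.add contDiff_const), ?_, ?_⟩
  · exact hφ.2.1.comp_homeomorph (Homeomorph.addRight y)
  · rw [tsupport_comp_add_right]; exact preimage_mono hφ.2.2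

variable [MeasurableSpace V] [BorelSpace V]

theorem testFun_memLp [FiniteDimensional ℝ V] {μ : Measure V} [IsFiniteMeasureOnCompacts μ]
    (hφ : φ ∈ testFun Ω) (p : ℝ≥0∞) : MemLp φ p μ :=
  (testFun_continuous hφ).memLp_of_hasCompactSupport hφ.2.1

theorem testFun_integrable_mul [FiniteDimensional ℝ V] {μ : Measure V}
    {u : V → ℝ} (hu : LocallyIntegrableOn u Ω μ) (hφ : φ ∈ testFun Ω) :
    Integrable (fun z => φ z * u z) μ := by
  have h1 : IntegrableOn u (tsupport φ) μ := by
    refine LocallyIntegrableOn.integrableOn_isCompact (hu.mono_set hφ.2.2) hφ.2.1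
  have h2 : Integrable ((tsupport φ).indicator u) μ :=
    h1.integrable_indicator (isClosed_tsupport φ).measurableSet
  obtain ⟨B, hB⟩ := (testFun_continuous hφ).bounded_above_of_compact_support hφ.2.1
  refine (h2.bdd_mul (c := B) (testFun_continuous hφ).aestronglyMeasurable
    (.of_forall hB)).congr (.of_forall fun z => ?_)
  by_cases hz : z ∈ tsupport φ
  · simp [indicator_of_mem hz]
  · simp [image_eq_zero_of_notMem_tsupport hz]

/-- A functional on test functions that is bounded in the `Lᵖ` norm is given by a function
in `L^q`. -/
theorem exists_repr_of_test [FiniteDimensional ℝ V] {μ : Measure V} [IsFiniteMeasureOnCompacts μ]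
    {p q C : ℝ} (hpq : p.HolderConjugate q) (hC : 0 ≤ C) (T : testFun Ω →ₗ[ℝ] ℝ)
    (hT : ∀ f : testFun Ω, |T f| ≤ C * 𝐍[(f : V → ℝ),p,μ]) :
    ∃ g : V → ℝ, Measurable g ∧ MemLp g (ofReal q) μ ∧ eLpNorm g (ofReal q) μ ≤ ofReal C ∧
      ∀ f : testFun Ω, T f = ∫ x, (f : V → ℝ) x * g x ∂μ :=
  exists_repr_of_submodule hpq hC (testFun Ω) (fun _ hf => testFun_memLp hf _) T hT

/-- The `L^q` norm on an open set of a locally integrable function, by duality with test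
functions. -/
theorem eLpNorm_le_of_forall_test [FiniteDimensional ℝ V] {μ : Measure V}
    [IsFiniteMeasureOnCompacts μ] {p q C : ℝ} (hpq : p.HolderConjugate q) (hC : 0 ≤ C)
    (hΩ : IsOpen Ω) {f : V → ℝ} (hf : LocallyIntegrableOn f Ω μ)
    (h : ∀ φ ∈ testFun Ω, |∫ z, φ z * f z ∂μ| ≤ C * 𝐍[φ,p,μ]) : MemLp f (ofReal q) (μ.restrict Ω) ∧
      eLpNorm f (ofReal q) (μ.restrict Ω) ≤ ofReal C := by
  have hint : ∀ φ ∈ testFun Ω, Integrable (fun z => φ z * f z) μ := fun φ hφ =>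
    testFun_integrable_mul hf hφ
  obtain ⟨g, -, hg1, hg2, hg3⟩ := exists_repr_of_test (μ := μ) (Ω := Ω) hpq hC
    { toFun := fun φ => ∫ z, (φ : V → ℝ) z * f z ∂μ
      map_add' := fun a b => by
        rw [← integral_add (hint a a.2) (hint b b.2)]
        simp [add_mul]
      map_smul' := fun c a => by simp [mul_assoc, integral_const_mul] } (fun φ => h φ φ.2)
  have hgl : LocallyIntegrable g μ := hg1.locallyIntegrable (ENNReal.one_le_ofReal.2 hpq.symm.lt.le)
  -- The representing function g of the functional φ ↦ ∫ φ f agrees with f on Ω by the fundamental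
  -- lemma of the calculus of variations. With C = 0 this also serves as a criterion for f to vanish
  -- almost everywhere.
  have hae := hΩ.ae_eq_zero_of_integral_contDiff_smul_eq_zero (μ := μ) (f := fun z => f z - g z)
    (hf.sub (hgl.locallyIntegrableOn Ω)) (fun k hk1 hk2 hk3 => by
      have hk : k ∈ testFun Ω := ⟨hk1, hk2, hk3⟩
      have h1 := hg3 ⟨k, hk⟩
      simp only [smul_eq_mul, mul_sub]
      rw [integral_sub (hint k hk) (testFun_integrable_mul (hgl.locallyIntegrableOn Ω) hk)]
      simpa [sub_eq_zero] using! h1)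
  have hae' : f =ᵐ[μ.restrict Ω] g := by
    rw [EventuallyEq, ae_restrict_iff' hΩ.measurableSet]
    filter_upwards [hae] with z hz hzΩ
    exact sub_eq_zero.1 (hz hzΩ)
  refine ⟨(hg1.restrict Ω).ae_eq hae'.symm, ?_⟩
  rw [eLpNorm_congr_ae hae']
  exact (eLpNorm_restrict_le _ _ _ _).trans hg2

end TestFunctions

/-- Test functions on a whole space. -/
local notation "𝓣[" X "]" => testFun (Set.univ : Set X)

/-! ### Translates of functions with a weak derivative. -/

section Translation

variable {V : Type*} [NormedAddCommGroup V] [NormedSpace ℝ V] [FiniteDimensional ℝ V]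
  [MeasurableSpace V] [BorelSpace V] {μ : Measure V} {Ω : Set V}

/-- The derivative of `s ↦ ∫ w(z) φ(z + s h) dz`. -/
theorem hasDerivAt_integral_translate {w : V → ℝ} (hw : LocallyIntegrable w μ)
    {φ : V → ℝ} (hφ : φ ∈ testFun univ) (h : V) (s₀ : ℝ) :
    HasDerivAt (fun s : ℝ => ∫ z, φ (z + s • h) * w z ∂μ)
      (∫ z, fderiv ℝ φ (z + s₀ • h) h * w z ∂μ) s₀ := by
  have hφ' := testFun_fderiv hφ h
  obtain ⟨B, hB⟩ := (testFun_continuous hφ').bounded_above_of_compact_support hφ'.2.1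
  have hB0 : 0 ≤ B := (norm_nonneg _).trans (hB 0)
  -- a compact set that contains all relevant supports
  set K : Set V := (fun x : V × ℝ => x.1 - x.2 • h) '' (tsupport φ ×ˢ Icc (s₀ - 1) (s₀ + 1)) with hK
  have hKc : IsCompact K := (hφ.2.1.isCompact.prod isCompact_Icc).image (by fun_prop)
  have hKout : ∀ s ∈ Metric.ball s₀ 1, ∀ z, z ∉ K → fderiv ℝ φ (z + s • h) h = 0 := by
    intro s hs z hz
    have hzs : z + s • h ∉ tsupport φ := by
      intro hmem
      apply hz
      rw [Metric.mem_ball, Real.dist_eq, abs_lt] at hs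
      exact ⟨(z + s • h, s), ⟨hmem, by constructor <;> linarith⟩, by simp⟩
    have := image_eq_zero_of_notMem_tsupport fun h' => hzs (tsupport_fderiv_subset ℝ h')
    rw [this]; rfl
  have hint : ∀ s : ℝ, Integrable (fun z => φ (z + s • h) * w z) μ := fun s =>
    testFun_integrable_mul (hw.locallyIntegrableOn univ)
      (testFun_mono (subset_univ _) (testFun_translate hφ (s • h)))
  have hmeas : ∀ s : ℝ, AEStronglyMeasurable (fun z => φ (z + s • h) * w z) μ := fun s => (hint s).1
  have hb : Integrable (fun z => B * ‖K.indicator w z‖) μ := by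
    refine Integrable.const_mul ?_ _
    exact ((hw.integrableOn_isCompact hKc).integrable_indicator hKc.measurableSet).norm
  refine (hasDerivAt_integral_of_dominated_loc_of_deriv_le
    (F' := fun s z => fderiv ℝ φ (z + s • h) h * w z) (Metric.ball_mem_nhds s₀ one_pos)
    (.of_forall hmeas) (hint s₀) ?_ ?_ hb ?_).2
  · exact (testFun_integrable_mul (hw.locallyIntegrableOn univ)
      (testFun_mono (subset_univ _) (testFun_translate hφ' (s₀ • h)))).1
  · refine .of_forall fun z s hs => ?_
    by_cases hz : z ∈ K
    · rw [norm_mul, indicator_of_mem hz]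
      exact mul_le_mul_of_nonneg_right (hB _) (norm_nonneg _)
    · rw [hKout s hs z hz]; simp; positivity
  · refine .of_forall fun z s _ => ?_
    have h1 : HasDerivAt (fun s : ℝ => z + s • h) h s := by
      simpa using ((hasDerivAt_id s).smul_const h).const_add z
    have h2 : HasDerivAt (fun s : ℝ => φ (z + s • h)) (fderiv ℝ φ (z + s • h) h) s :=
      ((testFun_differentiable hφ _).hasFDerivAt).comp_hasDerivAt s h1
    exact h2.mul_const _

/-- Two locally integrable functions on an open set agree in integrals against test functions
when one is cut off outside a compact set containing the support. -/
theorem integral_mul_indicator_of_support {K : Set V} {φ u : V → ℝ} (h : ∀ z, z ∉ K → φ z = 0) :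
    ∫ z, φ z * K.indicator u z ∂μ = ∫ z, φ z * u z ∂μ := by
  refine integral_congr_ae (.of_forall fun z => ?_)
  by_cases hz : z ∈ K
  · simp [hz]
  · simp [h z hz]

/-- **Translation estimate**: if `∂_h u = G ∈ L^q` weakly in the convex open set `Ω`, then the
difference `u(· + h) - u` is in `L^q`, with norm at most that of `G`. -/
theorem eLpNorm_translate_sub_le [μ.IsAddHaarMeasure] {p q : ℝ} (hpq : p.HolderConjugate q)
    (hΩ : IsOpen Ω) (hconv : Convex ℝ Ω) {u G : V → ℝ} (h : V)
    (hu : LocallyIntegrableOn u Ω μ) (hG : MemLp G (ofReal q) (μ.restrict Ω))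
    (hw : ∀ φ ∈ testFun Ω, ∫ z, fderiv ℝ φ z h * u z ∂μ = - ∫ z, φ z * G z ∂μ) :
    MemLp (fun z => u (z + h) - u z) (ofReal q) (μ.restrict (Ω ∩ (fun z => z + h) ⁻¹' Ω)) ∧
      eLpNorm (fun z => u (z + h) - u z) (ofReal q) (μ.restrict (Ω ∩ (fun z => z + h) ⁻¹' Ω)) ≤
        eLpNorm G (ofReal q) (μ.restrict Ω) := by
  have hΩ' : IsOpen (Ω ∩ (fun z => z + h) ⁻¹' Ω) := hΩ.inter (hΩ.preimage (by fun_prop))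
  have hut : LocallyIntegrableOn (fun z => u (z + h)) ((fun z => z + h) ⁻¹' Ω) μ := by
    rw [locallyIntegrableOn_iff (hΩ.preimage (by fun_prop : Continuous fun z => z + h)).isLocallyClosed]
    intro k hk hkc
    have hk' : IntegrableOn u ((fun z => z + h) '' k) μ :=
      LocallyIntegrableOn.integrableOn_isCompact
        (hu.mono_set (image_subset_iff.2 hk)) (hkc.image (by fun_prop))
    have hmp : MeasurePreserving (fun z => z + h) μ μ := measurePreserving_add_right μ h
    exact (hmp.integrableOn_image (Homeomorph.addRight h).measurableEmbedding).1 hk'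
  have hGfin : eLpNorm G (ofReal q) (μ.restrict Ω) ≠ ⊤ := hG.2.ne
  have key := eLpNorm_le_of_forall_test (μ := μ) hpq
    (C := 𝐍[G,q,μ.restrict Ω]) ENNReal.toReal_nonneg hΩ'
    (f := fun z => u (z + h) - u z)
    ((hut.mono_set inter_subset_right).sub (hu.mono_set inter_subset_left)) ?_
  · rwa [ENNReal.ofReal_toReal hGfin] at key
  intro φ hφ
  have hφΩ : φ ∈ testFun Ω := testFun_mono inter_subset_left hφ
  -- supports along the path
  set K : Set V := (fun x : V × ℝ => x.1 + x.2 • h) '' (tsupport φ ×ˢ Icc (0 : ℝ) 1) with hK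
  have hKc : IsCompact K := (hφ.2.1.isCompact.prod isCompact_Icc).image (by fun_prop)
  -- For z in the support of φ both z and z + h lie in Ω, so convexity keeps the whole segment
  -- there. Hence the weak derivative may be tested with all intermediate translates of φ.
  have hKΩ : K ⊆ Ω := by
    rintro _ ⟨⟨z, s⟩, ⟨hz, hs⟩, rfl⟩
    obtain ⟨h1, h2⟩ := hφ.2.2 hz
    have := hconv h1 h2 (sub_nonneg.2 hs.2) hs.1 (by ring)
    convert this using 1
    simp only [smul_add, sub_smul, one_smul]; abel
  have hφs : ∀ s ∈ Icc (0 : ℝ) 1, (fun z => φ (z + s • (-h))) ∈ testFun Ω := by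
    intro s hs
    have h1 := testFun_translate (testFun_mono (subset_univ _) hφ : φ ∈ testFun univ) (s • (-h))
    refine ⟨h1.1, h1.2.1, ?_⟩
    rw [tsupport_comp_add_right]
    intro z hz
    exact hKΩ ⟨(z + s • (-h), s), ⟨hz, hs⟩, by simp⟩
  have hKout : ∀ s ∈ Icc (0 : ℝ) 1, ∀ z, z ∉ K → z + s • (-h) ∉ tsupport φ := by
    intro s hs z hz hmem
    exact hz ⟨(z + s • (-h), s), ⟨hmem, hs⟩, by simp⟩
  set v : V → ℝ := K.indicator u with hv
  have hvint : Integrable v μ :=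
    (LocallyIntegrableOn.integrableOn_isCompact (hu.mono_set hKΩ) hKc).integrable_indicator
      hKc.measurableSet
  -- J interpolates between ∫ φ u at s = 0 and ∫ φ u(· + h) at s = 1. Its derivative is ∫ φ(z - sh)
  -- G(z) dz, at most ‖G‖_q ‖φ‖_p, and the mean value inequality finishes.
  set J : ℝ → ℝ := fun s => ∫ z, φ (z + s • (-h)) * v z ∂μ with hJ
  have hJ' : ∀ s, HasDerivAt J (∫ z, fderiv ℝ φ (z + s • (-h)) (-h) * v z ∂μ) s := fun s =>
    hasDerivAt_integral_translate hvint.locallyIntegrable (testFun_mono (subset_univ _) hφ) (-h) s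
  have hJv : ∀ s ∈ Icc (0 : ℝ) 1, J s = ∫ z, φ (z + s • (-h)) * u z ∂μ := by
    intro s hs
    exact integral_mul_indicator_of_support fun z hz =>
      image_eq_zero_of_notMem_tsupport (hKout s hs z hz)
  have hbd : ∀ s ∈ Icc (0 : ℝ) 1, |∫ z, fderiv ℝ φ (z + s • (-h)) (-h) * v z ∂μ| ≤
      𝐍[G,q,μ.restrict Ω] * 𝐍[φ,p,μ] := by
    intro s hs
    have e1 : ∫ z, fderiv ℝ φ (z + s • (-h)) (-h) * v z ∂μ = ∫ z, φ (z + s • (-h)) * G z ∂μ := by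
      rw [integral_mul_indicator_of_support (φ := fun z => fderiv ℝ φ (z + s • (-h)) (-h))]
      · have h1 := hw _ (hφs s hs)
        simp only [fderiv_comp_add_right] at h1
        simp only [map_neg, neg_mul, integral_neg]
        rw [h1, neg_neg]
      · intro z hz
        have := image_eq_zero_of_notMem_tsupport fun h' =>
          hKout s hs z hz (tsupport_fderiv_subset ℝ h')
        rw [this]; rfl
    have e2 : ∫ z, φ (z + s • (-h)) * G z ∂μ = ∫ z in Ω, φ (z + s • (-h)) * G z ∂μ := by
      rw [setIntegral_eq_integral_of_forall_compl_eq_zero]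
      intro z hz
      rw [testFun_eq_zero (hφs s hs) hz, zero_mul]
    rw [e1, e2]
    refine (abs_integral_mul_le hpq ((testFun_memLp (hφs s hs) _).restrict Ω) hG).trans ?_
    rw [mul_comm]
    refine mul_le_mul_of_nonneg_left (ENNReal.toReal_mono (testFun_memLp hφ _).2.ne ?_)
      ENNReal.toReal_nonneg
    refine (eLpNorm_restrict_le _ _ _ _).trans (le_of_eq ?_)
    exact eLpNorm_comp_measurePreserving (testFun_continuous hφ).aestronglyMeasurable
      (measurePreserving_add_right μ (s • (-h)))
  have hmv := norm_image_sub_le_of_norm_deriv_le_segment_01' (f := J)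
    (fun s _ => (hJ' s).hasDerivWithinAt) (fun s hs => hbd s (Ico_subset_Icc_self hs))
  have e0 : J 0 = ∫ z, φ z * u z ∂μ := by rw [hJv 0 (by simp)]; simp
  have e1 : J 1 = ∫ z, φ z * u (z + h) ∂μ := by
    rw [hJv 1 (by simp), ← integral_add_right_eq_self _ h]
    simp
  have i0 : Integrable (fun z => φ z * u z) μ := testFun_integrable_mul hu hφΩ
  have i1 : Integrable (fun z => φ z * u (z + h)) μ :=
    testFun_integrable_mul hut (testFun_mono inter_subset_right hφ)
  rw [e0, e1, ← integral_sub i1 i0] at hmv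
  simpa [mul_sub] using hmv

end Translation

/-! ### Averages of translates, weak continuity, mollifiers. -/

section Averages

variable {V : Type*} [NormedAddCommGroup V] [NormedSpace ℝ V] [FiniteDimensional ℝ V]
  [MeasurableSpace V] [BorelSpace V] {μ : Measure V} [μ.IsAddHaarMeasure]

/-- The average `∫ f(z + y) dν(y)` of translates of a function. -/
noncomputable def avgTranslate {F : Type*} [NormedAddCommGroup F] [NormedSpace ℝ F]
    (ν : Measure V) (f : V → F) (z : V) : F := ∫ y, f (z + y) ∂ν

theorem memLp_translate {F : Type*} [NormedAddCommGroup F] {f : V → F} {p : ℝ≥0∞}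
    (hf : MemLp f p μ) (y : V) : MemLp (fun z => f (z + y)) p μ :=
  hf.comp_measurePreserving (measurePreserving_add_right μ y)

theorem eLpNorm_translate {F : Type*} [NormedAddCommGroup F] {f : V → F} {p : ℝ≥0∞}
    (hf : AEStronglyMeasurable f μ) (y : V) : eLpNorm (fun z => f (z + y)) p μ = eLpNorm f p μ :=
  eLpNorm_comp_measurePreserving hf (measurePreserving_add_right μ y)

theorem integrable_mul_holder {α : Type*} [MeasurableSpace α] {m : Measure α} {p q : ℝ}
    (hpq : p.HolderConjugate q) {k f : α → ℝ} (hk : MemLp k (ofReal p) m)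
    (hf : MemLp f (ofReal q) m) : Integrable (fun z => k z * f z) m := by
  have := hpq.ennrealOfReal
  exact hk.integrable_mul hf

/-- The shear (x, y) ↦ (x, x + y) preserves the product measure, so composing with addition respects
null sets. -/
theorem aestronglyMeasurable_add {F : Type*} [NormedAddCommGroup F] {f : V → F}
    (hf : AEStronglyMeasurable f μ) (ν : Measure V) [SFinite ν] :
    AEStronglyMeasurable (fun x : V × V => f (x.1 + x.2)) (μ.prod ν) := by
  have h1 : MeasurePreserving (fun x : V × V => (x.1, x.1 + x.2)) (ν.prod μ) (ν.prod μ) :=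
    measurePreserving_prod_add ν μ
  have h2 : Measure.QuasiMeasurePreserving (Prod.snd : V × V → V) (ν.prod μ) μ :=
    Measure.quasiMeasurePreserving_snd
  have h3 := hf.comp_quasiMeasurePreserving (h2.comp h1.quasiMeasurePreserving)
  have h4 := h3.prod_swap
  refine h4.congr (.of_forall fun x => ?_)
  simp [add_comm]

theorem integrable_mul_add {p q : ℝ} (hpq : p.HolderConjugate q) {k f : V → ℝ}
    (hk : MemLp k (ofReal p) μ) (hf : MemLp f (ofReal q) μ) (ν : Measure V) [IsFiniteMeasure ν] :
    Integrable (fun x : V × V => k x.1 * f (x.1 + x.2)) (μ.prod ν) := by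
  have := hpq.ennrealOfReal
  have hm : AEStronglyMeasurable (fun x : V × V => k x.1 * f (x.1 + x.2)) (μ.prod ν) :=
    (hk.1.comp_quasiMeasurePreserving Measure.quasiMeasurePreserving_fst).mul
      (aestronglyMeasurable_add hf.1 ν)
  rw [integrable_prod_iff' hm]
  refine ⟨.of_forall fun y => hk.integrable_mul (memLp_translate hf y), ?_⟩
  refine Integrable.of_bound (C := 𝐍[k,p,μ] * 𝐍[f,q,μ]) hm.norm.prod_swap.integral_prod_right'
    (.of_forall fun y => ?_)
  have h1 := abs_integral_mul_le hpq hk.norm (memLp_translate hf y).norm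
  rw [eLpNorm_norm, eLpNorm_norm, eLpNorm_translate hf.1] at h1
  simpa [norm_mul] using h1

theorem integral_mul_avgTranslate {p q : ℝ} (hpq : p.HolderConjugate q) {k f : V → ℝ}
    (hk : MemLp k (ofReal p) μ) (hf : MemLp f (ofReal q) μ) (ν : Measure V) [IsFiniteMeasure ν] :
    ∫ z, k z * avgTranslate ν f z ∂μ = ∫ y, ∫ z, k z * f (z + y) ∂μ ∂ν := by
  rw [← integral_integral_swap (integrable_mul_add hpq hk hf ν)]
  simp [avgTranslate, integral_const_mul]

/-- Minkowski's integral inequality, obtained by duality: against a test function each translate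
contributes at most ‖f‖_q ‖φ‖_p, and ν has mass one. -/
theorem memLp_avgTranslate {p q : ℝ} (hpq : p.HolderConjugate q) {f : V → ℝ}
    (hf : MemLp f (ofReal q) μ) (ν : Measure V) [IsProbabilityMeasure ν] :
    MemLp (avgTranslate ν f) (ofReal q) μ ∧
      eLpNorm (avgTranslate ν f) (ofReal q) μ ≤ eLpNorm f (ofReal q) μ := by
  have h1p : (1 : ℝ≥0∞) ≤ ofReal q := ENNReal.one_le_ofReal.2 hpq.symm.lt.le
  have hm : AEStronglyMeasurable (avgTranslate ν f) μ :=
    (aestronglyMeasurable_add hf.1 ν).integral_prod_right'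
  have hloc : LocallyIntegrable (avgTranslate ν f) μ := by
    rw [locallyIntegrable_iff]
    intro K hK
    have hk : MemLp (K.indicator fun _ => (1 : ℝ)) (ofReal p) μ :=
      memLp_indicator_const _ hK.measurableSet _ (Or.inr hK.measure_lt_top.ne)
    have h1 := (integrable_mul_add hpq hk hf ν).integral_prod_left
    rw [← integrable_indicator_iff hK.measurableSet]
    refine h1.congr (.of_forall fun z => ?_)
    by_cases hz : z ∈ K <;> simp [hz, avgTranslate]
  have key := eLpNorm_le_of_forall_test (μ := μ) hpq
    (C := 𝐍[f,q,μ]) ENNReal.toReal_nonneg isOpen_univ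
    (f := avgTranslate ν f) (hloc.locallyIntegrableOn univ) ?_
  · rwa [ENNReal.ofReal_toReal hf.2.ne, Measure.restrict_univ] at key
  intro φ hφ
  have hφp : MemLp φ (ofReal p) μ := testFun_memLp hφ _
  rw [integral_mul_avgTranslate hpq hφp hf]
  have hb : ∀ y, ‖∫ z, φ z * f (z + y) ∂μ‖ ≤ 𝐍[f,q,μ] * 𝐍[φ,p,μ] := fun y => by
    have := abs_integral_mul_le hpq hφp (memLp_translate hf y)
    rwa [eLpNorm_translate hf.1, mul_comm] at this
  simpa using norm_integral_le_of_norm_le_const (μ := ν) (.of_forall hb)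

/-- Weak continuity of translations at `0`. -/
theorem continuousAt_integral_mul_translate {p q : ℝ} (hpq : p.HolderConjugate q) {k f : V → ℝ}
    (hk : MemLp k (ofReal p) μ) (hf : MemLp f (ofReal q) μ) :
    Continuous (fun y => ∫ z, k z * f (z + y) ∂μ) := by
  have h1p : (1 : ℝ≥0∞) ≤ ofReal p := ENNReal.one_le_ofReal.2 hpq.lt.le
  have h1q : (1 : ℝ≥0∞) ≤ ofReal q := ENNReal.one_le_ofReal.2 hpq.symm.lt.le
  refine continuous_of_uniform_approx_of_continuous fun u hu => ?_
  obtain ⟨ε, hε, hεu⟩ := Metric.mem_uniformity_dist.1 hu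
  set N := 𝐍[f,q,μ] with hN
  have hN0 : 0 ≤ N := ENNReal.toReal_nonneg
  obtain ⟨φ, hφ1, hφ2, hφ3⟩ := hk.exist_eLpNorm_sub_le ENNReal.ofReal_ne_top h1p
    (ε := ε / (2 * (N + 1))) (by positivity)
  have hφ : φ ∈ 𝓣[V] := ⟨hφ2, hφ1, subset_univ _⟩
  have := hpq.ennrealOfReal
  refine ⟨fun y => ∫ z, φ z * f (z + y) ∂μ, ?_, fun y => hεu ?_⟩
  -- For a test function φ in place of k the integral is a convolution with the reflected φ, hence
  -- continuous in y; general k are uniform limits of this case.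
  · have h1 : HasCompactSupport fun z => φ (-z) := hφ1.comp_homeomorph (Homeomorph.neg V)
    have h2 := h1.continuous_convolution_left (L := ContinuousLinearMap.mul ℝ ℝ) (μ := μ)
      (hφ2.continuous.comp continuous_neg) (hf.locallyIntegrable h1q)
    refine h2.congr fun y => ?_
    simp only [convolution, ContinuousLinearMap.mul_apply']
    rw [← integral_neg_eq_self]
    simp [add_comm]
  · rw [Real.dist_eq]
    beta_reduce
    rw [← integral_sub (integrable_mul_holder hpq hk (memLp_translate hf y))
      (integrable_mul_holder hpq (testFun_memLp hφ _) (memLp_translate hf y))]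
    simp only [← sub_mul]
    have h3 := abs_integral_mul_le hpq (hk.sub (testFun_memLp hφ _)) (memLp_translate hf y)
    rw [eLpNorm_translate hf.1] at h3
    have h4 : 𝐍[k - φ,p,μ] ≤ ε / (2 * (N + 1)) := ENNReal.toReal_le_of_le_ofReal (by positivity) hφ3
    refine lt_of_le_of_lt (h3.trans (mul_le_mul_of_nonneg_right h4 hN0)) ?_
    rw [div_mul_eq_mul_div, div_lt_iff₀ (by positivity)]
    nlinarith

/-- Weak convergence to zero of translates. -/
theorem tendsto_integral_mul_translate {p q : ℝ} (hpq : p.HolderConjugate q) {k f : V → ℝ}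
    (hk : MemLp k (ofReal p) μ) (hf : MemLp f (ofReal q) μ) :
    Tendsto (fun y => ∫ z, k z * f (z + y) ∂μ) (cocompact V) (𝓝 0) := by
  have h1p : (1 : ℝ≥0∞) ≤ ofReal p := ENNReal.one_le_ofReal.2 hpq.lt.le
  have h1q : (1 : ℝ≥0∞) ≤ ofReal q := ENNReal.one_le_ofReal.2 hpq.symm.lt.le
  have := hpq.ennrealOfReal
  rw [Metric.tendsto_nhds]
  intro ε hε
  set N := 𝐍[f,q,μ] with hN
  have hN0 : 0 ≤ N := ENNReal.toReal_nonneg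
  obtain ⟨φ, hφ1, hφ2, hφ3⟩ := hk.exist_eLpNorm_sub_le ENNReal.ofReal_ne_top h1p
    (ε := ε / (3 * (N + 1))) (by positivity)
  have hφ : φ ∈ 𝓣[V] := ⟨hφ2, hφ1, subset_univ _⟩
  set M := 𝐍[φ,p,μ] with hM
  have hM0 : 0 ≤ M := ENNReal.toReal_nonneg
  obtain ⟨ψ, hψ1, hψ2, hψ3⟩ := hf.exist_eLpNorm_sub_le ENNReal.ofReal_ne_top h1q
    (ε := ε / (3 * (M + 1))) (by positivity)
  have hψ : ψ ∈ 𝓣[V] := ⟨hψ2, hψ1, subset_univ _⟩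
  have hc : IsCompact ((fun x : V × V => x.1 - x.2) '' (tsupport ψ ×ˢ tsupport φ)) :=
    (hψ1.isCompact.prod hφ1.isCompact).image (by fun_prop)
  filter_upwards [hc.compl_mem_cocompact] with y hy
  -- For y outside the compact set of differences of the two supports the translated supports are
  -- disjoint. Only the two approximation errors remain, each at most ε/3; the +1 in the
  -- denominators covers vanishing norms.
  have hz : ∀ z, φ z * ψ (z + y) = 0 := by
    intro z
    by_contra h0
    have h1 : φ z ≠ 0 := left_ne_zero_of_mul h0
    have h2 : ψ (z + y) ≠ 0 := right_ne_zero_of_mul h0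
    exact hy ⟨(z + y, z), ⟨subset_tsupport _ h2, subset_tsupport _ h1⟩, by simp⟩
  have hsplit : ∫ z, k z * f (z + y) ∂μ = ∫ z, (k - φ) z * f (z + y) ∂μ +
      ∫ z, φ z * (f - ψ) (z + y) ∂μ := by
    rw [← integral_add]
    · refine integral_congr_ae (.of_forall fun z => ?_)
      have := hz z
      simp only [Pi.sub_apply]; linear_combination this
    · exact integrable_mul_holder hpq (hk.sub (testFun_memLp hφ _)) (memLp_translate hf y)
    · exact integrable_mul_holder hpq (testFun_memLp hφ _)
        (memLp_translate (hf.sub (testFun_memLp hψ _)) y)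
  rw [dist_zero_right, hsplit]
  refine (norm_add_le _ _).trans_lt ?_
  have h3 := abs_integral_mul_le hpq (hk.sub (testFun_memLp hφ _)) (memLp_translate hf y)
  rw [eLpNorm_translate hf.1] at h3
  have h4 : 𝐍[k - φ,p,μ] ≤ ε / (3 * (N + 1)) := ENNReal.toReal_le_of_le_ofReal (by positivity) hφ3
  have h5 := abs_integral_mul_le hpq (testFun_memLp (μ := μ) hφ (ofReal p))
    (memLp_translate (hf.sub (testFun_memLp hψ _)) y)
  rw [eLpNorm_translate (hf.sub (testFun_memLp hψ _)).1] at h5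
  have h6 : 𝐍[f - ψ,q,μ] ≤ ε / (3 * (M + 1)) := ENNReal.toReal_le_of_le_ofReal (by positivity) hψ3
  have h7 : ε / (3 * (N + 1)) * N ≤ ε / 3 := by
    rw [div_mul_eq_mul_div, div_le_div_iff₀ (by positivity) (by positivity)]
    nlinarith
  have h8 : M * (ε / (3 * (M + 1))) ≤ ε / 3 := by
    rw [mul_div_assoc', div_le_div_iff₀ (by positivity) (by positivity)]
    nlinarith
  have h9 := h3.trans (mul_le_mul_of_nonneg_right h4 hN0)
  have h10 := h5.trans (mul_le_mul_of_nonneg_left h6 hM0)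
  rw [Real.norm_eq_abs, Real.norm_eq_abs]
  linarith

/-- Averages over small translations converge weakly. -/
theorem exists_forall_abs_integral_mul_avgTranslate_sub_le {p q : ℝ} (hpq : p.HolderConjugate q)
    {k f : V → ℝ} (hk : MemLp k (ofReal p) μ) (hf : MemLp f (ofReal q) μ) {η : ℝ} (hη : 0 < η) :
    ∃ δ > 0, ∀ (ν : Measure V) [IsProbabilityMeasure ν], (∀ᵐ y ∂ν, ‖y‖ < δ) →
      |∫ z, k z * avgTranslate ν f z ∂μ - ∫ z, k z * f z ∂μ| ≤ η := by
  have hc := (continuousAt_integral_mul_translate (μ := μ) hpq hk hf).continuousAt (x := 0)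
  obtain ⟨δ, hδ, h⟩ := Metric.continuousAt_iff.1 hc η hη
  refine ⟨δ, hδ, fun ν _ hν => ?_⟩
  rw [integral_mul_avgTranslate hpq hk hf]
  have hi : Integrable (fun y => ∫ z, k z * f (z + y) ∂μ) ν :=
    (integrable_mul_add hpq hk hf ν).integral_prod_right
  have e : ∫ z, k z * f z ∂μ = ∫ _ : V, (∫ z, k z * f (z + 0) ∂μ) ∂ν := by simp
  rw [e, ← integral_sub hi (integrable_const _)]
  have hb : ∀ᵐ y ∂ν, ‖(∫ z, k z * f (z + y) ∂μ) - ∫ z, k z * f (z + 0) ∂μ‖ ≤ η := ?_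
  · simpa using norm_integral_le_of_norm_le_const hb
  filter_upwards [hν] with y hy
  have := h (x := y) (by simpa [dist_zero_right] using hy)
  rw [Real.dist_eq] at this
  exact this.le

/-- A smooth mollifier supported near a given point. -/
theorem exists_mollifier (μ : Measure V) [μ.IsAddHaarMeasure] (c : V) {δ : ℝ} (hδ : 0 < δ) :
    ∃ ρ : V → ℝ, ρ ∈ testFun (Metric.ball c δ) ∧ (∀ y, 0 ≤ ρ y) ∧ ∫ y, ρ y ∂μ = 1 := by
  let b : ContDiffBump c := ⟨δ / 4, δ / 2, by positivity, by linarith⟩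
  refine ⟨b.normed μ, ⟨b.contDiff_normed, b.hasCompactSupport_normed, ?_⟩,
    fun y => b.nonneg_normed y, b.integral_normed⟩
  rw [b.tsupport_normed_eq]
  exact Metric.closedBall_subset_ball (by simp only [b]; linarith)

/-- The probability measure with density `ρ`. -/
noncomputable def mollMeasure (μ : Measure V) (ρ : V → ℝ) : Measure V :=
  μ.withDensity fun y => ofReal (ρ y)

theorem isProbabilityMeasure_mollMeasure {ρ : V → ℝ} {Ω : Set V} (hρ : ρ ∈ testFun Ω)
    (h0 : ∀ y, 0 ≤ ρ y) (h1 : ∫ y, ρ y ∂μ = 1) : IsProbabilityMeasure (mollMeasure μ ρ) := by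
  refine ⟨?_⟩
  have hi : Integrable ρ μ := memLp_one_iff_integrable.1 (testFun_memLp hρ 1)
  rw [mollMeasure, withDensity_apply _ MeasurableSet.univ, Measure.restrict_univ,
    ← ofReal_integral_eq_lintegral_ofReal hi (.of_forall h0), h1, ENNReal.ofReal_one]

theorem ae_mollMeasure {ρ : V → ℝ} {Ω : Set V} (hρ : ρ ∈ testFun Ω) :
    ∀ᵐ y ∂(mollMeasure μ ρ), y ∈ Ω := by
  rw [mollMeasure, ae_withDensity_iff (testFun_continuous hρ).measurable.ennreal_ofReal]
  refine .of_forall fun y hy => ?_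
  by_contra h
  exact hy (by simp [testFun_eq_zero hρ h])

theorem avgTranslate_mollMeasure {F : Type*} [NormedAddCommGroup F] [NormedSpace ℝ F]
    {ρ : V → ℝ} {Ω : Set V} (hρ : ρ ∈ testFun Ω) (h0 : ∀ y, 0 ≤ ρ y) (f : V → F) (z : V) :
    avgTranslate (mollMeasure μ ρ) f z = ∫ y, ρ (y - z) • f y ∂μ := by
  rw [avgTranslate, mollMeasure, integral_withDensity_eq_integral_toReal_smul
    (testFun_continuous hρ).measurable.ennreal_ofReal (.of_forall fun _ => ENNReal.ofReal_lt_top),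
    ← integral_sub_right_eq_self _ z]
  refine integral_congr_ae (.of_forall fun y => ?_)
  simp [ENNReal.toReal_ofReal (h0 _)]

/-- The average is the convolution of f with the reflected density, so it inherits the smoothness of
ρ. -/
theorem contDiff_avgTranslate_mollMeasure {ρ : V → ℝ} {Ω : Set V} (hρ : ρ ∈ testFun Ω)
    (h0 : ∀ y, 0 ≤ ρ y) {f : V → ℝ} (hf : LocallyIntegrable f μ) :
    ContDiff ℝ ∞ (avgTranslate (mollMeasure μ ρ) f) := by
  have h1 : HasCompactSupport fun z => ρ (-z) := hρ.2.1.comp_homeomorph (Homeomorph.neg V)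
  have h2 := h1.contDiff_convolution_left (L := ContinuousLinearMap.mul ℝ ℝ) (μ := μ) (n := ⊤)
    (hρ.1.comp contDiff_neg) hf
  convert h2 using 1
  funext z
  rw [avgTranslate_mollMeasure hρ h0]
  simp only [convolution, ContinuousLinearMap.mul_apply', smul_eq_mul]
  rw [← integral_sub_left_eq_self _ μ z]
  simp

theorem hasCompactSupport_avgTranslate_mollMeasure {ρ : V → ℝ} {Ω : Set V} (hρ : ρ ∈ testFun Ω)
    (h0 : ∀ y, 0 ≤ ρ y) {f : V → ℝ} {K : Set V} (hK : IsCompact K) (hf : ∀ y, y ∉ K → f y = 0) :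
    HasCompactSupport (avgTranslate (mollMeasure μ ρ) f) := by
  have hc : IsCompact ((fun x : V × V => x.1 - x.2) '' (K ×ˢ tsupport ρ)) :=
    (hK.prod hρ.2.1.isCompact).image (by fun_prop)
  refine HasCompactSupport.intro hc fun z hz => ?_
  rw [avgTranslate_mollMeasure hρ h0]
  refine (integral_congr_ae (.of_forall fun y => ?_)).trans (integral_zero V ℝ)
  by_cases hy : y ∈ K
  · have : ρ (y - z) = 0 := by
      refine image_eq_zero_of_notMem_tsupport fun h => hz ⟨(y, y - z), ⟨hy, h⟩, by simp⟩
    simp [this]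
  · simp [hf y hy]

end Averages

/-! ### The Bellman function: Hessian estimate. -/

section Bellman

/-- A Bellman function of Nazarov–Treil type. -/
noncomputable def bellman (p q K u v : ℝ) : ℝ := u ^ 2 * (u ^ p + v ^ q) ^ (1 - 2 / p) + K * v ^ q

/-- The Hessian inequality in normalised variables. For a point (X, Y) and S = X^p + Y^q one puts x
= X^p/S, y = Y^q/S, h = X² S^{-2/p}, c = XY/S, and α, β are the relative increments a/X, b/Y. Every
mixed term is absorbed into α² and R = q² y β², and K is large enough to pay for R. -/
theorem bellman_quadratic {p q K h x y c α β : ℝ} (hp : 2 ≤ p) (hq : 1 < q)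
    (hK : 9 * q ≤ K * (q - 1)) (h0 : 0 ≤ h) (h1 : h ≤ 1) (hx : 0 ≤ x) (hx1 : x ≤ 1)
    (hy : 0 ≤ y) (hy1 : y ≤ 1) (hc : c ^ 2 ≤ h * y) :
    2 * c * |α * β| ≤ 2 * h * α ^ 2 + 4 * h * (1 - 2 / p) * α * (p * x * α + q * y * β)
      - h * (1 - 2 / p) * (2 / p) * (p * x * α + q * y * β) ^ 2
      + K * q * (q - 1) * y * β ^ 2 := by
  set g := 1 - 2 / p with hg
  have hp0 : 0 < p := by linarith
  have hg0 : 0 ≤ g := by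
    have : 2 / p ≤ 1 := by rw [div_le_one hp0]; exact hp
    linarith
  have h2p : 2 / p = 1 - g := by rw [hg]; ring
  have hgp : (1 - g) * p = 2 := by rw [← h2p]; field_simp
  have hg1 : g ≤ 1 := by
    have : 0 ≤ 2 / p := by positivity
    linarith
  rw [h2p]
  have hAM : 2 * c * |α * β| ≤ h * α ^ 2 + y * β ^ 2 := by
    refine abs_le_of_sq_le_sq' ?_ (by positivity) |>.2
    have e : (2 * c * |α * β|) ^ 2 = 4 * c ^ 2 * (α ^ 2 * β ^ 2) := by rw [mul_pow, sq_abs]; ring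
    rw [e]
    have h3 := mul_le_mul_of_nonneg_right hc (by positivity : 0 ≤ α ^ 2 * β ^ 2)
    have h4 : (h * α ^ 2 + y * β ^ 2) ^ 2 =
        (h * α ^ 2 - y * β ^ 2) ^ 2 + 4 * (h * y * (α ^ 2 * β ^ 2)) := by ring
    rw [h4]
    linarith [sq_nonneg (h * α ^ 2 - y * β ^ 2)]
  set R := q ^ 2 * y * β ^ 2 with hR
  have hR0 : 0 ≤ R := by positivity
  set A := p * x * α with hA
  set B := q * y * β with hB
  have hB2 : B ^ 2 ≤ R := by
    have e : R - B ^ 2 = q ^ 2 * β ^ 2 * (y * (1 - y)) := by rw [hB, hR]; ring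
    have : 0 ≤ q ^ 2 * β ^ 2 * (y * (1 - y)) :=
      mul_nonneg (by positivity) (mul_nonneg hy (by linarith))
    linarith
  have s1 : (A + B) ^ 2 ≤ 2 * A ^ 2 + 2 * B ^ 2 := by
    linarith [sq_nonneg (A - B), (by ring : (A + B) ^ 2 + (A - B) ^ 2 = 2 * A ^ 2 + 2 * B ^ 2)]
  have hgg : 0 ≤ g * (1 - g) := mul_nonneg hg0 (by linarith)
  have hgg' : g * (1 - g) ≤ 1 / 4 := by
    linarith [sq_nonneg (g - 1 / 2), (by ring : (g - 1 / 2) ^ 2 = 1 / 4 - g * (1 - g))]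
  have s2 : g * (1 - g) * A ^ 2 ≤ 2 * (g * (α * A)) := by
    have e : 2 * (g * (α * A)) - g * (1 - g) * A ^ 2 =
        g * p * α ^ 2 * x * (2 - ((1 - g) * p) * x) := by rw [hA]; ring
    have : 0 ≤ g * p * α ^ 2 * x * (2 - ((1 - g) * p) * x) := by
      rw [hgp]; exact mul_nonneg (by positivity) (by linarith)
    linarith
  have s3 : g * (1 - g) * B ^ 2 ≤ R / 4 :=
    (mul_le_mul hgg' hB2 (sq_nonneg _) (by norm_num)).trans (le_of_eq (by ring))
  have s4 : -(α ^ 2 + 4 * R) ≤ 4 * (g * (α * B)) := by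
    have h4 : g ^ 2 ≤ 1 := pow_le_one₀ hg0 hg1
    have h5 : g ^ 2 * B ^ 2 ≤ R := (mul_le_of_le_one_left (sq_nonneg _) h4).trans hB2
    have h9 : (α + 2 * g * B) ^ 2 = α ^ 2 + 4 * (g * (α * B)) + 4 * (g ^ 2 * B ^ 2) := by ring
    linarith [sq_nonneg (α + 2 * g * B)]
  -- The budget: the mixed term costs 4R and the square of A + B at most R/2, rounded up to 5R
  -- together. The final comparison with yβ² needs one more R, so 9R suffices.
  have s5 : 9 * R ≤ K * q * (q - 1) * y * β ^ 2 := by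
    have h3 := mul_le_mul_of_nonneg_right hK (by positivity : 0 ≤ q * y * β ^ 2)
    refine le_trans (le_of_eq ?_) (h3.trans (le_of_eq ?_))
    · rw [hR]; ring
    · ring
  have s6 : α ^ 2 - 5 * R ≤ 2 * α ^ 2 + 4 * g * α * (A + B) - g * (1 - g) * (A + B) ^ 2 := by
    have h4 := mul_le_mul_of_nonneg_left s1 hgg
    have e1 : 4 * g * α * (A + B) = 4 * (g * (α * A)) + 4 * (g * (α * B)) := by ring
    have e2 : g * (1 - g) * (2 * A ^ 2 + 2 * B ^ 2) =
        2 * (g * (1 - g) * A ^ 2) + 2 * (g * (1 - g) * B ^ 2) := by ring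
    rw [e2] at h4
    rw [e1]
    linarith
  have s7 := mul_le_mul_of_nonneg_left s6 h0
  have s8 : h * (5 * R) ≤ 5 * R := mul_le_of_le_one_left (by positivity) h1
  have s9 : y * β ^ 2 ≤ R := by
    rw [hR, mul_assoc]
    exact le_mul_of_one_le_left (by positivity) (one_le_pow₀ hq.le)
  have e3 : 2 * h * α ^ 2 + 4 * h * g * α * (A + B) - h * g * (1 - g) * (A + B) ^ 2 =
      h * (2 * α ^ 2 + 4 * g * α * (A + B) - g * (1 - g) * (A + B) ^ 2) := by ring
  rw [e3]
  rw [mul_sub h] at s7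
  linarith

/-- The expression is the second derivative of s ↦ bellman(u + sa, v + sb) - |ab| s² at the point
(X, Y) of the segment. Division by S = X^p + Y^q reduces it to `bellman_quadratic`. -/
theorem bellman_second_derivative {p q K X Y a b : ℝ} (hpq : p.HolderConjugate q) (hp : 2 ≤ p)
    (hK : 9 * q ≤ K * (q - 1)) (hX : 0 < X) (hY : 0 < Y) :
    0 ≤ 2 * a ^ 2 * (X ^ p + Y ^ q) ^ (1 - 2 / p)
      + 4 * X * a * ((1 - 2 / p) * (X ^ p + Y ^ q) ^ (1 - 2 / p - 1) *
          (p * X ^ (p - 1) * a + q * Y ^ (q - 1) * b))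
      + X ^ 2 * ((1 - 2 / p) * ((1 - 2 / p - 1) * (X ^ p + Y ^ q) ^ (1 - 2 / p - 1 - 1) *
          (p * X ^ (p - 1) * a + q * Y ^ (q - 1) * b) ^ 2
        + (X ^ p + Y ^ q) ^ (1 - 2 / p - 1) *
          (p * (p - 1) * X ^ (p - 1 - 1) * a ^ 2 + q * (q - 1) * Y ^ (q - 1 - 1) * b ^ 2)))
      + K * (q * (q - 1) * Y ^ (q - 1 - 1) * b ^ 2) - 2 * |a * b| := by
  have hp0 := hpq.pos
  have hq0 := hpq.symm.pos
  have hq1 := hpq.symm.lt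
  set U := X ^ p with hU
  set W := Y ^ q with hW
  have hU0 : 0 < U := Real.rpow_pos_of_pos hX _
  have hW0 : 0 < W := Real.rpow_pos_of_pos hY _
  set S := U + W with hS
  have hS0 : 0 < S := by positivity
  set g := 1 - 2 / p with hg
  set Z := S ^ g with hZ
  have hZ0 : 0 < Z := Real.rpow_pos_of_pos hS0 _
  set α := a / X with hα
  set β := b / Y with hβ
  have ea : a = X * α := by rw [hα]; field_simp
  have eb : b = Y * β := by rw [hβ]; field_simp
  have e1 : S ^ (g - 1) = Z / S := by rw [Real.rpow_sub hS0, Real.rpow_one]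
  have e2 : S ^ (g - 1 - 1) = Z / S / S := by rw [Real.rpow_sub hS0, e1, Real.rpow_one]
  have e3 : X ^ (p - 1) = U / X := by rw [Real.rpow_sub hX, Real.rpow_one]
  have e4 : X ^ (p - 1 - 1) = U / X / X := by rw [Real.rpow_sub hX, e3, Real.rpow_one]
  have e5 : Y ^ (q - 1) = W / Y := by rw [Real.rpow_sub hY, Real.rpow_one]
  have e6 : Y ^ (q - 1 - 1) = W / Y / Y := by rw [Real.rpow_sub hY, e5, Real.rpow_one]
  rw [e1, e2, e3, e4, e5, e6]
  set x := U / S with hx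
  set y := W / S with hy
  have hx0 : 0 ≤ x := by positivity
  have hy0 : 0 ≤ y := by positivity
  have hx1 : x ≤ 1 := by rw [hx, div_le_one hS0]; linarith
  have hy1 : y ≤ 1 := by rw [hy, div_le_one hS0]; linarith
  set h := X ^ 2 * Z / S with hh
  have hX2 : X ^ 2 = U ^ (2 / p) := by
    rw [hU, ← Real.rpow_mul hX.le, mul_div_cancel₀ _ hp0.ne', Real.rpow_two]
  have hY2 : Y ^ 2 = W ^ (2 / q) := by
    rw [hW, ← Real.rpow_mul hY.le, mul_div_cancel₀ _ hq0.ne', Real.rpow_two]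
  have hhx : h = x ^ (2 / p) := by
    rw [hh, hX2, hZ, hx, Real.div_rpow hU0.le hS0.le, hg, Real.rpow_sub hS0, Real.rpow_one]
    field_simp
  have hh0 : 0 ≤ h := by positivity
  have hh1 : h ≤ 1 := by rw [hhx]; exact Real.rpow_le_one hx0 hx1 (by positivity)
  have hinv := hpq.inv_add_inv_eq_one
  have hsum : 2 / p + 2 / q = 2 := by
    have : 2 / p + 2 / q = 2 * (p⁻¹ + q⁻¹) := by ring
    rw [this, hinv]; ring
  have hq2 : 1 ≤ 2 / q := by
    have : 2 / p ≤ 1 := by rw [div_le_one hp0]; exact hp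
    linarith
  -- Here p ≥ 2 enters: c² equals h y^{2/q} exactly, and 2/q ≥ 1 with y ≤ 1 lets the exponent drop
  -- to one.
  have hc : (X * Y / S) ^ 2 ≤ h * y := by
    have e : (X * Y / S) ^ 2 = h * y ^ (2 / q) := by
      rw [hhx, div_pow, mul_pow, hX2, hY2, hx, hy, Real.div_rpow hU0.le hS0.le,
        Real.div_rpow hW0.le hS0.le, div_mul_div_comm, ← Real.rpow_add hS0, hsum, Real.rpow_two]
    rw [e]
    refine mul_le_mul_of_nonneg_left ?_ hh0
    calc y ^ (2 / q) ≤ y ^ (1 : ℝ) := Real.rpow_le_rpow_of_exponent_ge' hy0 hy1 zero_le_one hq2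
      _ = y := Real.rpow_one y
  have key := bellman_quadratic (α := α) (β := β) hp hq1 hK hh0 hh1 hx0 hx1 hy0 hy1 hc
  have hp1 : 0 ≤ p - 1 := by linarith
  have hq1' : 0 ≤ q - 1 := by linarith
  have hg0 : 0 ≤ g := by
    have : 2 / p ≤ 1 := by rw [div_le_one hp0]; exact hp
    linarith
  -- The contribution of the second derivative of S is nonnegative and is simply discarded.
  have hrest : 0 ≤ h * g * (p * (p - 1) * x * α ^ 2 + q * (q - 1) * y * β ^ 2) := by positivity
  have habs : |a * b| = X * Y * |α * β| := by
    rw [ea, eb, show X * α * (Y * β) = (X * Y) * (α * β) by ring, abs_mul, abs_of_pos (by positivity : 0 < X * Y)]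
  have hgp : 1 - g = 2 / p := by rw [hg]; ring
  have key2 := mul_le_mul_of_nonneg_left key hS0.le
  have hrest2 := mul_nonneg hS0.le hrest
  rw [habs, ea, eb]
  have t1 : S * (2 * (X * Y / S) * |α * β|) = 2 * (X * Y * |α * β|) := by field_simp
  rw [t1, ← hg, ← hgp] at key2
  have : 2 * (X * α) ^ 2 * Z + 4 * X * (X * α) * (g * (Z / S) *
        (p * (U / X) * (X * α) + q * (W / Y) * (Y * β)))
      + X ^ 2 * (g * ((g - 1) * (Z / S / S) * (p * (U / X) * (X * α) + q * (W / Y) * (Y * β)) ^ 2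
      + Z / S * (p * (p - 1) * (U / X / X) * (X * α) ^ 2
        + q * (q - 1) * (W / Y / Y) * (Y * β) ^ 2)))
      + K * (q * (q - 1) * (W / Y / Y) * (Y * β) ^ 2) =
      S * (2 * h * α ^ 2 + 4 * h * g * α * (p * x * α + q * y * β)
      - h * g * (1 - g) * (p * x * α + q * y * β) ^ 2 + K * q * (q - 1) * y * β ^ 2)
      + S * (h * g * (p * (p - 1) * x * α ^ 2 + q * (q - 1) * y * β ^ 2)) := by
    rw [hh, hx, hy]
    field_simp
    ring
  rw [this]
  linarith

end Bellman

/-! ### Strong convexity and size of the Bellman function. -/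

section BellmanConvex

variable {p q K : ℝ}

theorem continuous_bellman (hpq : p.HolderConjugate q) (hp : 2 ≤ p) :
    Continuous fun z : ℝ × ℝ => bellman p q K z.1 z.2 := by
  have hp0 := hpq.pos
  have hg0 : 0 ≤ 1 - 2 / p := by
    have : 2 / p ≤ 1 := by rw [div_le_one hp0]; exact hp
    linarith
  have h1 := Real.continuous_rpow_const hpq.pos.le
  have h2 := Real.continuous_rpow_const hpq.symm.pos.le
  have h3 := Real.continuous_rpow_const hg0
  exact ((continuous_fst.pow 2).mul
    (h3.comp ((h1.comp continuous_fst).add (h2.comp continuous_snd)))).add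
    (continuous_const.mul (h2.comp continuous_snd))

/-- Along the segment, the Bellman function minus |ab| s² has nonnegative second derivative.
Strictly positive endpoints keep all real powers differentiable on the closed segment. -/
theorem bellman_strong_of_pos (hpq : p.HolderConjugate q) (hp : 2 ≤ p)
    (hK : 9 * q ≤ K * (q - 1)) {u v u' v' s : ℝ} (hu : 0 < u) (hv : 0 < v) (hu' : 0 < u')
    (hv' : 0 < v') (hs0 : 0 ≤ s) (hs1 : s ≤ 1) :
    bellman p q K ((1 - s) * u + s * u') ((1 - s) * v + s * v') +
        s * (1 - s) * |(u' - u) * (v' - v)| ≤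
      (1 - s) * bellman p q K u v + s * bellman p q K u' v' := by
  set a := u' - u with ha
  set b := v' - v with hb
  have hp0 := hpq.pos
  have hX : ∀ s ∈ Icc (0 : ℝ) 1, 0 < u + s * a := by
    intro s hs
    have : u + s * a = (1 - s) * u + s * u' := by rw [ha]; ring
    rw [this]
    rcases hs.1.eq_or_lt with h | h
    · rw [← h]; simpa
    · have := mul_nonneg (sub_nonneg.2 hs.2) hu.le
      have := mul_pos h hu'; linarith
  have hY : ∀ s ∈ Icc (0 : ℝ) 1, 0 < v + s * b := by
    intro s hs
    have : v + s * b = (1 - s) * v + s * v' := by rw [hb]; ring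
    rw [this]
    rcases hs.1.eq_or_lt with h | h
    · rw [← h]; simpa
    · have := mul_nonneg (sub_nonneg.2 hs.2) hv.le
      have := mul_pos h hv'; linarith
  set X : ℝ → ℝ := fun s => u + s * a with hXdef
  set Y : ℝ → ℝ := fun s => v + s * b with hYdef
  have dX : ∀ s, HasDerivAt X a s := fun s =>
    (((hasDerivAt_id s).mul_const a).const_add u).congr_deriv (one_mul a)
  have dY : ∀ s, HasDerivAt Y b s := fun s =>
    (((hasDerivAt_id s).mul_const b).const_add v).congr_deriv (one_mul b)
  set g := 1 - 2 / p with hg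
  have dpow : ∀ {Z : ℝ → ℝ} {c r s : ℝ}, HasDerivAt Z c s → 0 < Z s →
      HasDerivAt (fun s => Z s ^ r) (r * Z s ^ (r - 1) * c) s := by
    intro Z c r s hZ h0
    have := hZ.rpow_const (p := r) (Or.inl h0.ne')
    convert this using 1; ring
  set F : ℝ → ℝ := fun s => bellman p q K (X s) (Y s) - |a * b| * s ^ 2 with hF
  set S : ℝ → ℝ := fun s => X s ^ p + Y s ^ q with hS
  set S1 : ℝ → ℝ := fun s => p * X s ^ (p - 1) * a + q * Y s ^ (q - 1) * b with hS1
  have hSpos : ∀ s ∈ Icc (0 : ℝ) 1, 0 < S s := fun s hs =>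
    add_pos (Real.rpow_pos_of_pos (hX s hs) _) (Real.rpow_pos_of_pos (hY s hs) _)
  have dS : ∀ s ∈ Icc (0 : ℝ) 1, HasDerivAt S (S1 s) s := fun s hs =>
    (dpow (dX s) (hX s hs)).add (dpow (dY s) (hY s hs))
  set S2 : ℝ → ℝ := fun s => p * (p - 1) * X s ^ (p - 1 - 1) * a ^ 2 +
    q * (q - 1) * Y s ^ (q - 1 - 1) * b ^ 2 with hS2
  have dS1 : ∀ s ∈ Icc (0 : ℝ) 1, HasDerivAt S1 (S2 s) s := fun s hs => by
    have h1 := ((dpow (r := p - 1) (dX s) (hX s hs)).const_mul p).mul_const a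
    have h2 := ((dpow (r := q - 1) (dY s) (hY s hs)).const_mul q).mul_const b
    refine (h1.add h2).congr_deriv ?_
    simp only [hS2]; ring
  set F1 : ℝ → ℝ := fun s => 2 * X s * a * S s ^ g + X s ^ 2 * (g * S s ^ (g - 1) * S1 s) +
    K * (q * Y s ^ (q - 1) * b) - |a * b| * (2 * s) with hF1
  have dF : ∀ s ∈ Icc (0 : ℝ) 1, HasDerivAt F (F1 s) s := fun s hs => by
    have h1 := ((dX s).pow 2).mul (dpow (r := g) (dS s hs) (hSpos s hs))
    have h2 := (dpow (r := q) (dY s) (hY s hs)).const_mul K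
    have h3 := ((hasDerivAt_id s).pow 2).const_mul |a * b|
    refine ((h1.add h2).sub h3).congr_deriv ?_
    simp only [hF1, id]
    norm_num
  set F2 : ℝ → ℝ := fun s => 2 * a ^ 2 * S s ^ g + 4 * X s * a * (g * S s ^ (g - 1) * S1 s) +
    X s ^ 2 * (g * ((g - 1) * S s ^ (g - 1 - 1) * S1 s ^ 2 + S s ^ (g - 1) * S2 s)) +
    K * (q * (q - 1) * Y s ^ (q - 1 - 1) * b ^ 2) - 2 * |a * b| with hF2
  have dF1 : ∀ s ∈ Icc (0 : ℝ) 1, HasDerivAt F1 (F2 s) s := fun s hs => by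
    have h1 := (((dX s).const_mul 2).mul_const a).mul (dpow (r := g) (dS s hs) (hSpos s hs))
    have h2 := ((dX s).pow 2).mul
      (((dpow (r := g - 1) (dS s hs) (hSpos s hs)).const_mul g).mul (dS1 s hs))
    have h3 := (((dpow (r := q - 1) (dY s) (hY s hs)).const_mul q).mul_const b).const_mul K
    have h4 := ((hasDerivAt_id s).const_mul 2).const_mul |a * b|
    refine (((h1.add h2).add h3).sub h4).congr_deriv ?_
    simp only [hF2, Pi.pow_apply]
    norm_num
    ring
  have hconv : ConvexOn ℝ (Icc (0 : ℝ) 1) F := by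
    refine convexOn_of_hasDerivWithinAt2_nonneg (convex_Icc 0 1) (f' := F1) (f'' := F2)
      (fun s hs => (dF s hs).continuousAt.continuousWithinAt) (fun s hs => ?_) (fun s hs => ?_)
      (fun s hs => ?_)
    · exact (dF s (interior_subset hs)).hasDerivWithinAt
    · exact (dF1 s (interior_subset hs)).hasDerivWithinAt
    · exact bellman_second_derivative hpq hp hK (hX s (interior_subset hs))
        (hY s (interior_subset hs))
  have h := hconv.2 (left_mem_Icc.2 zero_le_one) (right_mem_Icc.2 zero_le_one)
    (sub_nonneg.2 hs1) hs0 (by ring)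
  simp only [hF, hXdef, hYdef, smul_eq_mul] at h
  have e1 : u + ((1 - s) * 0 + s * 1) * a = (1 - s) * u + s * u' := by rw [ha]; ring
  have e2 : v + ((1 - s) * 0 + s * 1) * b = (1 - s) * v + s * v' := by rw [hb]; ring
  have e3 : u + 1 * a = u' := by rw [ha]; ring
  have e4 : v + 1 * b = v' := by rw [hb]; ring
  rw [e1, e2, e3, e4] at h
  simp only [zero_mul, add_zero] at h
  linarith [h, (by ring : |a * b| * ((1 - s) * 0 + s * 1) ^ 2 = |a * b| * s ^ 2),
    (by ring : s * (1 - s) * |a * b| = |a * b| * s - |a * b| * s ^ 2)]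

/-- Both endpoints are shifted by e > 0 in each variable, which leaves the increments unchanged;
then e tends to zero by continuity. -/
theorem bellman_strong (hpq : p.HolderConjugate q) (hp : 2 ≤ p)
    (hK : 9 * q ≤ K * (q - 1)) {u v u' v' s : ℝ} (hu : 0 ≤ u) (hv : 0 ≤ v) (hu' : 0 ≤ u')
    (hv' : 0 ≤ v') (hs0 : 0 ≤ s) (hs1 : s ≤ 1) :
    bellman p q K ((1 - s) * u + s * u') ((1 - s) * v + s * v') +
        s * (1 - s) * |(u' - u) * (v' - v)| ≤
      (1 - s) * bellman p q K u v + s * bellman p q K u' v' := by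
  have hc := continuous_bellman (K := K) hpq hp
  have hc' : ∀ x y : ℝ → ℝ, Continuous x → Continuous y →
      Continuous fun e => bellman p q K (x e) (y e) := fun x y hx hy =>
    hc.comp (hx.prodMk hy)
  have key : ∀ e ∈ Ioi (0 : ℝ),
      bellman p q K ((1 - s) * (u + e) + s * (u' + e)) ((1 - s) * (v + e) + s * (v' + e)) +
        s * (1 - s) * |(u' - u) * (v' - v)| ≤
      (1 - s) * bellman p q K (u + e) (v + e) + s * bellman p q K (u' + e) (v' + e) := by
    intro e he
    have he' : 0 < e := he
    have := bellman_strong_of_pos hpq hp hK (u := u + e) (v := v + e) (u' := u' + e) (v' := v' + e)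
      (by linarith) (by linarith) (by linarith) (by linarith) hs0 hs1
    simpa using this
  have hl : ContinuousWithinAt (fun e => bellman p q K ((1 - s) * (u + e) + s * (u' + e))
      ((1 - s) * (v + e) + s * (v' + e)) + s * (1 - s) * |(u' - u) * (v' - v)|) (Ioi 0) 0 :=
    (Continuous.add (hc' _ _ (by fun_prop) (by fun_prop)) continuous_const).continuousWithinAt
  have hr : ContinuousWithinAt (fun e => (1 - s) * bellman p q K (u + e) (v + e) +
      s * bellman p q K (u' + e) (v' + e)) (Ioi 0) 0 :=
    ((continuous_const.mul (hc' _ _ (by fun_prop) (by fun_prop))).add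
      (continuous_const.mul (hc' _ _ (by fun_prop) (by fun_prop)))).continuousWithinAt
  have := le_of_tendsto_of_tendsto hl hr (eventually_nhdsWithin_of_forall key)
  simpa using this

/-- The form in which convexity is used: the surplus is exactly the product of the half differences
that `diffOp` computes. The factor 1/4 of the halved increments is s(1 - s) at s = 1/2. -/
theorem bellman_midpoint (hpq : p.HolderConjugate q) (hp : 2 ≤ p)
    (hK : 9 * q ≤ K * (q - 1)) {u v u' v' : ℝ} (hu : 0 ≤ u) (hv : 0 ≤ v) (hu' : 0 ≤ u')
    (hv' : 0 ≤ v') : bellman p q K ((u + u') / 2) ((v + v') / 2) + |(u - u') / 2 * ((v - v') / 2)| ≤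
      (bellman p q K u v + bellman p q K u' v') / 2 := by
  have h := bellman_strong hpq hp hK hu hv hu' hv' (s := 1 / 2) (by norm_num) (by norm_num)
  have e1 : (1 - 1 / 2) * u + 1 / 2 * u' = (u + u') / 2 := by ring
  have e2 : (1 - 1 / 2) * v + 1 / 2 * v' = (v + v') / 2 := by ring
  have e3 : |(u - u') / 2 * ((v - v') / 2)| = 1 / 2 * (1 - 1 / 2) * |(u' - u) * (v' - v)| := by
    rw [show (u - u') / 2 * ((v - v') / 2) = 1 / 4 * ((u' - u) * (v' - v)) by ring, abs_mul]
    norm_num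
  rw [e1, e2] at h
  rw [e3]; linarith

theorem convexOn_bellman (hpq : p.HolderConjugate q) (hp : 2 ≤ p) (hK : 9 * q ≤ K * (q - 1)) :
    ConvexOn ℝ {z : ℝ × ℝ | 0 ≤ z.1 ∧ 0 ≤ z.2} fun z => bellman p q K z.1 z.2 := by
  refine ⟨?_, ?_⟩
  · have : {z : ℝ × ℝ | 0 ≤ z.1 ∧ 0 ≤ z.2} = Ici 0 ×ˢ Ici 0 := rfl
    rw [this]; exact (convex_Ici 0).prod (convex_Ici 0)
  · intro x hx y hy a b ha hb hab
    have h := bellman_strong hpq hp hK hx.1 hx.2 hy.1 hy.2 hb (by linarith)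
    have e : 1 - b = a := by linarith
    rw [e] at h
    have h2 : 0 ≤ b * a * |(y.1 - x.1) * (y.2 - x.2)| := by positivity
    simp only [Prod.fst_add, Prod.snd_add, Prod.smul_fst, Prod.smul_snd, smul_eq_mul]
    linarith

theorem bellman_nonneg (hK : 0 ≤ K) {u v : ℝ} (hu : 0 ≤ u) (hv : 0 ≤ v) :
    0 ≤ bellman p q K u v := by
  unfold bellman; positivity

theorem bellman_le (hpq : p.HolderConjugate q) (hp : 2 ≤ p) (hK : 0 ≤ K) {u v : ℝ} (hu : 0 ≤ u)
    (hv : 0 ≤ v) : bellman p q K u v ≤ (1 + K) * (u ^ p + v ^ q) := by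
  have hp0 := hpq.pos
  have hU : 0 ≤ u ^ p := by positivity
  have hW : 0 ≤ v ^ q := by positivity
  have h2 : u ^ 2 * (u ^ p + v ^ q) ^ (1 - 2 / p) ≤ u ^ p + v ^ q := by
    rcases (add_nonneg hU hW).eq_or_lt with h | h
    · have : u ^ p = 0 := by linarith
      have hu0 : u = 0 := by
        by_contra h0
        exact (Real.rpow_pos_of_pos (lt_of_le_of_ne hu (Ne.symm h0)) p).ne' this
      rw [hu0]; simp only [ne_eq, OfNat.ofNat_ne_zero, not_false_eq_true, zero_pow, zero_mul]
      rw [hu0] at hU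
      positivity
    · have e : u ^ 2 = (u ^ p) ^ (2 / p) := by
        rw [← Real.rpow_mul hu, mul_div_cancel₀ _ hp0.ne', Real.rpow_two]
      calc u ^ 2 * (u ^ p + v ^ q) ^ (1 - 2 / p)
          ≤ (u ^ p + v ^ q) ^ (2 / p) * (u ^ p + v ^ q) ^ (1 - 2 / p) := by
            rw [e]
            refine mul_le_mul_of_nonneg_right ?_ (by positivity)
            exact Real.rpow_le_rpow hU (by linarith) (by positivity)
        _ = u ^ p + v ^ q := by rw [← Real.rpow_add h]; simp
  unfold bellman
  nlinarith

end BellmanConvex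

/-! ### The commutative algebra of translations and the random walk. -/

section DiscreteOperators

variable {V : Type*} [NormedAddCommGroup V] [NormedSpace ℝ V]

/-- Translation of functions. -/
def shiftOp (y : V) : Module.End ℝ (V → ℝ) where
  toFun f z := f (z + y)
  map_add' _ _ := rfl
  map_smul' _ _ := rfl

@[simp] theorem shiftOp_apply (y : V) (f : V → ℝ) (z : V) : shiftOp y f z = f (z + y) := rfl

theorem shiftOp_mul (y y' : V) : shiftOp y * shiftOp y' = shiftOp (y + y') := by
  ext f z; simp [add_assoc]

theorem shiftOp_zero : shiftOp (0 : V) = 1 := by ext f z; simp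

/-- Finite linear combinations of translations. -/
def transAlg (V : Type*) [NormedAddCommGroup V] [NormedSpace ℝ V] :
    Subalgebra ℝ (Module.End ℝ (V → ℝ)) := Algebra.adjoin ℝ (range shiftOp)

theorem shiftOp_mem (y : V) : shiftOp y ∈ transAlg V := Algebra.subset_adjoin ⟨y, rfl⟩

theorem transAlg_induction {p : Module.End ℝ (V → ℝ) → Prop} (h1 : ∀ y, p (shiftOp y))
    (h2 : ∀ A B, p A → p B → p (A + B)) (h3 : ∀ (c : ℝ) A, p A → p (c • A))
    (h4 : ∀ A B, p A → p B → p (A * B)) {A : Module.End ℝ (V → ℝ)} (hA : A ∈ transAlg V) :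
    p A := by
  refine Algebra.adjoin_induction (p := fun A _ => p A) ?_ ?_ ?_ ?_ hA
  · rintro _ ⟨y, rfl⟩; exact h1 y
  · intro r
    rw [Algebra.algebraMap_eq_smul_one, ← shiftOp_zero]
    exact h3 r _ (h1 0)
  · exact fun A B _ _ => h2 A B
  · exact fun A B _ _ => h4 A B

/-- Translations of a vector space commute, hence so do their combinations. This allows the
operators to be handled like Fourier multipliers. -/
theorem transAlg_commute {A B : Module.End ℝ (V → ℝ)} (hA : A ∈ transAlg V) (hB : B ∈ transAlg V) :
    Commute A B := by
  refine transAlg_induction (p := fun A => Commute A B) (fun y => ?_)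
    (fun A B h h' => h.add_left h') (fun c A h => h.smul_left c)
    (fun A B h h' => h.mul_left h') hA
  refine transAlg_induction (p := fun B => Commute (shiftOp y) B) (fun y' => ?_)
    (fun A B h h' => h.add_right h') (fun c A h => h.smul_right c)
    (fun A B h h' => h.mul_right h') hB
  rw [commute_iff_eq, shiftOp_mul, shiftOp_mul, add_comm]

theorem transAlg_comm_apply {A B : Module.End ℝ (V → ℝ)} (hA : A ∈ transAlg V)
    (hB : B ∈ transAlg V) (f : V → ℝ) : A (B f) = B (A f) := by
  have := (transAlg_commute hA hB).eq
  rw [← Module.End.mul_apply, this, Module.End.mul_apply]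

theorem transAlg_testFun {A : Module.End ℝ (V → ℝ)} (hA : A ∈ transAlg V) :
    ∀ φ ∈ 𝓣[V], A φ ∈ 𝓣[V] := by
  refine transAlg_induction (p := fun A => ∀ φ ∈ 𝓣[V], A φ ∈ testFun univ)
    (fun y φ hφ => testFun_mono (subset_univ _) (testFun_translate hφ y))
    (fun A B h h' φ hφ => ?_) (fun c A h φ hφ => ?_) (fun A B h h' φ hφ => h _ (h' φ hφ)) hA
  · exact Submodule.add_mem _ (h φ hφ) (h' φ hφ)
  · exact Submodule.smul_mem _ c (h φ hφ)

theorem transAlg_fderiv {A : Module.End ℝ (V → ℝ)} (hA : A ∈ transAlg V) {φ : V → ℝ}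
    (hφ : φ ∈ 𝓣[V]) (h : V) : 𝐃[A φ,h] = A 𝐃[φ,h] := by
  revert φ
  refine transAlg_induction (p := fun A => (∀ φ ∈ 𝓣[V], A φ ∈ testFun univ) ∧
    ∀ {φ : V → ℝ}, φ ∈ 𝓣[V] →
    𝐃[A φ,h] = A 𝐃[φ,h])
    (fun y => ⟨transAlg_testFun (shiftOp_mem y), fun {φ} hφ => ?_⟩)
    (fun A B h h' => ⟨fun φ hφ => Submodule.add_mem _ (h.1 φ hφ) (h'.1 φ hφ), fun {φ} hφ => ?_⟩)
    (fun c A h => ⟨fun φ hφ => Submodule.smul_mem _ c (h.1 φ hφ), fun {φ} hφ => ?_⟩)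
    (fun A B h h' => ⟨fun φ hφ => h.1 _ (h'.1 φ hφ), fun {φ} hφ => ?_⟩) hA |>.2
  · ext z
    change fderiv ℝ (fun z => φ (z + y)) z _ = _
    rw [fderiv_comp_add_right]; rfl
  · ext z
    have e : (A + B) φ = fun z => A φ z + B φ z := rfl
    rw [e, fderiv_fun_add (testFun_differentiable (h.1 φ hφ) z)
      (testFun_differentiable (h'.1 φ hφ) z), LinearMap.add_apply, ← h.2 hφ, ← h'.2 hφ]
    rfl
  · ext z
    have e : (c • A) φ = fun z => c • A φ z := rfl
    rw [e, fderiv_fun_const_smul (testFun_differentiable (h.1 φ hφ) z), LinearMap.smul_apply,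
      ← h.2 hφ]
    rfl
  · rw [Module.End.mul_apply, Module.End.mul_apply, h.2 (h'.1 φ hφ), h'.2 hφ]

variable [FiniteDimensional ℝ V] [MeasurableSpace V] [BorelSpace V] {μ : Measure V}
  [μ.IsAddHaarMeasure]

theorem transAlg_memLp {A : Module.End ℝ (V → ℝ)} (hA : A ∈ transAlg V) {p : ℝ≥0∞} :
    ∀ {f : V → ℝ}, MemLp f p μ → MemLp (A f) p μ :=
  transAlg_induction (p := fun A => ∀ {f : V → ℝ}, MemLp f p μ → MemLp (A f) p μ)
    (fun y _ hf => memLp_translate hf y) (fun _ _ h h' _ hf => (h hf).add (h' hf))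
    (fun c _ h _ hf => (h hf).const_smul c) (fun _ _ h h' _ hf => h (h' hf)) hA

/-- `A` is bounded by `c` in every `Lᵖ` norm. -/
def IsLpBounded (μ : Measure V) (c : ℝ) (A : Module.End ℝ (V → ℝ)) : Prop :=
  A ∈ transAlg V ∧ 0 ≤ c ∧ ∀ (p : ℝ≥0∞) (f : V → ℝ), 1 ≤ p → MemLp f p μ →
    (eLpNorm (A f) p μ).toReal ≤ c * (eLpNorm f p μ).toReal

theorem toReal_eLpNorm_add_le {α : Type*} [MeasurableSpace α] {m : Measure α} {p : ℝ≥0∞}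
    (hp : 1 ≤ p) {f g : α → ℝ} (hf : MemLp f p m) (hg : MemLp g p m) :
    (eLpNorm (f + g) p m).toReal ≤ (eLpNorm f p m).toReal + (eLpNorm g p m).toReal := by
  rw [← ENNReal.toReal_add hf.2.ne hg.2.ne]
  exact ENNReal.toReal_mono (ENNReal.add_ne_top.2 ⟨hf.2.ne, hg.2.ne⟩) (eLpNorm_add_le hf.1 hg.1 hp)

theorem toReal_eLpNorm_smul {α : Type*} [MeasurableSpace α] {m : Measure α} {p : ℝ≥0∞}
    (c : ℝ) (f : α → ℝ) : (eLpNorm (c • f) p m).toReal = |c| * (eLpNorm f p m).toReal := by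
  rw [eLpNorm_const_smul, ENNReal.toReal_mul, toReal_enorm, Real.norm_eq_abs]

theorem toReal_eLpNorm_sum_le {α ι : Type*} [MeasurableSpace α] {m : Measure α} {p : ℝ≥0∞}
    (hp : 1 ≤ p) (s : Finset ι) {f : ι → α → ℝ} (hf : ∀ i, MemLp (f i) p m) :
    (eLpNorm (∑ i ∈ s, f i) p m).toReal ≤ ∑ i ∈ s, (eLpNorm (f i) p m).toReal := by
  classical
  induction s using Finset.induction_on with
  | empty => simp
  | insert i s hi ih =>
    rw [Finset.sum_insert hi, Finset.sum_insert hi]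
    exact (toReal_eLpNorm_add_le hp (hf i) (memLp_finsetSum' s fun i _ => hf i)).trans (by gcongr)

namespace IsLpBounded

variable {A B : Module.End ℝ (V → ℝ)} {c c' : ℝ}

theorem shiftOp (y : V) : IsLpBounded μ 1 (_root_.shiftOp y) :=
  ⟨shiftOp_mem y, zero_le_one, fun p f _ hf => by
    rw [one_mul]; exact (congrArg _ (eLpNorm_translate hf.1 y)).le⟩

theorem add (hA : IsLpBounded μ c A) (hB : IsLpBounded μ c' B) : IsLpBounded μ (c + c') (A + B) :=
  ⟨Subalgebra.add_mem _ hA.1 hB.1, add_nonneg hA.2.1 hB.2.1, fun p f hp hf => by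
    rw [LinearMap.add_apply, add_mul]
    exact (toReal_eLpNorm_add_le hp (transAlg_memLp hA.1 hf) (transAlg_memLp hB.1 hf)).trans
      (add_le_add (hA.2.2 p f hp hf) (hB.2.2 p f hp hf))⟩

theorem smul (r : ℝ) (hA : IsLpBounded μ c A) : IsLpBounded μ (|r| * c) (r • A) :=
  ⟨Subalgebra.smul_mem _ hA.1 r, mul_nonneg (abs_nonneg _) hA.2.1, fun p f hp hf => by
    rw [LinearMap.smul_apply, toReal_eLpNorm_smul, mul_assoc]
    exact mul_le_mul_of_nonneg_left (hA.2.2 p f hp hf) (abs_nonneg _)⟩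

theorem mul (hA : IsLpBounded μ c A) (hB : IsLpBounded μ c' B) : IsLpBounded μ (c * c') (A * B) :=
  ⟨Subalgebra.mul_mem _ hA.1 hB.1, mul_nonneg hA.2.1 hB.2.1, fun p f hp hf => by
    rw [Module.End.mul_apply, mul_assoc]
    exact (hA.2.2 p _ hp (transAlg_memLp hB.1 hf)).trans
      (mul_le_mul_of_nonneg_left (hB.2.2 p f hp hf) hA.2.1)⟩

theorem one : IsLpBounded μ 1 (1 : Module.End ℝ (V → ℝ)) := by
  rw [← shiftOp_zero]; exact IsLpBounded.shiftOp 0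

theorem zero : IsLpBounded μ 0 (0 : Module.End ℝ (V → ℝ)) := by
  simpa using (IsLpBounded.one (μ := μ)).smul 0

theorem sum {ι : Type*} (s : Finset ι) {A : ι → Module.End ℝ (V → ℝ)} {c : ι → ℝ}
    (hA : ∀ i, IsLpBounded μ (c i) (A i)) : IsLpBounded μ (∑ i ∈ s, c i) (∑ i ∈ s, A i) := by
  classical
  induction s using Finset.induction_on with
  | empty => simpa using IsLpBounded.zero
  | insert i s hi ih =>
    rw [Finset.sum_insert hi, Finset.sum_insert hi]
    exact (hA i).add ih

theorem pow (hA : IsLpBounded μ 1 A) (k : ℕ) : IsLpBounded μ 1 (A ^ k) := by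
  induction k with
  | zero => simpa using IsLpBounded.one
  | succ k ih => rw [pow_succ]; simpa using ih.mul hA

end IsLpBounded

/-- The mean of two opposite translations. -/
noncomputable def meanOp (d : V) : Module.End ℝ (V → ℝ) := (1 / 2 : ℝ) • (shiftOp d + shiftOp (-d))

/-- The half difference of two opposite translations. -/
noncomputable def diffOp (d : V) : Module.End ℝ (V → ℝ) :=
  (1 / 2 : ℝ) • (shiftOp d + (-1 : ℝ) • shiftOp (-d))

theorem meanOp_apply (d : V) (f : V → ℝ) (z : V) : meanOp d f z = (f (z + d) + f (z + -d)) / 2 := by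
  simp [meanOp]; ring

theorem diffOp_apply (d : V) (f : V → ℝ) (z : V) : diffOp d f z = (f (z + d) - f (z + -d)) / 2 := by
  simp [diffOp]; ring

theorem isLpBounded_meanOp (d : V) : IsLpBounded μ 1 (meanOp d) := by
  have := ((IsLpBounded.shiftOp (μ := μ) d).add (IsLpBounded.shiftOp (-d))).smul (1 / 2)
  norm_num at this; simpa [meanOp] using this

theorem meanOp_mem (d : V) : meanOp d ∈ transAlg V :=
  Subalgebra.smul_mem _ (Subalgebra.add_mem _ (shiftOp_mem d) (shiftOp_mem _)) _

theorem diffOp_mem (d : V) : diffOp d ∈ transAlg V :=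
  Subalgebra.smul_mem _ (Subalgebra.add_mem _ (shiftOp_mem d)
    (Subalgebra.smul_mem _ (shiftOp_mem _) _)) _

/-- The identity cosh² - sinh² = 1 for translations; it turns the generator of the walk into a sum
of squared differences. -/
theorem meanOp_sq_sub (d : V) : meanOp d ^ 2 - diffOp d ^ 2 = 1 := by
  ext f z
  simp only [pow_two, LinearMap.sub_apply, Module.End.mul_apply, Pi.sub_apply, meanOp_apply,
    diffOp_apply, Module.End.one_apply, add_assoc, neg_add_cancel, add_neg_cancel, add_zero]
  ring

variable {ι : Type*} [Fintype ι]

/-- One step of the lazy random walk with steps `±d i`. -/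
noncomputable def walkOp (d : ι → V) : Module.End ℝ (V → ℝ) :=
  (Fintype.card ι : ℝ)⁻¹ • ∑ i, meanOp (d i) ^ 2

theorem isLpBounded_walkOp [Nonempty ι] (d : ι → V) : IsLpBounded μ 1 (walkOp d) := by
  have h0 : (Fintype.card ι : ℝ) ≠ 0 := by simp
  have := (IsLpBounded.sum (μ := μ) Finset.univ fun i =>
    (isLpBounded_meanOp (d i)).pow 2).smul (Fintype.card ι : ℝ)⁻¹
  simpa [walkOp, h0, abs_of_nonneg] using this

theorem walkOp_mem (d : ι → V) : walkOp d ∈ transAlg V :=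
  Subalgebra.smul_mem _ (Subalgebra.sum_mem _ fun _ _ => Subalgebra.pow_mem _ (meanOp_mem _) _) _

/-- This identifies 1 - P with a positive multiple of minus the discrete Laplacian of step 2d. -/
theorem one_sub_walkOp [Nonempty ι] (d : ι → V) :
    1 - walkOp d = -((Fintype.card ι : ℝ)⁻¹ • ∑ i, diffOp (d i) ^ 2) := by
  have h0 : (Fintype.card ι : ℝ) ≠ 0 := by simp
  have h1 : ∀ i, meanOp (d i) ^ 2 = 1 + diffOp (d i) ^ 2 := fun i =>
    sub_eq_iff_eq_add.1 (meanOp_sq_sub (d i))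
  simp only [walkOp, h1, Finset.sum_add_distrib, smul_add, Finset.sum_const, Finset.card_univ]
  rw [← Nat.cast_smul_eq_nsmul ℝ, smul_smul, inv_mul_cancel₀ h0, one_smul]
  abel

/-- Adjointness with respect to the `Lᵖ` pairings. -/
def IsAdj (μ : Measure V) (A B : Module.End ℝ (V → ℝ)) : Prop :=
  ∀ ⦃p q : ℝ⦄, p.HolderConjugate q → ∀ ⦃f g : V → ℝ⦄, MemLp f (ofReal p) μ →
    MemLp g (ofReal q) μ → ∫ z, A f z * g z ∂μ = ∫ z, f z * B g z ∂μ

theorem isAdj_shiftOp (y : V) : IsAdj μ (shiftOp y) (shiftOp (-y)) := by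
  intro p q _ f g _ _
  rw [← integral_sub_right_eq_self _ y]
  simp [sub_eq_add_neg]

theorem IsAdj.add {A B A' B' : Module.End ℝ (V → ℝ)} (h : IsAdj μ A B) (h' : IsAdj μ A' B')
    (hA : A ∈ transAlg V) (hB : B ∈ transAlg V) (hA' : A' ∈ transAlg V) (hB' : B' ∈ transAlg V) :
    IsAdj μ (A + A') (B + B') := by
  intro p q hpq f g hf hg
  simp only [LinearMap.add_apply, Pi.add_apply, add_mul, mul_add]
  rw [integral_add (integrable_mul_holder hpq (transAlg_memLp hA hf) hg)
    (integrable_mul_holder hpq (transAlg_memLp hA' hf) hg),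
    integral_add (integrable_mul_holder hpq hf (transAlg_memLp hB hg))
    (integrable_mul_holder hpq hf (transAlg_memLp hB' hg)), h hpq hf hg, h' hpq hf hg]

theorem IsAdj.smul {A B : Module.End ℝ (V → ℝ)} (h : IsAdj μ A B) (c : ℝ) :
    IsAdj μ (c • A) (c • B) := by
  intro p q hpq f g hf hg
  simp only [LinearMap.smul_apply, Pi.smul_apply, smul_eq_mul, mul_assoc, mul_left_comm _ c]
  rw [integral_const_mul, integral_const_mul, h hpq hf hg]

theorem IsAdj.mul {A B A' B' : Module.End ℝ (V → ℝ)} (h : IsAdj μ A B) (h' : IsAdj μ A' B')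
    (hB : B ∈ transAlg V) (hA' : A' ∈ transAlg V) : IsAdj μ (A * A') (B' * B) := by
  intro p q hpq f g hf hg
  simp only [Module.End.mul_apply]
  rw [h hpq (transAlg_memLp hA' hf) hg, h' hpq hf (transAlg_memLp hB hg)]

theorem isAdj_meanOp (d : V) : IsAdj μ (meanOp d) (meanOp d) := by
  have h2 := isAdj_shiftOp (μ := μ) (-d)
  rw [neg_neg] at h2
  have := ((isAdj_shiftOp (μ := μ) d).add h2 (shiftOp_mem _) (shiftOp_mem _) (shiftOp_mem _)
    (shiftOp_mem _)).smul (1 / 2)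
  rwa [add_comm (shiftOp (-d))] at this

theorem isAdj_diffOp (d : V) : IsAdj μ (diffOp d) ((-1 : ℝ) • diffOp d) := by
  have h2 := (isAdj_shiftOp (μ := μ) (-d)).smul (-1)
  rw [neg_neg] at h2
  have := ((isAdj_shiftOp (μ := μ) d).add h2 (shiftOp_mem _) (shiftOp_mem _)
    (Subalgebra.smul_mem _ (shiftOp_mem _) _) (Subalgebra.smul_mem _ (shiftOp_mem _) _)).smul (1 / 2)
  have e : (-1 : ℝ) • diffOp d = (1 / 2 : ℝ) • (shiftOp (-d) + (-1 : ℝ) • shiftOp d) := by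
    simp only [diffOp]; module
  rw [e]; exact this

theorem IsAdj.sum {ι : Type*} (s : Finset ι) {A : ι → Module.End ℝ (V → ℝ)}
    (h : ∀ i, IsAdj μ (A i) (A i)) (hA : ∀ i, A i ∈ transAlg V) :
    IsAdj μ (∑ i ∈ s, A i) (∑ i ∈ s, A i) := by
  classical
  induction s using Finset.induction_on with
  | empty => intro p q _ f g _ _; simp
  | insert i s hi ih =>
    rw [Finset.sum_insert hi]
    exact (h i).add ih (hA i) (hA i) (Subalgebra.sum_mem _ fun i _ => hA i)
      (Subalgebra.sum_mem _ fun i _ => hA i)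

theorem IsAdj.pow {A : Module.End ℝ (V → ℝ)} (h : IsAdj μ A A) (hA : A ∈ transAlg V) (k : ℕ) :
    IsAdj μ (A ^ k) (A ^ k) := by
  induction k with
  | zero => intro p q _ f g _ _; simp
  | succ k ih =>
    have := ih.mul h (Subalgebra.pow_mem _ hA k) hA
    rwa [← pow_succ, ← pow_succ'] at this

theorem isAdj_walkOp (d : ι → V) : IsAdj μ (walkOp d) (walkOp d) :=
  (IsAdj.sum _ (fun i => (isAdj_meanOp (d i)).pow (meanOp_mem _) 2)
    fun _ => Subalgebra.pow_mem _ (meanOp_mem _) 2).smul _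

end DiscreteOperators

/-! ### Bilinear embedding and discrete Riesz transforms. -/

section BilinearEstimate

variable {V : Type*} [NormedAddCommGroup V] [NormedSpace ℝ V] [FiniteDimensional ℝ V]
  [MeasurableSpace V] [BorelSpace V] {μ : Measure V} [μ.IsAddHaarMeasure]
  {ι : Type*} [Fintype ι] [Nonempty ι] {p q K : ℝ}

theorem meanOp_nonneg (d : V) {f : V → ℝ} (hf : ∀ z, 0 ≤ f z) (z : V) : 0 ≤ meanOp d f z := by
  rw [meanOp_apply]
  have := hf (z + d); have := hf (z + -d); positivity

theorem walkOp_apply (d : ι → V) (f : V → ℝ) (z : V) :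
    walkOp d f z = ∑ i, (Fintype.card ι : ℝ)⁻¹ * meanOp (d i) (meanOp (d i) f) z := by
  simp [walkOp, pow_two, Finset.mul_sum]

theorem walkOp_nonneg (d : ι → V) {f : V → ℝ} (hf : ∀ z, 0 ≤ f z) (z : V) : 0 ≤ walkOp d f z := by
  rw [walkOp_apply]
  exact Finset.sum_nonneg fun i _ => mul_nonneg (by positivity)
    (meanOp_nonneg _ (meanOp_nonneg _ hf) _)

theorem integrable_bellman (hpq : p.HolderConjugate q) (hp : 2 ≤ p) (hK : 0 ≤ K) {f g : V → ℝ}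
    (hf0 : ∀ z, 0 ≤ f z) (hg0 : ∀ z, 0 ≤ g z) (hf : MemLp f (ofReal p) μ)
    (hg : MemLp g (ofReal q) μ) : Integrable (fun z => bellman p q K (f z) (g z)) μ ∧
      ∫ z, bellman p q K (f z) (g z) ∂μ ≤ (1 + K) * (∫ z, f z ^ p ∂μ + ∫ z, g z ^ q ∂μ) := by
  have hi : ∀ {r : ℝ} {k : V → ℝ}, 0 < r → (∀ z, 0 ≤ k z) → MemLp k (ofReal r) μ →
      Integrable (fun z => k z ^ r) μ := by
    intro r k hr hk0 hk
    have := hk.integrable_norm_rpow (by simpa using hr) ENNReal.ofReal_ne_top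
    rw [ENNReal.toReal_ofReal hr.le] at this
    refine this.congr (.of_forall fun z => ?_)
    simp only [Real.norm_of_nonneg (hk0 z)]
  have h1 := (hi hpq.pos hf0 hf).add (hi hpq.symm.pos hg0 hg)
  have h2 : Integrable (fun z => (1 + K) * (f z ^ p + g z ^ q)) μ := h1.const_mul _
  have h3 : Integrable (fun z => bellman p q K (f z) (g z)) μ := by
    refine h2.mono' ?_ (.of_forall fun z => ?_)
    · exact (continuous_bellman hpq hp).comp_aestronglyMeasurable (hf.1.prodMk hg.1)
    · rw [Real.norm_of_nonneg (bellman_nonneg hK (hf0 z) (hg0 z))]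
      exact bellman_le hpq hp hK (hf0 z) (hg0 z)
  refine ⟨h3, ?_⟩
  rw [← integral_add (hi hpq.pos hf0 hf) (hi hpq.symm.pos hg0 hg), ← integral_const_mul]
  exact integral_mono h3 h2 fun z => bellman_le hpq hp hK (hf0 z) (hg0 z)

/-- By translation invariance ∫ B(f, g) is the integral of the mean of B(f, g) at z + d and z - d.
The midpoint inequality, applied pointwise, gives both the decrease and its rate. -/
theorem integral_bellman_meanOp (hpq : p.HolderConjugate q) (hp : 2 ≤ p) (hK0 : 0 ≤ K)
    (hK : 9 * q ≤ K * (q - 1)) {f g : V → ℝ}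
    (hf0 : ∀ z, 0 ≤ f z) (hg0 : ∀ z, 0 ≤ g z) (hf : MemLp f (ofReal p) μ)
    (hg : MemLp g (ofReal q) μ) (d : V) : ∫ z, bellman p q K (meanOp d f z) (meanOp d g z) ∂μ +
      ∫ z, |diffOp d f z * diffOp d g z| ∂μ ≤ ∫ z, bellman p q K (f z) (g z) ∂μ := by
  have hB := (integrable_bellman hpq hp hK0 hf0 hg0 hf hg).1
  have h1 := (integrable_bellman hpq hp hK0 (meanOp_nonneg d hf0) (meanOp_nonneg d hg0)
    (transAlg_memLp (meanOp_mem d) hf) (transAlg_memLp (meanOp_mem d) hg)).1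
  have h2 := (integrable_mul_holder hpq (transAlg_memLp (diffOp_mem d) hf)
    (transAlg_memLp (diffOp_mem d) hg)).abs
  have e : ∫ z, bellman p q K (f z) (g z) ∂μ =
      ∫ z, (bellman p q K (f (z + d)) (g (z + d)) + bellman p q K (f (z + -d)) (g (z + -d))) / 2
        ∂μ := by
    rw [integral_div, integral_add (hB.comp_add_right d) (hB.comp_add_right (-d)),
      integral_add_right_eq_self (fun z => bellman p q K (f z) (g z)) d,
      integral_add_right_eq_self (fun z => bellman p q K (f z) (g z)) (-d)]
    ring
  rw [e, ← integral_add h1 h2]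
  refine integral_mono (h1.add h2) (((hB.comp_add_right d).add (hB.comp_add_right (-d))).div_const 2)
    fun z => ?_
  simp only [meanOp_apply, diffOp_apply]
  exact bellman_midpoint hpq hp hK (hf0 _) (hg0 _) (hf0 _) (hg0 _)

/-- One step of the walk averages twice in a direction and then takes the mean over directions. Only
the gain of the first averaging is kept; the mean over directions is handled by Jensen's inequality.
-/
theorem integral_bellman_walkOp (hpq : p.HolderConjugate q) (hp : 2 ≤ p) (hK0 : 0 ≤ K)
    (hK : 9 * q ≤ K * (q - 1)) {f g : V → ℝ}
    (hf0 : ∀ z, 0 ≤ f z) (hg0 : ∀ z, 0 ≤ g z) (hf : MemLp f (ofReal p) μ)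
    (hg : MemLp g (ofReal q) μ) (d : ι → V) : ∫ z, bellman p q K (walkOp d f z) (walkOp d g z) ∂μ +
      ∑ i, (Fintype.card ι : ℝ)⁻¹ * ∫ z, |diffOp (d i) f z * diffOp (d i) g z| ∂μ ≤
        ∫ z, bellman p q K (f z) (g z) ∂μ := by
  have hN : (Fintype.card ι : ℝ) ≠ 0 := by simp
  set c := (Fintype.card ι : ℝ)⁻¹ with hc
  have hc0 : 0 ≤ c := by positivity
  have hsum : ∑ _i : ι, c = 1 := by simp [hc]
  have hm : ∀ {r : ℝ≥0∞} {k : V → ℝ} (i : ι), MemLp k r μ → MemLp (meanOp (d i) k) r μ :=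
    fun i hk => transAlg_memLp (meanOp_mem _) hk
  have step1 : ∫ z, bellman p q K (walkOp d f z) (walkOp d g z) ∂μ ≤
      ∑ i, c * ∫ z, bellman p q K (meanOp (d i) (meanOp (d i) f) z)
        (meanOp (d i) (meanOp (d i) g) z) ∂μ := by
    have hi : ∀ i, Integrable (fun z => bellman p q K (meanOp (d i) (meanOp (d i) f) z)
        (meanOp (d i) (meanOp (d i) g) z)) μ := fun i =>
      (integrable_bellman hpq hp hK0 (meanOp_nonneg _ (meanOp_nonneg _ hf0))
        (meanOp_nonneg _ (meanOp_nonneg _ hg0)) (hm i (hm i hf)) (hm i (hm i hg))).1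
    simp only [← integral_const_mul]
    rw [← integral_finsetSum _ fun i _ => (hi i).const_mul c]
    refine integral_mono (integrable_bellman hpq hp hK0 (walkOp_nonneg d hf0) (walkOp_nonneg d hg0)
      (transAlg_memLp (walkOp_mem d) hf) (transAlg_memLp (walkOp_mem d) hg)).1
      (integrable_finsetSum _ fun i _ => (hi i).const_mul c) fun z => ?_
    have := (convexOn_bellman hpq hp hK).map_sum_le (t := Finset.univ) (w := fun _ : ι => c)
      (p := fun i => (meanOp (d i) (meanOp (d i) f) z, meanOp (d i) (meanOp (d i) g) z))
      (fun _ _ => hc0) hsum (fun i _ => ⟨meanOp_nonneg _ (meanOp_nonneg _ hf0) _,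
        meanOp_nonneg _ (meanOp_nonneg _ hg0) _⟩)
    simp only [Prod.fst_sum, Prod.snd_sum, Prod.smul_fst, Prod.smul_snd, smul_eq_mul] at this
    simp only [walkOp_apply]
    exact this
  have step2 : ∀ i, ∫ z, bellman p q K (meanOp (d i) (meanOp (d i) f) z)
        (meanOp (d i) (meanOp (d i) g) z) ∂μ + ∫ z, |diffOp (d i) f z * diffOp (d i) g z| ∂μ ≤
      ∫ z, bellman p q K (f z) (g z) ∂μ := by
    intro i
    have h1 := integral_bellman_meanOp hpq hp hK0 hK hf0 hg0 hf hg (d i)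
    have h2 := integral_bellman_meanOp hpq hp hK0 hK (meanOp_nonneg (d i) hf0)
      (meanOp_nonneg (d i) hg0) (hm i hf) (hm i hg) (d i)
    have h3 : 0 ≤ ∫ z, |diffOp (d i) (meanOp (d i) f) z * diffOp (d i) (meanOp (d i) g) z| ∂μ :=
      integral_nonneg fun z => abs_nonneg _
    linarith
  have step3 := Finset.sum_le_sum fun i (_ : i ∈ Finset.univ) =>
    mul_le_mul_of_nonneg_left (step2 i) hc0
  simp only [mul_add, Finset.sum_add_distrib] at step3
  rw [← Finset.sum_mul, hsum, one_mul] at step3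
  linarith

/-- The losses of the decreasing quantities ∫ B(Pᵏf, Pᵏg) telescope, and B is nonnegative. The
induction replaces (f, g) by (Pf, Pg). -/
theorem sum_integral_diffOp_walkOp_le (hpq : p.HolderConjugate q) (hp : 2 ≤ p) (hK0 : 0 ≤ K)
    (hK : 9 * q ≤ K * (q - 1)) (d : ι → V) (N : ℕ) {f g : V → ℝ}
    (hf0 : ∀ z, 0 ≤ f z) (hg0 : ∀ z, 0 ≤ g z) (hf : MemLp f (ofReal p) μ)
    (hg : MemLp g (ofReal q) μ) : ∑ k ∈ Finset.range N, ∑ i, (Fintype.card ι : ℝ)⁻¹ *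
      ∫ z, |diffOp (d i) ((walkOp d ^ k) f) z * diffOp (d i) ((walkOp d ^ k) g) z| ∂μ ≤
        ∫ z, bellman p q K (f z) (g z) ∂μ := by
  induction N generalizing f g with
  | zero =>
    simp only [Finset.range_zero, Finset.sum_empty]
    exact integral_nonneg fun z => bellman_nonneg hK0 (hf0 z) (hg0 z)
  | succ N ih =>
    rw [Finset.sum_range_succ']
    have h1 := ih (walkOp_nonneg d hf0) (walkOp_nonneg d hg0) (transAlg_memLp (walkOp_mem d) hf)
      (transAlg_memLp (walkOp_mem d) hg)
    have h2 := integral_bellman_walkOp hpq hp hK0 hK hf0 hg0 hf hg d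
    simp only [pow_succ, Module.End.mul_apply, pow_zero, Module.End.one_apply]
    linarith

/-- The bilinear embedding for the random walk, for nonnegative functions. -/
theorem exists_bilinear_bound_nonneg (hpq : p.HolderConjugate q) : ∃ C : ℝ, 0 ≤ C ∧
    ∀ (d : ι → V) (N : ℕ) (i : ι) (f g : V → ℝ), (∀ z, 0 ≤ f z) → (∀ z, 0 ≤ g z) →
      MemLp f (ofReal p) μ → MemLp g (ofReal q) μ →
      ∑ k ∈ Finset.range N,
        ∫ z, |diffOp (d i) ((walkOp d ^ k) f) z * diffOp (d i) ((walkOp d ^ k) g) z| ∂μ ≤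
        C * (∫ z, f z ^ p ∂μ + ∫ z, g z ^ q ∂μ) := by
  -- Of two conjugate exponents one is at least 2, and the claim is symmetric under exchanging f
  -- with g and p with q.
  wlog hp : 2 ≤ p generalizing p q
  · have hq : 2 ≤ q := by
      have h1 := hpq.conjugate_eq
      have h2 := hpq.sub_one_pos
      rw [h1, le_div_iff₀ h2]
      linarith
    obtain ⟨C, hC, h⟩ := this hpq.symm hq
    refine ⟨C, hC, fun d N i f g hf0 hg0 hf hg => ?_⟩
    have := h d N i g f hg0 hf0 hg hf
    rw [add_comm (∫ z, g z ^ q ∂μ)] at this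
    simpa only [mul_comm] using this
  have hq1 : 0 < q - 1 := hpq.symm.sub_one_pos
  have hq0 := hpq.symm.pos
  set K := 9 * q / (q - 1) with hKdef
  have hK0 : 0 ≤ K := by positivity
  have hK : 9 * q ≤ K * (q - 1) := by rw [hKdef, div_mul_cancel₀ _ hq1.ne']
  have hN0 : 0 < (Fintype.card ι : ℝ) := by exact_mod_cast Fintype.card_pos
  refine ⟨(Fintype.card ι : ℝ) * (1 + K), by positivity, fun d N i f g hf0 hg0 hf hg => ?_⟩
  have h1 := sum_integral_diffOp_walkOp_le hpq hp hK0 hK d N hf0 hg0 hf hg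
  have h2 := (integrable_bellman hpq hp hK0 hf0 hg0 hf hg).2
  -- All directions contribute nonnegative terms, so a single one is bounded by their sum; the
  -- number of directions enters the constant.
  have h3 : (Fintype.card ι : ℝ)⁻¹ * ∑ k ∈ Finset.range N,
        ∫ z, |diffOp (d i) ((walkOp d ^ k) f) z * diffOp (d i) ((walkOp d ^ k) g) z| ∂μ ≤
      ∑ k ∈ Finset.range N, ∑ i, (Fintype.card ι : ℝ)⁻¹ *
      ∫ z, |diffOp (d i) ((walkOp d ^ k) f) z * diffOp (d i) ((walkOp d ^ k) g) z| ∂μ := by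
    rw [Finset.mul_sum]
    refine Finset.sum_le_sum fun k _ => ?_
    exact Finset.single_le_sum (f := fun i => (Fintype.card ι : ℝ)⁻¹ *
      ∫ z, |diffOp (d i) ((walkOp d ^ k) f) z * diffOp (d i) ((walkOp d ^ k) g) z| ∂μ)
      (fun j _ => mul_nonneg (by positivity) (integral_nonneg fun z => abs_nonneg _))
      (Finset.mem_univ i)
  have h4 := h3.trans (h1.trans h2)
  rw [inv_mul_le_iff₀ hN0] at h4
  rw [mul_assoc]; exact h4

/-- The geometric sum `∑_{k < N} P^{2k}`. -/
noncomputable def evenSum (d : ι → V) (N : ℕ) : Module.End ℝ (V → ℝ) :=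
  ∑ k ∈ Finset.range N, walkOp d ^ k * walkOp d ^ k

theorem evenSum_mem (d : ι → V) (N : ℕ) : evenSum d N ∈ transAlg V :=
  Subalgebra.sum_mem _ fun _ _ => Subalgebra.mul_mem _ (Subalgebra.pow_mem _ (walkOp_mem d) _)
    (Subalgebra.pow_mem _ (walkOp_mem d) _)

/-- P is self-adjoint and D skew-adjoint, and all of them commute. One of the two factors Pᵏ and one
of the two factors D are moved to g; this is why `evenSum` contains even powers only. -/
theorem integral_diffOp_sq_evenSum (hpq : p.HolderConjugate q) (d : ι → V) (N : ℕ) (i : ι)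
    {f g : V → ℝ} (hf : MemLp f (ofReal p) μ) (hg : MemLp g (ofReal q) μ) :
    ∫ z, diffOp (d i) (diffOp (d i) (evenSum d N f)) z * g z ∂μ = - ∑ k ∈ Finset.range N,
        ∫ z, diffOp (d i) ((walkOp d ^ k) f) z * diffOp (d i) ((walkOp d ^ k) g) z ∂μ := by
  have hP : ∀ k, walkOp d ^ k ∈ transAlg V := fun k => Subalgebra.pow_mem _ (walkOp_mem d) _
  have hE := diffOp_mem (d i)
  have hmem : ∀ k, MemLp (diffOp (d i) (diffOp (d i) ((walkOp d ^ k) ((walkOp d ^ k) f))))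
      (ofReal p) μ := fun k => transAlg_memLp hE (transAlg_memLp hE
        (transAlg_memLp (hP k) (transAlg_memLp (hP k) hf)))
  have e1 : ∀ z, diffOp (d i) (diffOp (d i) (evenSum d N f)) z * g z = ∑ k ∈ Finset.range N,
        diffOp (d i) (diffOp (d i) ((walkOp d ^ k) ((walkOp d ^ k) f))) z * g z := by
    intro z
    rw [← Finset.sum_mul]
    simp [evenSum, map_sum, Finset.sum_apply]
  simp only [e1]
  rw [integral_finsetSum _ fun k _ => integrable_mul_holder hpq (hmem k) hg,
    ← Finset.sum_neg_distrib]
  refine Finset.sum_congr rfl fun k _ => ?_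
  rw [isAdj_diffOp (d i) hpq (transAlg_memLp hE (transAlg_memLp (hP k) (transAlg_memLp (hP k) hf))) hg,
    transAlg_comm_apply hE (hP k),
    (isAdj_walkOp d).pow (walkOp_mem d) k hpq (transAlg_memLp hE (transAlg_memLp (hP k) hf))
      (transAlg_memLp (Subalgebra.smul_mem _ hE _) hg),
    transAlg_comm_apply (hP k) (Subalgebra.smul_mem _ hE _)]
  simp only [LinearMap.smul_apply, Pi.smul_apply, smul_eq_mul, neg_mul, one_mul, mul_neg]
  rw [integral_neg]

/-- The second order differences of the summed random walk are bounded in `L^p`, uniformly in the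
step size and the number of steps. -/
theorem exists_bound_diffOp_sq_evenSum (hpq : p.HolderConjugate q) : ∃ C : ℝ, 0 ≤ C ∧
    ∀ (d : ι → V) (N : ℕ) (i : ι) (f : V → ℝ), MemLp f (ofReal p) μ →
      (eLpNorm (diffOp (d i) (diffOp (d i) (evenSum d N f))) (ofReal p) μ).toReal ≤
        C * 𝐍[f,p,μ] := by
  obtain ⟨C, hC, hb⟩ := exists_bilinear_bound_nonneg (V := V) (μ := μ) (ι := ι) hpq
  refine ⟨8 * C, by positivity, fun d N i f hf => ?_⟩
  have hE := diffOp_mem (d i)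
  have hmem : ∀ {f : V → ℝ}, MemLp f (ofReal p) μ →
      MemLp (diffOp (d i) (diffOp (d i) (evenSum d N f))) (ofReal p) μ := fun hf =>
    transAlg_memLp hE (transAlg_memLp hE (transAlg_memLp (evenSum_mem d N) hf))
  have h1p : (1 : ℝ≥0∞) ≤ ofReal p := ENNReal.one_le_ofReal.2 hpq.lt.le
  -- nonnegative functions
  have hnn : ∀ f g : V → ℝ, (∀ z, 0 ≤ f z) → (∀ z, 0 ≤ g z) → MemLp f (ofReal p) μ →
      MemLp g (ofReal q) μ →
      |∫ z, diffOp (d i) (diffOp (d i) (evenSum d N f)) z * g z ∂μ| ≤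
        C * (∫ z, f z ^ p ∂μ + ∫ z, g z ^ q ∂μ) := by
    intro f g hf0 hg0 hf hg
    rw [integral_diffOp_sq_evenSum hpq d N i hf hg, abs_neg]
    refine (Finset.abs_sum_le_sum_abs _ _).trans
      (le_trans (Finset.sum_le_sum fun k _ => ?_) (hb d N i f g hf0 hg0 hf hg))
    exact abs_integral_le_integral_abs
  -- normalized functions
  have hposle : ∀ {r : ℝ} {k : V → ℝ}, 0 < r → MemLp k (ofReal r) μ → 𝐍[k,r,μ] ≤ 1 →
      ∫ z, max (k z) 0 ^ r ∂μ ≤ 1 ∧ ∫ z, max (-k z) 0 ^ r ∂μ ≤ 1 := by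
    intro r k hr hk h1
    have h2 : ∫ z, |k z| ^ r ∂μ ≤ 1 := by
      rw [← eLpNorm_toReal_rpow hr hk]
      exact Real.rpow_le_one ENNReal.toReal_nonneg h1 hr.le
    have hi : Integrable (fun z => |k z| ^ r) μ := by
      have := hk.integrable_norm_rpow (by simpa using hr) ENNReal.ofReal_ne_top
      rwa [ENNReal.toReal_ofReal hr.le] at this
    have hj : ∀ j : V → ℝ, (∀ z, j z ≤ |k z|) → ∫ z, max (j z) 0 ^ r ∂μ ≤ 1 := fun j hj =>
      (integral_mono_of_nonneg (.of_forall fun z => Real.rpow_nonneg (le_max_right _ _) _) hi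
        (.of_forall fun z => Real.rpow_le_rpow (le_max_right _ _)
          (max_le (hj z) (abs_nonneg _)) hr.le)).trans h2
    exact ⟨hj _ fun z => le_abs_self _, hj _ fun z => neg_le_abs _⟩
  have hnorm : ∀ f g : V → ℝ, MemLp f (ofReal p) μ → MemLp g (ofReal q) μ →
      𝐍[f,p,μ] ≤ 1 → 𝐍[g,q,μ] ≤ 1 →
      |∫ z, diffOp (d i) (diffOp (d i) (evenSum d N f)) z * g z ∂μ| ≤ 8 * C := by
    intro f g hf hg hf1 hg1
    -- Splitting into positive and negative parts gives four pairings of nonnegative functions, each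
    -- at most 2C since all the p-th and q-th power integrals are at most 1. Together they give 8C.
    set fp : V → ℝ := fun z => max (f z) 0 with hfp
    set fm : V → ℝ := fun z => max (-f z) 0 with hfm
    set gp : V → ℝ := fun z => max (g z) 0 with hgp
    set gm : V → ℝ := fun z => max (-g z) 0 with hgm
    have hfpL : MemLp fp (ofReal p) μ := hf.pos_part
    have hfmL : MemLp fm (ofReal p) μ := hf.neg_part
    have hgpL : MemLp gp (ofReal q) μ := hg.pos_part
    have hgmL : MemLp gm (ofReal q) μ := hg.neg_part
    have ef : f = fp - fm := funext fun z => (max_zero_sub_max_neg_zero_eq_self (f z)).symm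
    have eg : ∀ z, g z = gp z - gm z := fun z => (max_zero_sub_max_neg_zero_eq_self (g z)).symm
    obtain ⟨f1, f2⟩ := hposle hpq.pos hf hf1
    obtain ⟨g1, g2⟩ := hposle hpq.symm.pos hg hg1
    have m0 : ∀ x : ℝ, 0 ≤ max x 0 := fun x => le_max_right _ _
    have b1 := hnn fp gp (fun z => m0 _) (fun z => m0 _) hfpL hgpL
    have b2 := hnn fp gm (fun z => m0 _) (fun z => m0 _) hfpL hgmL
    have b3 := hnn fm gp (fun z => m0 _) (fun z => m0 _) hfmL hgpL
    have b4 := hnn fm gm (fun z => m0 _) (fun z => m0 _) hfmL hgmL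
    have c1 : ∀ a b : ℝ, a ≤ 1 → b ≤ 1 → C * (a + b) ≤ 2 * C := fun a b ha hb => by nlinarith
    have b1' := b1.trans (c1 _ _ f1 g1)
    have b2' := b2.trans (c1 _ _ f1 g2)
    have b3' := b3.trans (c1 _ _ f2 g1)
    have b4' := b4.trans (c1 _ _ f2 g2)
    have e : ∫ z, diffOp (d i) (diffOp (d i) (evenSum d N f)) z * g z ∂μ =
        (∫ z, diffOp (d i) (diffOp (d i) (evenSum d N fp)) z * gp z ∂μ -
        ∫ z, diffOp (d i) (diffOp (d i) (evenSum d N fp)) z * gm z ∂μ) -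
        (∫ z, diffOp (d i) (diffOp (d i) (evenSum d N fm)) z * gp z ∂μ -
        ∫ z, diffOp (d i) (diffOp (d i) (evenSum d N fm)) z * gm z ∂μ) := by
      have i1 := integrable_mul_holder hpq (hmem hfpL) hgpL
      have i2 := integrable_mul_holder hpq (hmem hfpL) hgmL
      have i3 := integrable_mul_holder hpq (hmem hfmL) hgpL
      have i4 := integrable_mul_holder hpq (hmem hfmL) hgmL
      have i12 : Integrable (fun z => diffOp (d i) (diffOp (d i) (evenSum d N fp)) z * gp z -
        diffOp (d i) (diffOp (d i) (evenSum d N fp)) z * gm z) μ := i1.sub i2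
      have i34 : Integrable (fun z => diffOp (d i) (diffOp (d i) (evenSum d N fm)) z * gp z -
        diffOp (d i) (diffOp (d i) (evenSum d N fm)) z * gm z) μ := i3.sub i4
      rw [← integral_sub i1 i2, ← integral_sub i3 i4, ← integral_sub i12 i34]
      refine integral_congr_ae (.of_forall fun z => ?_)
      simp only [ef, map_sub, Pi.sub_apply, eg z]
      ring
    rw [e]
    rw [abs_le] at b1' b2' b3' b4' ⊢
    constructor <;> linarith
  set F := 𝐍[f,p,μ] with hF
  have hF0 : 0 ≤ F := ENNReal.toReal_nonneg
  have hgen : ∀ g : V → ℝ, MemLp g (ofReal q) μ →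
      |∫ z, diffOp (d i) (diffOp (d i) (evenSum d N f)) z * g z ∂μ| ≤ 8 * C * F * 𝐍[g,q,μ] := by
    intro g hg
    set G := 𝐍[g,q,μ] with hG
    have hG0 : 0 ≤ G := ENNReal.toReal_nonneg
    -- Homogeneity upgrades the additive bound to a product. Normalising by the norm plus e avoids
    -- dividing by zero, and e then tends to zero.
    have hab : ∀ e ∈ Ioi (0 : ℝ), |∫ z, diffOp (d i) (diffOp (d i) (evenSum d N f)) z * g z ∂μ| ≤
        8 * C * (F + e) * (G + e) := by
      intro e he
      have he' : 0 < e := he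
      have ha : 0 < F + e := by linarith
      have hb : 0 < G + e := by linarith
      have h := hnorm ((F + e)⁻¹ • f) ((G + e)⁻¹ • g) (hf.const_smul _) (hg.const_smul _)
        (by rw [toReal_eLpNorm_smul, abs_of_pos (inv_pos.2 ha), inv_mul_le_iff₀ ha]; linarith)
        (by rw [toReal_eLpNorm_smul, abs_of_pos (inv_pos.2 hb), inv_mul_le_iff₀ hb]; linarith)
      have e2 : ∫ z, diffOp (d i) (diffOp (d i) (evenSum d N ((F + e)⁻¹ • f))) z *
          ((G + e)⁻¹ • g) z ∂μ = ((F + e) * (G + e))⁻¹ *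
          ∫ z, diffOp (d i) (diffOp (d i) (evenSum d N f)) z * g z ∂μ := by
        rw [← integral_const_mul]
        refine integral_congr_ae (.of_forall fun z => ?_)
        simp only [map_smul, Pi.smul_apply, smul_eq_mul, mul_inv]
        ring
      have hab0 : 0 < (F + e) * (G + e) := by positivity
      rw [e2, abs_mul, abs_of_pos (inv_pos.2 hab0), inv_mul_le_iff₀ hab0] at h
      linarith
    have hl : Tendsto (fun e : ℝ => 8 * C * (F + e) * (G + e)) (𝓝[>] 0)
        (𝓝 (8 * C * (F + 0) * (G + 0))) := by
      refine (Continuous.tendsto ?_ 0).mono_left nhdsWithin_le_nhds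
      fun_prop
    simpa using ge_of_tendsto hl (eventually_nhdsWithin_of_forall hab)
  have key := eLpNorm_le_of_forall_test (μ := μ) hpq.symm (C := 8 * C * F) (by positivity)
    isOpen_univ (f := diffOp (d i) (diffOp (d i) (evenSum d N f)))
    (((hmem hf).locallyIntegrable h1p).locallyIntegrableOn _) (fun φ hφ => by
      have := hgen φ (testFun_memLp hφ _)
      simpa only [mul_comm (φ _)] using this)
  rw [Measure.restrict_univ] at key
  exact ENNReal.toReal_le_of_le_ofReal (by positivity) key.2

end BilinearEstimate

/-! ### Convergence of first and second difference quotients. -/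

section DifferenceQuotients

variable {V : Type*} [NormedAddCommGroup V] [NormedSpace ℝ V] [FiniteDimensional ℝ V]
  [MeasurableSpace V] [BorelSpace V] {μ : Measure V} [μ.IsAddHaarMeasure] {p q : ℝ}

theorem integral_fderiv_mul_test {φ u : V → ℝ} (hφ : φ ∈ testFun univ) (hu : u ∈ testFun univ)
    (h : V) : ∫ z, fderiv ℝ φ z h * u z ∂μ = - ∫ z, φ z * fderiv ℝ u z h ∂μ := by
  have i : ∀ {f g : V → ℝ}, f ∈ testFun univ → g ∈ testFun univ →
      Integrable (fun z => f z * g z) μ := fun hf hg =>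
    ((testFun_continuous hf).mul (testFun_continuous hg)).integrable_of_hasCompactSupport
      hf.2.1.mul_right
  rw [integral_mul_fderiv_eq_neg_fderiv_mul_of_integrable (i (testFun_fderiv hφ h) hu)
    (i hφ (testFun_fderiv hu h)) (i hφ hu) (fun z _ => testFun_differentiable hφ z)
    fun z _ => testFun_differentiable hu z,
    neg_neg]

/-- The operator is half of a translated difference over the step 2rv, so the translation estimate
gives 2|r|/2. -/
theorem toReal_eLpNorm_diffOp_le (hpq : p.HolderConjugate q) {f : V → ℝ} (hf : f ∈ testFun univ)
    (r : ℝ) (v : V) : 𝐍[diffOp (r • v) f,p,μ] ≤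
      |r| * 𝐍[𝐃[f,v],p,μ] := by
  have h2 := (eLpNorm_translate_sub_le (μ := μ) (Ω := univ) hpq.symm isOpen_univ convex_univ
    (u := f) (G := 𝐃[f,(2 * r) • v]) ((2 * r) • v)
    ((testFun_continuous hf).locallyIntegrable.locallyIntegrableOn _)
    (testFun_memLp (testFun_fderiv hf _) _) fun φ hφ => integral_fderiv_mul_test hφ hf _).2
  simp only [univ_inter, preimage_univ, Measure.restrict_univ] at h2
  have e1 : diffOp (r • v) f =
      (1 / 2 : ℝ) • (fun z => (fun z => f (z + (2 * r) • v) - f z) (z + -(r • v))) := by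
    ext z
    simp only [diffOp_apply, Pi.smul_apply, smul_eq_mul]
    rw [show z + -(r • v) + (2 * r) • v = z + r • v by module]
    ring
  have e2 : 𝐃[f,(2 * r) • v] = (2 * r) • 𝐃[f,v] := by ext z; simp
  have hm : AEStronglyMeasurable (fun z => f (z + (2 * r) • v) - f z) μ := by
    have := testFun_continuous hf
    exact (by fun_prop : Continuous fun z => f (z + (2 * r) • v) - f z).aestronglyMeasurable
  rw [e1, toReal_eLpNorm_smul, eLpNorm_translate hm]
  rw [e2] at h2
  have h3 := ENNReal.toReal_mono
    (by rw [← e2]; exact (testFun_memLp (testFun_fderiv hf _) _).2.ne) h2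
  rw [toReal_eLpNorm_smul, abs_mul, abs_two] at h3
  rw [abs_of_pos (by norm_num : (0 : ℝ) < 1 / 2)]
  linarith

theorem diffOp_testFun {f : V → ℝ} (hf : f ∈ testFun univ) (d : V) :
    diffOp d f ∈ testFun univ := transAlg_testFun (diffOp_mem d) _ hf

/-- Symmetric difference quotients of a test function converge in `Lᵖ`. -/
theorem tendsto_diffQuot (hpq : p.HolderConjugate q) {f : V → ℝ} (hf : f ∈ testFun univ)
    (v : V) {r : ℕ → ℝ} {R : ℝ} (hr0 : ∀ k, r k ≠ 0) (hrR : ∀ k, |r k| ≤ R)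
    (hr : Tendsto r atTop (𝓝 0)) :
    Tendsto (fun k => 𝐍[(r k)⁻¹ • diffOp (r k • v) f - 𝐃[f,v],p,μ]) atTop (𝓝 0) := by
  have hf' := testFun_fderiv hf v
  obtain ⟨B, hB⟩ := (testFun_continuous hf').bounded_above_of_compact_support hf'.2.1
  have hB0 : 0 ≤ B := (norm_nonneg _).trans (hB 0)
  -- K contains the supports of all the difference quotients with |r| ≤ R and of the derivative.
  -- There each of them is at most B, so 2B on K dominates.
  set K : Set V := (fun x : V × ℝ => x.1 - x.2 • v) '' (tsupport f ×ˢ Icc (-R) R) with hK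
  have hKc : IsCompact K := (hf.2.1.isCompact.prod isCompact_Icc).image (by fun_prop)
  have hR0 : 0 ≤ R := (abs_nonneg _).trans (hrR 0)
  have hKout : ∀ z, z ∉ K → ∀ s, |s| ≤ R → f (z + s • v) = 0 := by
    intro z hz s hs
    by_contra hne
    exact hz ⟨(z + s • v, s), ⟨subset_tsupport _ hne, abs_le.1 hs⟩, by simp⟩
  have hfK : ∀ z, z ∉ K → fderiv ℝ f z v = 0 := by
    intro z hz
    by_contra hne
    refine hz ⟨(z, 0), ⟨?_, ?_⟩, by simp⟩
    · by_contra hzs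
      exact hne (by rw [fderiv_of_notMem_tsupport ℝ hzs]; rfl)
    · exact ⟨by simpa using hR0, hR0⟩
  have hder : ∀ z s, HasDerivAt (fun s : ℝ => f (z + s • v)) (fderiv ℝ f (z + s • v) v) s := by
    intro z s
    have h1 := (testFun_differentiable hf (z + s • v)).hasFDerivAt
    have h2 : HasDerivAt (fun s : ℝ => z + s • v) v s := by
      simpa using ((hasDerivAt_id s).smul_const v).const_add z
    exact h1.comp_hasDerivAt s h2
  have hmv : ∀ z s, |f (z + s • v) - f (z + -(s • v))| ≤ B * |2 * s| := by
    intro z s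
    have := Convex.norm_image_sub_le_of_norm_hasDerivWithin_le (f := fun s : ℝ => f (z + s • v))
      (f' := fun s => fderiv ℝ f (z + s • v) v) (s := univ) (x := -s) (y := s) (C := B)
      (fun x _ => (hder z x).hasDerivWithinAt) (fun x _ => hB _) convex_univ (mem_univ _)
      (mem_univ _)
    simpa [← two_mul] using this
  have key := tendsto_eLpNorm_sub_of_dominated (μ := μ) (l := atTop) (p := p) hpq.pos
    (F := fun k => (r k)⁻¹ • diffOp (r k • v) f) (f := 𝐃[f,v])
    (g := K.indicator fun _ => 2 * B)
    (fun k => (testFun_memLp (diffOp_testFun hf _) 1).1.const_smul _)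
    (testFun_memLp hf' 1).1
    ((memLp_indicator_const _ hKc.measurableSet _ (Or.inr hKc.measure_lt_top.ne))) ?_ ?_
  · have := (ENNReal.continuousAt_toReal ENNReal.zero_ne_top).tendsto.comp key
    simpa [Function.comp_def] using this
  · refine fun k => .of_forall fun z => ?_
    have hk : 0 < |r k| := abs_pos.2 (hr0 k)
    by_cases hz : z ∈ K
    · rw [indicator_of_mem hz]
      refine (norm_sub_le _ _).trans ?_
      have h1 : ‖((r k)⁻¹ • diffOp (r k • v) f) z‖ ≤ B := by
        simp only [Pi.smul_apply, smul_eq_mul, diffOp_apply, norm_mul, norm_inv, Real.norm_eq_abs]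
        rw [inv_mul_le_iff₀ hk, abs_div, abs_two]
        have := hmv z (r k)
        rw [abs_mul, abs_two] at this
        linarith
      linarith [hB z]
    · rw [indicator_of_notMem hz, hfK z hz]
      simp only [Pi.smul_apply, diffOp_apply]
      rw [hKout z hz _ (hrR k), ← neg_smul, hKout z hz _ (by rw [abs_neg]; exact hrR k)]
      simp
  · refine .of_forall fun z => ?_
    have h1 := (hder z 0).tendsto_slope_zero
    simp only [zero_add, zero_smul, add_zero, smul_eq_mul] at h1
    have hrn : Tendsto r atTop (𝓝[≠] 0) := tendsto_nhdsWithin_iff.2 ⟨hr, Eventually.of_forall hr0⟩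
    have hrn' : Tendsto (fun k => - r k) atTop (𝓝[≠] 0) :=
      tendsto_nhdsWithin_iff.2 ⟨by simpa using hr.neg, .of_forall fun k => neg_ne_zero.2 (hr0 k)⟩
    have h2 := ((h1.comp hrn).add (h1.comp hrn')).const_mul (1 / 2)
    refine (h2.congr fun k => ?_).trans (by rw [← two_mul]; simp)
    simp only [Function.comp_apply, Pi.smul_apply, diffOp_apply, smul_eq_mul, neg_smul, inv_neg]
    ring

/-- Second order difference quotients of a test function converge in `Lᵖ`. -/
theorem tendsto_diffQuot_sq (hpq : p.HolderConjugate q) {f : V → ℝ} (hf : f ∈ testFun univ)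
    (v : V) {r : ℕ → ℝ} {R : ℝ} (hr0 : ∀ k, r k ≠ 0) (hrR : ∀ k, |r k| ≤ R)
    (hr : Tendsto r atTop (𝓝 0)) :
    Tendsto (fun k => (eLpNorm ((r k ^ 2)⁻¹ • diffOp (r k • v) (diffOp (r k • v) f) -
      𝐃[𝐃[f,v],v]) (ofReal p) μ).toReal)
      atTop (𝓝 0) := by
  have h1p : (1 : ℝ≥0∞) ≤ ofReal p := ENNReal.one_le_ofReal.2 hpq.lt.le
  have hf' := testFun_fderiv hf v
  have lim := tendsto_diffQuot (μ := μ) hpq hf' v hr0 hrR hr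
  have lim2 := lim.add lim
  rw [add_zero] at lim2
  refine squeeze_zero (fun _ => ENNReal.toReal_nonneg) (fun k => ?_) lim2
  -- ψ is the error of the first order quotient. The second order error is r⁻¹Dψ plus the first
  -- order error of ∂_v f; the former is at most ‖∂_v ψ‖, and ∂_v ψ is that same first order error.
  -- Hence two copies of a null sequence dominate.
  set ψ : V → ℝ := (r k)⁻¹ • diffOp (r k • v) f - fun z => fderiv ℝ f z v with hψ
  have hψt : ψ ∈ testFun univ := (testFun univ).sub_mem
    ((testFun univ).smul_mem _ (diffOp_testFun hf _)) hf'
  have e : ((r k ^ 2)⁻¹ • diffOp (r k • v) (diffOp (r k • v) f) - 𝐃[𝐃[f,v],v]) =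
      (r k)⁻¹ • diffOp (r k • v) ψ + ((r k)⁻¹ • diffOp (r k • v) 𝐃[f,v] - 𝐃[𝐃[f,v],v]) := by
    rw [hψ, map_sub, map_smul, smul_sub, smul_smul]
    rw [pow_two, mul_inv]
    abel
  have hd : 𝐃[ψ,v] = (r k)⁻¹ • diffOp (r k • v) 𝐃[f,v] - 𝐃[𝐃[f,v],v] := by
    ext z
    have d1 := testFun_differentiable (diffOp_testFun hf (r k • v)) z
    have d2 := testFun_differentiable hf' z
    have := (d1.hasFDerivAt.const_smul (r k)⁻¹).sub d2.hasFDerivAt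
    rw [hψ, this.fderiv]
    have h3 := congrFun (transAlg_fderiv (diffOp_mem (r k • v)) hf v) z
    simp only [_root_.sub_apply, _root_.smul_apply, Pi.sub_apply, Pi.smul_apply]
    rw [← h3]
  have m1 : MemLp ((r k)⁻¹ • diffOp (r k • v) ψ) (ofReal p) μ :=
    (testFun_memLp (diffOp_testFun hψt _) _).const_smul _
  have m2 : MemLp 𝐃[ψ,v] (ofReal p) μ := testFun_memLp (testFun_fderiv hψt v) _
  rw [e, ← hd]
  refine (toReal_eLpNorm_add_le h1p m1 m2).trans (add_le_add ?_ le_rfl)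
  rw [toReal_eLpNorm_smul, abs_inv, inv_mul_le_iff₀ (abs_pos.2 (hr0 k))]
  exact toReal_eLpNorm_diffOp_le hpq hψt _ _

end DifferenceQuotients

/-! ### Telescoping the random walk at a fixed scale. -/

section SecondOrder

variable {V : Type*} [NormedAddCommGroup V] [NormedSpace ℝ V] [FiniteDimensional ℝ V]
  [MeasurableSpace V] [BorelSpace V] {μ : Measure V} [μ.IsAddHaarMeasure] {p q : ℝ}

/-- The fundamental theorem of calculus in s ↦ ∫ ψ(z + sv) w(z) dz over [-r, r]: a discrete
difference is controlled by derivatives of all translates of ψ. -/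
theorem abs_integral_diffOp_mul_le {w : V → ℝ} (hw : LocallyIntegrable w μ) {ψ : V → ℝ}
    (hψ : ψ ∈ testFun univ) {B : ℝ} (v : V)
    (hB : ∀ y, |∫ z, fderiv ℝ ψ (z + y) v * w z ∂μ| ≤ B) (r : ℝ) :
    |∫ z, diffOp (r • v) ψ z * w z ∂μ| ≤ |r| * B := by
  have h := Convex.norm_image_sub_le_of_norm_hasDerivWithin_le
    (f := fun s : ℝ => ∫ z, ψ (z + s • v) * w z ∂μ)
    (f' := fun s => ∫ z, fderiv ℝ ψ (z + s • v) v * w z ∂μ) (s := univ) (x := -r) (y := r) (C := B)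
    (fun x _ => (hasDerivAt_integral_translate hw hψ v x).hasDerivWithinAt) (fun x _ => hB _)
    convex_univ (mem_univ _) (mem_univ _)
  have i : ∀ s : ℝ, Integrable (fun z => ψ (z + s • v) * w z) μ := fun s => by
    have h0 := transAlg_testFun (shiftOp_mem (s • v)) _ hψ
    exact testFun_integrable_mul (hw.locallyIntegrableOn _) h0
  have e : ∫ z, diffOp (r • v) ψ z * w z ∂μ =
      1 / 2 * (∫ z, ψ (z + r • v) * w z ∂μ - ∫ z, ψ (z + (-r) • v) * w z ∂μ) := by
    rw [← integral_sub (i r) (i (-r)), ← integral_const_mul]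
    refine integral_congr_ae (.of_forall fun z => ?_)
    simp only [diffOp_apply, neg_smul]
    ring
  rw [e, abs_mul, abs_of_pos (by norm_num : (0 : ℝ) < 1 / 2)]
  simp only [sub_neg_eq_add, ← two_mul, Real.norm_eq_abs, abs_mul, abs_two] at h
  linarith

variable {ι : Type*} [Fintype ι] [Nonempty ι]

/-- The geometric sum of P² is `evenSum`, and 1 - P² = (1 - P)(1 + P); the first factor is then
rewritten as squared differences. -/
theorem one_sub_walkOp_pow (d : ι → V) (K : ℕ) : 1 - walkOp d ^ (2 * K) = -((Fintype.card ι : ℝ)⁻¹ •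
      ∑ i, diffOp (d i) * (diffOp (d i) * ((1 + walkOp d) * evenSum d K))) := by
  have h1 : evenSum d K = ∑ k ∈ Finset.range K, (walkOp d ^ 2) ^ k :=
    Finset.sum_congr rfl fun k _ => by rw [← pow_add, ← pow_mul, two_mul]
  have h2 : 1 - walkOp d ^ (2 * K) = (1 - walkOp d) * ((1 + walkOp d) * evenSum d K) := by
    rw [pow_mul, ← mul_neg_geom_sum, h1, ← mul_assoc]
    congr 1
    rw [mul_add, sub_mul, sub_mul]
    simp only [one_mul, mul_one, pow_two]
    abel
  rw [h2, one_sub_walkOp]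
  ext f z
  simp only [Module.End.mul_apply, LinearMap.neg_apply, LinearMap.smul_apply, LinearMap.sum_apply,
    pow_two]

/-- Decay of the differences along the random walk in `L²`. -/
theorem exists_walkOp_decay : ∃ C : ℝ, 0 ≤ C ∧
    ∀ (d : ι → V) (K : ℕ) (i : ι) (f : V → ℝ), MemLp f (ofReal 2) μ →
      K * (eLpNorm (diffOp (d i) ((walkOp d ^ K) f)) (ofReal 2) μ).toReal ^ 2 ≤
        C * 𝐍[f,2,μ] ^ 2 := by
  have hpq : Real.HolderConjugate 2 2 := by rw [Real.holderConjugate_iff]; norm_num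
  have h12 : (1 : ℝ≥0∞) ≤ ofReal 2 := ENNReal.one_le_ofReal.2 (by norm_num)
  obtain ⟨C, hC, hb⟩ := exists_bound_diffOp_sq_evenSum (V := V) (μ := μ) (ι := ι) hpq
  refine ⟨C, hC, fun d K i f hf => ?_⟩
  have hE := diffOp_mem (d i)
  have hP : ∀ k, walkOp d ^ k ∈ transAlg V := fun k => Subalgebra.pow_mem _ (walkOp_mem d) _
  have hsq : ∀ {g : V → ℝ}, MemLp g (ofReal 2) μ → 𝐍[g,2,μ] ^ 2 = ∫ z, g z * g z ∂μ := by
    intro g hg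
    have := eLpNorm_toReal_rpow (μ := μ) (p := 2) (by norm_num) hg
    rw [Real.rpow_two] at this
    rw [this]
    refine integral_congr_ae (.of_forall fun z => ?_)
    simp only [Real.rpow_two, sq_abs]
    ring
  have h1 := integral_diffOp_sq_evenSum (μ := μ) hpq d K i hf hf
  have h2 := abs_integral_mul_le hpq (transAlg_memLp hE (transAlg_memLp hE
    (transAlg_memLp (evenSum_mem d K) hf))) hf
  -- P is an L² contraction commuting with D, so ‖D Pᵏ f‖₂ decreases in k and K times the last term
  -- is at most the sum. The sum is a pairing of -D² `evenSum` f with f, bounded uniformly in K.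
  have h3 : ∀ k ∈ Finset.range K,
      (eLpNorm (diffOp (d i) ((walkOp d ^ K) f)) (ofReal 2) μ).toReal ^ 2 ≤
      ∫ z, diffOp (d i) ((walkOp d ^ k) f) z * diffOp (d i) ((walkOp d ^ k) f) z ∂μ := by
    intro k hk
    have hk' : K = (K - k) + k := by have := Finset.mem_range.1 hk; omega
    have hm := transAlg_memLp hE (transAlg_memLp (hP k) hf)
    rw [← hsq hm]
    have h5 := ((isLpBounded_walkOp (μ := μ) d).pow (K - k)).2.2 _ _ h12 hm
    rw [one_mul, transAlg_comm_apply (hP _) hE, ← Module.End.mul_apply (walkOp d ^ (K - k)),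
      ← pow_add, ← hk'] at h5
    exact pow_le_pow_left₀ ENNReal.toReal_nonneg h5 2
  have h4 := Finset.sum_le_sum h3
  rw [Finset.sum_const, Finset.card_range, nsmul_eq_mul] at h4
  rw [h1, abs_neg] at h2
  have h6 := le_abs_self (∑ k ∈ Finset.range K,
        ∫ z, diffOp (d i) ((walkOp d ^ k) f) z * diffOp (d i) ((walkOp d ^ k) f) z ∂μ)
  have h7 := mul_le_mul_of_nonneg_right (hb d K i f hf)
    (ENNReal.toReal_nonneg (a := eLpNorm f (ofReal 2) μ))
  calc _ ≤ _ := h4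
    _ ≤ _ := h6
    _ ≤ _ := h2
    _ ≤ _ := h7
    _ = _ := by ring

/-- A long translation is a telescoping sum of N short ones, each of the same norm. -/
theorem toReal_eLpNorm_shift_nsmul_sub_le {p : ℝ≥0∞} (hp : 1 ≤ p) {f : V → ℝ} (hf : MemLp f p μ)
    (y : V) (N : ℕ) :
    (eLpNorm (shiftOp (N • y) f - f) p μ).toReal ≤ N * (eLpNorm (shiftOp y f - f) p μ).toReal := by
  induction N with
  | zero => simp [shiftOp_zero]
  | succ N ih =>
    have hy := transAlg_memLp (shiftOp_mem y) hf
    have hNy := transAlg_memLp (shiftOp_mem (N • y)) hf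
    have e : shiftOp ((N + 1) • y) f - f =
        shiftOp (N • y) (shiftOp y f - f) + (shiftOp (N • y) f - f) := by
      rw [map_sub, ← Module.End.mul_apply (shiftOp (N • y)), shiftOp_mul, ← succ_nsmul]
      abel
    rw [e]
    refine (toReal_eLpNorm_add_le hp (transAlg_memLp (shiftOp_mem _) (hy.sub hf))
      (hNy.sub hf)).trans ?_
    have h1 := (IsLpBounded.shiftOp (μ := μ) (N • y)).2.2 p _ hp (hy.sub hf)
    push_cast
    linarith

theorem shiftOp_two_nsmul_sub (d : V) (f : V → ℝ) :
    shiftOp ((2 : ℕ) • d) f - f = (2 : ℝ) • shiftOp d (diffOp d f) := by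
  ext z
  simp only [Pi.sub_apply, shiftOp_apply, Pi.smul_apply, diffOp_apply, smul_eq_mul]
  rw [show z + d + -d = z by abel, show z + d + d = z + (2 : ℕ) • d by rw [two_nsmul]; abel]
  ring

variable {κ : Type*} [Fintype κ]

/-- One step of the estimate, at a fixed scale of the random walk. -/
theorem exists_abs_integral_sub_walkOp_le (hpq : p.HolderConjugate q) : ∃ C : ℝ, 0 ≤ C ∧
    ∀ (v : ι → V) (e : κ → V) (c : ι → κ → ι → ℝ) (w : V → ℝ) (M : ℝ), LocallyIntegrable w μ →
      0 ≤ M →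
      (∀ i, ∀ ψ ∈ testFun univ, |∫ z, fderiv ℝ ψ z (v i) * w z ∂μ| ≤ M * ∑ l, 𝐍[𝐃[ψ,e l],p,μ]) →
      ∀ f ∈ testFun univ, ∀ (r : ℝ) (K : ℕ), 0 ≤ r →
        |∫ z, (f - (walkOp (fun i => r • v i) ^ (2 * K)) f) z * w z ∂μ| ≤
          M * ∑ i, ∑ l, ((∑ j, |c i l j|) * (C * 𝐍[f,p,μ]) +
            2 * K * (eLpNorm (r • diffOp (r • v i) 𝐃[f,e l] -
              ∑ j, c i l j • diffOp (r • v j) (diffOp (r • v j) f)) (ofReal p) μ).toReal) := by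
  obtain ⟨C, hC, hb⟩ := exists_bound_diffOp_sq_evenSum (V := V) (μ := μ) (ι := ι) hpq
  refine ⟨2 * C, by positivity, fun v e c w M hw hM hH f hf r K hr => ?_⟩
  have h1p : (1 : ℝ≥0∞) ≤ ofReal p := ENNReal.one_le_ofReal.2 hpq.lt.le
  set d : ι → V := fun i => r • v i with hd
  have hfL := testFun_memLp (μ := μ) hf (ofReal p)
  have hP := isLpBounded_walkOp (μ := μ) d
  have h1P := (IsLpBounded.one (μ := μ)).add hP
  have hES := evenSum_mem d K
  -- S alone is bounded only by 2K, but Dⱼ² S is bounded by 2C uniformly in the scale and in K. Both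
  -- bounds are used: the second for the main term and the first for the discretisation error.
  set S := (1 + walkOp d) * evenSum d K with hS
  have hSm : S ∈ transAlg V := Subalgebra.mul_mem _ h1P.1 hES
  have hSb : IsLpBounded μ (2 * K) S := by
    have h3 : IsLpBounded μ (∑ _k ∈ Finset.range K, (1 * 1 : ℝ)) (evenSum d K) :=
      IsLpBounded.sum _ fun k => (hP.pow k).mul (hP.pow k)
    have h4 := h1P.mul h3
    norm_num at h4
    exact h4
  have e1 : f - (walkOp d ^ (2 * K)) f =
      -((Fintype.card ι : ℝ)⁻¹ • ∑ i, diffOp (d i) (diffOp (d i) (S f))) := by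
    have := congrArg (fun A : Module.End ℝ (V → ℝ) => A f) (one_sub_walkOp_pow d K)
    rw [← hS] at this
    simpa only [LinearMap.sum_apply, Module.End.mul_apply, LinearMap.neg_apply,
      LinearMap.smul_apply, LinearMap.sub_apply, Module.End.one_apply] using this
  have hψ : ∀ i, diffOp (d i) (S f) ∈ testFun univ := fun i =>
    diffOp_testFun (transAlg_testFun hSm _ hf) _
  -- the estimate for a single difference
  have h2 : ∀ i, |∫ z, diffOp (d i) (diffOp (d i) (S f)) z * w z ∂μ| ≤
      |r| * (M * ∑ l, 𝐍[diffOp (d i) (S 𝐃[f,e l]),p,μ]) := by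
    intro i
    refine abs_integral_diffOp_mul_le hw (hψ i) (v i) (fun y => ?_) r
    have hy := transAlg_testFun (shiftOp_mem y) _ (hψ i)
    have h5 := hH i _ hy
    have h6 : ∀ u : V, (fun z => fderiv ℝ (shiftOp y (diffOp (d i) (S f))) z u) =
        shiftOp y (diffOp (d i) (S 𝐃[f,u])) := by
      intro u
      rw [transAlg_fderiv (shiftOp_mem y) (hψ i), transAlg_fderiv (diffOp_mem _)
        (transAlg_testFun hSm _ hf), transAlg_fderiv hSm hf]
    have h7 : ∀ z, fderiv ℝ (shiftOp y (diffOp (d i) (S f))) z (v i) =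
        fderiv ℝ (diffOp (d i) (S f)) (z + y) (v i) := by
      intro z
      have := congrFun (transAlg_fderiv (shiftOp_mem y) (hψ i) (v i)) z
      simpa using this
    simp only [h7] at h5
    refine h5.trans (mul_le_mul_of_nonneg_left (Finset.sum_le_sum fun l _ => ?_) hM)
    rw [h6]
    have hm := transAlg_memLp (diffOp_mem (d i)) (transAlg_memLp hSm
      (testFun_memLp (μ := μ) (testFun_fderiv hf (e l)) (ofReal p)))
    exact ((IsLpBounded.shiftOp (μ := μ) y).2.2 _ _ h1p hm).trans (by rw [one_mul])
  -- The mixed quantity r Dᵢ ∂_l f is replaced by the combination of pure squares ∑ⱼ c Dⱼ² f, which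
  -- S renders uniformly bounded. The difference of the two is the error term in the conclusion.
  have h3 : ∀ i l, r * 𝐍[diffOp (d i) (S 𝐃[f,e l]),p,μ] ≤ (∑ j, |c i l j|) * (2 * C * 𝐍[f,p,μ]) +
        2 * K * (eLpNorm (r • diffOp (d i) 𝐃[f,e l] -
          ∑ j, c i l j • diffOp (d j) (diffOp (d j) f)) (ofReal p) μ).toReal := by
    intro i l
    have hfl := testFun_memLp (μ := μ) (testFun_fderiv hf (e l)) (ofReal p)
    have hDD : ∀ j, MemLp (diffOp (d j) (diffOp (d j) f)) (ofReal p) μ := fun j =>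
      transAlg_memLp (diffOp_mem _) (transAlg_memLp (diffOp_mem _) hfL)
    have hsum : MemLp (∑ j, c i l j • diffOp (d j) (diffOp (d j) f)) (ofReal p) μ :=
      memLp_finsetSum' _ fun j _ => (hDD j).const_smul _
    have herr := ((transAlg_memLp (diffOp_mem (d i)) hfl).const_smul r).sub hsum
    have e2 : r • diffOp (d i) (S 𝐃[f,e l]) = ∑ j, c i l j • S (diffOp (d j) (diffOp (d j) f)) +
        S (r • diffOp (d i) 𝐃[f,e l] - ∑ j, c i l j • diffOp (d j) (diffOp (d j) f)) := by
      rw [map_sub, map_smul, map_sum, transAlg_comm_apply (diffOp_mem _) hSm]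
      simp only [map_smul]
      abel
    rw [show r = |r| from (abs_of_nonneg hr).symm, ← toReal_eLpNorm_smul, e2, abs_of_nonneg hr]
    refine (toReal_eLpNorm_add_le h1p (memLp_finsetSum' _ fun j _ =>
      (transAlg_memLp hSm (hDD j)).const_smul _) (transAlg_memLp hSm herr)).trans
        (add_le_add ?_ (hSb.2.2 _ _ h1p herr))
    refine (toReal_eLpNorm_sum_le h1p _ fun j => (transAlg_memLp hSm (hDD j)).const_smul _).trans ?_
    rw [Finset.sum_mul]
    refine Finset.sum_le_sum fun j _ => ?_
    rw [toReal_eLpNorm_smul]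
    refine mul_le_mul_of_nonneg_left ?_ (abs_nonneg _)
    have e3 : S (diffOp (d j) (diffOp (d j) f)) =
        (1 + walkOp d) (diffOp (d j) (diffOp (d j) (evenSum d K f))) := by
      rw [← transAlg_comm_apply (diffOp_mem _) hSm, ← transAlg_comm_apply (diffOp_mem _) hSm, hS,
        Module.End.mul_apply, transAlg_comm_apply (diffOp_mem _) h1P.1,
        transAlg_comm_apply (diffOp_mem _) h1P.1]
    rw [e3]
    refine (h1P.2.2 _ _ h1p (transAlg_memLp (diffOp_mem _) (transAlg_memLp (diffOp_mem _)
      (transAlg_memLp hES hfL)))).trans ?_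
    have := hb d K j f hfL
    linarith
  rw [e1]
  have i2 : ∀ i, Integrable (fun z => diffOp (d i) (diffOp (d i) (S f)) z * w z) μ := fun i =>
    testFun_integrable_mul (hw.locallyIntegrableOn _) (diffOp_testFun (hψ i) _)
  have e4 : ∫ z, (-((Fintype.card ι : ℝ)⁻¹ • ∑ i, diffOp (d i) (diffOp (d i) (S f)))) z * w z ∂μ =
      -((Fintype.card ι : ℝ)⁻¹ * ∑ i, ∫ z, diffOp (d i) (diffOp (d i) (S f)) z * w z ∂μ) := by
    rw [← integral_finsetSum _ fun i _ => i2 i, ← integral_const_mul, ← integral_neg]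
    refine integral_congr_ae (.of_forall fun z => ?_)
    simp only [Pi.neg_apply, Pi.smul_apply, Finset.sum_apply, smul_eq_mul, ← Finset.sum_mul]
    ring
  rw [e4, abs_neg, abs_mul]
  have hcard : |(Fintype.card ι : ℝ)⁻¹| ≤ 1 := by
    rw [abs_of_nonneg (by positivity)]
    exact inv_le_one_of_one_le₀ (by exact_mod_cast Fintype.card_pos)
  calc |(Fintype.card ι : ℝ)⁻¹| * |∑ i, ∫ z, diffOp (d i) (diffOp (d i) (S f)) z * w z ∂μ|
      ≤ 1 * |∑ i, ∫ z, diffOp (d i) (diffOp (d i) (S f)) z * w z ∂μ| :=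
        mul_le_mul_of_nonneg_right hcard (abs_nonneg _)
    _ ≤ ∑ i, |∫ z, diffOp (d i) (diffOp (d i) (S f)) z * w z ∂μ| := by
        rw [one_mul]; exact Finset.abs_sum_le_sum_abs _ _
    _ ≤ ∑ i, M * ∑ l, r * 𝐍[diffOp (d i) (S 𝐃[f,e l]),p,μ] := by
        refine Finset.sum_le_sum fun i _ => (h2 i).trans (le_of_eq ?_)
        rw [abs_of_nonneg hr, ← Finset.mul_sum]
        ring
    _ ≤ _ := by
        rw [Finset.mul_sum]
        exact Finset.sum_le_sum fun i _ => mul_le_mul_of_nonneg_left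
          (Finset.sum_le_sum fun l _ => h3 i l) hM

end SecondOrder

/-! ### Passage to the limit under diffusive scaling. -/

section NegativeOrder

variable {V : Type*} [NormedAddCommGroup V] [NormedSpace ℝ V] [FiniteDimensional ℝ V]
  [MeasurableSpace V] [BorelSpace V] {μ : Measure V} [μ.IsAddHaarMeasure] {p q : ℝ}
  {ι : Type*} [Fintype ι] [Nonempty ι] {κ : Type*} [Fintype κ]

/-- Consistency of the discretisation: the error is o(r²), because ∂_v ∂_l f is by assumption the
same combination of pure second derivatives, and both sides are approximated by their difference
quotients. -/
theorem tendsto_second_order_error (hpq : p.HolderConjugate q) (v : ι → V) (e : κ → V)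
    (c : ι → κ → ι → ℝ) {f : V → ℝ} (hf : f ∈ testFun univ) (hc : ∀ i l, 𝐃[𝐃[f,e l],v i] =
      ∑ j, c i l j • 𝐃[𝐃[f,v j],v j])
    {r : ℕ → ℝ} {R : ℝ} (hr0 : ∀ k, r k ≠ 0) (hrR : ∀ k, |r k| ≤ R)
    (hr : Tendsto r atTop (𝓝 0)) (i : ι) (l : κ) : Tendsto (fun k => (r k ^ 2)⁻¹ *
      (eLpNorm (r k • diffOp (r k • v i) 𝐃[f,e l] -
        ∑ j, c i l j • diffOp (r k • v j) (diffOp (r k • v j) f))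
          (ofReal p) μ).toReal) atTop (𝓝 0) := by
  have h1p : (1 : ℝ≥0∞) ≤ ofReal p := ENNReal.one_le_ofReal.2 hpq.lt.le
  have l1 := tendsto_diffQuot (μ := μ) hpq (testFun_fderiv hf (e l)) (v i) hr0 hrR hr
  have l2 := tendsto_finsetSum (Finset.univ : Finset ι) fun j _ =>
    (tendsto_diffQuot_sq (μ := μ) hpq hf (v j) hr0 hrR hr).const_mul |c i l j|
  have l3 := l1.add l2
  simp only [mul_zero, Finset.sum_const_zero, add_zero] at l3
  refine squeeze_zero (fun k => by positivity) (fun k => ?_) l3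
  have hfl := testFun_fderiv hf (e l)
  have m1 : MemLp ((r k)⁻¹ • diffOp (r k • v i) 𝐃[f,e l] - 𝐃[𝐃[f,e l],v i]) (ofReal p) μ :=
    ((testFun_memLp (diffOp_testFun hfl _) _).const_smul _).sub
      (testFun_memLp (testFun_fderiv hfl _) _)
  have m2 : ∀ j, MemLp ((r k ^ 2)⁻¹ • diffOp (r k • v j) (diffOp (r k • v j) f) -
      𝐃[𝐃[f,v j],v j]) (ofReal p) μ := fun j =>
    ((testFun_memLp (diffOp_testFun (diffOp_testFun hf _) _) _).const_smul _).sub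
      (testFun_memLp (testFun_fderiv (testFun_fderiv hf _) _) _)
  have e1 : (r k ^ 2)⁻¹ • (r k • diffOp (r k • v i) 𝐃[f,e l] -
        ∑ j, c i l j • diffOp (r k • v j) (diffOp (r k • v j) f)) =
      ((r k)⁻¹ • diffOp (r k • v i) 𝐃[f,e l] - 𝐃[𝐃[f,e l],v i]) +
      ∑ j, (-c i l j) • ((r k ^ 2)⁻¹ • diffOp (r k • v j) (diffOp (r k • v j) f) -
        𝐃[𝐃[f,v j],v j]) := by
    rw [hc i l]
    have e2 : (r k ^ 2)⁻¹ • r k • diffOp (r k • v i) 𝐃[f,e l] =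
        (r k)⁻¹ • diffOp (r k • v i) 𝐃[f,e l] := by
      rw [smul_smul]; congr 1; field_simp [hr0 k]
    have e4 : ∑ j, (-c i l j) • ((r k ^ 2)⁻¹ • diffOp (r k • v j) (diffOp (r k • v j) f) -
        𝐃[𝐃[f,v j],v j]) =
        (∑ j, c i l j • 𝐃[𝐃[f,v j],v j]) -
        (r k ^ 2)⁻¹ • ∑ j, c i l j • diffOp (r k • v j) (diffOp (r k • v j) f) := by
      rw [Finset.smul_sum, ← Finset.sum_sub_distrib]
      exact Finset.sum_congr rfl fun j _ => by module
    rw [smul_sub, e2, e4]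
    abel
  have e3 : |(r k ^ 2)⁻¹| = (r k ^ 2)⁻¹ := abs_of_nonneg (by positivity)
  have e5 := toReal_eLpNorm_smul (m := μ) (p := ofReal p) (r k ^ 2)⁻¹
    (r k • diffOp (r k • v i) 𝐃[f,e l] - ∑ j, c i l j • diffOp (r k • v j) (diffOp (r k • v j) f))
  rw [e3] at e5
  rw [← e5, e1]
  refine (toReal_eLpNorm_add_le h1p m1 (memLp_finsetSum' _ fun j _ => (m2 j).const_smul _)).trans
    (add_le_add le_rfl ((toReal_eLpNorm_sum_le h1p _ fun j => (m2 j).const_smul _).trans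
      (Finset.sum_le_sum fun j _ => ?_)))
  rw [toReal_eLpNorm_smul, abs_neg]

/-- If a square integrable function `w` is bounded by `M` as a functional of the form `div w` on the
first order Sobolev space `Ẇ^{1,p}`, then it is bounded by a multiple of `M` on `Lᵖ`. -/
theorem exists_abs_integral_mul_le_of_fderiv (hpq : p.HolderConjugate q) (v : ι → V) (e : κ → V)
    (c : ι → κ → ι → ℝ) (hc : ∀ f ∈ 𝓣[V], ∀ i l, 𝐃[𝐃[f,e l],v i] = ∑ j, c i l j • 𝐃[𝐃[f,v j],v j])
    (i₀ : ι) (hv : v i₀ ≠ 0) : ∃ C : ℝ, 0 ≤ C ∧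
    ∀ (w : V → ℝ) (M : ℝ), MemLp w (ofReal 2) μ → 0 ≤ M →
      (∀ i, ∀ ψ ∈ testFun univ, |∫ z, fderiv ℝ ψ z (v i) * w z ∂μ| ≤ M * ∑ l, 𝐍[𝐃[ψ,e l],p,μ]) →
      ∀ g ∈ testFun univ, |∫ z, g z * w z ∂μ| ≤ C * M * 𝐍[g,p,μ] := by
  obtain ⟨C, hC, hmain⟩ := exists_abs_integral_sub_walkOp_le (V := V) (μ := μ) (ι := ι) (κ := κ) hpq
  obtain ⟨C₂, hC₂, hdecay⟩ := exists_walkOp_decay (V := V) (μ := μ) (ι := ι)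
  have h1p : (1 : ℝ≥0∞) ≤ ofReal p := ENNReal.one_le_ofReal.2 hpq.lt.le
  have h22 : Real.HolderConjugate 2 2 := by rw [Real.holderConjugate_iff]; norm_num
  have h12 : (1 : ℝ≥0∞) ≤ ofReal 2 := ENNReal.one_le_ofReal.2 (by norm_num)
  set D : ℝ := ∑ i, ∑ l, (∑ j, |c i l j|) * C with hD
  have hD0 : 0 ≤ D := Finset.sum_nonneg fun i _ => Finset.sum_nonneg fun l _ =>
    mul_nonneg (Finset.sum_nonneg fun j _ => abs_nonneg _) hC
  refine ⟨2 * D, by positivity, fun w M hw2 hM hH g hg => ?_⟩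
  have hw : LocallyIntegrable w μ := hw2.locallyIntegrable h12
  have hint : ∀ {f : V → ℝ}, f ∈ testFun univ → Integrable (fun z => f z * w z) μ := fun hf =>
    testFun_integrable_mul (hw.locallyIntegrableOn _) hf
  set W := 𝐍[w,2,μ] with hW
  set G2 := 𝐍[g,2,μ] with hG2
  set Gp := 𝐍[g,p,μ] with hGp
  have hgL := fun s => testFun_memLp (μ := μ) hg s
  -- differences of translates
  have hdiff : ∀ t : ℝ, 0 < t → |∫ z, (g - shiftOp ((2 * t) • v i₀) g) z * w z ∂μ| ≤
      2 * D * M * Gp := by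
    intro t ht
    set y := (2 * t) • v i₀ with hy
    -- The decay estimate only controls differences of P^{2K}g, so g is first replaced by g minus a
    -- translate. The translation is sent to infinity at the end. The bound ‖f‖_p ≤ 2‖g‖_p accounts
    -- for the 2 in the constant 2D.
    set f := g - shiftOp y g with hf
    have hft : f ∈ testFun univ := (testFun univ).sub_mem hg (transAlg_testFun (shiftOp_mem y) _ hg)
    have hfp : 𝐍[f,p,μ] ≤ 2 * Gp := by
      have h1 := transAlg_memLp (shiftOp_mem y) (hgL (ofReal p))
      have h2 := toReal_eLpNorm_add_le h1p (hgL (ofReal p)) (h1.const_smul (-1 : ℝ))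
      have h3 := (IsLpBounded.shiftOp (μ := μ) y).2.2 _ _ h1p (hgL (ofReal p))
      rw [toReal_eLpNorm_smul, abs_neg, abs_one, one_mul] at h2
      rw [one_mul] at h3
      rw [hf, sub_eq_add_neg, ← neg_one_smul ℝ (shiftOp y g)]
      linarith
    have hT : ∀ T : ℕ, 0 < T → |∫ z, f z * w z ∂μ| ≤
        2 * D * M * Gp + Real.sqrt (2 * C₂ * G2 ^ 2 * W ^ 2 / T) := by
      intro T hT
      -- Diffusive scaling: the step is r = t/(N+1), with K = T(N+1)² steps, so K r² = T t² stays
      -- fixed while r → 0. The accumulated error K · o(r²) then vanishes for each fixed T.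
      set r : ℕ → ℝ := fun N => t / (N + 1) with hr
      have hN : ∀ N : ℕ, (0 : ℝ) < N + 1 := fun N => by positivity
      have hr0 : ∀ N, 0 < r N := fun N => div_pos ht (hN N)
      have hrt : ∀ N, |r N| ≤ t := fun N => by
        rw [abs_of_pos (hr0 N)]
        exact div_le_self ht.le (by linarith [(Nat.cast_nonneg N : (0 : ℝ) ≤ N)])
      have hrlim : Tendsto r atTop (𝓝 0) :=
        (tendsto_const_div_atTop_nhds_zero_nat t).comp (tendsto_add_atTop_nat 1) |>.congr
          fun N => by simp [hr]
      have herr := fun i l => tendsto_second_order_error (μ := μ) hpq v e c hft (hc f hft)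
        (fun k => (hr0 k).ne') hrt hrlim i l
      set err : ι → κ → ℕ → ℝ := fun i l k => (eLpNorm (r k • diffOp (r k • v i) 𝐃[f,e l] -
          ∑ j, c i l j • diffOp (r k • v j) (diffOp (r k • v j) f)) (ofReal p) μ).toReal
      have hlim : Tendsto (fun N => 2 * D * M * Gp + Real.sqrt (2 * C₂ * G2 ^ 2 * W ^ 2 / T) +
          M * ∑ i, ∑ l, 2 * T * t ^ 2 * ((r N ^ 2)⁻¹ * err i l N)) atTop
          (𝓝 (2 * D * M * Gp + Real.sqrt (2 * C₂ * G2 ^ 2 * W ^ 2 / T) +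
            M * ∑ _i : ι, ∑ _l : κ, 2 * T * t ^ 2 * 0)) :=
        (((tendsto_finsetSum _ fun i _ => tendsto_finsetSum _ fun l _ =>
          (herr i l).const_mul (2 * T * t ^ 2)).const_mul M).const_add _)
      simp only [mul_zero, Finset.sum_const_zero, add_zero] at hlim
      refine ge_of_tendsto' hlim fun N => ?_
      set K : ℕ := T * (N + 1) ^ 2 with hK
      set d : ι → V := fun i => r N • v i with hd
      have hPm : walkOp d ^ (2 * K) ∈ transAlg V := Subalgebra.pow_mem _ (walkOp_mem d) _
      have hsplit : ∫ z, f z * w z ∂μ = ∫ z, (f - (walkOp d ^ (2 * K)) f) z * w z ∂μ +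
          ∫ z, (walkOp d ^ (2 * K)) f z * w z ∂μ := by
        have hPf := transAlg_testFun hPm _ hft
        rw [← integral_add (hint ((testFun univ).sub_mem hft hPf)) (hint hPf)]
        refine integral_congr_ae (.of_forall fun z => ?_)
        simp only [Pi.sub_apply]; ring
      have hA := hmain v e c w M hw hM hH f hft (r N) K (hr0 N).le
      have hA' : |∫ z, (f - (walkOp d ^ (2 * K)) f) z * w z ∂μ| ≤ 2 * D * M * Gp +
          M * ∑ i, ∑ l, 2 * T * t ^ 2 * ((r N ^ 2)⁻¹ * err i l N) := by
        refine hA.trans ?_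
        have e2 : ∀ i l, (2 : ℝ) * K * err i l N = 2 * T * t ^ 2 * ((r N ^ 2)⁻¹ * err i l N) := by
          intro i l
          have : ((K : ℕ) : ℝ) = T * t ^ 2 * (r N ^ 2)⁻¹ := by
            simp only [hK, hr]
            push_cast
            field_simp
          rw [this]; ring
        have e3 : (M * ∑ i, ∑ l, ((∑ j, |c i l j|) * (C * 𝐍[f,p,μ]) + 2 * K * err i l N)) =
            M * (D * 𝐍[f,p,μ]) + M * ∑ i, ∑ l, 2 * T * t ^ 2 * ((r N ^ 2)⁻¹ * err i l N) := by
          simp only [Finset.sum_add_distrib, e2, hD, Finset.sum_mul, mul_add, mul_assoc]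
        refine e3.le.trans (add_le_add ?_ le_rfl)
        calc M * (D * 𝐍[f,p,μ]) ≤ M * (D * (2 * Gp)) := by gcongr
          _ = _ := by ring
      -- Remainder after 2K steps. The translation y consists of N + 1 steps of length 2dᵢ₀, so
      -- ‖P^{2K}f‖₂ is at most 2(N+1) ‖D P^{2K} g‖₂. The decay rate K^{-1/2} cancels N + 1 and
      -- leaves T^{-1/2}.
      have hB : |∫ z, (walkOp d ^ (2 * K)) f z * w z ∂μ| ≤
          Real.sqrt (2 * C₂ * G2 ^ 2 * W ^ 2 / T) := by
        have hPg := transAlg_memLp hPm (hgL (ofReal 2))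
        have hy2 : y = (N + 1) • ((2 : ℕ) • d i₀) := by
          simp only [hy, hd, hr, ← Nat.cast_smul_eq_nsmul ℝ, smul_smul]
          congr 1
          push_cast
          field_simp
        have h1 := abs_integral_mul_le h22 (transAlg_memLp hPm (testFun_memLp (μ := μ) hft _)) hw2
        have e4 : (walkOp d ^ (2 * K)) f = (-1 : ℝ) •
            (shiftOp y ((walkOp d ^ (2 * K)) g) - (walkOp d ^ (2 * K)) g) := by
          rw [hf, map_sub, transAlg_comm_apply (shiftOp_mem y) hPm]
          module
        have h2 : (eLpNorm ((walkOp d ^ (2 * K)) f) (ofReal 2) μ).toReal ≤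
            (N + 1 : ℕ) * (2 * (eLpNorm (diffOp (d i₀) ((walkOp d ^ (2 * K)) g))
              (ofReal 2) μ).toReal) := by
          rw [e4, toReal_eLpNorm_smul, abs_neg, abs_one, one_mul, hy2]
          refine (toReal_eLpNorm_shift_nsmul_sub_le h12 hPg _ _).trans ?_
          rw [shiftOp_two_nsmul_sub, toReal_eLpNorm_smul, abs_two]
          have := (IsLpBounded.shiftOp (μ := μ) (d i₀)).2.2 _ _ h12
            (transAlg_memLp (diffOp_mem (d i₀)) hPg)
          rw [one_mul] at this
          gcongr
        have h3 := hdecay d (2 * K) i₀ g (hgL _)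
        set X := (eLpNorm (diffOp (d i₀) ((walkOp d ^ (2 * K)) g)) (ofReal 2) μ).toReal
        have hX0 : 0 ≤ X := ENNReal.toReal_nonneg
        have hW0 : 0 ≤ W := ENNReal.toReal_nonneg
        refine Real.le_sqrt_of_sq_le ?_
        have hT' : (0 : ℝ) < T := by exact_mod_cast hT
        rw [le_div_iff₀ hT']
        have h4 : |∫ z, (walkOp d ^ (2 * K)) f z * w z ∂μ| ≤ ((N + 1 : ℕ) * (2 * X)) * W :=
          h1.trans (mul_le_mul_of_nonneg_right h2 hW0)
        have h5 := pow_le_pow_left₀ (abs_nonneg _) h4 2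
        have h6 : ((2 * K : ℕ) : ℝ) = 2 * T * (N + 1) ^ 2 := by simp only [hK]; push_cast; ring
        rw [h6] at h3
        calc _ ≤ (((N + 1 : ℕ) * (2 * X)) * W) ^ 2 * T := mul_le_mul_of_nonneg_right h5 hT'.le
          _ = 2 * W ^ 2 * (2 * T * (N + 1) ^ 2 * X ^ 2) := by push_cast; ring
          _ ≤ 2 * W ^ 2 * (C₂ * G2 ^ 2) := mul_le_mul_of_nonneg_left h3 (by positivity)
          _ = _ := by ring
      rw [hsplit]
      refine (abs_add_le _ _).trans ((add_le_add hA' hB).trans (le_of_eq (by ring)))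
    -- With N already eliminated, letting T → ∞ removes the remainder. The L² norms of g and w enter
    -- only there, so they are absent from the final constant.
    have hlim2 : Tendsto (fun T : ℕ => 2 * D * M * Gp +
        Real.sqrt (2 * C₂ * G2 ^ 2 * W ^ 2 / T)) atTop (𝓝 (2 * D * M * Gp + Real.sqrt 0)) :=
      ((Real.continuous_sqrt.tendsto 0).comp (tendsto_const_div_atTop_nhds_zero_nat _)).const_add _
    rw [Real.sqrt_zero, add_zero] at hlim2
    exact ge_of_tendsto hlim2 ((eventually_gt_atTop 0).mono hT)
  -- the translates move off to infinity
  have hg2 := transAlg_memLp (shiftOp_mem (0 : V)) (hgL (ofReal 2))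
  have hinf := tendsto_integral_mul_translate (μ := μ) h22 hw2 (hgL (ofReal 2))
  have hco : Tendsto (fun k : ℕ => (2 * ((k : ℝ) + 1)) • v i₀) atTop (cocompact V) := by
    rw [← Metric.cobounded_eq_cocompact, ← tendsto_norm_atTop_iff_cobounded]
    simp only [norm_smul]
    refine Tendsto.atTop_mul_const (norm_pos_iff.2 hv) ?_
    have : Tendsto (fun k : ℕ => (k : ℝ)) atTop atTop := tendsto_natCast_atTop_atTop
    refine tendsto_atTop_mono (fun k => ?_) this
    rw [Real.norm_eq_abs]
    have := (Nat.cast_nonneg k : (0 : ℝ) ≤ k)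
    refine le_trans ?_ (le_abs_self _)
    linarith
  have hlim := (hinf.comp hco).const_sub (∫ z, g z * w z ∂μ)
  rw [sub_zero] at hlim
  refine le_of_tendsto' hlim.abs fun k => ?_
  have h := hdiff ((k : ℝ) + 1) (by positivity)
  refine le_trans (le_of_eq (congrArg abs ?_)) h
  have hi : Integrable (fun z => w z * g (z + (2 * ((k : ℝ) + 1)) • v i₀)) μ :=
    (hint (transAlg_testFun (shiftOp_mem ((2 * ((k : ℝ) + 1)) • v i₀)) _ hg)).congr
      (.of_forall fun z => mul_comm _ _)
  rw [Function.comp_apply, ← integral_sub (hint hg) hi]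
  refine integral_congr_ae (.of_forall fun z => ?_)
  simp only [Pi.sub_apply, shiftOp_apply]
  ring

end NegativeOrder

/-! ### From ∇w in Ẇ^{-1,p'} to w in L^{p'} on ℝⁿ. -/

section BoundaryNegativeOrder

variable {n : ℕ} {p q : ℝ}

theorem fderiv_fderiv_apply {V : Type*} [NormedAddCommGroup V] [NormedSpace ℝ V] {f : V → ℝ}
    (hf : f ∈ testFun univ) (z u v : V) : fderiv ℝ 𝐃[f,u] z v = fderiv ℝ (fderiv ℝ f) z v u := by
  have h1 : DifferentiableAt ℝ (fderiv ℝ f) z :=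
    ((hf.1.fderiv_right (m := 1) (WithTop.coe_le_coe.2 le_top)).differentiable (by norm_num)) z
  rw [fderiv_clm_apply h1 (differentiableAt_const u)]
  simp

/-- A square integrable function on `ℝⁿ` whose gradient is bounded on `Ẇ^{1,p}` is in `L^{p'}`. -/
theorem exists_memLp_of_abs_integral_fderiv (hn : 1 ≤ n) (hpq : p.HolderConjugate q) :
    ∃ C : ℝ, 0 ≤ C ∧ ∀ (w : Bdry n → ℝ) (M : ℝ), MemLp w 2 volume → 0 ≤ M →
      (∀ j, ∀ ψ ∈ testFun univ, |∫ z, fderiv ℝ ψ z (bdryDir n j) * w z| ≤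
        M * ∑ l, 𝐍[𝐃[ψ,bdryDir n l],p,volume]) →
      MemLp w (ofReal q) volume ∧ eLpNorm w (ofReal q) volume ≤ ofReal (C * M) := by
  classical
  let j₀ : Fin n := ⟨0, hn⟩
  -- The walk moves along the directions e_a and e_a + e_l. Polarisation then expresses mixed
  -- derivatives by pure ones: ∂_a∂_l = (∂²_{e_a+e_l} - ∂_a² - ∂_l²)/2. The coefficients `c₀` record
  -- this identity, also valid when a = l.
  let ι := Fin n ⊕ (Fin n × Fin n)
  have : Nonempty ι := ⟨Sum.inl j₀⟩
  let v : ι → Bdry n := Sum.elim (bdryDir n) fun a => bdryDir n a.1 + bdryDir n a.2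
  let c₀ : Fin n → Fin n → ι → ℝ := fun a l => (1 / 2 : ℝ) • (Pi.single (Sum.inr (a, l)) 1 -
    Pi.single (Sum.inl a) 1 - Pi.single (Sum.inl l) 1)
  let c : ι → Fin n → ι → ℝ := Sum.elim c₀ fun a l => c₀ a.1 l + c₀ a.2 l
  have hc₀ : ∀ (B : Bdry n →L[ℝ] Bdry n →L[ℝ] ℝ), (∀ x y, B x y = B y x) → ∀ a l,
      ∑ j, c₀ a l j * B (v j) (v j) = B (bdryDir n a) (bdryDir n l) := by
    intro B hB a l
    have hs : ∀ (k : ι) (g : ι → ℝ), ∑ j, (Pi.single k (1 : ℝ) : ι → ℝ) j * g j = g k := by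
      intro k g
      rw [Finset.sum_eq_single k (fun j _ hj => by rw [Pi.single_eq_of_ne hj, zero_mul])
        fun h => absurd (Finset.mem_univ k) h]
      rw [Pi.single_eq_same, one_mul]
    have e : ∑ j, c₀ a l j * B (v j) (v j) =
        1 / 2 * (∑ j, (Pi.single (Sum.inr (a, l)) (1 : ℝ) : ι → ℝ) j * B (v j) (v j) -
          ∑ j, (Pi.single (Sum.inl a) (1 : ℝ) : ι → ℝ) j * B (v j) (v j) -
          ∑ j, (Pi.single (Sum.inl l) (1 : ℝ) : ι → ℝ) j * B (v j) (v j)) := by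
      rw [← Finset.sum_sub_distrib, ← Finset.sum_sub_distrib, Finset.mul_sum]
      refine Finset.sum_congr rfl fun j _ => ?_
      simp only [c₀, Pi.smul_apply, Pi.sub_apply, smul_eq_mul]
      ring
    rw [e, hs, hs, hs]
    simp only [v, Sum.elim_inl, Sum.elim_inr, map_add, _root_.add_apply]
    rw [hB (bdryDir n l) (bdryDir n a)]
    ring
  have hc : ∀ f ∈ 𝓣[Bdry n], ∀ i l, 𝐃[𝐃[f,bdryDir n l],v i] = ∑ j, c i l j • 𝐃[𝐃[f,v j],v j] := by
    intro f hf i l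
    ext z
    have hs : ∀ x y, fderiv ℝ (fderiv ℝ f) z x y = fderiv ℝ (fderiv ℝ f) z y x := by
      have := (hf.1.contDiffAt (x := z)).isSymmSndFDerivAt
        (by rw [minSmoothness_of_isRCLikeNormedField]; exact WithTop.coe_le_coe.2 le_top)
      exact this
    simp only [Finset.sum_apply, Pi.smul_apply, fderiv_fderiv_apply hf, smul_eq_mul]
    rcases i with a | a
    · exact (hc₀ _ hs a l).symm
    · simp only [c, Sum.elim_inr, Pi.add_apply, add_mul, Finset.sum_add_distrib, hc₀ _ hs]
      simp [v]
  have hv : v (Sum.inl j₀) ≠ 0 := by simp [v, bdryDir]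
  obtain ⟨C, hC, h⟩ := exists_abs_integral_mul_le_of_fderiv (μ := (volume : Measure (Bdry n))) hpq
    v (bdryDir n) c hc (Sum.inl j₀) hv
  refine ⟨C * 2, by positivity, fun w M hw hM hH => ?_⟩
  have h2 : ofReal 2 = 2 := by simp
  have hwl : LocallyIntegrable w volume := hw.locallyIntegrable (by norm_num)
  -- A derivative along e_a + e_l costs the bound for two coordinate directions, hence 2M.
  have h12 := h w (2 * M) (by rwa [h2]) (by positivity) ?_
  · have := eLpNorm_le_of_forall_test (μ := (volume : Measure (Bdry n))) (Ω := univ) hpq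
      (C := C * 2 * M) (by positivity) isOpen_univ (f := w) (hwl.locallyIntegrableOn _)
      (fun φ hφ => (h12 φ hφ).trans (le_of_eq (by ring)))
    simpa using this
  · intro i ψ hψ
    set S := ∑ l, 𝐍[𝐃[ψ,bdryDir n l],p,volume]
    have hS : 0 ≤ S := Finset.sum_nonneg fun l _ => ENNReal.toReal_nonneg
    have hMS : 0 ≤ M * S := by positivity
    rcases i with a | a
    · refine (hH a ψ hψ).trans ?_
      change M * S ≤ 2 * M * S
      linarith
    · have hi : ∀ j, Integrable (fun z => fderiv ℝ ψ z (bdryDir n j) * w z) volume := fun j =>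
        testFun_integrable_mul (hwl.locallyIntegrableOn _) (testFun_fderiv hψ _)
      simp only [v, Sum.elim_inr, map_add, add_mul]
      rw [integral_add (hi _) (hi _)]
      have h3 := hH a.1 ψ hψ
      have h4 := hH a.2 ψ hψ
      refine (abs_add_le _ _).trans ?_
      linarith

end BoundaryNegativeOrder

/-! ### Scalar energy functions on the half-space. -/

section HalfSpace

variable {n : ℕ}

instance : (volume : Measure (Full n)).IsAddHaarMeasure := by
  change ((volume : Measure ℝ).prod (volume : Measure (Bdry n))).IsAddHaarMeasure
  infer_instance

theorem holderConjugate_two : Real.HolderConjugate 2 2 := by rw [Real.holderConjugate_iff]; norm_num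

theorem ennreal_ofReal_two : ofReal 2 = 2 := by simp

theorem mem_halfSpace {z : Full n} : z ∈ ℍ[n] ↔ 0 < z.1 := Iff.rfl

theorem isOpen_halfSpace : IsOpen ℍ[n] := (halfSpace n).isOpen

theorem measurableSet_halfSpace : MeasurableSet ℍ[n] := isOpen_halfSpace.measurableSet

theorem convex_halfSpace : Convex ℝ ℍ[n] := by
  intro x hx y hy a b ha hb hab
  rw [mem_halfSpace] at *
  simp only [Prod.fst_add, Prod.smul_fst, smul_eq_mul]
  rcases ha.eq_or_lt with h | h
  · have : b = 1 := by linarith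
    subst h; subst this; simpa using hy
  · have := mul_pos h hx
    have := mul_nonneg hb hy.le
    linarith

theorem preimage_add_halfSpace {y : Full n} (hy : 0 ≤ y.1) : ℍ[n] ∩ (fun z => z + y) ⁻¹' ℍ[n] =
      ℍ[n] := by
  refine inter_eq_left.2 fun z hz => ?_
  rw [mem_preimage, mem_halfSpace, Prod.fst_add]
  rw [mem_halfSpace] at hz
  linarith

/-- The coordinates of a point of `ℝ^{1+n}`. -/
def fullCoord (y : Full n) : Fin (n + 1) → ℝ := Fin.cons y.1 fun j => y.2 j

theorem sum_fullCoord (y : Full n) : ∑ i, fullCoord y i • fullDir n i = y := by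
  rw [Fin.sum_univ_succ]
  simp only [fullCoord, fullDir, Fin.cons_zero, Fin.cons_succ]
  ext1
  · simp [Prod.fst_sum]
  · simp only [Prod.snd_add, Prod.smul_snd, smul_zero, zero_add, Prod.snd_sum]
    ext j
    simp [Pi.single_apply]

theorem abs_fullCoord_le (y : Full n) (i : Fin (n + 1)) : |fullCoord y i| ≤ ‖y‖ := by
  refine Fin.cases ?_ (fun j => ?_) i
  · exact norm_fst_le y
  · exact (PiLp.norm_apply_le y.2 j).trans (norm_snd_le y)

theorem locallyIntegrableOn_of_memLp {E : Type*} [NormedAddCommGroup E] {v : Full n → E}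
    (h : ∀ K : Set (Full n), IsCompact K → K ⊆ ℍ[n] → MemLp v 2 (volume.restrict K)) :
    LocallyIntegrableOn v ℍ[n] volume := by
  rw [locallyIntegrableOn_iff isOpen_halfSpace.isLocallyClosed]
  intro K hK hKc
  have : IsFiniteMeasure (volume.restrict K) := ⟨by simpa using hKc.measure_lt_top⟩
  exact (h K hKc hK).integrable (by norm_num)

/-- `u` is a real valued function in the energy space of the half-space, with weak gradient `G`. -/
structure IsScalarEnergy (u : Full n → ℝ) (G : Fin (n + 1) → Full n → ℝ) : Prop where
  memLp_loc : ∀ K : Set (Full n), IsCompact K → K ⊆ ℍ[n] → MemLp u 2 (volume.restrict K)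
  memLp_grad : ∀ i, MemLp (G i) 2 volℍ[n]
  weak_grad : ∀ i, ∀ φ ∈ testFun ℍ[n], ∫ z, fderiv ℝ φ z (fullDir n i) * u z = - ∫ z, φ z * G i z

namespace IsScalarEnergy

variable {u v : Full n → ℝ} {G F : Fin (n + 1) → Full n → ℝ}

theorem of_memLp (hu : MemLp u 2 volℍ[n]) (hG : ∀ i, MemLp (G i) 2 volℍ[n])
    (hw : ∀ i, ∀ φ ∈ testFun ℍ[n],
      ∫ z, fderiv ℝ φ z (fullDir n i) * u z = - ∫ z, φ z * G i z) : IsScalarEnergy u G :=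
  ⟨fun _ _ hK => hu.mono_measure (Measure.restrict_mono hK le_rfl), hG, hw⟩

theorem locallyIntegrableOn (h : IsScalarEnergy u G) : LocallyIntegrableOn u ℍ[n] volume :=
  locallyIntegrableOn_of_memLp h.memLp_loc

theorem locallyIntegrableOn_grad (h : IsScalarEnergy u G) (i : Fin (n + 1)) :
    LocallyIntegrableOn (G i) ℍ[n] volume :=
  locallyIntegrableOn_of_memLp fun _ _ hK =>
    (h.memLp_grad i).mono_measure (Measure.restrict_mono hK le_rfl)

theorem integrable_mul (h : IsScalarEnergy u G) {φ : Full n → ℝ}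
    (hφ : φ ∈ testFun ℍ[n]) : Integrable (fun z => φ z * u z) volume :=
  testFun_integrable_mul h.locallyIntegrableOn hφ

theorem integrable_mul_grad (h : IsScalarEnergy u G) (i : Fin (n + 1)) {φ : Full n → ℝ}
    (hφ : φ ∈ testFun ℍ[n]) : Integrable (fun z => φ z * G i z) volume :=
  testFun_integrable_mul (h.locallyIntegrableOn_grad i) hφ

theorem sub (h : IsScalarEnergy u G) (h' : IsScalarEnergy v F) :
    IsScalarEnergy (fun z => u z - v z) fun i z => G i z - F i z := by
  refine ⟨fun K hK hKH => (h.memLp_loc K hK hKH).sub (h'.memLp_loc K hK hKH),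
    fun i => (h.memLp_grad i).sub (h'.memLp_grad i), fun i φ hφ => ?_⟩
  have hφ' := testFun_fderiv hφ (fullDir n i)
  simp only [mul_sub]
  rw [integral_sub (h.integrable_mul hφ') (h'.integrable_mul hφ'),
    integral_sub (h.integrable_mul_grad i hφ) (h'.integrable_mul_grad i hφ), h.weak_grad i φ hφ,
    h'.weak_grad i φ hφ]
  ring

/-- The support moves upward by y and stays inside the half-space. For this reason energy functions
may be translated only by y with nonnegative vertical part. -/
theorem testFun_sub {φ : Full n → ℝ} (hφ : φ ∈ testFun ℍ[n]) {y : Full n}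
    (hy : 0 ≤ y.1) : (fun z => φ (z + -y)) ∈ testFun ℍ[n] := by
  refine testFun_mono (fun z hz => ?_) (testFun_translate hφ (-y))
  rw [mem_preimage, mem_halfSpace, Prod.fst_add, Prod.fst_neg] at hz
  rw [mem_halfSpace]
  linarith

theorem fderiv_comp_add {V : Type*} [NormedAddCommGroup V] [NormedSpace ℝ V] (φ : V → ℝ)
    (y z : V) : fderiv ℝ (fun z => φ (z + y)) z = fderiv ℝ φ (z + y) :=
  fderiv_comp_add_right y

theorem weak_grad_translate (h : IsScalarEnergy u G) {y : Full n} (hy : 0 ≤ y.1) (i : Fin (n + 1))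
    {φ : Full n → ℝ} (hφ : φ ∈ testFun ℍ[n]) :
    ∫ z, fderiv ℝ φ z (fullDir n i) * u (z + y) = - ∫ z, φ z * G i (z + y) := by
  have := h.weak_grad i _ (testFun_sub hφ hy)
  simp only [fderiv_comp_add] at this
  rw [← integral_add_right_eq_self _ y, ← integral_add_right_eq_self (fun z => φ (z + -y) * G i z) y]
    at this
  simpa using this

theorem memLp_add {f : Full n → ℝ} {p : ℝ≥0∞} (hf : MemLp f p volℍ[n]) {y : Full n} (hy : 0 ≤ y.1) :
    MemLp (fun z => f (z + y)) p volℍ[n] := by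
  have h1 : MemLp (ℍ[n].indicator f) p volume :=
    (memLp_indicator_iff_restrict measurableSet_halfSpace).2 hf
  refine ((memLp_translate h1 y).restrict ℍ[n]).ae_eq ?_
  rw [EventuallyEq, ae_restrict_iff' measurableSet_halfSpace]
  refine .of_forall fun z hz => ?_
  rw [indicator_of_mem]
  rw [mem_halfSpace, Prod.fst_add] at *
  linarith

theorem translate (h : IsScalarEnergy u G) {y : Full n} (hy : 0 ≤ y.1) :
    IsScalarEnergy (fun z => u (z + y)) fun i z => G i (z + y) := by
  refine ⟨fun K hK hKH => ?_, fun i => memLp_add (h.memLp_grad i) hy,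
    fun i φ hφ => h.weak_grad_translate hy i hφ⟩
  have h1 := h.memLp_loc ((fun z => z + y) '' K) (hK.image (by fun_prop)) (by
    rintro _ ⟨z, hz, rfl⟩
    have := hKH hz
    rw [mem_halfSpace] at *
    rw [Prod.fst_add]; linarith)
  have h2 := (measurePreserving_add_right (volume : Measure (Full n)) y).restrict_preimage_emb
    (Homeomorph.addRight y).measurableEmbedding ((fun z => z + y) '' K)
  rw [preimage_image_eq _ (add_left_injective y)] at h2
  exact h1.comp_measurePreserving h2

/-- The weak derivative in an arbitrary direction. -/
theorem weak_fderiv (h : IsScalarEnergy u G) (y : Full n) {φ : Full n → ℝ} (hφ : φ ∈ testFun ℍ[n]) :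
    ∫ z, fderiv ℝ φ z y * u z = - ∫ z, φ z * ∑ i, fullCoord y i * G i z := by
  have e1 : ∀ z, fderiv ℝ φ z y * u z =
      ∑ i, fullCoord y i * (fderiv ℝ φ z (fullDir n i) * u z) := by
    intro z
    conv_lhs => rw [← sum_fullCoord y]
    simp [Finset.sum_mul, mul_assoc]
  have e2 : ∀ z, φ z * ∑ i, fullCoord y i * G i z = ∑ i, fullCoord y i * (φ z * G i z) := by
    intro z
    rw [Finset.mul_sum]
    exact Finset.sum_congr rfl fun i _ => by ring
  simp only [e1, e2]
  rw [integral_finsetSum _ fun i _ => (h.integrable_mul (testFun_fderiv hφ _)).const_mul _,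
    integral_finsetSum _ fun i _ => (h.integrable_mul_grad i hφ).const_mul _,
    ← Finset.sum_neg_distrib]
  refine Finset.sum_congr rfl fun i _ => ?_
  rw [integral_const_mul, integral_const_mul, h.weak_grad i φ hφ]
  ring

/-- Differences of translates of energy functions are square integrable. -/
theorem memLp_translate_sub (h : IsScalarEnergy u G) (y : Full n) :
    MemLp (fun z => u (z + y) - u z) 2 (volume.restrict (ℍ[n] ∩ (fun z => z + y) ⁻¹' ℍ[n])) ∧
      eLpNorm (fun z => u (z + y) - u z) 2 (volume.restrict (ℍ[n] ∩ (fun z => z + y) ⁻¹' ℍ[n])) ≤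
      ofReal ‖y‖ * ∑ i, eLpNorm (G i) 2 volℍ[n] := by
  have hm : ∀ i, MemLp (fun z => fullCoord y i * G i z) 2
      volℍ[n] := fun i => (h.memLp_grad i).const_mul _
  have hG : MemLp (fun z => ∑ i, fullCoord y i * G i z) 2
      volℍ[n] := memLp_finsetSum _ fun i _ => hm i
  have key := eLpNorm_translate_sub_le (μ := (volume : Measure (Full n))) holderConjugate_two
    isOpen_halfSpace convex_halfSpace (u := u) (G := fun z => ∑ i, fullCoord y i * G i z) y
    h.locallyIntegrableOn (by rwa [ennreal_ofReal_two]) fun φ hφ => h.weak_fderiv y hφ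
  rw [ennreal_ofReal_two] at key
  refine ⟨key.1, key.2.trans ?_⟩
  have e : (fun z => ∑ i, fullCoord y i * G i z) = ∑ i, fullCoord y i • G i := by ext z; simp
  rw [e]
  refine (eLpNorm_sum_le (f := fun i => fullCoord y i • G i) (fun i _ => (hm i).1)
    (by norm_num)).trans ?_
  rw [Finset.mul_sum]
  refine Finset.sum_le_sum fun i _ => ?_
  rw [eLpNorm_const_smul]
  gcongr
  rw [← ofReal_norm]
  exact ENNReal.ofReal_le_ofReal (abs_fullCoord_le y i)

/-- An energy function itself need not be square integrable, but these differences are; cutoff and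
mollification are therefore applied to differences only. -/
theorem memLp_sub_translate (h : IsScalarEnergy u G) {y : Full n} (hy : 0 ≤ y.1) :
    MemLp (fun z => u z - u (z + y)) 2 volℍ[n] := by
  have := (h.memLp_translate_sub y).1
  rw [preimage_add_halfSpace hy] at this
  refine this.neg.ae_eq (.of_forall fun z => ?_)
  simp

/-- Multiplication by a cutoff function. -/
theorem mul_test (h : IsScalarEnergy u G) (hu : MemLp u 2 volℍ[n]) {χ : Full n → ℝ}
    (hχ : χ ∈ 𝓣[Full n]) : IsScalarEnergy (fun z => χ z * u z)
      fun i z => χ z * G i z + fderiv ℝ χ z (fullDir n i) * u z := by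
  have hm : ∀ {f g : Full n → ℝ}, f ∈ 𝓣[Full n] → MemLp g 2 volℍ[n] →
      MemLp (fun z => f z * g z) 2 volℍ[n] := by
    intro f g hf hg
    obtain ⟨B, hB⟩ := (testFun_continuous hf).bounded_above_of_compact_support hf.2.1
    refine hg.of_le_mul (c := B) ((testFun_continuous hf).aestronglyMeasurable.mul hg.1)
      (.of_forall fun z => ?_)
    rw [norm_mul]
    gcongr
    exact hB z
  refine of_memLp (hm hχ hu) (fun i => (hm hχ (h.memLp_grad i)).add
    (hm (testFun_fderiv hχ _) hu)) fun i φ hφ => ?_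
  have hχφ : (fun z => χ z * φ z) ∈ testFun ℍ[n] := testFun_mul hχ.1 hφ
  have h1 := h.weak_grad i _ hχφ
  have h3 : (fun z => fderiv ℝ χ z (fullDir n i) * φ z) ∈ testFun ℍ[n] :=
    testFun_mul (testFun_fderiv hχ _).1 hφ
  have h4 : (fun z => χ z * fderiv ℝ φ z (fullDir n i)) ∈ testFun ℍ[n] :=
    testFun_mul hχ.1 (testFun_fderiv hφ _)
  have e1 : ∀ z, fderiv ℝ (fun z => χ z * φ z) z (fullDir n i) =
      χ z * fderiv ℝ φ z (fullDir n i) + fderiv ℝ χ z (fullDir n i) * φ z := by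
    intro z
    rw [fderiv_fun_mul (testFun_differentiable hχ z) (testFun_differentiable hφ z)]
    simp [mul_comm]
  simp only [e1, add_mul] at h1
  rw [integral_add (h.integrable_mul h4) (h.integrable_mul h3)] at h1
  have i1 : Integrable (fun z => φ z * (χ z * G i z)) volume :=
    (h.integrable_mul_grad i hχφ).congr (.of_forall fun z => by ring)
  have i2 : Integrable (fun z => φ z * (fderiv ℝ χ z (fullDir n i) * u z)) volume :=
    (h.integrable_mul h3).congr (.of_forall fun z => by ring)
  simp only [mul_add]
  rw [integral_add i1 i2]
  have e2 : ∫ z, fderiv ℝ φ z (fullDir n i) * (χ z * u z) =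
      ∫ z, χ z * fderiv ℝ φ z (fullDir n i) * u z :=
    integral_congr_ae (.of_forall fun z => by ring)
  have e3 : ∫ z, φ z * (χ z * G i z) = ∫ z, χ z * φ z * G i z :=
    integral_congr_ae (.of_forall fun z => by ring)
  have e4 : ∫ z, φ z * (fderiv ℝ χ z (fullDir n i) * u z) =
      ∫ z, fderiv ℝ χ z (fullDir n i) * φ z * u z :=
    integral_congr_ae (.of_forall fun z => by ring)
  rw [e2, e3, e4]
  linarith

/-- Averages of translates in non-downward directions. -/
theorem avg (h : IsScalarEnergy u G) (hu : MemLp u 2 volℍ[n]) (ν : Measure (Full n))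
    [IsProbabilityMeasure ν] (hν : ∀ᵐ y ∂ν, 0 ≤ y.1) :
    IsScalarEnergy (avgTranslate ν (ℍ[n].indicator u))
      fun i => avgTranslate ν (ℍ[n].indicator (G i)) := by
  have hm : ∀ {f : Full n → ℝ}, MemLp f 2 volℍ[n] → MemLp (ℍ[n].indicator f) (ofReal 2) volume := by
    intro f hf
    rw [ennreal_ofReal_two]
    exact (memLp_indicator_iff_restrict measurableSet_halfSpace).2 hf
  have hm' : ∀ {f : Full n → ℝ}, MemLp f 2 volℍ[n] → MemLp (avgTranslate ν (ℍ[n].indicator f)) 2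
        volℍ[n] := by
    intro f hf
    have := (memLp_avgTranslate holderConjugate_two (hm hf) ν).1
    rw [ennreal_ofReal_two] at this
    exact this.restrict _
  refine of_memLp (hm' hu) (fun i => hm' (h.memLp_grad i)) fun i φ hφ => ?_
  rw [integral_mul_avgTranslate holderConjugate_two (testFun_memLp (testFun_fderiv hφ _) _) (hm hu),
    integral_mul_avgTranslate holderConjugate_two (testFun_memLp hφ _) (hm (h.memLp_grad i)),
    ← integral_neg]
  refine integral_congr_ae ?_
  filter_upwards [hν] with y hy
  have e : ∀ (ψ f : Full n → ℝ), ψ ∈ testFun ℍ[n] →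
      ∫ z, ψ z * ℍ[n].indicator f (z + y) = ∫ z, ψ z * f (z + y) := by
    intro ψ f hψ
    refine integral_congr_ae (.of_forall fun z => ?_)
    by_cases hz : z ∈ ℍ[n]
    · have : z + y ∈ ℍ[n] := by rw [mem_halfSpace, Prod.fst_add] at *; linarith
      simp only [indicator_of_mem this]
    · simp only [testFun_eq_zero hψ hz, zero_mul]
  rw [e _ _ (testFun_fderiv hφ _), e _ _ hφ]
  exact h.weak_grad_translate hy i hφ

end IsScalarEnergy

end HalfSpace

/-! ### Cutoff functions at scale k + 1. -/

section Cutoff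

variable {V : Type*} [NormedAddCommGroup V] [NormedSpace ℝ V] [FiniteDimensional ℝ V]

/-- A smooth cutoff function that is `1` on the ball of radius `k + 1`. -/
noncomputable def cutoff (V : Type*) [NormedAddCommGroup V] [NormedSpace ℝ V]
    [FiniteDimensional ℝ V] (k : ℕ) (z : V) : ℝ :=
  (⟨1, 2, one_pos, one_lt_two⟩ : ContDiffBump (0 : V)) ((((k : ℝ) + 1)⁻¹) • z)

theorem cutoff_mem (k : ℕ) : cutoff V k ∈ 𝓣[V] := by
  have hk : (((k : ℝ) + 1)⁻¹) ≠ 0 := by positivity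
  refine ⟨(ContDiffBump.contDiff _).comp (contDiff_const_smul _), ?_, subset_univ _⟩
  exact (ContDiffBump.hasCompactSupport _).comp_homeomorph (Homeomorph.smulOfNeZero _ hk)

theorem cutoff_nonneg (k : ℕ) (z : V) : 0 ≤ cutoff V k z := ContDiffBump.nonneg _

theorem cutoff_le_one (k : ℕ) (z : V) : cutoff V k z ≤ 1 := ContDiffBump.le_one _

theorem tendsto_cutoff (z : V) : Tendsto (fun k => cutoff V k z) atTop (𝓝 1) := by
  refine tendsto_const_nhds.congr' ?_
  filter_upwards [tendsto_natCast_atTop_atTop.eventually_ge_atTop ‖z‖] with k hk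
  symm
  refine ContDiffBump.one_of_mem_closedBall _ ?_
  rw [mem_closedBall_zero_iff, norm_smul, norm_inv, Real.norm_of_nonneg (by positivity),
    inv_mul_le_iff₀ (by positivity)]
  change ‖z‖ ≤ (k + 1) * 1
  linarith

/-- All cutoffs are dilates of one bump function, so the chain rule gives the factor 1/(k+1). -/
theorem exists_abs_fderiv_cutoff_le (h : V) : ∃ B : ℝ, 0 ≤ B ∧
    ∀ k z, |fderiv ℝ (cutoff V k) z h| ≤ B * ((k : ℝ) + 1)⁻¹ := by
  set b : ContDiffBump (0 : V) := ⟨1, 2, one_pos, one_lt_two⟩ with hb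
  have hbt : (b : V → ℝ) ∈ 𝓣[V] := ⟨b.contDiff, b.hasCompactSupport, subset_univ _⟩
  obtain ⟨B, hB⟩ := (testFun_continuous (testFun_fderiv hbt h)).bounded_above_of_compact_support
    (testFun_fderiv hbt h).2.1
  refine ⟨B, (norm_nonneg _).trans (hB 0), fun k z => ?_⟩
  have h1 : HasFDerivAt (cutoff V k)
      ((fderiv ℝ b ((((k : ℝ) + 1)⁻¹) • z)).comp ((((k : ℝ) + 1)⁻¹) • ContinuousLinearMap.id ℝ V))
      z := by
    refine HasFDerivAt.comp z (testFun_differentiable hbt _).hasFDerivAt ?_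
    exact (hasFDerivAt_id z).const_smul _
  rw [h1.fderiv]
  simp only [ContinuousLinearMap.comp_apply, _root_.smul_apply, ContinuousLinearMap.id_apply,
    map_smul, smul_eq_mul, abs_mul]
  rw [abs_of_nonneg (by positivity : 0 ≤ ((k : ℝ) + 1)⁻¹), mul_comm]
  exact mul_le_mul_of_nonneg_right (hB _) (by positivity)

end Cutoff

/-! ### Approximation of energy functions and density of test functions. -/

section Approximation

variable {n : ℕ}

theorem integrable_mul_two {α : Type*} [MeasurableSpace α] {m : Measure α} {f g : α → ℝ}
    (hf : MemLp f 2 m) (hg : MemLp g 2 m) : Integrable (fun z => f z * g z) m := by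
  rw [← ennreal_ofReal_two] at hf hg
  exact integrable_mul_holder holderConjugate_two hf hg

/-- Probability measures on the closed half-space that concentrate at the origin. -/
structure IsApproxIdentity (ν : ℕ → Measure (Full n)) : Prop where
  prob : ∀ k, IsProbabilityMeasure (ν k)
  up : ∀ k, ∀ᵐ y ∂(ν k), 0 ≤ y.1
  small : ∀ δ > 0, ∀ᶠ k in atTop, ∀ᵐ y ∂(ν k), ‖y‖ < δ

theorem setIntegral_mul_eq {Ξ f : Full n → ℝ} : ∫ z in ℍ[n], Ξ z * f z =
      ∫ z, ℍ[n].indicator Ξ z * f z := by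
  rw [← integral_indicator measurableSet_halfSpace]
  refine integral_congr_ae (.of_forall fun z => ?_)
  by_cases hz : z ∈ ℍ[n] <;> simp [hz]

theorem memLp_indicator_halfSpace {f : Full n → ℝ} (hf : MemLp f 2 volℍ[n]) :
    MemLp (ℍ[n].indicator f) (ofReal 2) volume := by
  rw [ennreal_ofReal_two]
  exact (memLp_indicator_iff_restrict measurableSet_halfSpace).2 hf

theorem IsApproxIdentity.tendsto {ν : ℕ → Measure (Full n)} (hν : IsApproxIdentity ν)
    {Ξ f : Full n → ℝ} (hΞ : MemLp Ξ 2 volℍ[n]) (hf : MemLp f 2 volℍ[n]) :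
    Tendsto (fun k => ∫ z in ℍ[n], Ξ z * avgTranslate (ν k) (ℍ[n].indicator f) z) atTop
      (𝓝 (∫ z in ℍ[n], Ξ z * f z)) := by
  have e : ∫ z in ℍ[n], Ξ z * f z = ∫ z, ℍ[n].indicator Ξ z * ℍ[n].indicator f z := by
    rw [setIntegral_mul_eq]
    refine integral_congr_ae (.of_forall fun z => ?_)
    by_cases hz : z ∈ ℍ[n] <;> simp [hz]
  rw [e]
  simp only [setIntegral_mul_eq]
  rw [Metric.tendsto_atTop']
  intro η hη
  obtain ⟨δ, hδ, h⟩ := exists_forall_abs_integral_mul_avgTranslate_sub_le holderConjugate_two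
    (memLp_indicator_halfSpace hΞ) (memLp_indicator_halfSpace hf) (half_pos hη)
  obtain ⟨N, hN⟩ := eventually_atTop.1 (hν.small δ hδ)
  refine ⟨N, fun k hk => ?_⟩
  have := hν.prob k
  rw [Real.dist_eq]
  exact (h (ν k) (hN k hk.le)).trans_lt (half_lt_self hη)

/-- The product rule term carries a derivative of size O(1/k), which is harmless because v is in L²;
the main term converges by domination. -/
theorem tendsto_integral_cutoff {Ξ f v : Full n → ℝ} (hΞ : MemLp Ξ 2 volℍ[n])
    (hf : MemLp f 2 volℍ[n]) (hv : MemLp v 2 volℍ[n]) (h : Full n) : Tendsto (fun k => ∫ z in ℍ[n],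
      Ξ z * (cutoff (Full n) k z * f z + fderiv ℝ (cutoff (Full n) k) z h * v z)) atTop
      (𝓝 (∫ z in ℍ[n], Ξ z * f z)) := by
  obtain ⟨B, hB0, hB⟩ := exists_abs_fderiv_cutoff_le h
  have hlimB : Tendsto (fun k : ℕ => B * ((k : ℝ) + 1)⁻¹) atTop (𝓝 0) := by
    have := (tendsto_one_div_add_atTop_nhds_zero_nat (𝕜 := ℝ)).const_mul B
    simpa using this
  have hΞf := integrable_mul_two hΞ hf
  have hΞv := integrable_mul_two hΞ hv
  have hcm : ∀ k, Continuous (cutoff (Full n) k) := fun k => testFun_continuous (cutoff_mem k)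
  have hcm' : ∀ k, Continuous 𝐃[cutoff (Full n) k,h] := fun k =>
    testFun_continuous (testFun_fderiv (cutoff_mem k) h)
  refine tendsto_integral_of_dominated_convergence (fun z => ‖Ξ z * f z‖ + B * ‖Ξ z * v z‖)
    (fun k => hΞ.1.mul (((hcm k).aestronglyMeasurable.mul hf.1).add
      ((hcm' k).aestronglyMeasurable.mul hv.1))) (hΞf.norm.add (hΞv.norm.const_mul B)) ?_ ?_
  · refine fun k => .of_forall fun z => ?_
    have h1 : |cutoff (Full n) k z| ≤ 1 := by
      rw [abs_of_nonneg (cutoff_nonneg _ _)]; exact cutoff_le_one _ _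
    have h2 : |fderiv ℝ (cutoff (Full n) k) z h| ≤ B :=
      (hB k z).trans (mul_le_of_le_one_right hB0 (inv_le_one_of_one_le₀ (by
        linarith [(Nat.cast_nonneg k : (0 : ℝ) ≤ k)])))
    rw [mul_add]
    refine (norm_add_le _ _).trans (add_le_add ?_ ?_)
    · rw [mul_left_comm, norm_mul]
      exact mul_le_of_le_one_left (norm_nonneg _) h1
    · rw [mul_left_comm, norm_mul]
      exact mul_le_mul_of_nonneg_right h2 (norm_nonneg _)
  · refine .of_forall fun z => ?_
    have h1 : Tendsto (fun k => fderiv ℝ (cutoff (Full n) k) z h) atTop (𝓝 0) :=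
      squeeze_zero_norm (fun k => hB k z) hlimB
    have := (((tendsto_cutoff z).mul_const (f z)).add (h1.mul_const (v z))).const_mul (Ξ z)
    simpa using this

/-- A sequence of horizontal translations that tends to infinity. -/
noncomputable def farPoint (hn : 1 ≤ n) (k : ℕ) : Full n := (0, (k : ℝ) • bdryDir n ⟨0, hn⟩)

/-- Translates going to infinity tend weakly to zero in L². Thus subtracting a translate, which buys
global integrability, costs nothing in the limit. A horizontal direction exists because n ≥ 1. -/
theorem tendsto_integral_far (hn : 1 ≤ n) {Ξ f : Full n → ℝ} (hΞ : MemLp Ξ 2 volℍ[n])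
    (hf : MemLp f 2 volℍ[n]) : Tendsto (fun k => ∫ z in ℍ[n],
      Ξ z * (f z - f (z + farPoint hn k))) atTop
      (𝓝 (∫ z in ℍ[n], Ξ z * f z)) := by
  have h1 := tendsto_integral_mul_translate holderConjugate_two (memLp_indicator_halfSpace hΞ)
    (memLp_indicator_halfSpace hf)
  have hco : Tendsto (farPoint hn) atTop (cocompact (Full n)) := by
    rw [← Metric.cobounded_eq_cocompact, ← tendsto_norm_atTop_iff_cobounded]
    refine tendsto_atTop_mono (fun k => ?_) (tendsto_natCast_atTop_atTop (R := ℝ))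
    refine le_trans (le_of_eq ?_) (norm_snd_le (farPoint hn k))
    simp [farPoint, norm_smul, bdryDir]
  have h2 := (h1.comp hco).const_sub (∫ z in ℍ[n], Ξ z * f z)
  rw [sub_zero] at h2
  refine h2.congr fun k => ?_
  have e : ∫ z, ℍ[n].indicator Ξ z * ℍ[n].indicator f (z + farPoint hn k) =
      ∫ z in ℍ[n], Ξ z * f (z + farPoint hn k) := by
    rw [setIntegral_mul_eq]
    refine integral_congr_ae (.of_forall fun z => ?_)
    by_cases hz : z ∈ ℍ[n]
    · have : z + farPoint hn k ∈ ℍ[n] := by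
        rw [mem_halfSpace] at *
        simpa [farPoint] using hz
      simp [hz, this]
    · simp [hz]
  have i2 := integrable_mul_two hΞ (IsScalarEnergy.memLp_add hf (y := farPoint hn k) le_rfl)
  simp only [Function.comp_apply]
  rw [e, ← integral_sub (integrable_mul_two hΞ hf) i2]
  refine integral_congr_ae (.of_forall fun z => ?_)
  simp only; ring

/-- The approximation `ν * (χ (u - u(· + y)))` of a function on the half-space. -/
noncomputable def approxFun (ν : Measure (Full n)) (χ : Full n → ℝ) (y : Full n)
    (u : Full n → ℝ) : Full n → ℝ :=
  avgTranslate ν (ℍ[n].indicator fun z => χ z * (u z - u (z + y)))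

/-- The gradient of the approximation `approxFun`. -/
noncomputable def approxGrad (ν : Measure (Full n)) (χ : Full n → ℝ) (y : Full n)
    (u : Full n → ℝ) (G : Fin (n + 1) → Full n → ℝ) (i : Fin (n + 1)) : Full n → ℝ :=
  avgTranslate ν (ℍ[n].indicator fun z =>
    χ z * (G i z - G i (z + y)) + fderiv ℝ χ z (fullDir n i) * (u z - u (z + y)))

variable {u : Full n → ℝ} {G : Fin (n + 1) → Full n → ℝ}

theorem IsScalarEnergy.cutoff_sub (h : IsScalarEnergy u G) {χ : Full n → ℝ}
    (hχ : χ ∈ 𝓣[Full n]) {y : Full n} (hy : 0 ≤ y.1) :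
    IsScalarEnergy (fun z => χ z * (u z - u (z + y))) fun i z => χ z * (G i z - G i (z + y)) +
      fderiv ℝ χ z (fullDir n i) * (u z - u (z + y)) :=
  (h.sub (h.translate hy)).mul_test (h.memLp_sub_translate hy) hχ

theorem IsScalarEnergy.memLp_cutoff_sub (h : IsScalarEnergy u G) {χ : Full n → ℝ}
    (hχ : χ ∈ 𝓣[Full n]) {y : Full n} (hy : 0 ≤ y.1) : MemLp (fun z => χ z * (u z - u (z + y))) 2
      volℍ[n] := by
  obtain ⟨B, hB⟩ := (testFun_continuous hχ).bounded_above_of_compact_support hχ.2.1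
  have hg := h.memLp_sub_translate hy
  refine hg.of_le_mul (c := B) ((testFun_continuous hχ).aestronglyMeasurable.mul hg.1)
    (.of_forall fun z => ?_)
  rw [norm_mul]
  gcongr
  exact hB z

theorem IsScalarEnergy.approx (h : IsScalarEnergy u G) {χ : Full n → ℝ}
    (hχ : χ ∈ 𝓣[Full n]) {y : Full n} (hy : 0 ≤ y.1) (ν : Measure (Full n))
    [IsProbabilityMeasure ν] (hν : ∀ᵐ y ∂ν, 0 ≤ y.1) :
    IsScalarEnergy (approxFun ν χ y u) (approxGrad ν χ y u G) :=
  (h.cutoff_sub hχ hy).avg (h.memLp_cutoff_sub hχ hy) ν hν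

/-- The approximations converge weakly: successively in the mollification, the cutoff, and the
translation. -/
theorem IsScalarEnergy.tendsto_approx (h : IsScalarEnergy u G) (hn : 1 ≤ n) (i : Fin (n + 1))
    {Ξ : Full n → ℝ} (hΞ : MemLp Ξ 2 volℍ[n]) :
    (∀ ν : ℕ → Measure (Full n), IsApproxIdentity ν → ∀ j k, Tendsto (fun l => ∫ z in ℍ[n],
        Ξ z * approxGrad (ν l) (cutoff (Full n) k) (farPoint hn j) u G i z) atTop
      (𝓝 (∫ z in ℍ[n], Ξ z * (cutoff (Full n) k z * (G i z - G i (z + farPoint hn j)) +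
        fderiv ℝ (cutoff (Full n) k) z (fullDir n i) * (u z - u (z + farPoint hn j)))))) ∧
    (∀ j, Tendsto (fun k => ∫ z in ℍ[n], Ξ z *
        (cutoff (Full n) k z * (G i z - G i (z + farPoint hn j)) +
        fderiv ℝ (cutoff (Full n) k) z (fullDir n i) * (u z - u (z + farPoint hn j)))) atTop
      (𝓝 (∫ z in ℍ[n], Ξ z * (G i z - G i (z + farPoint hn j))))) ∧
    Tendsto (fun j => ∫ z in ℍ[n], Ξ z * (G i z - G i (z + farPoint hn j))) atTop
      (𝓝 (∫ z in ℍ[n], Ξ z * G i z)) :=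
  ⟨fun _ hν _ k => hν.tendsto hΞ ((h.cutoff_sub (cutoff_mem k) le_rfl).memLp_grad i),
    fun _ => tendsto_integral_cutoff hΞ ((h.sub (h.translate le_rfl)).memLp_grad i)
      (h.memLp_sub_translate le_rfl) _, tendsto_integral_far hn hΞ (h.memLp_grad i)⟩

/-- The weak gradient of a smooth function is its gradient. -/
theorem IsScalarEnergy.grad_ae_eq (h : IsScalarEnergy u G) (hu : u ∈ 𝓣[Full n]) (i : Fin (n + 1)) :
    G i =ᵐ[volℍ[n]] 𝐃[u,fullDir n i] := by
  have hu' := testFun_fderiv hu (fullDir n i)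
  have hl : LocallyIntegrableOn 𝐃[u,fullDir n i] ℍ[n] volume :=
    (testFun_continuous hu').locallyIntegrable.locallyIntegrableOn _
  have hl2 := (h.locallyIntegrableOn_grad i).sub hl
  have key := (eLpNorm_le_of_forall_test holderConjugate_two le_rfl isOpen_halfSpace hl2
    fun φ hφ => ?_).2
  · rw [ENNReal.ofReal_zero, nonpos_iff_eq_zero, eLpNorm_eq_zero_iff
      (hl2.aestronglyMeasurable) (by simp)] at key
    filter_upwards [key] with z hz
    exact sub_eq_zero.1 hz
  · simp only [Pi.sub_apply, mul_sub]
    have h1 := h.weak_grad i φ hφ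
    rw [integral_fderiv_mul_test (testFun_mono (subset_univ _) hφ) hu] at h1
    rw [integral_sub (h.integrable_mul_grad i hφ) (testFun_integrable_mul hl hφ)]
    rw [neg_inj.1 h1]
    simp

/-- The densities live in balls with centre at height 1/(k+1) and the same radius, so they only look
upward yet concentrate at the origin. Convolving the extension by zero is then smooth on the whole
space and has the correct gradient in the half-space. -/
theorem exists_isApproxIdentity_smooth : ∃ ρ : ℕ → Full n → ℝ,
    (∀ k, ρ k ∈ 𝓣[Full n]) ∧ (∀ k y, 0 ≤ ρ k y) ∧
      IsApproxIdentity fun k => mollMeasure volume (ρ k) := by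
  have hd : ∀ k : ℕ, (0 : ℝ) < 1 / ((k : ℝ) + 1) := fun k => by positivity
  choose ρ h1 h2 h3 using fun k : ℕ => exists_mollifier (volume : Measure (Full n))
    (((1 / ((k : ℝ) + 1) : ℝ), (0 : Bdry n)) : Full n) (hd k)
  refine ⟨ρ, fun k => testFun_mono (subset_univ _) (h1 k), h2,
    fun k => isProbabilityMeasure_mollMeasure (h1 k) (h2 k) (h3 k), fun k => ?_, fun δ hδ => ?_⟩
  · filter_upwards [ae_mollMeasure (h1 k)] with y hy
    have := (norm_fst_le (y - ((1 / ((k : ℝ) + 1) : ℝ), (0 : Bdry n)))).trans_lt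
      (mem_ball_iff_norm.1 hy)
    rw [Prod.fst_sub, Real.norm_eq_abs, abs_lt] at this
    linarith [this.1]
  · have hlim := (tendsto_one_div_add_atTop_nhds_zero_nat (𝕜 := ℝ)).eventually_lt_const
      (half_pos hδ)
    filter_upwards [hlim] with k hk
    filter_upwards [ae_mollMeasure (h1 k)] with y hy
    have h4 := mem_ball_iff_norm.1 hy
    have h5 : ‖(((1 / ((k : ℝ) + 1) : ℝ), (0 : Bdry n)) : Full n)‖ = 1 / ((k : ℝ) + 1) := by
      rw [Prod.norm_mk, norm_zero, max_eq_left (norm_nonneg _), Real.norm_of_nonneg (hd k).le]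
    have h6 := norm_le_norm_add_norm_sub' y ((1 / ((k : ℝ) + 1) : ℝ), (0 : Bdry n))
    linarith

/-- Gradients of test functions on the whole space are dense among the gradients of energy
functions. -/
theorem IsScalarEnergy.sum_integral_eq_zero (h : IsScalarEnergy u G) (hn : 1 ≤ n)
    {Ξ : Fin (n + 1) → Full n → ℝ} (hΞ : ∀ i, MemLp (Ξ i) 2 volℍ[n]) (h0 : ∀ φ ∈ 𝓣[Full n],
      ∑ i, ∫ z in ℍ[n], Ξ i z * fderiv ℝ φ z (fullDir n i) = 0) :
    ∑ i, ∫ z in ℍ[n], Ξ i z * G i z = 0 := by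
  obtain ⟨ρ, h1, h2, hν⟩ := exists_isApproxIdentity_smooth (n := n)
  have hlim := fun i => h.tendsto_approx hn i (hΞ i)
  -- The three limits are undone from the outside in. What remains is an approximation that is a
  -- test function on the whole space, where the functional vanishes by assumption.
  refine tendsto_nhds_unique (tendsto_finsetSum _ fun i _ => (hlim i).2.2)
    (tendsto_const_nhds.congr fun j => ?_)
  refine (tendsto_nhds_unique (tendsto_finsetSum _ fun i _ => (hlim i).2.1 j)
    (tendsto_const_nhds.congr fun k => ?_)).symm
  refine (tendsto_nhds_unique (tendsto_finsetSum _ fun i _ => (hlim i).1 _ hν j k)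
    (tendsto_const_nhds.congr fun l => ?_)).symm
  have := hν.prob l
  have happ := h.approx (cutoff_mem k) (y := farPoint hn j) le_rfl _ (hν.up l)
  set f := ℍ[n].indicator fun z => cutoff (Full n) k z * (u z - u (z + farPoint hn j)) with hf
  have hfL : MemLp f (ofReal 2) volume :=
    memLp_indicator_halfSpace (h.memLp_cutoff_sub (cutoff_mem k) le_rfl)
  have hfl : LocallyIntegrable f volume := hfL.locallyIntegrable (by rw [ennreal_ofReal_two]; norm_num)
  have ht : approxFun (mollMeasure volume (ρ l)) (cutoff (Full n) k) (farPoint hn j) u ∈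
      𝓣[Full n] := by
    refine ⟨contDiff_avgTranslate_mollMeasure (h1 l) (h2 l) hfl,
      hasCompactSupport_avgTranslate_mollMeasure (h1 l) (h2 l)
        (cutoff_mem (V := Full n) k).2.1.isCompact fun y hy => ?_, subset_univ _⟩
    rw [indicator_apply_eq_zero]
    intro _
    rw [image_eq_zero_of_notMem_tsupport hy, zero_mul]
  rw [← h0 _ ht]
  refine Finset.sum_congr rfl fun i _ => integral_congr_ae ?_
  filter_upwards [happ.grad_ae_eq ht i] with z hz
  rw [hz]

end Approximation

/-! ### Weighted Poincaré inequality and closedness of the space of gradients. -/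

section Poincare

theorem eLpNorm_two_sq {α E : Type*} [MeasurableSpace α] [NormedAddCommGroup E] {μ : Measure α}
    (f : α → E) : eLpNorm f 2 μ ^ 2 = ∫⁻ x, ‖f x‖ₑ ^ 2 ∂μ := by
  have := eLpNorm_nnreal_pow_eq_lintegral (f := f) (μ := μ) (p := 2) (by norm_num)
  simpa using this

/-- The variance as a double integral. -/
theorem integral_sub_mean_sq {α : Type*} [MeasurableSpace α] {κ : Measure α} [IsFiniteMeasure κ]
    (hκ : κ.real univ ≠ 0) {f : α → ℝ} (hf : MemLp f 2 κ) :
    ∫ z, (f z - (κ.real univ)⁻¹ * ∫ y, f y ∂κ) ^ 2 ∂κ =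
      (2 * κ.real univ)⁻¹ * ∫ z, ∫ y, (f z - f y) ^ 2 ∂κ ∂κ := by
  have h1 : Integrable f κ := hf.integrable (by norm_num)
  have h2 : Integrable (fun z => f z ^ 2) κ := hf.integrable_sq
  have e1 : ∀ c : ℝ, ∫ y, (c - f y) ^ 2 ∂κ =
      κ.real univ * c ^ 2 - 2 * c * ∫ y, f y ∂κ + ∫ y, f y ^ 2 ∂κ := by
    intro c
    have i1 : Integrable (fun _ : α => c ^ 2) κ := integrable_const _
    have i2 : Integrable (fun y => 2 * c * f y) κ := h1.const_mul _
    have i3 : Integrable (fun y => c ^ 2 - 2 * c * f y) κ := i1.sub i2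
    simp only [sub_sq]
    rw [integral_add i3 h2, integral_sub i1 i2, integral_const_mul, integral_const, smul_eq_mul]
  set I := ∫ y, f y ∂κ with hI
  set J := ∫ y, f y ^ 2 ∂κ with hJ
  set W := κ.real univ with hW
  have e2 : ∫ z, (W * f z ^ 2 - 2 * f z * I + J) ∂κ = W * J - 2 * I * I + W * J := by
    have i1 : Integrable (fun z => W * f z ^ 2) κ := h2.const_mul _
    have i2 : Integrable (fun z => 2 * f z * I) κ := (h1.const_mul 2).mul_const I
    have i3 : Integrable (fun z => W * f z ^ 2 - 2 * f z * I) κ := i1.sub i2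
    rw [integral_add i3 (integrable_const _), integral_sub i1 i2, integral_const_mul,
      integral_mul_const, integral_const_mul, integral_const, smul_eq_mul]
  have e3 : ∫ z, (f z - W⁻¹ * I) ^ 2 ∂κ = ∫ z, (W⁻¹ * I - f z) ^ 2 ∂κ :=
    integral_congr_ae (.of_forall fun z => by ring)
  simp only [e1]
  rw [e2, e3, e1]
  field_simp
  ring

variable {n : ℕ}

/-- The exponent of the weight in the Poincaré inequality. -/
noncomputable def weightExp (n : ℕ) : ℝ := Module.finrank ℝ (Full n) + 3

/-- The weight `(1 + |z|)^{-r}`. -/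
noncomputable def halfWeight (n : ℕ) (z : Full n) : ℝ≥0∞ := ofReal ((1 + ‖z‖) ^ (-weightExp n))

theorem measurable_halfWeight : Measurable (halfWeight n) := by unfold halfWeight; fun_prop

/-- The half-space with the weight `halfWeight`. -/
noncomputable def halfMeasure (n : ℕ) : Measure (Full n) := volℍ[n].withDensity (halfWeight n)

theorem lintegral_halfMeasure {F : Full n → ℝ≥0∞} (hF : Measurable F) : ∫⁻ z, F z ∂(halfMeasure n) =
      ∫⁻ z, ℍ[n].indicator (fun z => halfWeight n z * F z) z := by
  rw [halfMeasure, lintegral_withDensity_eq_lintegral_mul _ measurable_halfWeight hF,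
    lintegral_indicator measurableSet_halfSpace]
  rfl

instance : IsFiniteMeasure (halfMeasure n) := by
  refine ⟨?_⟩
  rw [halfMeasure, withDensity_apply _ MeasurableSet.univ, Measure.restrict_univ]
  have h1 := integrable_one_add_norm (μ := (volume : Measure (Full n))) (r := weightExp n)
    (by unfold weightExp; linarith)
  exact (h1.restrict (s := ℍ[n])).lintegral_lt_top

theorem halfMeasure_real_univ_ne_zero : (halfMeasure n).real univ ≠ 0 := by
  rw [Measure.real, ENNReal.toReal_ne_zero]
  refine ⟨?_, measure_ne_top _ _⟩
  rw [Ne, Measure.measure_univ_eq_zero, halfMeasure, withDensity_eq_zero_iff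
    measurable_halfWeight.aemeasurable]
  intro h
  have h2 : volℍ[n] = 0 := by
    rw [← Measure.measure_univ_eq_zero, ← nonpos_iff_eq_zero]
    refine (measure_mono_null (fun z _ => ?_) h).le
    simp only [Pi.zero_apply, mem_compl_iff, mem_ofPred_eq, halfWeight, ENNReal.ofReal_eq_zero,
      not_le]
    positivity
  rw [Measure.restrict_eq_zero] at h2
  refine (isOpen_halfSpace.measure_pos volume ⟨((1 : ℝ), (0 : Bdry n)), ?_⟩).ne' h2
  rw [mem_halfSpace]; exact one_pos

/-- Since h = (z + h) - z, one has 1 + |h| ≤ (1 + |z|)(1 + |z + h|). The product of two weights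
therefore decays in the difference of the points. -/
theorem halfWeight_mul_le (z h : Full n) :
    halfWeight n z * halfWeight n (z + h) ≤ ofReal ((1 + ‖h‖) ^ (-weightExp n)) := by
  have hz : (0 : ℝ) < 1 + ‖z‖ := by positivity
  have hzh : (0 : ℝ) < 1 + ‖z + h‖ := by positivity
  have hh : (0 : ℝ) < 1 + ‖h‖ := by positivity
  rw [halfWeight, halfWeight, ← ENNReal.ofReal_mul (by positivity), ← Real.mul_rpow hz.le hzh.le]
  refine ENNReal.ofReal_le_ofReal (Real.rpow_le_rpow_of_nonpos hh ?_ ?_)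
  · have h1 : ‖h‖ ≤ ‖z + h‖ + ‖z‖ := by
      have := norm_sub_le (z + h) z
      rwa [add_sub_cancel_left] at this
    nlinarith [norm_nonneg z, norm_nonneg (z + h)]
  · unfold weightExp
    have : (0 : ℝ) ≤ Module.finrank ℝ (Full n) := Nat.cast_nonneg _
    linarith

/-- The weighted Poincaré inequality in the half-space. -/
theorem exists_poincare (n : ℕ) : ∃ C : ℝ≥0∞, C ≠ ⊤ ∧ ∀ φ : Full n → ℝ, φ ∈ 𝓣[Full n] →
      eLpNorm (fun z => φ z - ((halfMeasure n).real univ)⁻¹ * ∫ y, φ y ∂(halfMeasure n)) 2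
        (halfMeasure n) ≤
      C * ∑ i, eLpNorm 𝐃[φ,fullDir n i] 2 volℍ[n] := by
  set H : Set (Full n) := ℍ[n] with hH
  set κ := halfMeasure n with hκ
  set W := κ.real univ with hW
  have hW0 : W ≠ 0 := halfMeasure_real_univ_ne_zero
  have hWpos : 0 < W := lt_of_le_of_ne measureReal_nonneg hW0.symm
  -- The translation estimate produces |h|², which lowers the decay exponent from dimension + 3 to
  -- dimension + 1; this is still integrable and dictates the choice of `weightExp`.
  set Z : ℝ≥0∞ := ∫⁻ h : Full n, ofReal ((1 + ‖h‖) ^ (-(weightExp n - 2))) with hZ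
  have hZt : Z ≠ ⊤ := by
    have h1 := integrable_one_add_norm (μ := (volume : Measure (Full n))) (r := weightExp n - 2)
      (by unfold weightExp; linarith)
    exact h1.lintegral_lt_top.ne
  set D : ℝ≥0∞ := ofReal ((2 * W)⁻¹) * Z with hD
  have hDt : D ≠ ⊤ := ENNReal.mul_ne_top ENNReal.ofReal_ne_top hZt
  -- The estimate is proved for squares with constant D, and D ≤ (D + 1)²; thus D + 1 avoids a
  -- square root.
  refine ⟨D + 1, ENNReal.add_ne_top.2 ⟨hDt, ENNReal.one_ne_top⟩, fun φ hφ => ?_⟩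
  set S := ∑ i, eLpNorm 𝐃[φ,fullDir n i] 2 (volume.restrict H) with hS
  have hφc := testFun_continuous hφ
  have hen : IsScalarEnergy φ fun i z => fderiv ℝ φ z (fullDir n i) := by
    refine IsScalarEnergy.of_memLp (testFun_memLp hφ 2) (fun i => testFun_memLp
      (testFun_fderiv hφ _) 2) fun i ψ hψ => integral_fderiv_mul_test
        (testFun_mono (subset_univ _) hψ) hφ _
  have htr : ∀ h : Full n, ∫⁻ z in H ∩ (fun z => z + h) ⁻¹' H, ‖φ (z + h) - φ z‖ₑ ^ 2 ≤
      (ofReal ‖h‖ * S) ^ 2 := by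
    intro h
    rw [← eLpNorm_two_sq (fun z => φ (z + h) - φ z)]
    exact pow_le_pow_left' (hen.memLp_translate_sub h).2 2
  set w := H.indicator fun z => halfWeight n z with hw
  have hmeas : Measurable fun x : Full n × Full n => w x.1 * w x.2 * ‖φ x.2 - φ x.1‖ₑ ^ 2 := by
    have h1 : Measurable w := measurable_halfWeight.indicator measurableSet_halfSpace
    have h2 : Measurable fun x : Full n × Full n => ‖φ x.2 - φ x.1‖ₑ ^ 2 := by
      have : Continuous fun x : Full n × Full n => φ x.2 - φ x.1 := by fun_prop
      exact (this.measurable.enorm).pow_const 2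
    exact ((h1.comp measurable_fst).mul (h1.comp measurable_snd)).mul h2
  have hdbl : ∫⁻ z, ∫⁻ y, ‖φ y - φ z‖ₑ ^ 2 ∂κ ∂κ ≤ Z * S ^ 2 := by
    have m1 : ∀ z, Measurable fun y => ‖φ y - φ z‖ₑ ^ 2 := fun z =>
      ((hφc.sub continuous_const).measurable.enorm).pow_const 2
    have m2 : Measurable fun z => ∫⁻ y, ‖φ y - φ z‖ₑ ^ 2 ∂κ := by
      have : Continuous fun x : Full n × Full n => φ x.2 - φ x.1 := by fun_prop
      exact ((this.measurable.enorm).pow_const 2).lintegral_prod_right'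
    have e1 : ∫⁻ z, ∫⁻ y, ‖φ y - φ z‖ₑ ^ 2 ∂κ ∂κ = ∫⁻ z, ∫⁻ y, w z * w y * ‖φ y - φ z‖ₑ ^ 2 := by
      rw [lintegral_halfMeasure m2]
      refine lintegral_congr fun z => ?_
      by_cases hz : z ∈ H
      · rw [hw, indicator_of_mem hz, lintegral_halfMeasure (m1 z)]
        have m3 : Measurable fun y => H.indicator (fun y => halfWeight n y * ‖φ y - φ z‖ₑ ^ 2) y :=
          (measurable_halfWeight.mul (m1 z)).indicator measurableSet_halfSpace
        refine (lintegral_const_mul _ m3).symm.trans (lintegral_congr fun y => ?_)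
        by_cases hy : y ∈ H
        · rw [indicator_of_mem hy, indicator_of_mem hz, indicator_of_mem hy, mul_assoc]
        · rw [indicator_of_notMem hy, indicator_of_notMem hy, mul_zero, mul_zero, zero_mul]
      · rw [hw, indicator_of_notMem hz, indicator_of_notMem hz]
        simp
    -- Substituting y = z + h turns the double integral into an integral over h of squared norms of
    -- u(· + h) - u type differences, to which the translation estimate for energy functions
    -- applies.
    have e2 : ∀ z, ∫⁻ y, w z * w y * ‖φ y - φ z‖ₑ ^ 2 = ∫⁻ h, w z *
          w (z + h) * ‖φ (z + h) - φ z‖ₑ ^ 2 := fun z =>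
      (lintegral_add_left_eq_self (μ := (volume : Measure (Full n))) (fun y => w z *
          w y * ‖φ y - φ z‖ₑ ^ 2) z).symm
    rw [e1]
    simp only [e2]
    rw [lintegral_lintegral_swap]
    · rw [hZ, ← lintegral_mul_const _ (by fun_prop)]
      refine lintegral_mono fun h => ?_
      calc ∫⁻ z, w z *
            w (z + h) * ‖φ (z + h) - φ z‖ₑ ^ 2
          ≤ ∫⁻ z, (H ∩ (fun z => z + h) ⁻¹' H).indicator (fun z =>
              ofReal ((1 + ‖h‖) ^ (-weightExp n)) * ‖φ (z + h) - φ z‖ₑ ^ 2) z := by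
            refine lintegral_mono fun z => ?_
            by_cases hz : z ∈ H
            · by_cases hzh : z + h ∈ H
              · rw [hw, indicator_of_mem hz, indicator_of_mem hzh,
                  indicator_of_mem (show z ∈ H ∩ (fun z => z + h) ⁻¹' H from ⟨hz, hzh⟩)]
                gcongr
                exact halfWeight_mul_le z h
              · simp [hw, hzh]
            · simp [hw, hz]
        _ = ofReal ((1 + ‖h‖) ^ (-weightExp n)) *
            ∫⁻ z in H ∩ (fun z => z + h) ⁻¹' H, ‖φ (z + h) - φ z‖ₑ ^ 2 := by
            rw [lintegral_indicator (measurableSet_halfSpace.inter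
              ((measurable_add_const h) measurableSet_halfSpace)), lintegral_const_mul]
            exact (((hφc.comp (continuous_add_const h)).sub hφc).measurable.enorm).pow_const 2
        _ ≤ ofReal ((1 + ‖h‖) ^ (-weightExp n)) * (ofReal ‖h‖ * S) ^ 2 := by gcongr; exact htr h
        _ ≤ ofReal ((1 + ‖h‖) ^ (-(weightExp n - 2))) * S ^ 2 := by
            rw [mul_pow, ← mul_assoc]
            gcongr
            rw [← ENNReal.ofReal_pow (norm_nonneg h), ← ENNReal.ofReal_mul (by positivity)]
            refine ENNReal.ofReal_le_ofReal ?_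
            have h1 : (0 : ℝ) < 1 + ‖h‖ := by positivity
            rw [show -(weightExp n - 2) = -weightExp n + (2 : ℕ) by push_cast; ring,
              Real.rpow_add_natCast h1.ne']
            gcongr
            linarith
    · have h3 : Measurable fun x : Full n × Full n => (x.1, x.1 + x.2) := by fun_prop
      exact (hmeas.comp h3).aemeasurable
  have hφ2 : MemLp φ 2 κ := by
    obtain ⟨B, hB⟩ := hφc.bounded_above_of_compact_support hφ.2.1
    exact MemLp.of_bound hφc.aestronglyMeasurable B (.of_forall hB)
  have hvar := integral_sub_mean_sq hW0 hφ2
  set c := W⁻¹ * ∫ y, φ y ∂κ with hc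
  have hsq : ∀ x : ℝ, ‖x‖ₑ ^ 2 = ofReal (x ^ 2) := by
    intro x
    rw [← ofReal_norm, ← ENNReal.ofReal_pow (norm_nonneg _), Real.norm_eq_abs, sq_abs]
  have hI : ∀ z, ofReal (∫ y, (φ z - φ y) ^ 2 ∂κ) = ∫⁻ y, ‖φ y - φ z‖ₑ ^ 2 ∂κ := by
    intro z
    have hm : MemLp (fun y => φ z - φ y) 2 κ := (memLp_const (φ z)).sub hφ2
    rw [ofReal_integral_eq_lintegral_ofReal hm.integrable_sq (.of_forall fun y => sq_nonneg _)]
    refine lintegral_congr fun y => ?_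
    rw [hsq, ← neg_sub, neg_sq]
  have hfin : eLpNorm (fun z => φ z - c) 2 κ ^ 2 ≤ D * S ^ 2 := by
    have hm : MemLp (fun z => φ z - c) 2 κ := hφ2.sub (memLp_const _)
    have e1 : eLpNorm (fun z => φ z - c) 2 κ ^ 2 = ofReal (∫ z, (φ z - c) ^ 2 ∂κ) := by
      rw [eLpNorm_two_sq, ofReal_integral_eq_lintegral_ofReal hm.integrable_sq
        (.of_forall fun y => sq_nonneg _)]
      exact lintegral_congr fun z => hsq _
    rw [e1, hvar, ENNReal.ofReal_mul (by positivity), hD, mul_assoc]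
    gcongr
    refine le_trans ?_ hdbl
    refine (ENNReal.ofReal_le_ofReal (le_abs_self _)).trans ?_
    rw [← Real.norm_eq_abs, ofReal_norm]
    refine (enorm_integral_le_lintegral_enorm _).trans (lintegral_mono fun z => ?_)
    rw [← hI, ← ofReal_norm, Real.norm_of_nonneg (integral_nonneg fun y => sq_nonneg _)]
  have h5 : eLpNorm (fun z => φ z - c) 2 κ ^ 2 ≤ ((D + 1) * S) ^ 2 := by
    refine hfin.trans ?_
    rw [mul_pow]
    gcongr
    calc D ≤ D + 1 := le_self_add
      _ = (D + 1) * 1 := (mul_one _).symm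
      _ ≤ (D + 1) * (D + 1) := by gcongr; exact le_add_self
      _ = (D + 1) ^ 2 := (pow_two _).symm
  exact (ENNReal.pow_le_pow_left_iff (by norm_num)).1 h5

/-- The weight is bounded below on bounded sets, so convergence in the weighted L² norm implies
local L² convergence. -/
theorem restrict_le_smul_halfMeasure {K : Set (Full n)} (hK : IsCompact K) (hKH : K ⊆ ℍ[n]) :
    ∃ C : ℝ≥0∞, C ≠ ⊤ ∧ volume.restrict K ≤ C • halfMeasure n := by
  obtain ⟨R, hR⟩ := hK.isBounded.exists_norm_le
  set c : ℝ := (1 + |R|) ^ (-weightExp n) with hc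
  have hc0 : 0 < c := by positivity
  refine ⟨ofReal c⁻¹, ENNReal.ofReal_ne_top, ?_⟩
  refine Measure.le_iff.2 fun s hs => ?_
  rw [Measure.restrict_apply hs, Measure.smul_apply, smul_eq_mul, halfMeasure,
    withDensity_apply _ hs, ← setLIntegral_one, ← lintegral_const_mul _ measurable_halfWeight,
    Measure.restrict_restrict hs]
  refine (lintegral_mono_ae ?_).trans (lintegral_mono_set (inter_subset_inter_right s hKH))
  rw [ae_restrict_iff' (hs.inter hK.measurableSet)]
  refine .of_forall fun z hz => ?_
  rw [halfWeight, ← ENNReal.ofReal_mul (by positivity), ← ENNReal.ofReal_one]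
  refine ENNReal.ofReal_le_ofReal ?_
  rw [inv_mul_eq_div, one_le_div hc0]
  refine Real.rpow_le_rpow_of_nonpos (by positivity) ?_ ?_
  · linarith [hR z hz.2, le_abs_self R]
  · unfold weightExp
    have : (0 : ℝ) ≤ Module.finrank ℝ (Full n) := Nat.cast_nonneg _
    linarith

/-- The space of gradients of energy functions is closed. -/
theorem exists_isScalarEnergy_of_tendsto {φ : ℕ → Full n → ℝ}
    (hφ : ∀ k, φ k ∈ 𝓣[Full n]) {G : Fin (n + 1) → Full n → ℝ} (hG : ∀ i, MemLp (G i) 2 volℍ[n])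
    (hlim : ∀ i, Tendsto (fun k => eLpNorm (fun z => fderiv ℝ (φ k) z (fullDir n i) - G i z) 2
      volℍ[n]) atTop (𝓝 0)) :
    ∃ u, IsScalarEnergy u G := by
  obtain ⟨C, hC, hP⟩ := exists_poincare n
  set κ := halfMeasure n with hκ
  -- Convergence of gradients determines the functions only up to constants. After subtracting
  -- weighted means, the Poincaré inequality makes the sequence Cauchy in the weighted L² space.
  set c : ℕ → ℝ := fun k => (κ.real univ)⁻¹ * ∫ y, φ k y ∂κ with hc
  have hφc := fun k => testFun_continuous (hφ k)
  have hφ2 : ∀ k, MemLp (φ k) 2 κ := fun k => by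
    obtain ⟨B, hB⟩ := (hφc k).bounded_above_of_compact_support (hφ k).2.1
    exact MemLp.of_bound (hφc k).aestronglyMeasurable B (.of_forall hB)
  have hf : ∀ k, MemLp (fun z => φ k z - c k) 2 κ := fun k => (hφ2 k).sub (memLp_const _)
  set a : ℕ → ℝ≥0∞ := fun k => ∑ i, eLpNorm (fun z => fderiv ℝ (φ k) z (fullDir n i) - G i z) 2
      volℍ[n] with ha
  have halim : Tendsto a atTop (𝓝 0) := by
    have := tendsto_finsetSum (Finset.univ : Finset (Fin (n + 1))) fun i _ => hlim i
    simpa using this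
  have hdist : ∀ k l, eLpNorm ((fun z => φ k z - c k) - fun z => φ l z - c l) 2 κ ≤
      C * (a k + a l) := by
    intro k l
    have h1 := hP _ ((testFun univ).sub_mem (hφ k) (hφ l))
    have e1 : ((fun z => φ k z - c k) - fun z => φ l z - c l) = fun z => (φ k - φ l) z -
        (κ.real univ)⁻¹ * ∫ y, (φ k - φ l) y ∂κ := by
      ext z
      simp only [Pi.sub_apply, hc]
      rw [integral_sub ((hφ2 k).integrable (by norm_num)) ((hφ2 l).integrable (by norm_num))]
      ring
    rw [e1]
    refine h1.trans ?_
    gcongr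
    rw [ha]
    simp only
    rw [← Finset.sum_add_distrib]
    refine Finset.sum_le_sum fun i _ => ?_
    have e2 : 𝐃[φ k - φ l,fullDir n i] = (fun z => fderiv ℝ (φ k) z (fullDir n i) - G i z) -
          fun z => fderiv ℝ (φ l) z (fullDir n i) - G i z := by
      ext z
      rw [fderiv_sub (testFun_differentiable (hφ k) z) (testFun_differentiable (hφ l) z)]
      simp
    rw [e2]
    have hm : ∀ k, MemLp (fun z => fderiv ℝ (φ k) z (fullDir n i) - G i z) 2 volℍ[n] := fun k =>
      MemLp.sub (testFun_memLp (testFun_fderiv (hφ k) _) 2) (hG i)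
    exact eLpNorm_sub_le (hm k).1 (hm l).1 (by norm_num)
  -- the limit
  have hcau : CauchySeq fun k => (hf k).toLp := by
    rw [EMetric.cauchySeq_iff]
    intro ε hε
    have h2 : Tendsto (fun k => C * (a k + a k)) atTop (𝓝 0) := by
      have := ENNReal.Tendsto.const_mul (a := C) (halim.add halim) (Or.inr hC)
      simpa using this
    have h3 : Tendsto (fun k => C * a k) atTop (𝓝 0) := by
      have := ENNReal.Tendsto.const_mul (a := C) halim (Or.inr hC)
      simpa using this
    obtain ⟨N, hN⟩ := eventually_atTop.1 (h3.eventually (gt_mem_nhds (ENNReal.half_pos hε.ne')))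
    refine ⟨N, fun k hk l hl => ?_⟩
    rw [Lp.edist_toLp_toLp]
    refine (hdist k l).trans_lt ?_
    rw [mul_add, ← ENNReal.add_halves ε]
    exact ENNReal.add_lt_add (hN k hk) (hN l hl)
  obtain ⟨U, hU⟩ := cauchySeq_tendsto_of_complete hcau
  have hUL : MemLp U 2 κ := Lp.memLp U
  have hUlim : Tendsto (fun k => eLpNorm ((fun z => φ k z - c k) - ⇑U) 2 κ) atTop (𝓝 0) := by
    rw [tendsto_iff_edist_tendsto_0] at hU
    refine hU.congr fun k => ?_
    conv_lhs => rw [← Lp.toLp_coeFn U hUL]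
    rw [Lp.edist_toLp_toLp]
  refine ⟨U, fun K hK hKH => ?_, hG, fun i ψ hψ => ?_⟩
  · obtain ⟨D, hD, hle⟩ := restrict_le_smul_halfMeasure hK hKH
    exact hUL.of_measure_le_smul hD hle
  · have hKc : IsCompact (tsupport ψ) := hψ.2.1
    obtain ⟨D, hD, hle⟩ := restrict_le_smul_halfMeasure hKc hψ.2.2
    have hUK : MemLp (⇑U) 2 (volume.restrict (tsupport ψ)) := hUL.of_measure_le_smul hD hle
    have hfK : ∀ k, MemLp (fun z => φ k z - c k) 2 (volume.restrict (tsupport ψ)) := fun k =>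
      (hf k).of_measure_le_smul hD hle
    have hKlim : Tendsto (fun k => eLpNorm ((fun z => φ k z - c k) - ⇑U) 2
        (volume.restrict (tsupport ψ))) atTop (𝓝 0) := by
      have h4 : Tendsto (fun k => D ^ (1 / (2 : ℝ≥0∞)).toReal *
          eLpNorm ((fun z => φ k z - c k) - ⇑U) 2 κ) atTop (𝓝 0) := by
        have := ENNReal.Tendsto.const_mul (a := D ^ (1 / (2 : ℝ≥0∞)).toReal) hUlim
          (Or.inr (ENNReal.rpow_ne_top_of_nonneg (by positivity) hD))
        simpa using this
      refine tendsto_of_tendsto_of_tendsto_of_le_of_le tendsto_const_nhds h4 (fun _ => zero_le)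
        fun k => ?_
      refine (eLpNorm_mono_measure _ hle).trans ?_
      rcases eq_or_ne D 0 with h0 | h0
      · simp [h0]
      · rw [eLpNorm_smul_measure_of_ne_zero h0, smul_eq_mul]
    have hψ' := testFun_fderiv hψ (fullDir n i)
    have hconv : ∀ {g : Full n → ℝ} {F : ℕ → Full n → ℝ} {f : Full n → ℝ} {s : Set (Full n)},
        g ∈ testFun ℍ[n] → tsupport g ⊆ s → MeasurableSet s →
        (∀ k, MemLp (F k) 2 (volume.restrict s)) →
        MemLp f 2 (volume.restrict s) →
        Tendsto (fun k => eLpNorm (F k - f) 2 (volume.restrict s)) atTop (𝓝 0) →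
        Tendsto (fun k => ∫ z, g z * F k z) atTop (𝓝 (∫ z, g z * f z)) := by
      intro g F f s hg hgs hs hF hfm hl
      have hgL : MemLp g 2 (volume.restrict s) := testFun_memLp hg 2
      have e3 : ∀ f : Full n → ℝ, ∫ z, g z * f z = ∫ z in s, g z * f z := by
        intro f
        rw [setIntegral_eq_integral_of_forall_compl_eq_zero]
        intro z hz
        rw [image_eq_zero_of_notMem_tsupport fun h => hz (hgs h), zero_mul]
      simp only [e3]
      rw [tendsto_iff_norm_sub_tendsto_zero]
      have h5 : Tendsto (fun k => (eLpNorm g 2 (volume.restrict s)).toReal *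
          (eLpNorm (F k - f) 2 (volume.restrict s)).toReal) atTop (𝓝 0) := by
        have := ((ENNReal.tendsto_toReal ENNReal.zero_ne_top).comp hl).const_mul
          (eLpNorm g 2 (volume.restrict s)).toReal
        simpa using this
      refine squeeze_zero (fun k => norm_nonneg _) (fun k => ?_) h5
      have h6 := abs_integral_mul_le holderConjugate_two (μ := volume.restrict s)
        (f := g) (g := F k - f) (by rwa [ennreal_ofReal_two])
        (by rw [ennreal_ofReal_two]; exact (hF k).sub hfm)
      rw [ennreal_ofReal_two] at h6
      rw [← integral_sub (integrable_mul_two hgL (hF k)) (integrable_mul_two hgL hfm)]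
      simp only [Pi.sub_apply, mul_sub] at h6
      exact h6
    have l1 := hconv hψ' (tsupport_fderiv_apply_subset ℝ _) (isClosed_tsupport ψ).measurableSet
      hfK hUK hKlim
    have l2 := (hconv hψ hψ.2.2 measurableSet_halfSpace (fun k =>
      testFun_memLp (testFun_fderiv (hφ k) (fullDir n i)) 2) (hG i) (hlim i)).neg
    refine tendsto_nhds_unique l1 (l2.congr fun k => ?_)
    have hψu : ψ ∈ 𝓣[Full n] := testFun_mono (subset_univ _) hψ
    rw [← integral_fderiv_mul_test hψu (hφ k)]
    simp only [mul_sub]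
    have i1 : Integrable (fun z => fderiv ℝ ψ z (fullDir n i) * φ k z) volume :=
      testFun_integrable_mul ((hφc k).locallyIntegrable.locallyIntegrableOn _) hψ'
    have i2 : Integrable 𝐃[ψ,fullDir n i] volume := memLp_one_iff_integrable.1 (testFun_memLp hψ' 1)
    rw [integral_sub i1 (i2.mul_const _), integral_mul_const]
    -- The subtracted constants do not affect the weak gradient: the derivative of ψ integrates to
    -- zero, being the derivative of the translation invariant quantity ∫ ψ(z + s e).
    have h0 : ∫ z, fderiv ℝ ψ z (fullDir n i) = 0 := by
      have h7 := hasDerivAt_integral_translate (μ := (volume : Measure (Full n)))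
        (w := fun _ => (1 : ℝ)) (continuous_const.locallyIntegrable) hψu (fullDir n i) 0
      simp only [mul_one, integral_add_right_eq_self, zero_smul, add_zero] at h7
      exact h7.unique (hasDerivAt_const _ _)
    rw [h0, zero_mul, sub_zero]

end Poincare

/-! ### Vertical primitives of square integrable functions. -/

section VerticalPrimitive

theorem enorm_setIntegral_sq_le {g : ℝ → ℝ} (hg : AEStronglyMeasurable g volume) {s t : ℝ} :
    ‖∫ r in Ioc s t, g r‖ₑ ^ 2 ≤ ofReal (t - s) * ∫⁻ r, ‖g r‖ₑ ^ 2 := by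
  have h1 : ‖∫ r in Ioc s t, g r‖ₑ ≤ eLpNorm g 1 (volume.restrict (Ioc s t)) := by
    rw [eLpNorm_one_eq_lintegral_enorm]
    exact enorm_integral_le_lintegral_enorm _
  have h2 := eLpNorm_le_eLpNorm_mul_rpow_measure_univ (μ := volume.restrict (Ioc s t)) (p := 1)
    (q := 2) (f := g) (by norm_num) hg.restrict
  have h3 : (1 / (1 : ℝ≥0∞).toReal - 1 / (2 : ℝ≥0∞).toReal) = (1 / 2 : ℝ) := by norm_num
  rw [h3] at h2
  refine (pow_le_pow_left' (h1.trans h2) 2).trans ?_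
  rw [mul_pow, eLpNorm_two_sq, ← ENNReal.rpow_natCast (_ ^ (1 / 2 : ℝ)), ← ENNReal.rpow_mul,
    Measure.restrict_apply MeasurableSet.univ, univ_inter, Real.volume_Ioc, mul_comm]
  norm_num
  gcongr
  exact Measure.restrict_le_self

/-- Fubini on the region 0 < s ≤ t, with the integral of b' over (s, ∞) equal to -b(s). There is no
boundary term, although b need not vanish at 0, because the primitive does. -/
theorem integral_deriv_mul_primitive {b g : ℝ → ℝ} (hb : ContDiff ℝ 1 b) (hbc : HasCompactSupport b)
    (hg : MemLp g 2 volume) :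
    ∫ t in Ioi 0, deriv b t * ∫ s in Ioc 0 t, g s = - ∫ t in Ioi 0, b t * g t := by
  have hb' : Continuous (deriv b) := hb.continuous_deriv le_rfl
  obtain ⟨T, hT⟩ := hbc.deriv.isCompact.isBounded.exists_norm_le
  have hout : ∀ t, T < t → deriv b t = 0 := fun t ht => by
    by_contra h
    have := hT t (subset_tsupport _ h)
    rw [Real.norm_eq_abs] at this
    linarith [le_abs_self t]
  have hgi : IntegrableOn g (Ioc 0 T) := by
    have : MemLp g 2 (volume.restrict (Ioc 0 T)) := hg.restrict _
    exact this.integrable (by norm_num)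
  have hbi : IntegrableOn (deriv b) (Ioi 0) :=
    (hb'.integrable_of_hasCompactSupport hbc.deriv).integrableOn
  have hprod := hbi.mul_prod hgi
  have hset : MeasurableSet {x : ℝ × ℝ | x.2 ≤ x.1} := measurableSet_le measurable_snd measurable_fst
  have hind := hprod.indicator hset
  have e1 : ∀ t, deriv b t * ∫ s in Ioc 0 t, g s =
      ∫ s in Ioc 0 T, {x : ℝ × ℝ | x.2 ≤ x.1}.indicator (fun x => deriv b x.1 * g x.2) (t, s) := by
    intro t
    rcases lt_or_ge T t with h | h
    · rw [hout t h, zero_mul]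
      refine (integral_eq_zero_of_ae (.of_forall fun s => ?_)).symm
      by_cases hs : (t, s) ∈ {x : ℝ × ℝ | x.2 ≤ x.1}
      · rw [indicator_of_mem hs]; simp [hout t h]
      · rw [indicator_of_notMem hs]; rfl
    · rw [← integral_const_mul, ← integral_indicator measurableSet_Ioc,
        ← integral_indicator measurableSet_Ioc]
      refine integral_congr_ae (.of_forall fun s => ?_)
      simp only [indicator_apply, mem_Ioc, mem_ofPred_eq]
      by_cases h0 : 0 < s
      · by_cases hst : s ≤ t
        · simp [h0, hst, hst.trans h]
        · simp [hst]
      · simp [h0]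
  have e2 : ∀ s ∈ Ioc 0 T, ∫ t in Ioi 0,
      {x : ℝ × ℝ | x.2 ≤ x.1}.indicator (fun x => deriv b x.1 * g x.2) (t, s) = -(b s * g s) := by
    intro s hs
    have e3 : ∫ t in Ioi 0,
        {x : ℝ × ℝ | x.2 ≤ x.1}.indicator (fun x => deriv b x.1 * g x.2) (t, s) =
        ∫ t in Ici s, deriv b t * g s := by
      rw [← integral_indicator measurableSet_Ioi, ← integral_indicator measurableSet_Ici]
      refine integral_congr_ae (.of_forall fun t => ?_)
      simp only [indicator_apply, mem_Ioi, mem_Ici, mem_ofPred_eq]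
      by_cases hst : s ≤ t
      · simp [hst, hs.1.trans_le hst]
      · simp [hst]
    rw [e3, integral_mul_const, integral_Ici_eq_integral_Ioi, hbc.integral_Ioi_deriv_eq hb, neg_mul]
  simp only [e1]
  rw [integral_integral_swap (f := fun t s => {x : ℝ × ℝ | x.2 ≤ x.1}.indicator
    (fun x => deriv b x.1 * g x.2) (t, s)) hind, setIntegral_congr_fun measurableSet_Ioc e2, integral_neg]
  congr 1
  have hout2 : ∀ t, T < t → b t = 0 := by
    intro t ht
    have h1 := hbc.integral_Ioi_deriv_eq hb t
    have h2 : ∫ x in Ioi t, deriv b x = 0 := by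
      refine (setIntegral_congr_fun measurableSet_Ioi (g := fun _ => 0) fun x hx => ?_).trans
        (by simp)
      exact hout x (ht.trans hx)
    linarith
  refine (setIntegral_eq_of_subset_of_forall_sdiff_eq_zero measurableSet_Ioi
    (fun x hx => hx.1) fun x hx => ?_).symm
  have : T < x := by
    by_contra h
    exact hx.2 ⟨hx.1, not_lt.1 h⟩
  rw [hout2 x this, zero_mul]

variable {n : ℕ}

theorem restrict_halfSpace : (volume : Measure (Full n)).restrict ℍ[n] =
    (volume.restrict (Ioi (0 : ℝ))).prod volume := by
  have : ℍ[n] = Ioi (0 : ℝ) ×ˢ univ := by ext z; simp [halfSpace]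
  rw [this, Measure.volume_eq_prod, ← Measure.prod_restrict, Measure.restrict_univ]

/-- The vertical primitive of a function. -/
noncomputable def vint (g : Full n → ℝ) (z : Full n) : ℝ := ∫ s in Ioc 0 z.1, g (s, z.2)

variable {g : Full n → ℝ}

theorem stronglyMeasurable_vint (hg : StronglyMeasurable g) : StronglyMeasurable (vint g) := by
  have hset : MeasurableSet {x : Full n × ℝ | 0 < x.2 ∧ x.2 ≤ x.1.1} :=
    (measurableSet_lt measurable_const measurable_snd).inter
      (measurableSet_le measurable_snd measurable_fst.fst)
  have h1 : StronglyMeasurable fun x : Full n × ℝ => g (x.2, x.1.2) :=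
    hg.comp_measurable (measurable_snd.prodMk measurable_fst.snd)
  have h2 := (h1.indicator hset).integral_prod_right' (ν := (volume : Measure ℝ))
  convert h2 using 1
  ext z
  rw [vint, ← integral_indicator measurableSet_Ioc]
  rfl

theorem vint_zero (x : Bdry n) : vint g (0, x) = 0 := by simp [vint]

theorem ae_memLp_section (hg : StronglyMeasurable g) (hg2 : MemLp g 2 volume) :
    ∀ᵐ x : Bdry n, MemLp (fun s : ℝ => g (s, x)) 2 volume := by
  have h1 : ∫⁻ x : Bdry n, ∫⁻ s : ℝ, ‖g (s, x)‖ₑ ^ 2 ≠ ⊤ := by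
    rw [← lintegral_prod_symm' (fun z : ℝ × Bdry n => ‖g z‖ₑ ^ 2)
      ((hg.measurable.enorm).pow_const 2), ← Measure.volume_eq_prod, ← eLpNorm_two_sq]
    exact ENNReal.pow_ne_top hg2.2.ne
  have h2 : Measurable fun x : Bdry n => ∫⁻ s : ℝ, ‖g (s, x)‖ₑ ^ 2 :=
    ((hg.measurable.enorm).pow_const 2).lintegral_prod_left'
  filter_upwards [ae_lt_top h2 h1] with x hx
  refine ⟨(hg.comp_measurable (by fun_prop)).aestronglyMeasurable, ?_⟩
  rw [← eLpNorm_two_sq] at hx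
  exact lt_top_iff_ne_top.2 fun h => by simp [h] at hx

/-- Cauchy–Schwarz on each vertical segment. This is the Hölder continuity of order 1/2 in t with
values in L², from which continuity of traces follows. -/
theorem eLpNorm_vint_sub_sq_le (hg : StronglyMeasurable g) (hg2 : MemLp g 2 volume) {s t : ℝ}
    (hs : 0 ≤ s) (hst : s ≤ t) :
    eLpNorm (fun x : Bdry n => vint g (t, x) - vint g (s, x)) 2 volume ^ 2 ≤
      ofReal (t - s) * eLpNorm g 2 volume ^ 2 := by
  rw [eLpNorm_two_sq, eLpNorm_two_sq]
  have hm : Measurable fun z : ℝ × Bdry n => ‖g z‖ₑ ^ 2 := (hg.measurable.enorm).pow_const 2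
  calc ∫⁻ x : Bdry n, ‖vint g (t, x) - vint g (s, x)‖ₑ ^ 2
      ≤ ∫⁻ x : Bdry n, ofReal (t - s) * ∫⁻ r : ℝ, ‖g (r, x)‖ₑ ^ 2 := by
        refine lintegral_mono_ae ?_
        filter_upwards [ae_memLp_section hg hg2] with x hx
        have hi : ∀ a b, IntegrableOn (fun s : ℝ => g (s, x)) (Ioc a b) := fun a b => by
          have : MemLp (fun s : ℝ => g (s, x)) 2 (volume.restrict (Ioc a b)) := hx.restrict _
          exact this.integrable (by norm_num)
        have e : vint g (t, x) - vint g (s, x) = ∫ r in Ioc s t, g (r, x) := by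
          simp only [vint]
          rw [← Ioc_union_Ioc_eq_Ioc hs hst, setIntegral_union
            (Ioc_disjoint_Ioc_of_le le_rfl) measurableSet_Ioc (hi _ _) (hi _ _)]
          ring
        rw [e]
        exact enorm_setIntegral_sq_le hx.1
    _ = ofReal (t - s) * ∫⁻ z, ‖g z‖ₑ ^ 2 := by
        rw [lintegral_const_mul _ hm.lintegral_prod_left', Measure.volume_eq_prod,
          lintegral_prod_symm' _ hm]

theorem eLpNorm_vint_sq_le (hg : StronglyMeasurable g) (hg2 : MemLp g 2 volume) {t : ℝ}
    (ht : 0 ≤ t) : eLpNorm (fun x : Bdry n => vint g (t, x)) 2 volume ^ 2 ≤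
      ofReal t * eLpNorm g 2 volume ^ 2 := by
  have := eLpNorm_vint_sub_sq_le hg hg2 le_rfl ht
  simpa [vint_zero] using this

theorem memLp_vint_section (hg : StronglyMeasurable g) (hg2 : MemLp g 2 volume) {t : ℝ}
    (ht : 0 ≤ t) : MemLp (fun x : Bdry n => vint g (t, x)) 2 volume := by
  refine ⟨((stronglyMeasurable_vint hg).comp_measurable (by fun_prop)).aestronglyMeasurable, ?_⟩
  have h := eLpNorm_vint_sq_le hg hg2 ht
  refine lt_top_iff_ne_top.2 fun h1 => ?_
  rw [h1] at h
  simp only [ne_eq, OfNat.ofNat_ne_zero, not_false_eq_true, ENNReal.top_pow, top_le_iff] at h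
  exact ENNReal.mul_ne_top ENNReal.ofReal_ne_top (ENNReal.pow_ne_top hg2.2.ne) h

theorem memLp_vint (hg : StronglyMeasurable g) (hg2 : MemLp g 2 volume) {K : Set (Full n)}
    (hK : IsCompact K) : MemLp (vint g) 2 (volume.restrict (ℍ[n] ∩ K)) := by
  refine ⟨(stronglyMeasurable_vint hg).aestronglyMeasurable, ?_⟩
  obtain ⟨R, hR⟩ := hK.isBounded.exists_norm_le
  have hm : Measurable fun z : ℝ × Bdry n => ‖vint g z‖ₑ ^ 2 :=
    ((stronglyMeasurable_vint hg).measurable.enorm).pow_const 2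
  have hsub : ℍ[n] ∩ K ⊆ Ioc 0 R ×ˢ univ := fun z hz =>
    ⟨⟨hz.1, (le_abs_self _).trans ((norm_fst_le z).trans (hR z hz.2))⟩, mem_univ _⟩
  have h1 : eLpNorm (vint g) 2 (volume.restrict (Ioc 0 R ×ˢ univ)) ^ 2 < ⊤ := by
    rw [eLpNorm_two_sq, Measure.volume_eq_prod, ← Measure.prod_restrict, Measure.restrict_univ,
      lintegral_prod _ hm.aemeasurable]
    have h2 : ∀ t ∈ Ioc 0 R, ∫⁻ x, ‖vint g (t, x)‖ₑ ^ 2 ≤ ofReal R * eLpNorm g 2 volume ^ 2 := by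
      intro t ht
      have := eLpNorm_vint_sq_le hg hg2 ht.1.le
      rw [eLpNorm_two_sq] at this
      refine this.trans ?_
      gcongr
      exact ht.2
    refine (setLIntegral_mono measurable_const h2).trans_lt ?_
    rw [setLIntegral_const, Real.volume_Ioc]
    exact ENNReal.mul_lt_top (ENNReal.mul_lt_top ENNReal.ofReal_lt_top
      (ENNReal.pow_lt_top hg2.2)) ENNReal.ofReal_lt_top
  refine (eLpNorm_mono_measure _ (Measure.restrict_mono hsub le_rfl)).trans_lt ?_
  exact lt_top_iff_ne_top.2 fun h => by simp [h] at h1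

theorem integrable_test_mul_of_memLp {K : Set (Full n)} {η u : Full n → ℝ}
    (hη : η ∈ 𝓣[Full n]) (hK : tsupport η ⊆ K) (hu : MemLp u 2 (volume.restrict (ℍ[n] ∩ K))) :
    Integrable (fun z => η z * u z) volℍ[n] := by
  have h1 : MemLp η 2 (volume.restrict (ℍ[n] ∩ K)) := testFun_memLp hη 2
  have h2 : IntegrableOn (fun z => η z * u z) (ℍ[n] ∩ K) volume := integrable_mul_two h1 hu
  refine h2.of_forall_sdiff_eq_zero measurableSet_halfSpace fun z hz => ?_
  rw [image_eq_zero_of_notMem_tsupport fun h => hz.2 ⟨hz.1, hK h⟩, zero_mul]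

theorem fullDir_zero : fullDir n 0 = ((1 : ℝ), (0 : Bdry n)) := rfl

theorem hasDerivAt_section {η : Full n → ℝ} (hη : Differentiable ℝ η) (t : ℝ) (x : Bdry n) :
    HasDerivAt (fun t => η (t, x)) (fderiv ℝ η (t, x) (fullDir n 0)) t := by
  have h2 : HasDerivAt (fun s : ℝ => ((s, x) : Full n)) ((1 : ℝ), (0 : Bdry n)) t :=
    (hasDerivAt_id t).prodMk (hasDerivAt_const t x)
  exact (hη (t, x)).hasFDerivAt.comp_hasDerivAt t h2

theorem hasCompactSupport_section {η : Full n → ℝ} (hη : HasCompactSupport η) (x : Bdry n) :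
    HasCompactSupport fun t : ℝ => η (t, x) := by
  refine HasCompactSupport.intro (hη.isCompact.image continuous_fst) fun t ht => ?_
  exact image_eq_zero_of_notMem_tsupport fun h => ht ⟨(t, x), h, rfl⟩

theorem integral_fderiv_mul_vint (hg : StronglyMeasurable g) (hg2 : MemLp g 2 volume)
    {η : Full n → ℝ} (hη : η ∈ 𝓣[Full n]) : ∫ z in ℍ[n], fderiv ℝ η z (fullDir n 0) * vint g z =
      - ∫ z in ℍ[n], η z * g z := by
  have hη' := testFun_fderiv hη (fullDir n 0)
  have i1 := integrable_test_mul_of_memLp hη' (K := tsupport η)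
    (tsupport_fderiv_apply_subset ℝ _) (memLp_vint hg hg2 hη.2.1)
  have i2 : Integrable (fun z => η z * g z) volℍ[n] :=
    integrable_mul_two (testFun_memLp hη 2) (hg2.restrict _)
  rw [restrict_halfSpace] at i1 i2 ⊢
  rw [integral_prod_symm _ i1, integral_prod_symm _ i2, ← integral_neg]
  refine integral_congr_ae ?_
  filter_upwards [ae_memLp_section hg hg2] with x hx
  have hb : ContDiff ℝ 1 fun t : ℝ => η (t, x) :=
    (hη.1.of_le (by simp)).comp (contDiff_id.prodMk contDiff_const)
  have h := integral_deriv_mul_primitive hb (hasCompactSupport_section hη.2.1 x) hx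
  rw [← h]
  refine integral_congr_ae (.of_forall fun t => ?_)
  simp only [(hasDerivAt_section (testFun_differentiable hη) t x).deriv, vint]

/-- On each vertical line f is constant, so integrating the derivative of η leaves only its boundary
value. -/
theorem integral_fderiv_mul_snd {f : Bdry n → ℝ} (hf : LocallyIntegrable f volume)
    {η : Full n → ℝ} (hη : η ∈ 𝓣[Full n]) :
    Integrable (fun z : Full n => fderiv ℝ η z (fullDir n 0) * f z.2) volℍ[n] ∧
    ∫ z in ℍ[n], fderiv ℝ η z (fullDir n 0) * f z.2 = - ∫ x, η (0, x) * f x := by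
  have hη' := testFun_fderiv hη (fullDir n 0)
  obtain ⟨R, hR⟩ := hη.2.1.isCompact.isBounded.exists_norm_le
  have hout : ∀ z : Full n, R < ‖z‖ → fderiv ℝ η z (fullDir n 0) = 0 := by
    intro z hz
    by_contra h
    have h1 := tsupport_fderiv_apply_subset ℝ (fullDir n 0) (subset_tsupport _ h)
    linarith [hR z h1]
  have i1 : Integrable (fun z : Full n => fderiv ℝ η z (fullDir n 0) * f z.2) volℍ[n] := by
    have hfi : IntegrableOn f (Metric.closedBall 0 R) volume :=
      hf.integrableOn_isCompact (isCompact_closedBall _ _)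
    have h0 : IntegrableOn (fun _ : ℝ => (1 : ℝ)) (Ioc 0 R) := by simp
    have h1 := h0.mul_prod hfi
    rw [Measure.prod_restrict, ← Measure.volume_eq_prod] at h1
    obtain ⟨B, hB⟩ := (testFun_continuous hη').bounded_above_of_compact_support hη'.2.1
    have h2 : IntegrableOn (fun z : Full n => fderiv ℝ η z (fullDir n 0) * f z.2)
        (Ioc 0 R ×ˢ Metric.closedBall 0 R) volume := by
      have := h1.bdd_mul (c := B) (f := fun z : Full n => fderiv ℝ η z (fullDir n 0))
        (testFun_continuous hη').aestronglyMeasurable (.of_forall hB)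
      simp only [one_mul] at this
      exact this
    refine IntegrableOn.of_forall_sdiff_eq_zero h2 measurableSet_halfSpace fun z hz => ?_
    rw [hout z, zero_mul]
    by_contra h
    rw [not_lt] at h
    refine hz.2 ⟨⟨hz.1, (le_abs_self _).trans ((norm_fst_le z).trans h)⟩, ?_⟩
    rw [mem_closedBall_zero_iff]
    exact (norm_snd_le z).trans h
  refine ⟨i1, ?_⟩
  rw [restrict_halfSpace] at i1 ⊢
  rw [integral_prod_symm _ i1, ← integral_neg]
  refine integral_congr_ae (.of_forall fun x => ?_)
  have hb : ContDiff ℝ 1 fun t : ℝ => η (t, x) :=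
    (hη.1.of_le (by simp)).comp (contDiff_id.prodMk contDiff_const)
  simp only [integral_mul_const]
  rw [← neg_mul, ← (hasCompactSupport_section hη.2.1 x).integral_Ioi_deriv_eq hb]
  congr 1
  refine integral_congr_ae (.of_forall fun t => ?_)
  simp only [(hasDerivAt_section (testFun_differentiable hη) t x).deriv]

end VerticalPrimitive

/-! ### Energy functions as vertical primitives from the boundary. -/

section TraceRepresentation

variable {n : ℕ} {u : Full n → ℝ} {G : Fin (n + 1) → Full n → ℝ}

theorem setIntegral_testFun_mul {φ : Full n → ℝ} (hφ : φ ∈ testFun ℍ[n]) (f : Full n → ℝ) :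
    ∫ z in ℍ[n], φ z * f z = ∫ z, φ z * f z :=
  setIntegral_eq_integral_of_forall_compl_eq_zero fun z hz => by
    rw [testFun_eq_zero hφ hz, zero_mul]

theorem ae_eq_zero_of_forall_test {f : Full n → ℝ} (hf : LocallyIntegrableOn f ℍ[n] volume)
    (h : ∀ φ ∈ testFun ℍ[n], ∫ z, φ z * f z = 0) : ∀ᵐ z ∂volℍ[n], f z = 0 := by
  have key := (eLpNorm_le_of_forall_test holderConjugate_two le_rfl isOpen_halfSpace hf
    fun φ hφ => by rw [h φ hφ]; simp).2
  rw [ENNReal.ofReal_zero, nonpos_iff_eq_zero, eLpNorm_eq_zero_iff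
      hf.aestronglyMeasurable (by simp)] at key
  exact key

theorem locallyIntegrable_of_memLp_two {V : Type*} [NormedAddCommGroup V] [NormedSpace ℝ V]
    [FiniteDimensional ℝ V] [MeasurableSpace V] [BorelSpace V] {μ : Measure V}
    [IsFiniteMeasureOnCompacts μ] {E : Type*} [NormedAddCommGroup E] {f : V → E}
    (hf : ∀ K : Set V, IsCompact K → MemLp f 2 (μ.restrict K)) : LocallyIntegrable f μ := by
  have : ProperSpace V := FiniteDimensional.proper ℝ V
  rw [locallyIntegrable_iff]
  intro K hK
  have : IsFiniteMeasure (μ.restrict K) := ⟨by simpa using hK.measure_lt_top⟩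
  exact (hf K hK).integrable (by norm_num)

theorem locallyIntegrable_comp_snd {f : Bdry n → ℝ} (hf : LocallyIntegrable f volume) :
    LocallyIntegrable (fun z : Full n => f z.2) volume := by
  rw [locallyIntegrable_iff]
  intro K hKc
  have h1 : IsCompact (Prod.fst '' K) := hKc.image continuous_fst
  have h2 : IsCompact (Prod.snd '' K) := hKc.image continuous_snd
  have : IsFiniteMeasure ((volume : Measure ℝ).restrict (Prod.fst '' K)) :=
    ⟨by simpa using h1.measure_lt_top⟩
  have h3 : IntegrableOn f (Prod.snd '' K) volume := hf.integrableOn_isCompact h2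
  have h4 := h3.comp_snd ((volume : Measure ℝ).restrict (Prod.fst '' K))
  rw [Measure.prod_restrict, ← Measure.volume_eq_prod] at h4
  exact IntegrableOn.mono_set h4 fun z hz => ⟨⟨z, hz, rfl⟩, ⟨z, hz, rfl⟩⟩

/-- A function on the half-space that does not depend on the vertical variable in the weak sense
is a function of the horizontal variable. -/
theorem exists_ae_eq_comp_snd {W : Full n → ℝ} (hW : StronglyMeasurable W)
    (hW2 : ∀ K : Set (Full n), IsCompact K → K ⊆ ℍ[n] → MemLp W 2 (volume.restrict K))
    (h0 : ∀ φ ∈ testFun ℍ[n], ∫ z, fderiv ℝ φ z (fullDir n 0) * W z = 0) :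
    ∃ f : Bdry n → ℝ, (∀ K : Set (Bdry n), IsCompact K → MemLp f 2 (volume.restrict K)) ∧
      ∀ᵐ z ∂volℍ[n], W z = f z.2 := by
  have hWl := locallyIntegrableOn_of_memLp hW2
  -- translation invariance
  have htr : ∀ h : ℝ, ∀ᵐ z, z ∈ ℍ[n] → z + (h, 0) ∈ ℍ[n] → W (z + (h, 0)) = W z := by
    intro h
    have e0 : ((h, 0) : Full n) = h • fullDir n 0 := by simp [fullDir_zero]
    have key := eLpNorm_translate_sub_le (μ := (volume : Measure (Full n))) holderConjugate_two
      isOpen_halfSpace convex_halfSpace (u := W) (G := fun _ => 0) ((h, 0) : Full n) hWl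
      MemLp.zero' (fun φ hφ => by
        simp only [e0, map_smul, smul_eq_mul, mul_assoc, mul_zero, integral_zero, neg_zero]
        rw [integral_const_mul, h0 φ hφ, mul_zero])
    have h1 : eLpNorm (fun z => W (z + (h, 0)) - W z) (ofReal 2) (volume.restrict
        (ℍ[n] ∩ (fun z => z + (h, 0)) ⁻¹' ℍ[n]))
        = 0 := by
      have := key.2
      rw [show (fun _ : Full n => (0 : ℝ)) = 0 from rfl, eLpNorm_zero, nonpos_iff_eq_zero] at this
      exact this
    rw [eLpNorm_eq_zero_iff key.1.1 (by simp), EventuallyEq, ae_restrict_iff'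
      (measurableSet_halfSpace.inter ((measurable_add_const _) measurableSet_halfSpace))] at h1
    filter_upwards [h1] with z hz hz1 hz2
    exact sub_eq_zero.1 (hz ⟨hz1, hz2⟩)
  -- The candidate f is the average of W over heights in [1, 3], away from the boundary, with weight
  -- θ.
  obtain ⟨θ, hθ, hθ0, hθ1⟩ := exists_mollifier (volume : Measure ℝ) 2 one_pos
  have hθc := testFun_continuous hθ
  obtain ⟨B, hB⟩ := hθc.bounded_above_of_compact_support hθ.2.1
  have hθs : ∀ s, s ∉ Icc (1 : ℝ) 3 → θ s = 0 := by
    intro s hs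
    refine testFun_eq_zero hθ fun h => hs ?_
    rw [Real.ball_eq_Ioo] at h
    constructor <;> linarith [h.1, h.2]
  set f : Bdry n → ℝ := fun x => ∫ s, θ s * W (s, x) with hf
  -- localization
  set Q : ℝ → Set (Full n) := fun R => Icc 1 3 ×ˢ Metric.closedBall 0 R with hQ
  have hQc : ∀ R, IsCompact (Q R) := fun R => isCompact_Icc.prod (isCompact_closedBall _ _)
  have hQm : ∀ R, MeasurableSet (Q R) := fun R => (hQc R).measurableSet
  have hQH : ∀ R, Q R ⊆ ℍ[n] := fun R z hz => by rw [mem_halfSpace]; linarith [hz.1.1]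
  set F : ℝ → Full n → ℝ := fun R => (Q R).indicator fun z => θ z.1 * W z with hF
  have hFm : ∀ R, StronglyMeasurable (F R) := fun R =>
    (((hθc.comp continuous_fst).stronglyMeasurable).mul hW).indicator (hQm R)
  have hF2 : ∀ R, MemLp (F R) 2 volume := by
    intro R
    rw [memLp_indicator_iff_restrict (hQm R)]
    refine (hW2 (Q R) (hQc R) (hQH R)).of_le_mul (c := B)
      (((hθc.comp continuous_fst).stronglyMeasurable).mul hW).aestronglyMeasurable
      (.of_forall fun z => ?_)
    rw [norm_mul]
    gcongr
    exact hB _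
  have hFf : ∀ R x, x ∈ Metric.closedBall (0 : Bdry n) R → ∀ s, F R (s, x) = θ s * W (s, x) := by
    intro R x hx s
    by_cases hs : s ∈ Icc (1 : ℝ) 3
    · simp only [hF]
      rw [indicator_of_mem (show (s, x) ∈ Q R from ⟨hs, hx⟩)]
    · simp only [hF]
      rw [hθs s hs, zero_mul, indicator_of_notMem fun h => hs h.1]
  have hf2 : ∀ K : Set (Bdry n), IsCompact K → MemLp f 2 (volume.restrict K) := by
    intro K hK
    obtain ⟨R, hR⟩ := hK.isBounded.exists_norm_le
    refine ((memLp_vint_section (hFm R) (hF2 R) (t := 3) (by norm_num)).restrict K).ae_eq ?_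
    rw [EventuallyEq, ae_restrict_iff' hK.measurableSet]
    refine .of_forall fun x hx => ?_
    have hx' : x ∈ Metric.closedBall (0 : Bdry n) R := mem_closedBall_zero_iff.2 (hR x hx)
    simp only [hf, vint, hFf R x hx']
    refine setIntegral_eq_integral_of_forall_compl_eq_zero fun s hs => ?_
    rw [hθs s fun h => hs ⟨by linarith [h.1], h.2⟩, zero_mul]
  have hfl : LocallyIntegrableOn (fun z : Full n => f z.2) ℍ[n] volume :=
    (locallyIntegrable_comp_snd (locallyIntegrable_of_memLp_two hf2)).locallyIntegrableOn _
  refine ⟨f, hf2, ?_⟩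
  have hdiff := ae_eq_zero_of_forall_test (hWl.sub hfl) fun φ hφ => ?_
  · filter_upwards [hdiff] with z hz
    exact sub_eq_zero.1 hz
  have hiW : Integrable (fun z => φ z * W z) volume := testFun_integrable_mul hWl hφ
  have hif : Integrable (fun z : Full n => φ z * f z.2) volume := testFun_integrable_mul hfl hφ
  simp only [Pi.sub_apply, mul_sub]
  rw [integral_sub hiW hif, sub_eq_zero]
  obtain ⟨R, hR⟩ := hφ.2.1.isCompact.isBounded.exists_norm_le
  -- The window contains every h with t + h in [1, 3] for |t| ≤ R, that is, for every height t met
  -- by the support of φ. Restricting to it makes the measure finite, as Fubini requires.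
  set m : Measure ℝ := volume.restrict (Icc (-(R + 3)) (R + 3)) with hm
  set ν : Measure (Full n) := m.map fun h => (h, 0) with hν
  have hmeas : Measurable fun h : ℝ => ((h, 0) : Full n) := by fun_prop
  have : IsFiniteMeasure m := ⟨by simp [hm]⟩
  have : IsFiniteMeasure ν := Measure.isFiniteMeasure_map _ _
  have hmap : ∀ k : Full n → ℝ, StronglyMeasurable k → ∫ y, k y ∂ν = ∫ h, k (h, 0) ∂m :=
    fun k hk => integral_map hmeas.aemeasurable hk.aestronglyMeasurable
  have havg : ∀ z ∈ tsupport φ, avgTranslate ν (F R) z = f z.2 := by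
    intro z hz
    have hz1 : |z.1| ≤ R := (norm_fst_le z).trans (hR z hz)
    have hz2 : z.2 ∈ Metric.closedBall (0 : Bdry n) R :=
      mem_closedBall_zero_iff.2 ((norm_snd_le z).trans (hR z hz))
    rw [avgTranslate, hmap (fun y => F R (z + y)) ((hFm R).comp_measurable (measurable_const_add z))]
    have e1 : ∀ h : ℝ, F R (z + (h, 0)) = θ (z.1 + h) * W (z.1 + h, z.2) := by
      intro h
      rw [show z + (h, 0) = (z.1 + h, z.2) by ext1 <;> simp]
      exact hFf R _ hz2 _
    simp only [e1]
    rw [hm, setIntegral_eq_integral_of_forall_compl_eq_zero, hf]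
    · exact integral_add_left_eq_self (fun s => θ s * W (s, z.2)) z.1
    · intro h hh
      rw [hθs, zero_mul]
      intro h2
      rw [abs_le] at hz1
      exact hh ⟨by linarith [h2.1], by linarith [h2.2]⟩
  -- Pairing with f is an average over vertical shifts h of pairings with θW shifted. Translation
  -- invariance of W then replaces W(t + h, x) by W(t, x), and the factor θ(t + h) integrates to 1
  -- in h.
  have hL : ∫ z : Full n, φ z * f z.2 = ∫ h, ∫ z, φ z * F R (z + (h, 0)) ∂volume ∂m := by
    have h1 := integral_mul_avgTranslate (μ := (volume : Measure (Full n))) holderConjugate_two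
      (testFun_memLp hφ _) (f := F R) (by rw [ennreal_ofReal_two]; exact hF2 R) ν
    have h2 : StronglyMeasurable fun y : Full n => ∫ z, φ z * F R (z + y) := by
      have : StronglyMeasurable fun x : Full n × Full n => φ x.2 * F R (x.2 + x.1) :=
        ((testFun_continuous hφ).stronglyMeasurable.comp_measurable measurable_snd).mul
          ((hFm R).comp_measurable (measurable_snd.add measurable_fst))
      exact this.integral_prod_right'
    rw [hmap _ h2] at h1
    rw [← h1]
    refine integral_congr_ae (.of_forall fun z => ?_)
    by_cases hz : z ∈ tsupport φ
    · simp only [havg z hz]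
    · simp only [image_eq_zero_of_notMem_tsupport hz, zero_mul]
  have hM : ∀ h : ℝ, ∫ z, φ z * F R (z + (h, 0)) = ∫ z, θ (z.1 + h) * (φ z * W z) := by
    intro h
    refine integral_congr_ae ?_
    filter_upwards [htr h] with z hz
    by_cases hzs : z ∈ tsupport φ
    · have hz2 : z.2 ∈ Metric.closedBall (0 : Bdry n) R :=
        mem_closedBall_zero_iff.2 ((norm_snd_le z).trans (hR z hzs))
      rw [show z + (h, 0) = (z.1 + h, z.2) by ext1 <;> simp, hFf R _ hz2]
      by_cases hs : z.1 + h ∈ Icc (1 : ℝ) 3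
      · have h3 := hz (hφ.2.2 hzs) (by
          rw [mem_halfSpace, Prod.fst_add]
          linarith [hs.1])
        rw [show z + (h, 0) = (z.1 + h, z.2) by ext1 <;> simp] at h3
        rw [h3]; ring
      · rw [hθs _ hs]; ring
    · rw [image_eq_zero_of_notMem_tsupport hzs]; ring
  rw [hL]
  simp only [hM]
  rw [integral_integral_swap (f := fun (h : ℝ) (z : Full n) => θ (z.1 + h) * (φ z * W z))]
  · simp only [integral_mul_const]
    refine integral_congr_ae (.of_forall fun z => ?_)
    by_cases hz : z ∈ tsupport φ
    · have hz1 : |z.1| ≤ R := (norm_fst_le z).trans (hR z hz)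
      have e2 : ∫ h, θ (z.1 + h) ∂m = 1 := by
        rw [hm, setIntegral_eq_integral_of_forall_compl_eq_zero, integral_add_left_eq_self, hθ1]
        intro h hh
        refine hθs _ fun h2 => ?_
        rw [abs_le] at hz1
        exact hh ⟨by linarith [h2.1], by linarith [h2.2]⟩
      simp only [e2, one_mul]
    · simp only [image_eq_zero_of_notMem_tsupport hz, zero_mul, mul_zero]
  · have h5 := hiW.comp_snd m
    refine h5.bdd_mul (c := B) ?_ (.of_forall fun x => hB _)
    exact (hθc.comp (by fun_prop : Continuous fun x : ℝ × Full n => x.2.1 + x.1)).aestronglyMeasurable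

/-- Energy functions are primitives of their vertical derivative, starting from a locally square
integrable function on the boundary. -/
theorem IsScalarEnergy.exists_representation (h : IsScalarEnergy u G) :
    ∃ g : Full n → ℝ, StronglyMeasurable g ∧ MemLp g 2 volume ∧
      g =ᵐ[volℍ[n]] G 0 ∧ ∃ f : Bdry n → ℝ,
        (∀ K : Set (Bdry n), IsCompact K → MemLp f 2 (volume.restrict K)) ∧
        ∀ᵐ z ∂volℍ[n], u z = f z.2 + vint g z := by
  have hG := memLp_indicator_halfSpace (h.memLp_grad 0)
  rw [ennreal_ofReal_two] at hG
  set g := hG.1.mk _ with hg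
  have hgm : StronglyMeasurable g := hG.1.stronglyMeasurable_mk
  have hge : ℍ[n].indicator (G 0) =ᵐ[volume] g := hG.1.ae_eq_mk
  have hg2 : MemLp g 2 volume := hG.ae_eq hge
  have hgG : g =ᵐ[volℍ[n]] G 0 := by
    rw [EventuallyEq, ae_restrict_iff' measurableSet_halfSpace]
    filter_upwards [hge] with z hz hzH
    rw [← hz, indicator_of_mem hzH]
  refine ⟨g, hgm, hg2, hgG, ?_⟩
  have hum : AEStronglyMeasurable u volℍ[n] := h.locallyIntegrableOn.aestronglyMeasurable
  have hWm : AEStronglyMeasurable (fun z => u z - vint g z) volℍ[n] :=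
    hum.sub (stronglyMeasurable_vint hgm).aestronglyMeasurable
  have hWe := hWm.ae_eq_mk
  set W := hWm.mk _ with hW
  have hvl : ∀ K : Set (Full n), IsCompact K → K ⊆ ℍ[n] →
      MemLp (vint g) 2 (volume.restrict K) := fun K hK hKH => by
    have := memLp_vint hgm hg2 hK
    rwa [inter_eq_right.2 hKH] at this
  -- Subtracting the vertical primitive of G 0 leaves a function with vanishing vertical derivative,
  -- which depends only on x; that function is the trace.
  obtain ⟨f, hf, hWf⟩ := exists_ae_eq_comp_snd hWm.stronglyMeasurable_mk (fun K hK hKH =>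
    ((h.memLp_loc K hK hKH).sub (hvl K hK hKH)).ae_eq
      (ae_restrict_of_ae_restrict_of_subset hKH hWe)) fun φ hφ => by
    have hφ' := testFun_fderiv hφ (fullDir n 0)
    have hvli := locallyIntegrableOn_of_memLp hvl
    have e1 : ∫ z, fderiv ℝ φ z (fullDir n 0) * W z =
        ∫ z, fderiv ℝ φ z (fullDir n 0) * (u z - vint g z) := by
      rw [← setIntegral_testFun_mul hφ', ← setIntegral_testFun_mul hφ']
      refine integral_congr_ae ?_
      filter_upwards [hWe] with z hz
      rw [hz]
    have e2 : ∫ z, φ z * G 0 z = ∫ z in ℍ[n], φ z * g z := by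
      rw [← setIntegral_testFun_mul hφ]
      refine integral_congr_ae ?_
      filter_upwards [hgG] with z hz
      rw [hz]
    have e3 := integral_fderiv_mul_vint hgm hg2 (testFun_mono (subset_univ _) hφ)
    rw [setIntegral_testFun_mul hφ'] at e3
    rw [e1]
    simp only [mul_sub]
    rw [integral_sub (h.integrable_mul hφ') (testFun_integrable_mul hvli hφ'), h.weak_grad 0 φ hφ,
      e2, e3, sub_self]
  refine ⟨f, hf, ?_⟩
  filter_upwards [hWe, hWf] with z h1 h2
  linarith

end TraceRepresentation

/-! ### Traces: existence, uniqueness, Green's identity. -/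

section Traces

variable {n : ℕ}

/-- `f` is the value at `t = 0` of `u`, for functions that are continuous in `t ≥ 0` with values
in the locally square integrable functions on the boundary. -/
def HasBoundaryValue {E : Type*} [NormedAddCommGroup E] (u : Full n → E) (f : Bdry n → E) : Prop :=
  ∃ U : ℝ → Bdry n → E, (∀ᵐ t ∂(volume.restrict (Ioi (0 : ℝ))), U t =ᵐ[volume] fun x => u (t, x)) ∧
    (∀ t, 0 ≤ t → ∀ K : Set (Bdry n), IsCompact K → MemLp (U t) 2 (volume.restrict K)) ∧
    (∀ t, 0 ≤ t → ∀ K : Set (Bdry n), IsCompact K →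
      Tendsto (fun s => eLpNorm (U s - U t) 2 (volume.restrict K)) (𝓝[Ici 0] t) (𝓝 0)) ∧
    U 0 = f

theorem isTrace_iff {m : ℕ} {u : Full n → ℂᵛ[m]}
    {f : Bdry n → ℂᵛ[m]} : IsTrace u f ↔ HasBoundaryValue u f := Iff.rfl

namespace HasBoundaryValue

variable {E F : Type*} [NormedAddCommGroup E] [NormedAddCommGroup F] {u v : Full n → E}
  {f g : Bdry n → E}

theorem memLp (h : HasBoundaryValue u f) {K : Set (Bdry n)} (hK : IsCompact K) :
    MemLp f 2 (volume.restrict K) := by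
  obtain ⟨U, -, h2, -, rfl⟩ := h
  exact h2 0 le_rfl K hK

/-- The continuous representative is altered only at t = 0 and there only on a null set, which none
of the norms detects. -/
theorem congr (h : HasBoundaryValue u f) (hfg : f =ᵐ[volume] g) : HasBoundaryValue u g := by
  obtain ⟨U, h1, h2, h3, rfl⟩ := h
  have hU : ∀ t, Function.update U 0 g t =ᵐ[volume] U t := by
    intro t
    rcases eq_or_ne t 0 with rfl | ht
    · rw [Function.update_self]; exact hfg.symm
    · rw [Function.update_of_ne ht]
  refine ⟨Function.update U 0 g, ?_, fun t ht K hK => ?_, fun t ht K hK => ?_,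
    Function.update_self ..⟩
  · filter_upwards [h1] with t ht using (hU t).trans ht
  · exact (h2 t ht K hK).ae_eq (ae_restrict_of_ae (hU t).symm)
  · refine (h3 t ht K hK).congr fun s => ?_
    exact eLpNorm_congr_ae (ae_restrict_of_ae ((hU s).symm.sub (hU t).symm))

theorem add (h : HasBoundaryValue u f) (h' : HasBoundaryValue v g) :
    HasBoundaryValue (u + v) (f + g) := by
  obtain ⟨U, h1, h2, h3, rfl⟩ := h
  obtain ⟨V, k1, k2, k3, rfl⟩ := h'
  refine ⟨U + V, ?_, fun t ht K hK => (h2 t ht K hK).add (k2 t ht K hK), fun t ht K hK => ?_, rfl⟩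
  · filter_upwards [h1, k1] with t ht kt using ht.add kt
  · have h4 := (h3 t ht K hK).add (k3 t ht K hK)
    rw [add_zero] at h4
    refine tendsto_of_tendsto_of_tendsto_of_le_of_le' tendsto_const_nhds h4
      (.of_forall fun _ => zero_le) ?_
    filter_upwards [self_mem_nhdsWithin] with s hs
    rw [show (U + V) s - (U + V) t = (U s - U t) + (V s - V t) by simp only [Pi.add_apply]; abel]
    exact eLpNorm_add_le ((h2 s hs K hK).sub (h2 t ht K hK)).1
      ((k2 s hs K hK).sub (k2 t ht K hK)).1 (by norm_num)

theorem zero : HasBoundaryValue (0 : Full n → E) 0 :=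
  ⟨0, .of_forall fun _ => .of_forall fun _ => rfl,
    fun _ _ _ _ => MemLp.zero, fun _ _ _ _ => by simpa using tendsto_const_nhds, rfl⟩

theorem sum {ι : Type*} (s : Finset ι) {u : ι → Full n → E} {f : ι → Bdry n → E}
    (h : ∀ i ∈ s, HasBoundaryValue (u i) (f i)) :
    HasBoundaryValue (∑ i ∈ s, u i) (∑ i ∈ s, f i) := by
  classical
  induction s using Finset.induction_on with
  | empty => simpa using zero
  | insert a s ha ih =>
    rw [Finset.sum_insert ha, Finset.sum_insert ha]
    exact (h a (Finset.mem_insert_self ..)).add (ih fun i hi => h i (Finset.mem_insert_of_mem hi))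

theorem clm [NormedSpace ℝ E] [NormedSpace ℝ F] (h : HasBoundaryValue u f) (L : E →L[ℝ] F) :
    HasBoundaryValue (fun z => L (u z)) fun x => L (f x) := by
  obtain ⟨U, h1, h2, h3, rfl⟩ := h
  refine ⟨fun t x => L (U t x), ?_, fun t ht K hK => L.comp_memLp' (h2 t ht K hK),
    fun t ht K hK => ?_, rfl⟩
  · filter_upwards [h1] with t ht
    filter_upwards [ht] with x hx
    rw [hx]
  · have h4 := ENNReal.Tendsto.const_mul (a := ofReal ‖L‖) (h3 t ht K hK)
      (Or.inr ENNReal.ofReal_ne_top)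
    rw [mul_zero] at h4
    refine tendsto_of_tendsto_of_tendsto_of_le_of_le tendsto_const_nhds h4 (fun _ => zero_le)
      fun s => ?_
    refine eLpNorm_le_mul_eLpNorm_of_ae_le_mul (.of_forall fun x => ?_) 2
    simp only [Pi.sub_apply, ← map_sub]
    exact L.le_opNorm _

/-- Two continuous representatives agree at almost every t > 0, hence at arbitrarily small t, and
both converge locally in L² as t → 0. A countable exhaustion by balls yields the global statement.
-/
theorem ae_eq (h : HasBoundaryValue u f) (h' : HasBoundaryValue u g) : f =ᵐ[volume] g := by
  obtain ⟨U, h1, h2, h3, rfl⟩ := h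
  obtain ⟨V, k1, k2, k3, rfl⟩ := h'
  have hfr : ∃ᶠ s in 𝓝[Ici 0] (0 : ℝ), 0 ≤ s ∧ U s =ᵐ[volume] V s := by
    have hae := (ae_restrict_iff' measurableSet_Ioi).1 (h1.and k1)
    rw [frequently_iff]
    intro W hW
    obtain ⟨ε, hε, hεW⟩ := Metric.mem_nhdsWithin_iff.1 hW
    have hpos : (volume : Measure ℝ) (Ioo 0 ε) ≠ 0 := by simp [hε]
    obtain ⟨s, hs, hs'⟩ := ((frequently_ae_mem_iff.2 hpos).and_eventually hae).exists
    refine ⟨s, hεW ⟨?_, hs.1.le⟩, hs.1.le, ?_⟩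
    · rw [Metric.mem_ball, Real.dist_eq, sub_zero, abs_of_pos hs.1]; exact hs.2
    · exact (hs' hs.1).1.trans (hs' hs.1).2.symm
  have key : ∀ K : Set (Bdry n), IsCompact K → ∀ᵐ x ∂(volume.restrict K), U 0 x = V 0 x := by
    intro K hK
    have h4 := (h3 0 le_rfl K hK).add (k3 0 le_rfl K hK)
    rw [add_zero] at h4
    have h5 : eLpNorm (U 0 - V 0) 2 (volume.restrict K) ≤ 0 := by
      refine ge_of_tendsto_of_frequently h4 (hfr.mono fun s hs => ?_)
      have e : U 0 - V 0 =ᵐ[volume.restrict K] (V s - V 0) - (U s - U 0) := by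
        filter_upwards [ae_restrict_of_ae hs.2] with x hx
        simp only [Pi.sub_apply, hx]; abel
      rw [eLpNorm_congr_ae e, add_comm]
      exact eLpNorm_sub_le ((k2 s hs.1 K hK).sub (k2 0 le_rfl K hK)).1
        ((h2 s hs.1 K hK).sub (h2 0 le_rfl K hK)).1 (by norm_num)
    rw [nonpos_iff_eq_zero, eLpNorm_eq_zero_iff ((h2 0 le_rfl K hK).sub (k2 0 le_rfl K hK)).1
      (by norm_num)] at h5
    filter_upwards [h5] with x hx using sub_eq_zero.1 hx
  have h6 : ∀ᵐ x : Bdry n, ∀ k : ℕ, x ∈ Metric.closedBall (0 : Bdry n) k → U 0 x = V 0 x :=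
    ae_all_iff.2 fun k => (ae_restrict_iff' Metric.isClosed_closedBall.measurableSet).1
      (key _ (isCompact_closedBall _ _))
  filter_upwards [h6] with x hx
  obtain ⟨k, hk⟩ := exists_nat_ge ‖x‖
  exact hx k (by simpa using hk)

end HasBoundaryValue

/-- Products of test functions of `t` and of `x`. -/
theorem testFun_prod_mul {b : ℝ → ℝ} {ψ : Bdry n → ℝ} (hb : b ∈ 𝓣[ℝ]) (hψ : ψ ∈ 𝓣[Bdry n]) :
    (fun z : Full n => b z.1 * ψ z.2) ∈ 𝓣[Full n] := by
  refine ⟨(hb.1.comp contDiff_fst).mul (hψ.1.comp contDiff_snd), ?_, subset_univ _⟩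
  refine HasCompactSupport.intro (hb.2.1.isCompact.prod hψ.2.1.isCompact) fun z hz => ?_
  rw [mem_prod, not_and_or] at hz
  rcases hz with hz | hz
  · rw [image_eq_zero_of_notMem_tsupport hz, zero_mul]
  · rw [image_eq_zero_of_notMem_tsupport hz, mul_zero]

/-- The restriction of a test function to the boundary. -/
theorem testFun_boundary {η : Full n → ℝ} (hη : η ∈ 𝓣[Full n]) :
    (fun x : Bdry n => η (0, x)) ∈ 𝓣[Bdry n] := by
  refine ⟨hη.1.comp (contDiff_prodMk_right 0), ?_, subset_univ _⟩
  refine HasCompactSupport.intro (hη.2.1.isCompact.image continuous_snd) fun x hx => ?_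
  exact image_eq_zero_of_notMem_tsupport fun h => hx ⟨_, h, rfl⟩

theorem exists_testFun_eq_one : ∃ b ∈ 𝓣[ℝ], ∀ t, |t| ≤ 1 → b t = 1 := by
  refine ⟨(⟨1, 2, one_pos, one_lt_two⟩ : ContDiffBump (0 : ℝ)),
    ⟨ContDiffBump.contDiff _, ContDiffBump.hasCompactSupport _, subset_univ _⟩, fun t ht => ?_⟩
  exact ContDiffBump.one_of_mem_closedBall _ (by simpa using ht)

theorem ae_eq_of_forall_testFun {f g : Bdry n → ℝ} (hf : LocallyIntegrable f volume)
    (hg : LocallyIntegrable g volume) (h : ∀ ψ ∈ 𝓣[Bdry n], ∫ x, ψ x * f x = ∫ x, ψ x * g x) :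
    f =ᵐ[volume] g := by
  have hfg : LocallyIntegrableOn (f - g) univ volume := locallyIntegrableOn_univ.2 (hf.sub hg)
  have key := (eLpNorm_le_of_forall_test (μ := (volume : Measure (Bdry n))) holderConjugate_two
    le_rfl isOpen_univ hfg fun ψ hψ => by
      have e : ∫ x, ψ x * (f - g) x = 0 := by
        simp only [Pi.sub_apply, mul_sub]
        rw [integral_sub (testFun_integrable_mul (locallyIntegrableOn_univ.2 hf) hψ)
          (testFun_integrable_mul (locallyIntegrableOn_univ.2 hg) hψ), h ψ hψ, sub_self]
      rw [e]; simp).2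
  rw [Measure.restrict_univ, ENNReal.ofReal_zero, nonpos_iff_eq_zero, eLpNorm_eq_zero_iff
      (hf.sub hg).aestronglyMeasurable (by simp)] at key
  filter_upwards [key] with x hx using sub_eq_zero.1 hx

/-- A real valued energy function `u` with gradient `G`, together with its boundary value `f`,
characterized by Green's identity in the vertical variable. -/
structure IsTracedEnergy (u : Full n → ℝ) (G : Fin (n + 1) → Full n → ℝ) (f : Bdry n → ℝ) :
    Prop extends IsScalarEnergy u G where
  memLp_trace : ∀ K : Set (Bdry n), IsCompact K → MemLp f 2 (volume.restrict K)
  integrable_test : ∀ η ∈ 𝓣[Full n], Integrable (fun z => η z * u z) volℍ[n]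
  green : ∀ η ∈ 𝓣[Full n], (∫ z in ℍ[n], fderiv ℝ η z (fullDir n 0) * u z) +
      ∫ z in ℍ[n], η z * G 0 z = - ∫ x, η (0, x) * f x

variable {u v : Full n → ℝ} {G F : Fin (n + 1) → Full n → ℝ} {f g : Bdry n → ℝ}

/-- With u(t, x) = f(x) + ∫₀ᵗ g, the right side is the continuous representative, and Green's
identity is the sum of the identities for the two terms. -/
theorem IsScalarEnergy.exists_isTracedEnergy (h : IsScalarEnergy u G) :
    ∃ f, IsTracedEnergy u G f ∧ HasBoundaryValue u f ∧ (MemLp u 2 volℍ[n] → MemLp f 2 volume) := by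
  obtain ⟨g, hgm, hg2, hgG, f, hf, hu⟩ := h.exists_representation
  have hfl := locallyIntegrable_of_memLp_two hf
  have hu' := hu
  rw [restrict_halfSpace] at hu'
  have hus := Measure.ae_ae_of_ae_prod hu'
  have hi1 : ∀ η ∈ 𝓣[Full n], Integrable (fun z => η z * f z.2) volℍ[n] := fun η hη =>
    (testFun_integrable_mul (locallyIntegrableOn_univ.2 (locallyIntegrable_comp_snd hfl))
      hη).restrict
  have hi2 : ∀ η ∈ 𝓣[Full n], Integrable (fun z => η z * vint g z) volℍ[n] := fun η hη =>
    integrable_test_mul_of_memLp hη subset_rfl (memLp_vint hgm hg2 hη.2.1.isCompact)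
  have hsplit : ∀ η : Full n → ℝ, (fun z => η z * f z.2 + η z * vint g z)
      =ᵐ[volℍ[n]] fun z => η z * u z := by
    intro η
    filter_upwards [hu] with z hz
    rw [hz]; ring
  refine ⟨f, ⟨h, hf, fun η hη => ((hi1 η hη).add (hi2 η hη)).congr (hsplit η), fun η hη => ?_⟩,
    ⟨fun t x => f x + vint g (t, x), ?_, fun t ht K hK => ?_, fun t ht K hK => ?_, ?_⟩,
    fun hu2 => ?_⟩
  · have hη' := testFun_fderiv hη (fullDir n 0)
    have e0 : ∫ z in ℍ[n], fderiv ℝ η z (fullDir n 0) * u z =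
        ∫ z in ℍ[n], (fderiv ℝ η z (fullDir n 0) * f z.2 + fderiv ℝ η z (fullDir n 0) * vint g z) :=
      (integral_congr_ae (hsplit 𝐃[η,fullDir n 0])).symm
    rw [e0, integral_add (hi1 _ hη') (hi2 _ hη'),
      (integral_fderiv_mul_snd hfl hη).2, integral_fderiv_mul_vint hgm hg2 hη]
    have : ∫ z in ℍ[n], η z * G 0 z = ∫ z in ℍ[n], η z * g z := by
      refine integral_congr_ae ?_
      filter_upwards [hgG] with z hz
      rw [hz]
    rw [this]; ring
  · filter_upwards [hus] with t ht
    filter_upwards [ht] with x hx using hx.symm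
  · exact (hf K hK).add ((memLp_vint_section hgm hg2 ht).restrict K)
  · have hle : ∀ s, 0 ≤ s → eLpNorm ((fun x => f x + vint g (s, x)) -
        fun x => f x + vint g (t, x)) 2 (volume.restrict K) ≤
        (ofReal |s - t| * eLpNorm g 2 volume ^ 2) ^ (2⁻¹ : ℝ) := by
      intro s hs
      refine (eLpNorm_mono_measure _ Measure.restrict_le_self).trans ?_
      rw [show ((fun x => f x + vint g (s, x)) - fun x => f x + vint g (t, x)) =
        fun x => vint g (s, x) - vint g (t, x) by ext x; simp]
      rw [← ENNReal.rpow_le_rpow_iff (z := 2) two_pos, ← ENNReal.rpow_mul]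
      norm_num
      rcases le_total s t with hst | hst
      · have := eLpNorm_vint_sub_sq_le hgm hg2 hs hst
        rw [abs_of_nonpos (by linarith), neg_sub]
        convert this using 2
        exact eLpNorm_sub_comm (fun x => vint g (s, x)) (fun x => vint g (t, x)) 2 volume
      · rw [abs_of_nonneg (by linarith)]
        exact eLpNorm_vint_sub_sq_le hgm hg2 ht hst
    have hlim : Tendsto (fun s => (ofReal |s - t| * eLpNorm g 2 volume ^ 2) ^ (2⁻¹ : ℝ))
        (𝓝 t) (𝓝 0) := by
      have h1 : Tendsto (fun s => ofReal |s - t|) (𝓝 t) (𝓝 0) := by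
        have : Continuous fun s => ofReal |s - t| := ENNReal.continuous_ofReal.comp (by fun_prop)
        simpa using this.tendsto t
      have h2 := (ENNReal.Tendsto.mul_const (b := eLpNorm g 2 volume ^ 2) h1
        (Or.inr (ENNReal.pow_ne_top hg2.eLpNorm_ne_top))).ennrpow_const 2⁻¹
      simpa using h2
    refine tendsto_of_tendsto_of_tendsto_of_le_of_le' tendsto_const_nhds
      (hlim.mono_left nhdsWithin_le_nhds) (.of_forall fun _ => zero_le) ?_
    filter_upwards [self_mem_nhdsWithin] with s hs using hle s hs
  · ext x
    simp [vint_zero]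
  · have h1 : Integrable (fun z => u z ^ 2) ((volume.restrict (Ioi (0 : ℝ))).prod
        (volume : Measure (Bdry n))) := by
      rw [← restrict_halfSpace]; exact hu2.integrable_sq
    have hm := hu2.1
    rw [restrict_halfSpace] at hm
    -- Almost every slice u(t, ·) is square integrable; fixing one height, f is this slice minus the
    -- primitive at that height, which is in L².
    have h3 : ∃ t : ℝ, 0 < t ∧ Integrable (fun x : Bdry n => u (t, x) ^ 2) volume ∧
        AEStronglyMeasurable (fun x : Bdry n => u (t, x)) volume ∧
        ∀ᵐ x : Bdry n, u (t, x) = f x + vint g (t, x) := by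
      have h4 := (h1.prod_right_ae.and (hm.prodMk_left.and hus)).and
        (ae_restrict_mem measurableSet_Ioi)
      have : (ae ((volume : Measure ℝ).restrict (Ioi 0))).NeBot := by
        rw [ae_neBot, Ne, Measure.restrict_eq_zero]; simp
      obtain ⟨t, ⟨a, b, c⟩, d⟩ := h4.exists
      exact ⟨t, d, a, b, c⟩
    obtain ⟨t, ht, h5, h6, h7⟩ := h3
    refine (((memLp_two_iff_integrable_sq h6).2 h5).sub (memLp_vint_section hgm hg2 ht.le)).ae_eq ?_
    filter_upwards [h7] with x hx
    simp [hx]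

namespace IsTracedEnergy

theorem locallyIntegrable_trace (h : IsTracedEnergy u G f) : LocallyIntegrable f volume :=
  locallyIntegrable_of_memLp_two h.memLp_trace

/-- Green's identity is tested with b(t)ψ(x), where b = 1 near 0. Its left side does not involve the
trace, so ∫ ψ f is determined for every ψ. -/
theorem ae_eq (h : IsTracedEnergy u G f) (h' : IsTracedEnergy u G g) : f =ᵐ[volume] g := by
  obtain ⟨b, hb, hb1⟩ := exists_testFun_eq_one
  refine ae_eq_of_forall_testFun h.locallyIntegrable_trace h'.locallyIntegrable_trace fun ψ hψ => ?_
  have e1 := h.green _ (testFun_prod_mul hb hψ)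
  have e2 := h'.green _ (testFun_prod_mul hb hψ)
  simp only [hb1 0 (by simp), one_mul] at e1 e2
  linarith

theorem congr (h : IsTracedEnergy u G f) (hfg : f =ᵐ[volume] g) : IsTracedEnergy u G g := by
  refine ⟨h.1, fun K hK => (h.memLp_trace K hK).ae_eq (ae_restrict_of_ae hfg), h.integrable_test,
    fun η hη => ?_⟩
  rw [h.green η hη, neg_inj]
  refine integral_congr_ae ?_
  filter_upwards [hfg] with x hx
  rw [hx]

theorem hasBoundaryValue (h : IsTracedEnergy u G f) : HasBoundaryValue u f := by
  obtain ⟨f', h1, h2, -⟩ := h.1.exists_isTracedEnergy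
  exact h2.congr (h1.ae_eq h)

theorem memLp_two (h : IsTracedEnergy u G f) (hu : MemLp u 2 volℍ[n]) : MemLp f 2 volume := by
  obtain ⟨f', h1, -, h2⟩ := h.1.exists_isTracedEnergy
  exact (h2 hu).ae_eq (h1.ae_eq h)

end IsTracedEnergy

theorem IsScalarEnergy.isTracedEnergy (h : IsScalarEnergy u G) (hf : HasBoundaryValue u f) :
    IsTracedEnergy u G f := by
  obtain ⟨f', h1, h2, -⟩ := h.exists_isTracedEnergy
  exact h1.congr (h2.ae_eq hf)

end Traces

/-! ### Translation, cutoff and averaging of traces. -/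

section TraceOperations

variable {n : ℕ} {u v : Full n → ℝ} {G F : Fin (n + 1) → Full n → ℝ} {f g : Bdry n → ℝ}

theorem measurePreserving_add_right_restrict {V : Type*} [AddGroup V] [MeasurableSpace V]
    [MeasurableAdd₂ V] {μ : Measure V} [μ.IsAddRightInvariant] (y : V) (s : Set V) :
    MeasurePreserving (fun x => x + y) (μ.restrict ((fun x => x + y) ⁻¹' s)) (μ.restrict s) :=
  (measurePreserving_add_right μ y).restrict_preimage_emb
    (MeasurableEquiv.addRight y).measurableEmbedding s

theorem measurePreserving_horizontal (y : Bdry n) :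
    MeasurePreserving (fun z : Full n => z + (0, y)) volℍ[n] volℍ[n] := by
  have h3 : (fun z : Full n => z + (0, y)) ⁻¹' ℍ[n] = ℍ[n] := by
    ext z; rw [mem_preimage, mem_halfSpace, mem_halfSpace, Prod.fst_add, add_zero]
  simpa only [h3] using measurePreserving_add_right_restrict (μ := volume) ((0, y) : Full n) ℍ[n]

theorem memLp_two_translate {f : Bdry n → ℝ}
    (hf : ∀ K : Set (Bdry n), IsCompact K → MemLp f 2 (volume.restrict K))
    (y : Bdry n) {K : Set (Bdry n)} (hK : IsCompact K) :
    MemLp (fun x => f (x + y)) 2 (volume.restrict K) := by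
  have h1 := hf _ (hK.image (by fun_prop : Continuous fun x => x + y))
  have h2 := measurePreserving_add_right_restrict (μ := volume) y ((fun x => x + y) '' K)
  rw [preimage_image_eq _ (add_left_injective y)] at h2
  exact h1.comp_measurePreserving h2

namespace IsTracedEnergy

theorem integrable_test_grad (h : IsTracedEnergy u G f) (i : Fin (n + 1)) {η : Full n → ℝ}
    (hη : η ∈ 𝓣[Full n]) : Integrable (fun z => η z * G i z) volℍ[n] :=
  integrable_mul_two ((testFun_memLp hη 2).restrict _) (h.memLp_grad i)

theorem integrable_trace (h : IsTracedEnergy u G f) {ψ : Bdry n → ℝ}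
    (hψ : ψ ∈ 𝓣[Bdry n]) : Integrable (fun x => ψ x * f x) volume :=
  testFun_integrable_mul (locallyIntegrableOn_univ.2 h.locallyIntegrable_trace) hψ

theorem sub (h : IsTracedEnergy u G f) (h' : IsTracedEnergy v F g) :
    IsTracedEnergy (fun z => u z - v z) (fun i z => G i z - F i z) fun x => f x - g x := by
  refine ⟨h.1.sub h'.1, fun K hK => (h.memLp_trace K hK).sub (h'.memLp_trace K hK),
    fun η hη => ?_, fun η hη => ?_⟩
  · simp only [mul_sub]
    exact (h.integrable_test η hη).sub (h'.integrable_test η hη)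
  · have hη' := testFun_fderiv hη (fullDir n 0)
    have hη0 := testFun_boundary hη
    simp only [mul_sub]
    rw [integral_sub (h.integrable_test _ hη') (h'.integrable_test _ hη'),
      integral_sub (h.integrable_test_grad 0 hη) (h'.integrable_test_grad 0 hη),
      integral_sub (h.integrable_trace hη0) (h'.integrable_trace hη0)]
    linarith [h.green η hη, h'.green η hη]

theorem setIntegral_horizontal (k : Full n → ℝ) (y : Bdry n) :
    ∫ z in ℍ[n], k (z + (0, y)) = ∫ z in ℍ[n], k z :=
  (measurePreserving_horizontal y).integral_comp
    (MeasurableEquiv.addRight ((0, y) : Full n)).measurableEmbedding k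

/-- Horizontal translation. -/
theorem translate (h : IsTracedEnergy u G f) (y : Bdry n) :
    IsTracedEnergy (fun z => u (z + (0, y))) (fun i z => G i (z + (0, y))) fun x => f (x + y) := by
  have hshift : ∀ {η : Full n → ℝ}, η ∈ 𝓣[Full n] →
      (fun z => η (z + (0, -y))) ∈ 𝓣[Full n] := fun hη =>
    testFun_mono (subset_univ _) (testFun_translate hη _)
  have hz : ∀ z : Full n, z + (0, y) + (0, -y) = z := fun z => by rw [add_assoc]; simp
  refine ⟨h.1.translate le_rfl, fun K hK => ?_, fun η hη => ?_, fun η hη => ?_⟩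
  · exact memLp_two_translate h.memLp_trace y hK
  · have := (measurePreserving_horizontal y).integrable_comp_of_integrable
      (h.integrable_test _ (hshift hη))
    simpa only [Function.comp_def, hz] using this
  · have h1 := h.green _ (hshift hη)
    simp only [IsScalarEnergy.fderiv_comp_add] at h1
    rw [← setIntegral_horizontal (fun z => fderiv ℝ η (z + (0, -y)) (fullDir n 0) * u z) y,
      ← setIntegral_horizontal (fun z => η (z + (0, -y)) * G 0 z) y,
      ← integral_add_right_eq_self _ y] at h1
    simp only [hz] at h1
    rw [h1]
    congr 1
    refine integral_congr_ae (.of_forall fun x => ?_)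
    simp

/-- Multiplication by a cutoff function. -/
theorem mul_test (h : IsTracedEnergy u G f) (hu : MemLp u 2 volℍ[n]) {χ : Full n → ℝ}
    (hχ : χ ∈ 𝓣[Full n]) : IsTracedEnergy (fun z => χ z * u z)
      (fun i z => χ z * G i z + fderiv ℝ χ z (fullDir n i) * u z) fun x => χ (0, x) * f x := by
  have hmul : ∀ {η ζ : Full n → ℝ}, η ∈ 𝓣[Full n] →
      ζ ∈ 𝓣[Full n] → (fun z => η z * ζ z) ∈ 𝓣[Full n] :=
    fun hη hζ => testFun_mul hη.1 hζ
  refine ⟨h.1.mul_test hu hχ, fun K hK => ?_, fun η hη => ?_, fun η hη => ?_⟩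
  · obtain ⟨B, hB⟩ := (testFun_continuous hχ).bounded_above_of_compact_support hχ.2.1
    refine (h.memLp_trace K hK).of_le_mul (c := B)
      ((testFun_continuous (testFun_boundary hχ)).aestronglyMeasurable.mul
        (h.memLp_trace K hK).1) (.of_forall fun x => ?_)
    rw [norm_mul]
    exact mul_le_mul_of_nonneg_right (hB _) (norm_nonneg _)
  · have := h.integrable_test _ (hmul hη hχ)
    simpa only [mul_assoc] using this
  · have h1 := h.green _ (hmul hη hχ)
    have hη' := testFun_fderiv hη (fullDir n 0)
    have hχ' := testFun_fderiv hχ (fullDir n 0)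
    have e1 : ∀ z, fderiv ℝ (fun z => η z * χ z) z (fullDir n 0) * u z =
        fderiv ℝ η z (fullDir n 0) * χ z * u z + η z * fderiv ℝ χ z (fullDir n 0) * u z := by
      intro z
      rw [fderiv_fun_mul (testFun_differentiable hη z) (testFun_differentiable hχ z)]
      simp only [_root_.add_apply, _root_.smul_apply, smul_eq_mul]
      ring
    simp only [e1] at h1
    rw [integral_add (h.integrable_test _ (hmul hη' hχ)) (h.integrable_test _ (hmul hη hχ'))] at h1
    have e2 : ∫ z in ℍ[n], η z * (χ z * G 0 z + fderiv ℝ χ z (fullDir n 0) * u z) =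
        (∫ z in ℍ[n], η z * χ z * G 0 z) + ∫ z in ℍ[n], η z * fderiv ℝ χ z (fullDir n 0) * u z := by
      rw [← integral_add (h.integrable_test_grad 0 (hmul hη hχ))
        (h.integrable_test _ (hmul hη hχ'))]
      refine integral_congr_ae (.of_forall fun z => ?_)
      simp only; ring
    rw [e2]
    simp only [← mul_assoc]
    linarith

/-- Averages of horizontal translates. -/
theorem avg (h : IsTracedEnergy u G f) (hu : MemLp u 2 volℍ[n]) (κ : Measure (Bdry n))
    [IsProbabilityMeasure κ] : IsTracedEnergy
      (avgTranslate (κ.map fun y => (0, y)) (ℍ[n].indicator u))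
      (fun i => avgTranslate (κ.map fun y => (0, y)) (ℍ[n].indicator (G i)))
      (avgTranslate κ f) := by
  have hmeas : Measurable fun y : Bdry n => ((0, y) : Full n) := by fun_prop
  set ν : Measure (Full n) := κ.map fun y => (0, y) with hν
  have : IsProbabilityMeasure ν := Measure.isProbabilityMeasure_map hmeas.aemeasurable
  have hup : ∀ᵐ y ∂ν, 0 ≤ y.1 := by
    rw [hν, ae_map_iff hmeas.aemeasurable (measurableSet_le measurable_const measurable_fst)]
    exact .of_forall fun _ => le_rfl
  have hf2 := h.memLp_two hu
  have hmem : ∀ {w : Full n → ℝ}, MemLp w 2 volℍ[n] →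
      MemLp (avgTranslate ν (ℍ[n].indicator w)) 2 volume := fun hw => by
    have := (memLp_avgTranslate holderConjugate_two (memLp_indicator_halfSpace hw) ν).1
    rwa [ennreal_ofReal_two] at this
  have hswap : ∀ {η w : Full n → ℝ}, η ∈ 𝓣[Full n] → MemLp w 2 volℍ[n] →
      Integrable (fun y => ∫ z in ℍ[n], η z * w (z + (0, y))) κ ∧
      ∫ z in ℍ[n], η z * avgTranslate ν (ℍ[n].indicator w) z =
      ∫ y, (∫ z in ℍ[n], η z * w (z + (0, y))) ∂κ := by
    intro η w hη hw
    have hη2 := memLp_indicator_halfSpace ((testFun_memLp hη 2).restrict ℍ[n])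
    have hw2 := memLp_indicator_halfSpace hw
    have h1 := integral_mul_avgTranslate holderConjugate_two hη2 hw2 ν
    have h2 := (integrable_mul_add holderConjugate_two hη2 hw2 ν).integral_prod_right
    have e : ∀ y : Bdry n, ∫ z, ℍ[n].indicator η z * ℍ[n].indicator w (z + (0, y)) =
        ∫ z in ℍ[n], η z * w (z + (0, y)) := by
      intro y
      rw [setIntegral_mul_eq]
      refine integral_congr_ae (.of_forall fun z => ?_)
      by_cases hz : z ∈ ℍ[n]
      · have : z + (0, y) ∈ ℍ[n] := by rw [mem_halfSpace] at *; simpa using hz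
        simp only [indicator_of_mem this]
      · simp only [indicator_of_notMem hz, zero_mul]
    rw [setIntegral_mul_eq, h1, hν, integral_map hmeas.aemeasurable h2.1]
    rw [hν, integrable_map_measure h2.1 hmeas.aemeasurable] at h2
    exact ⟨h2.congr (.of_forall fun y => e y), integral_congr_ae (.of_forall fun y => e y)⟩
  refine ⟨h.1.avg hu ν hup, fun K _ => ?_, fun η hη => ?_, fun η hη => ?_⟩
  · have := (memLp_avgTranslate holderConjugate_two (f := f) (μ := (volume : Measure (Bdry n)))
      (by rwa [ennreal_ofReal_two]) κ).1
    rw [ennreal_ofReal_two] at this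
    exact this.restrict K
  · exact integrable_mul_two ((testFun_memLp hη 2).restrict _) ((hmem hu).restrict _)
  · have s1 := hswap (testFun_fderiv hη (fullDir n 0)) hu
    have s2 := hswap hη (h.memLp_grad 0)
    -- Each horizontal translate satisfies Green's identity; the identity for the average is
    -- obtained by integrating over the translations.
    rw [s1.2, s2.2, ← integral_add s1.1 s2.1]
    have s3 := integral_mul_avgTranslate (μ := (volume : Measure (Bdry n))) holderConjugate_two
      (testFun_memLp (testFun_boundary hη) _) (f := f) (by rwa [ennreal_ofReal_two]) κ
    rw [s3, ← integral_neg]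
    refine integral_congr_ae (.of_forall fun y => ?_)
    exact (h.translate y).green η hη

end IsTracedEnergy

/-- The boundary value of the approximations `approxFun`, for a horizontal averaging measure. -/
noncomputable def approxTrace (κ : Measure (Bdry n)) (χ : Full n → ℝ) (y : Bdry n)
    (f : Bdry n → ℝ) : Bdry n → ℝ :=
  avgTranslate κ fun x => χ (0, x) * (f x - f (x + y))

/-- Averaging only horizontally keeps the trace explicit: it undergoes the same operations on the
boundary. The upward averages used for density would mix in interior values. -/
theorem IsTracedEnergy.approx (h : IsTracedEnergy u G f) {χ : Full n → ℝ}
    (hχ : χ ∈ 𝓣[Full n]) (y : Bdry n) (κ : Measure (Bdry n)) [IsProbabilityMeasure κ] :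
    IsTracedEnergy (approxFun (κ.map fun y => (0, y)) χ (0, y) u)
      (approxGrad (κ.map fun y => (0, y)) χ (0, y) u G) (approxTrace κ χ y f) :=
  ((h.sub (h.translate y)).mul_test (h.1.memLp_sub_translate le_rfl) hχ).avg
    (h.1.memLp_cutoff_sub hχ le_rfl) κ

theorem exists_isApproxIdentity_horizontal : ∃ ρ : ℕ → Bdry n → ℝ,
    (∀ k, ρ k ∈ 𝓣[Bdry n]) ∧ (∀ k y, 0 ≤ ρ k y) ∧
      (∀ k, IsProbabilityMeasure (mollMeasure volume (ρ k))) ∧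
      IsApproxIdentity fun k => (mollMeasure volume (ρ k)).map fun y => ((0, y) : Full n) := by
  have hd : ∀ k : ℕ, (0 : ℝ) < 1 / ((k : ℝ) + 1) := fun k => by positivity
  have hmeas : Measurable fun y : Bdry n => ((0, y) : Full n) := by fun_prop
  choose ρ h1 h2 h3 using fun k : ℕ => exists_mollifier (volume : Measure (Bdry n)) 0 (hd k)
  have hp := fun k => isProbabilityMeasure_mollMeasure (h1 k) (h2 k) (h3 k)
  refine ⟨ρ, fun k => testFun_mono (subset_univ _) (h1 k), h2, hp, fun k => ?_, fun k => ?_,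
    fun δ hδ => ?_⟩
  · have := hp k
    exact Measure.isProbabilityMeasure_map hmeas.aemeasurable
  · rw [ae_map_iff hmeas.aemeasurable (measurableSet_le measurable_const measurable_fst)]
    exact .of_forall fun _ => le_rfl
  · filter_upwards [(tendsto_one_div_add_atTop_nhds_zero_nat (𝕜 := ℝ)).eventually_lt_const hδ]
      with k hk
    rw [ae_map_iff hmeas.aemeasurable (measurableSet_lt measurable_norm measurable_const)]
    filter_upwards [ae_mollMeasure (h1 k)] with y hy
    rw [Prod.norm_mk, norm_zero, max_eq_right (norm_nonneg _)]
    exact (mem_ball_zero_iff.1 hy).trans hk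

end TraceOperations

/-! ### Norms of the approximate traces. -/

section BoundaryApproximation

variable {n : ℕ} {f : Bdry n → ℝ} {p q : ℝ}

theorem locallyIntegrable_translate (hf : LocallyIntegrable f volume) (y : Bdry n) :
    LocallyIntegrable (fun x => f (x + y)) volume := by
  rw [locallyIntegrable_iff]
  intro K hK
  have h1 := hf.integrableOn_isCompact (hK.image (by fun_prop : Continuous fun x => x + y))
  have h2 := measurePreserving_add_right_restrict (μ := volume) y ((fun x => x + y) '' K)
  rw [preimage_image_eq _ (add_left_injective y)] at h2
  exact h2.integrable_comp_of_integrable h1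

theorem memLp_testFun_mul {χ v : Bdry n → ℝ} (hχ : χ ∈ 𝓣[Bdry n])
    {r : ℝ≥0∞} (hv : ∀ K : Set (Bdry n), IsCompact K → MemLp v r (volume.restrict K)) :
    MemLp (fun x => χ x * v x) r volume := by
  obtain ⟨B, hB⟩ := (testFun_continuous hχ).bounded_above_of_compact_support hχ.2.1
  have h1 : MemLp (fun x => χ x * v x) r (volume.restrict (tsupport χ)) := by
    refine (hv _ hχ.2.1.isCompact).of_le_mul (c := B)
      ((testFun_continuous hχ).aestronglyMeasurable.mul (hv _ hχ.2.1.isCompact).1)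
      (.of_forall fun x => ?_)
    rw [norm_mul]
    exact mul_le_mul_of_nonneg_right (hB _) (norm_nonneg _)
  rw [← memLp_indicator_iff_restrict (isClosed_tsupport χ).measurableSet] at h1
  refine h1.ae_eq (.of_forall fun x => ?_)
  by_cases hx : x ∈ tsupport χ
  · rw [indicator_of_mem hx]
  · simp only [indicator_of_notMem hx, image_eq_zero_of_notMem_tsupport hx, zero_mul]

theorem memLp_sub_translate_loc
    (hf : ∀ K : Set (Bdry n), IsCompact K → MemLp f 2 (volume.restrict K))
    (y : Bdry n) (K : Set (Bdry n)) (hK : IsCompact K) :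
    MemLp (fun x => f x - f (x + y)) 2 (volume.restrict K) :=
  (hf K hK).sub (memLp_two_translate hf y hK)

/-- The approximate traces are test functions. -/
theorem approxTrace_mem (hf : ∀ K : Set (Bdry n), IsCompact K → MemLp f 2 (volume.restrict K))
    {χ : Full n → ℝ} (hχ : χ ∈ 𝓣[Full n]) (y : Bdry n) {ρ : Bdry n → ℝ}
    (hρ : ρ ∈ 𝓣[Bdry n]) (h0 : ∀ y, 0 ≤ ρ y) :
    approxTrace (mollMeasure volume ρ) χ y f ∈ 𝓣[Bdry n] := by
  have hχ0 := testFun_boundary hχ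
  have hD := memLp_testFun_mul hχ0 (memLp_sub_translate_loc hf y)
  refine ⟨contDiff_avgTranslate_mollMeasure hρ h0 (hD.locallyIntegrable (by norm_num)),
    hasCompactSupport_avgTranslate_mollMeasure hρ h0 hχ0.2.1.isCompact fun x hx => ?_,
    subset_univ _⟩
  rw [show χ (0, x) = 0 from image_eq_zero_of_notMem_tsupport (f := fun x => χ (0, x)) hx, zero_mul]

theorem fderiv_boundary {χ : Full n → ℝ} (hχ : χ ∈ 𝓣[Full n]) (x h : Bdry n) :
    fderiv ℝ (fun x : Bdry n => χ (0, x)) x h = fderiv ℝ χ (0, x) (0, h) := by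
  have h1 : HasFDerivAt (fun x : Bdry n => ((0 : ℝ), x)) (ContinuousLinearMap.inr ℝ ℝ (Bdry n)) x :=
    hasFDerivAt_prodMk_right 0 x
  have h2 := ((testFun_differentiable hχ (0, x)).hasFDerivAt).comp x h1
  rw [show (fun x : Bdry n => χ (0, x)) = χ ∘ fun x => (0, x) from rfl, h2.fderiv]
  rfl

/-- Approximate traces inherit `L^q` bounds on differences. -/
theorem eLpNorm_approxTrace_le (hpq : p.HolderConjugate q) {y : Bdry n}
    (hv : MemLp (fun x => f x - f (x + y)) (ofReal q) volume) (k : ℕ)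
    (κ : Measure (Bdry n)) [IsProbabilityMeasure κ] :
    eLpNorm (approxTrace κ (cutoff (Full n) k) y f) (ofReal q) volume ≤
      eLpNorm (fun x => f x - f (x + y)) (ofReal q) volume := by
  have hle : ∀ x, ‖cutoff (Full n) k (0, x) * (f x - f (x + y))‖ ≤ ‖f x - f (x + y)‖ := by
    intro x
    rw [norm_mul, Real.norm_of_nonneg (cutoff_nonneg _ _)]
    exact mul_le_of_le_one_left (norm_nonneg _) (cutoff_le_one _ _)
  have hm : MemLp (fun x => cutoff (Full n) k (0, x) * (f x - f (x + y))) (ofReal q)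
      volume := hv.of_le ((testFun_continuous
        (testFun_boundary (cutoff_mem k))).aestronglyMeasurable.mul hv.1) (.of_forall hle)
  exact (memLp_avgTranslate hpq hm κ).2.trans (eLpNorm_mono hle)

theorem weak_fderiv_translate {f g : Bdry n → ℝ} {h : Bdry n}
    (hw : ∀ ψ ∈ 𝓣[Bdry n], ∫ x, fderiv ℝ ψ x h * f x = - ∫ x, ψ x * g x)
    (y : Bdry n) {η : Bdry n → ℝ} (hη : η ∈ 𝓣[Bdry n]) :
    ∫ x, fderiv ℝ η x h * f (x + y) = - ∫ x, η x * g (x + y) := by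
  have h1 := hw _ (testFun_mono (subset_univ _) (testFun_translate hη (-y)))
  simp only [IsScalarEnergy.fderiv_comp_add] at h1
  rw [← integral_add_right_eq_self _ y,
    ← integral_add_right_eq_self (fun x => η (x + -y) * g x) y] at h1
  simpa using h1

/-- Approximate traces inherit weak gradients, up to an error due to the cutoff. -/
theorem exists_eLpNorm_fderiv_approxTrace_le (hpq : p.HolderConjugate q)
    (hf : ∀ K : Set (Bdry n), IsCompact K → MemLp f 2 (volume.restrict K)) {F : Fin n → Bdry n → ℝ}
    (hF : ∀ l, MemLp (F l) (ofReal q) volume) (hw : ∀ l, ∀ ψ ∈ 𝓣[Bdry n],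
      ∫ x, fderiv ℝ ψ x (bdryDir n l) * f x = - ∫ x, ψ x * F l x) (y : Bdry n) :
    ∃ C : ℝ≥0∞, C ≠ ⊤ ∧ ∀ (k : ℕ) (ρ : Bdry n → ℝ), ρ ∈ 𝓣[Bdry n] →
      (∀ y, 0 ≤ ρ y) → IsProbabilityMeasure (mollMeasure volume ρ) → ∀ l,
      eLpNorm (fun x => fderiv ℝ (approxTrace (mollMeasure volume ρ) (cutoff (Full n) k) y f) x
        (bdryDir n l)) (ofReal q) volume ≤
      2 * eLpNorm (F l) (ofReal q) volume + C * ofReal ((k : ℝ) + 1)⁻¹ := by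
  have hfl := locallyIntegrable_of_memLp_two hf
  have hflt := locallyIntegrable_translate hfl y
  have hq1 : (1 : ℝ≥0∞) ≤ ofReal q := ENNReal.one_le_ofReal.2 hpq.symm.lt.le
  -- weak derivatives in arbitrary directions
  have hwy : ∀ ψ ∈ 𝓣[Bdry n], ∫ x, fderiv ℝ ψ x y * f x = - ∫ x, ψ x * ∑ l, y l * F l x := by
    intro ψ hψ
    have e1 : ∀ x, fderiv ℝ ψ x y * f x = ∑ l, y l * (fderiv ℝ ψ x (bdryDir n l) * f x) := by
      intro x
      have : y = ∑ l, y l • bdryDir n l := by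
        ext j
        simp [bdryDir, Pi.single_apply]
      conv_lhs => rw [this]
      simp [Finset.sum_mul, mul_assoc]
    have e2 : ∀ x, ψ x * ∑ l, y l * F l x = ∑ l, y l * (ψ x * F l x) := by
      intro x
      rw [Finset.mul_sum]
      exact Finset.sum_congr rfl fun l _ => by ring
    have i1 : ∀ l, Integrable (fun x => fderiv ℝ ψ x (bdryDir n l) * f x) volume := fun l =>
      testFun_integrable_mul (locallyIntegrableOn_univ.2 hfl) (testFun_fderiv hψ _)
    have i2 : ∀ l, Integrable (fun x => ψ x * F l x) volume := fun l =>
      testFun_integrable_mul (locallyIntegrableOn_univ.2 ((hF l).locallyIntegrable hq1)) hψ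
    simp only [e1, e2]
    rw [integral_finsetSum _ fun l _ => (i1 l).const_mul _,
      integral_finsetSum _ fun l _ => (i2 l).const_mul _, ← Finset.sum_neg_distrib]
    refine Finset.sum_congr rfl fun l _ => ?_
    rw [integral_const_mul, integral_const_mul, hw l ψ hψ, mul_neg]
  -- The function f itself need not be in L^q, but its difference over y is, since the weak
  -- derivative of f in the direction y is.
  have hv : MemLp (fun x => f x - f (x + y)) (ofReal q) volume := by
    have h1 := (eLpNorm_translate_sub_le hpq isOpen_univ convex_univ y
      (locallyIntegrableOn_univ.2 hfl) (G := fun x => ∑ l, y l * F l x)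
      (by rw [Measure.restrict_univ]; exact memLp_finsetSum _ fun l _ => (hF l).const_mul _) hwy).1
    rw [preimage_univ, inter_univ, Measure.restrict_univ] at h1
    exact h1.neg.ae_eq (.of_forall fun x => by simp)
  have hvl : LocallyIntegrable (fun x => f x - f (x + y)) volume := hfl.sub hflt
  choose B hB0 hB using fun l : Fin n =>
    exists_abs_fderiv_cutoff_le (V := Full n) ((0, bdryDir n l) : Full n)
  -- The constant depends on y through the norm of the difference, but neither on k nor on the
  -- mollifier. The factor 2 in the main term comes from F l minus its translate, the factor 1/(k+1)
  -- from differentiating the cutoff.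
  refine ⟨(∑ l, ofReal (B l)) * eLpNorm (fun x => f x - f (x + y)) (ofReal q) volume,
    ENNReal.mul_ne_top (by simp) hv.eLpNorm_ne_top, fun k ρ hρ h0 hprob l => ?_⟩
  have hχ := testFun_boundary (cutoff_mem (V := Full n) k)
  set χ : Bdry n → ℝ := fun x => cutoff (Full n) k (0, x) with hχd
  have hg := approxTrace_mem hf (cutoff_mem k) y hρ h0
  set g := approxTrace (mollMeasure volume ρ) (cutoff (Full n) k) y f with hgd
  have hD2 := memLp_testFun_mul hχ (memLp_sub_translate_loc hf y)
  set D : Bdry n → ℝ := fun x => χ x * (f x - f (x + y)) with hD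
  set D' : Bdry n → ℝ := fun x => χ x * (F l x - F l (x + y)) +
    fderiv ℝ χ x (bdryDir n l) * (f x - f (x + y)) with hD'
  have hFy : MemLp (fun x => F l (x + y)) (ofReal q) volume := memLp_translate (hF l) y
  have hm1 : MemLp (fun x => χ x * (F l x - F l (x + y))) (ofReal q) volume ∧
      eLpNorm (fun x => χ x * (F l x - F l (x + y))) (ofReal q) volume ≤
      2 * eLpNorm (F l) (ofReal q) volume := by
    have hle : ∀ x, ‖χ x * (F l x - F l (x + y))‖ ≤ ‖F l x - F l (x + y)‖ := by
      intro x
      rw [norm_mul, hχd, Real.norm_of_nonneg (cutoff_nonneg _ _)]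
      exact mul_le_of_le_one_left (norm_nonneg _) (cutoff_le_one _ _)
    refine ⟨((hF l).sub hFy).of_le ((testFun_continuous hχ).aestronglyMeasurable.mul
      ((hF l).sub hFy).1) (.of_forall hle), (eLpNorm_mono hle).trans ?_⟩
    refine (eLpNorm_sub_le (hF l).1 hFy.1 hq1).trans ?_
    rw [eLpNorm_translate (hF l).1, two_mul]
  have hm2 : MemLp (fun x => fderiv ℝ χ x (bdryDir n l) * (f x - f (x + y))) (ofReal q)
      volume ∧ eLpNorm (fun x => fderiv ℝ χ x (bdryDir n l) * (f x - f (x + y)))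
        (ofReal q) volume ≤ ofReal (B l * ((k : ℝ) + 1)⁻¹) *
        eLpNorm (fun x => f x - f (x + y)) (ofReal q) volume := by
    have hle : ∀ x, ‖fderiv ℝ χ x (bdryDir n l) * (f x - f (x + y))‖ ≤
        B l * ((k : ℝ) + 1)⁻¹ * ‖f x - f (x + y)‖ := by
      intro x
      rw [norm_mul, fderiv_boundary (cutoff_mem k)]
      exact mul_le_mul_of_nonneg_right (hB l k _) (norm_nonneg _)
    exact ⟨hv.of_le_mul ((testFun_continuous (testFun_fderiv hχ _)).aestronglyMeasurable.mul hv.1)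
      (.of_forall hle), eLpNorm_le_mul_eLpNorm_of_ae_le_mul (.of_forall hle) _⟩
  have hD'm : MemLp D' (ofReal q) volume := hm1.1.add hm2.1
  have hD'n : eLpNorm D' (ofReal q) volume ≤ 2 * eLpNorm (F l) (ofReal q) volume +
      (∑ l, ofReal (B l)) * eLpNorm (fun x => f x - f (x + y)) (ofReal q) volume *
        ofReal ((k : ℝ) + 1)⁻¹ := by
    refine (eLpNorm_add_le hm1.1.1 hm2.1.1 hq1).trans (add_le_add hm1.2 (hm2.2.trans ?_))
    rw [ENNReal.ofReal_mul (hB0 l), mul_right_comm]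
    gcongr
    exact Finset.single_le_sum (f := fun l => ofReal (B l)) (fun _ _ => zero_le) (Finset.mem_univ l)
  have hweak : ∀ ψ ∈ 𝓣[Bdry n], ∫ x, fderiv ℝ ψ x (bdryDir n l) * D x = - ∫ x, ψ x * D' x := by
    intro ψ hψ
    have iv : ∀ {η}, η ∈ 𝓣[Bdry n] →
        Integrable (fun x => η x * (f x - f (x + y))) volume := fun hη =>
      testFun_integrable_mul (locallyIntegrableOn_univ.2 hvl) hη
    have hmul : (fun x => ψ x * χ x) ∈ 𝓣[Bdry n] := testFun_mul hψ.1 hχ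
    have hl := (hF l).locallyIntegrable hq1
    have hly := hFy.locallyIntegrable hq1
    have e1 : ∫ x, fderiv ℝ (fun x => ψ x * χ x) x (bdryDir n l) * (f x - f (x + y)) =
        - ∫ x, ψ x * χ x * (F l x - F l (x + y)) := by
      have hm := testFun_fderiv hmul (bdryDir n l)
      simp only [mul_sub]
      rw [integral_sub (testFun_integrable_mul (locallyIntegrableOn_univ.2 hfl) hm)
        (testFun_integrable_mul (locallyIntegrableOn_univ.2 hflt) hm),
        integral_sub (testFun_integrable_mul (locallyIntegrableOn_univ.2 hl) hmul)
        (testFun_integrable_mul (locallyIntegrableOn_univ.2 hly) hmul), hw l _ hmul, weak_fderiv_translate (hw l) y hmul]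
      ring
    have hψ' := testFun_fderiv hψ (bdryDir n l)
    have hχ' := testFun_fderiv hχ (bdryDir n l)
    have e2 : ∀ x, fderiv ℝ (fun x => ψ x * χ x) x (bdryDir n l) * (f x - f (x + y)) =
        fderiv ℝ ψ x (bdryDir n l) * χ x * (f x - f (x + y)) +
          ψ x * fderiv ℝ χ x (bdryDir n l) * (f x - f (x + y)) := by
      intro x
      rw [fderiv_fun_mul (testFun_differentiable hψ x) (testFun_differentiable hχ x)]
      simp only [_root_.add_apply, _root_.smul_apply, smul_eq_mul]
      ring
    simp only [e2] at e1
    rw [integral_add (iv (testFun_mul hψ'.1 hχ)) (iv (testFun_mul hψ.1 hχ'))] at e1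
    have e3 : ∫ x, ψ x * D' x = (∫ x, ψ x * χ x * (F l x - F l (x + y))) +
        ∫ x, ψ x * fderiv ℝ χ x (bdryDir n l) * (f x - f (x + y)) := by
      have i3 : Integrable (fun x => ψ x * χ x * (F l x - F l (x + y))) volume :=
        testFun_integrable_mul (locallyIntegrableOn_univ.2 (hl.sub hly)) hmul
      rw [← integral_add i3 (iv (testFun_mul hψ.1 hχ'))]
      refine integral_congr_ae (.of_forall fun x => ?_)
      simp only [hD']; ring
    rw [e3]
    have e4 : ∫ x, fderiv ℝ ψ x (bdryDir n l) * D x =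
        ∫ x, fderiv ℝ ψ x (bdryDir n l) * χ x * (f x - f (x + y)) := by
      simp only [hD, mul_assoc]
    rw [e4]; linarith
  -- The classical derivative of the mollified function is the average of the weak derivative D'.
  -- Both have the same pairings with test functions: D is in L² and D' in L^q, so the exchange of
  -- integrals is made with different exponents on the two sides.
  have hae : 𝐃[g,bdryDir n l] =ᵐ[volume] avgTranslate (mollMeasure volume ρ) D' := by
    have hA := memLp_avgTranslate hpq hD'm (mollMeasure volume ρ)
    refine ae_eq_of_forall_testFun ((testFun_continuous (testFun_fderiv hg _)).locallyIntegrable)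
      (hA.1.locallyIntegrable hq1) fun ψ hψ => ?_
    have h1 := integral_fderiv_mul_test (μ := (volume : Measure (Bdry n))) hψ hg (bdryDir n l)
    have h2 := integral_mul_avgTranslate (μ := (volume : Measure (Bdry n))) holderConjugate_two
      (testFun_memLp (testFun_fderiv hψ (bdryDir n l)) _) (f := D)
      (by rwa [ennreal_ofReal_two]) (mollMeasure volume ρ)
    have h3 := integral_mul_avgTranslate (μ := (volume : Measure (Bdry n))) hpq
      (testFun_memLp hψ _) hD'm (mollMeasure volume ρ)
    rw [h3, ← neg_inj, ← h1, ← integral_neg]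
    refine h2.trans (integral_congr_ae (.of_forall fun x => ?_))
    exact weak_fderiv_translate hweak x hψ
  rw [eLpNorm_congr_ae hae]
  exact (memLp_avgTranslate hpq hD'm _).2.trans hD'n

end BoundaryApproximation

/-! ### Real coordinates of complex vectors. -/

section RealCoordinates

/-- The real part (`false`) and the imaginary part (`true`). -/
noncomputable def part : Bool → ℂ →L[ℝ] ℝ
  | true => Complex.imCLM
  | false => Complex.reCLM

/-- The real basis of `ℂ` that belongs to `part`. -/
noncomputable def cunit : Bool → ℂ
  | true => Complex.I
  | false => 1

theorem part_cunit (b c : Bool) : part b (cunit c) = if b = c then 1 else 0 := by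
  cases b <;> cases c <;> simp [part, cunit]

theorem sum_part (z : ℂ) : ∑ b, part b z • cunit b = z := by
  rw [Fintype.sum_bool]
  apply Complex.ext <;> simp [part, cunit]

theorem eq_of_part {z w : ℂ} (h : ∀ b, part b z = part b w) : z = w := by
  rw [← sum_part z, ← sum_part w]
  simp only [h]

theorem norm_cunit (b : Bool) : ‖cunit b‖ = 1 := by cases b <;> simp [cunit]

theorem abs_part_le (b : Bool) (z : ℂ) : |part b z| ≤ ‖z‖ := by
  cases b
  · exact Complex.abs_re_le_norm z
  · exact Complex.abs_im_le_norm z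

theorem re_conj_mul (z w : ℂ) : (z * conj w).re = ∑ b, part b w * part b z := by
  rw [Fintype.sum_bool]
  simp [part]
  ring

variable {ι : Type*} [Fintype ι]

/-- The real coordinates of a complex vector. -/
noncomputable def coord (c : ι × Bool) : EuclideanSpace ℂ ι →L[ℝ] ℝ :=
  (part c.2).comp ((EuclideanSpace.proj c.1 : EuclideanSpace ℂ ι →L[ℂ] ℂ).restrictScalars ℝ)

theorem coord_apply (c : ι × Bool) (v : EuclideanSpace ℂ ι) : coord c v = part c.2 (v c.1) := rfl

/-- Real parts of complex pairings are sums of real scalar pairings. Imaginary parts are recovered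
later by multiplying one argument by i. -/
theorem re_inner_eq (v w : EuclideanSpace ℂ ι) : (inner ℂ v w).re = ∑ c, coord c v * coord c w := by
  rw [PiLp.inner_apply, Complex.re_sum, Fintype.sum_prod_type]
  refine Finset.sum_congr rfl fun a _ => ?_
  simp only [coord_apply]
  rw [← re_conj_mul]
  simp [RCLike.inner_apply]

theorem abs_coord_le (c : ι × Bool) (v : EuclideanSpace ℂ ι) : |coord c v| ≤ ‖v‖ :=
  (abs_part_le _ _).trans (PiLp.norm_apply_le v c.1)

theorem eLpNorm_coord_le {α : Type*} [MeasurableSpace α] {μ : Measure α} (u : α → EuclideanSpace ℂ ι) (p : ℝ≥0∞) (c : ι × Bool) :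
    eLpNorm (fun z => coord c (u z)) p μ ≤ eLpNorm u p μ :=
  eLpNorm_mono fun z => abs_coord_le c (u z)

variable [DecidableEq ι]

/-- The real basis that belongs to `coord`. -/
noncomputable def realBasis (c : ι × Bool) : EuclideanSpace ℂ ι :=
  EuclideanSpace.single c.1 (cunit c.2)

theorem realBasis_apply (c : ι × Bool) (a : ι) :
    realBasis c a = if a = c.1 then cunit c.2 else 0 := by
  simp [realBasis]

theorem sum_coord (v : EuclideanSpace ℂ ι) : ∑ c, coord c v • realBasis c = v := by
  ext a
  rw [Fintype.sum_prod_type]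
  simp only [WithLp.ofLp_sum, Finset.sum_apply, PiLp.smul_apply, realBasis_apply, coord_apply,
    smul_ite, smul_zero, Finset.sum_ite_irrel, Finset.sum_const_zero]
  rw [Finset.sum_ite_eq, if_pos (Finset.mem_univ a)]
  exact sum_part (v a)

theorem coord_realBasis (c d : ι × Bool) : coord c (realBasis d) = if c = d then 1 else 0 := by
  rw [coord_apply, realBasis_apply]
  by_cases h : c.1 = d.1
  · rw [if_pos h, part_cunit]
    by_cases h2 : c.2 = d.2
    · rw [if_pos h2, if_pos (Prod.ext h h2)]
    · rw [if_neg h2, if_neg fun e => h2 (by rw [e])]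
  · rw [if_neg h, if_neg fun e => h (by rw [e]), map_zero]

theorem coord_sum_smul (x : ι × Bool → ℝ) (c : ι × Bool) :
    coord c (∑ d, x d • realBasis d) = x c := by
  simp [map_sum, coord_realBasis]

theorem norm_realBasis (c : ι × Bool) : ‖realBasis c‖ = 1 := by simp [realBasis, norm_cunit]

theorem norm_le_sum_coord (v : EuclideanSpace ℂ ι) : ‖v‖ ≤ ∑ c, |coord c v| := by
  conv_lhs => rw [← sum_coord v]
  refine (norm_sum_le _ _).trans (Finset.sum_le_sum fun c _ => ?_)
  rw [norm_smul, norm_realBasis, mul_one, Real.norm_eq_abs]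

variable {α : Type*} [MeasurableSpace α] {μ : Measure α}

theorem memLp_iff_coord {u : α → EuclideanSpace ℂ ι} {p : ℝ≥0∞} :
    MemLp u p μ ↔ ∀ c, MemLp (fun z => coord c (u z)) p μ := by
  refine ⟨fun h c => (coord c).comp_memLp' h, fun h => ?_⟩
  have h1 : MemLp (fun z => ∑ c, coord c (u z) • realBasis c) p μ := memLp_finsetSum _ fun c _ =>
      (ContinuousLinearMap.toSpanSingleton ℝ (realBasis c)).comp_memLp' (h c)
  simpa only [sum_coord] using h1

theorem memLp_part_iff {v : α → ℂ} {p : ℝ≥0∞} :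
    MemLp v p μ ↔ ∀ b, MemLp (fun z => part b (v z)) p μ := by
  rw [← memLp_re_im_iff, Bool.forall_bool]
  rfl

theorem eLpNorm_le_sum_coord {u : α → EuclideanSpace ℂ ι} {p : ℝ≥0∞} (hp : 1 ≤ p)
    (hu : MemLp u p μ) : eLpNorm u p μ ≤ ∑ c, eLpNorm (fun z => coord c (u z)) p μ := by
  calc eLpNorm u p μ ≤ eLpNorm (fun z => ∑ c, |coord c (u z)|) p μ := by
        refine eLpNorm_mono_real fun z => norm_le_sum_coord _
    _ = eLpNorm (∑ c, fun z => |coord c (u z)|) p μ := by congr 1; ext z; simp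
    _ ≤ ∑ c, eLpNorm (fun z => |coord c (u z)|) p μ :=
        eLpNorm_sum_le (fun c _ => (memLp_iff_coord.1 hu c).1.norm) hp
    _ = _ := Finset.sum_congr rfl fun c _ => eLpNorm_norm fun z => coord c (u z)

theorem part_integral {f : α → ℂ} (hf : Integrable f μ) (b : Bool) :
    part b (∫ z, f z ∂μ) = ∫ z, part b (f z) ∂μ := ((part b).integral_comp_comm hf).symm

theorem part_smul (b : Bool) (r : ℝ) (z : ℂ) : part b (r • z) = r * part b z := by
  rw [map_smul, smul_eq_mul]

end RealCoordinates

/-! ### Complex energy functions and their scalar components. -/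

section Conversion

variable {n m : ℕ}

/-- Test functions of Mathlib and their real coordinates. -/
theorem testFun_coord {V ι : Type*} [NormedAddCommGroup V] [NormedSpace ℝ V] [Fintype ι]
    {Ω : Opens V} (φ : 𝓓(Ω, EuclideanSpace ℂ ι)) (c : ι × Bool) :
    (fun z => coord c (φ z)) ∈ testFun (Ω : Set V) := by
  refine ⟨(coord c).contDiff.comp φ.contDiff, φ.hasCompactSupport.comp_left (map_zero _),
    (closure_mono fun z hz => ?_).trans φ.tsupport_subset⟩
  rw [Function.mem_support] at *
  exact fun h => hz (by rw [h, map_zero])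

theorem contDiff_sum_realBasis {V ι : Type*} [NormedAddCommGroup V] [NormedSpace ℝ V] [Fintype ι]
    [DecidableEq ι] {Ω : Set V} {ψ : ι × Bool → V → ℝ} (hψ : ∀ c, ψ c ∈ testFun Ω) :
    ContDiff ℝ ∞ (fun z => ∑ c, ψ c z • realBasis c) ∧
      HasCompactSupport (fun z => ∑ c, ψ c z • realBasis c) ∧
      tsupport (fun z => ∑ c, ψ c z • realBasis c) ⊆ Ω := by
  have hsub : tsupport (fun z => ∑ c, ψ c z • realBasis c) ⊆ ⋃ c, tsupport (ψ c) := by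
    refine closure_minimal (fun z hz => ?_) (isClosed_iUnion_of_finite fun c => isClosed_tsupport _)
    by_contra h
    refine hz (Finset.sum_eq_zero fun c _ => ?_)
    rw [image_eq_zero_of_notMem_tsupport fun hc => h (mem_iUnion.2 ⟨c, hc⟩), zero_smul]
  refine ⟨ContDiff.sum fun c _ => (hψ c).1.smul contDiff_const, ?_,
    hsub.trans (iUnion_subset fun c => (hψ c).2.2)⟩
  exact (isCompact_iUnion fun c => (hψ c).2.1.isCompact).of_isClosed_subset
    (isClosed_tsupport _) hsub

/-- The test function with given real coordinates. -/
noncomputable def testOfCoord {V ι : Type*} [NormedAddCommGroup V] [NormedSpace ℝ V] [Fintype ι]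
    [DecidableEq ι] {Ω : Opens V} {ψ : ι × Bool → V → ℝ}
    (hψ : ∀ c, ψ c ∈ testFun (Ω : Set V)) : 𝓓(Ω, EuclideanSpace ℂ ι) where
  toFun z := ∑ c, ψ c z • realBasis c
  contDiff' := (contDiff_sum_realBasis hψ).1
  hasCompactSupport' := (contDiff_sum_realBasis hψ).2.1
  tsupport_subset' := (contDiff_sum_realBasis hψ).2.2

theorem coord_testOfCoord {V ι : Type*} [NormedAddCommGroup V] [NormedSpace ℝ V] [Fintype ι]
    [DecidableEq ι] {Ω : Opens V} {ψ : ι × Bool → V → ℝ}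
    (hψ : ∀ c, ψ c ∈ testFun (Ω : Set V)) (c : ι × Bool) (z : V) :
    coord c (testOfCoord hψ z) = ψ c z := coord_sum_smul (fun c => ψ c z) c

theorem coord_classicalGrad {V ι κ : Type*} [NormedAddCommGroup V] [NormedSpace ℝ V] [Fintype ι]
    [Fintype κ] (e : κ → V) {φ : V → EuclideanSpace ℂ ι} {z : V} (hφ : DifferentiableAt ℝ φ z)
    (a : ι) (i : κ) (b : Bool) :
    coord ((a, i), b) (classicalGrad e φ z) = fderiv ℝ (fun z => coord (a, b) (φ z)) z (e i) := by
  have h := ((coord (a, b)).hasFDerivAt (x := φ z)).comp z hφ.hasFDerivAt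
  have h2 : fderiv ℝ (fun z => coord (a, b) (φ z)) z = (coord (a, b)).comp (fderiv ℝ φ z) := h.fderiv
  rw [h2]
  rfl

theorem integrable_test_smul {Ω : Set (Full n)} {v : Full n → ℂ} {φ : Full n → ℝ}
    (hv : ∀ b, LocallyIntegrableOn (fun z => part b (v z)) Ω volume)
    (hφ : φ ∈ testFun Ω) : Integrable (fun z => φ z • v z) volume := by
  rw [← memLp_one_iff_integrable, memLp_part_iff]
  intro b
  rw [memLp_one_iff_integrable]
  refine (testFun_integrable_mul (hv b) hφ).congr (.of_forall fun z => ?_)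
  simp only [part_smul]

variable {u : Full n → ℂᵛ[m]} {G : Full n → ℂᴳ[m,n]}

/-- The test functions in the weak gradient are real, so the identity separates into the real
coordinates; integrability separates as well. This transfers the scalar theory to systems. -/
theorem isEnergyFunction_iff : IsEnergyFunction u G ↔ ∀ c : Fin m × Bool,
    IsScalarEnergy (fun z => coord c (u z)) fun i z => coord ((c.1, i), c.2) (G z) := by
  have key : (∀ c : Fin m × Bool, ∀ K : Set (Full n), IsCompact K →
      K ⊆ ℍ[n] → MemLp (fun z => coord c (u z)) 2 (volume.restrict K)) →
      (∀ c : Fin m × Bool, ∀ i, MemLp (fun z => coord ((c.1, i), c.2) (G z)) 2 volℍ[n]) →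
      ∀ φ ∈ testFun ℍ[n], ∀ (a : Fin m) (i : Fin (n + 1)),
      ((∫ z in ℍ[n], (fderiv ℝ φ z (fullDir n i)) • (u z a) = - ∫ z in ℍ[n], (φ z) • (G z (a, i))) ↔
      ∀ b, ∫ z, fderiv ℝ φ z (fullDir n i) * coord (a, b) (u z) =
        - ∫ z, φ z * coord ((a, i), b) (G z)) := by
    intro h1 h2 φ hφ a i
    have hφ' := testFun_fderiv hφ (fullDir n i)
    have hu : ∀ b, LocallyIntegrableOn (fun z => part b (u z a)) ℍ[n]
        volume := fun b => locallyIntegrableOn_of_memLp (h1 (a, b))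
    have hG : ∀ b, LocallyIntegrableOn (fun z => part b (G z (a, i)))
        ℍ[n] volume := fun b => locallyIntegrableOn_of_memLp
      fun K _ hK => (h2 (a, b) i).mono_measure (Measure.restrict_mono hK le_rfl)
    have e1 : ∀ b, part b (∫ z in ℍ[n], (fderiv ℝ φ z (fullDir n i)) • (u z a)) =
        ∫ z, fderiv ℝ φ z (fullDir n i) * coord (a, b) (u z) := by
      intro b
      rw [part_integral (integrable_test_smul hu hφ').restrict]
      simp only [part_smul]
      exact setIntegral_testFun_mul hφ' _
    have e2 : ∀ b, part b (- ∫ z in ℍ[n], (φ z) • (G z (a, i))) =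
        - ∫ z, φ z * coord ((a, i), b) (G z) := by
      intro b
      rw [map_neg, part_integral (integrable_test_smul hG hφ).restrict]
      simp only [part_smul]
      rw [← setIntegral_testFun_mul hφ]
      rfl
    refine ⟨fun h b => ?_, fun h => eq_of_part fun b => ?_⟩
    · rw [← e1, ← e2, h]
    · rw [e1, e2, h b]
  constructor
  · intro h
    have h1 : ∀ c : Fin m × Bool, ∀ K : Set (Full n), IsCompact K →
      K ⊆ ℍ[n] → MemLp (fun z => coord c (u z)) 2 (volume.restrict K) :=
      fun c K hK hKH => memLp_iff_coord.1 (h.memLp_loc K hK hKH) c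
    have h2 : ∀ c : Fin m × Bool, ∀ i, MemLp (fun z => coord ((c.1, i), c.2) (G z)) 2 volℍ[n] :=
      fun c i => memLp_iff_coord.1 h.memLp_grad ((c.1, i), c.2)
    exact fun c => ⟨h1 c, h2 c, fun i φ hφ => (key h1 h2 φ hφ c.1 i).1
      (h.weak_grad ⟨φ, hφ.1, hφ.2.1, hφ.2.2⟩ c.1 i) c.2⟩
  · intro h
    refine ⟨fun K hK hKH => memLp_iff_coord.2 fun c => (h c).memLp_loc K hK hKH,
      memLp_iff_coord.2 fun c => (h (c.1.1, c.2)).memLp_grad c.1.2, fun φ a i => ?_⟩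
    exact (key (fun c => (h c).memLp_loc) (fun c => (h c).memLp_grad) φ
      ⟨φ.contDiff, φ.hasCompactSupport, φ.tsupport_subset⟩ a i).2
      fun b => (h (a, b)).weak_grad i φ ⟨φ.contDiff, φ.hasCompactSupport, φ.tsupport_subset⟩

theorem hasBoundaryValue_iff {f : Bdry n → ℂᵛ[m]} : HasBoundaryValue u f ↔
      ∀ c, HasBoundaryValue (fun z => coord c (u z)) fun x => coord c (f x) := by
  refine ⟨fun h c => h.clm (coord c), fun h => ?_⟩
  have h1 := HasBoundaryValue.sum Finset.univ fun c _ =>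
    (h c).clm (ContinuousLinearMap.toSpanSingleton ℝ (realBasis c))
  convert h1 using 1
  · ext1 z
    simp only [Finset.sum_apply, ContinuousLinearMap.toSpanSingleton_apply, sum_coord]
  · ext1 z
    simp only [Finset.sum_apply, ContinuousLinearMap.toSpanSingleton_apply, sum_coord]

/-- The components of an energy function with trace. -/
theorem isTracedEnergy_coord {f : Bdry n → ℂᵛ[m]} (h : IsEnergyFunction u G)
    (hf : IsTrace u f) (c : Fin m × Bool) :
    IsTracedEnergy (fun z => coord c (u z)) (fun i z => coord ((c.1, i), c.2) (G z))
      fun x => coord c (f x) :=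
  (isEnergyFunction_iff.1 h c).isTracedEnergy (hasBoundaryValue_iff.1 hf c)

/-- Assembly of an energy function with trace from its components. -/
theorem exists_energy_of_coord {v : Fin m × Bool → Full n → ℝ}
    {F : Fin m × Bool → Fin (n + 1) → Full n → ℝ} {g : Fin m × Bool → Bdry n → ℝ}
    (h : ∀ c, IsTracedEnergy (v c) (F c) (g c)) :
    IsEnergyFunction (fun z => ∑ c, v c z • realBasis c)
      (fun z => ∑ d : (Fin m × Fin (n + 1)) × Bool, F (d.1.1, d.2) d.1.2 z • realBasis d) ∧
    IsTrace (fun z => ∑ c, v c z • realBasis c) fun x => ∑ c, g c x • realBasis c := by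
  refine ⟨isEnergyFunction_iff.2 fun c => ?_, isTrace_iff.2 (hasBoundaryValue_iff.2 fun c => ?_)⟩
  · have := (h c).1
    simpa only [coord_sum_smul (fun c => v c _),
      coord_sum_smul (fun d : (Fin m × Fin (n + 1)) × Bool => F (d.1.1, d.2) d.1.2 _)] using this
  · have := (h c).hasBoundaryValue
    simpa only [coord_sum_smul (fun c => v c _), coord_sum_smul (fun c => g c _)] using this

theorem IsEnergyFunction.exists_trace (h : IsEnergyFunction u G) : ∃ f, IsTrace u f := by
  choose f hf using fun c => (isEnergyFunction_iff.1 h c).exists_isTracedEnergy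
  have := (exists_energy_of_coord fun c => (hf c).1).2
  simp only [sum_coord] at this
  exact ⟨_, this⟩

end Conversion

/-! ### Bounded coefficients as operators; the adjoint form. -/

section MatrixMultiplication

variable {κ : Type*} [Fintype κ] {α : Type*} [MeasurableSpace α] {μ : Measure α}

/-- The matrix `M` applied to a vector. -/
noncomputable def matApply (M : Matrix κ κ ℂ) (ξ : EuclideanSpace ℂ κ) : EuclideanSpace ℂ κ :=
  WithLp.toLp 2 fun a => ∑ b, M a b * ξ b

theorem matApply_apply (M : Matrix κ κ ℂ) (ξ : EuclideanSpace ℂ κ) (a : κ) :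
    matApply M ξ a = ∑ b, M a b * ξ b := rfl

theorem matApply_add (M : Matrix κ κ ℂ) (ξ η : EuclideanSpace ℂ κ) :
    matApply M (ξ + η) = matApply M ξ + matApply M η := by
  ext a
  simp [matApply_apply, mul_add, Finset.sum_add_distrib]

theorem matApply_smul (M : Matrix κ κ ℂ) (c : ℂ) (ξ : EuclideanSpace ℂ κ) :
    matApply M (c • ξ) = c • matApply M ξ := by
  ext a
  simp [matApply_apply, Finset.mul_sum, mul_left_comm]

theorem sesqForm_eq_inner (M : Matrix κ κ ℂ) (ξ η : EuclideanSpace ℂ κ) :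
    sesqForm M ξ η = inner ℂ η (matApply M ξ) := by
  simp [sesqForm, PiLp.inner_apply, RCLike.inner_apply, matApply_apply, Finset.sum_mul]

/-- The algebraic source of the duality: integrated, it identifies the energy pairing of w and u for
A* with the conjugate of that of u and w for A. -/
theorem sesqForm_conjTranspose (M : Matrix κ κ ℂ) (ξ η : EuclideanSpace ℂ κ) :
    sesqForm Mᴴ ξ η = conj (sesqForm M η ξ) := by
  simp only [sesqForm, map_sum, map_mul, Complex.conj_conj, Matrix.conjTranspose_apply]
  rw [Finset.sum_comm]
  refine Finset.sum_congr rfl fun a _ => Finset.sum_congr rfl fun b _ => ?_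
  rw [← Complex.star_def]; ring

theorem norm_matApply_le (M : Matrix κ κ ℂ) (ξ : EuclideanSpace ℂ κ) :
    ‖matApply M ξ‖ ≤ (∑ a, ∑ b, ‖M a b‖) * ‖ξ‖ := by
  classical
  have h : matApply M ξ = ∑ a, (∑ b, M a b * ξ b) • EuclideanSpace.single a (1 : ℂ) := by
    ext c
    simp [matApply_apply, Pi.single_apply]
  rw [h, Finset.sum_mul]
  refine (norm_sum_le _ _).trans (Finset.sum_le_sum fun a _ => ?_)
  rw [norm_smul, PiLp.norm_single, norm_one, mul_one, Finset.sum_mul]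
  refine (norm_sum_le _ _).trans (Finset.sum_le_sum fun b _ => ?_)
  rw [norm_mul]
  exact mul_le_mul_of_nonneg_left (PiLp.norm_apply_le ξ b) (norm_nonneg _)

variable {A : α → Matrix κ κ ℂ}

theorem exists_ae_norm_matApply_le (hA : ∀ a b, MemLp (fun z => A z a b) ∞ μ) :
    ∃ C : ℝ, 0 ≤ C ∧ ∀ᵐ z ∂μ, ∀ ξ, ‖matApply (A z) ξ‖ ≤ C * ‖ξ‖ := by
  have h1 : ∀ a b, ∀ᵐ z ∂μ, ‖A z a b‖ ≤ (eLpNorm (fun z => A z a b) ⊤ μ).toReal := by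
    intro a b
    have := ae_le_eLpNormEssSup (f := fun z => A z a b) (μ := μ)
    filter_upwards [this] with z hz
    rw [← eLpNorm_exponent_top] at hz
    have := ENNReal.toReal_mono (hA a b).eLpNorm_ne_top hz
    simpa using this
  refine ⟨∑ a, ∑ b, (eLpNorm (fun z => A z a b) ⊤ μ).toReal, by positivity, ?_⟩
  filter_upwards [ae_all_iff.2 fun a => ae_all_iff.2 fun b => h1 a b] with z hz ξ
  refine (norm_matApply_le _ _).trans ?_
  gcongr with a _ b _
  exact hz a b

theorem memLp_matApply (hA : ∀ a b, MemLp (fun z => A z a b) ∞ μ) {ξ : α → EuclideanSpace ℂ κ}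
    (hξ : MemLp ξ 2 μ) : MemLp (fun z => matApply (A z) (ξ z)) 2 μ := by
  classical
  obtain ⟨C, -, hC⟩ := exists_ae_norm_matApply_le hA
  refine hξ.of_le_mul (c := C) ?_ (hC.mono fun z hz => hz _)
  have h : (fun z => matApply (A z) (ξ z)) =
      fun z => ∑ a, (∑ b, A z a b * ξ z b) • EuclideanSpace.single a (1 : ℂ) := by
    ext z c
    simp [matApply_apply, Pi.single_apply]
  rw [h]
  have hc : ∀ b, AEStronglyMeasurable (fun z => ξ z b) μ := fun b =>
    (EuclideanSpace.proj b : EuclideanSpace ℂ κ →L[ℂ] ℂ).continuous.comp_aestronglyMeasurable hξ.1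
  refine Finset.aestronglyMeasurable_fun_sum _ fun a _ => AEStronglyMeasurable.smul_const ?_ _
  exact Finset.aestronglyMeasurable_fun_sum _ fun b _ => (hA a b).1.mul (hc b)

/-- Multiplication by bounded coefficients, as an operator on `L²`. -/
theorem exists_mulOperator (hA : ∀ a b, MemLp (fun z => A z a b) ∞ μ) :
    ∃ T : Lp (EuclideanSpace ℂ κ) 2 μ →L[ℂ] Lp (EuclideanSpace ℂ κ) 2 μ,
      ∀ f : Lp (EuclideanSpace ℂ κ) 2 μ, T f =ᵐ[μ] fun z => matApply (A z) (f z) := by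
  obtain ⟨C, hC0, hC⟩ := exists_ae_norm_matApply_le hA
  have hm : ∀ f : Lp (EuclideanSpace ℂ κ) 2 μ, MemLp (fun z => matApply (A z) (f z)) 2 μ :=
    fun f => memLp_matApply hA (Lp.memLp f)
  let T₀ : Lp (EuclideanSpace ℂ κ) 2 μ →ₗ[ℂ] Lp (EuclideanSpace ℂ κ) 2 μ :=
    { toFun := fun f => (hm f).toLp
      map_add' := fun f g => by
        rw [← MemLp.toLp_add]
        refine MemLp.toLp_congr _ _ ?_
        filter_upwards [Lp.coeFn_add f g] with z hz
        rw [hz, Pi.add_apply, matApply_add]; rfl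
      map_smul' := fun c f => by
        rw [RingHom.id_apply, ← MemLp.toLp_const_smul]
        refine MemLp.toLp_congr _ _ ?_
        filter_upwards [Lp.coeFn_smul c f] with z hz
        rw [hz, Pi.smul_apply, matApply_smul]; rfl }
  refine ⟨T₀.mkContinuous C fun f => Lp.norm_le_mul_norm_of_ae_le_mul ?_, fun f =>
    MemLp.coeFn_toLp (hm f)⟩
  filter_upwards [MemLp.coeFn_toLp (hm f), hC] with z hz h2
  rw [show T₀ f z = _ from hz]
  exact h2 _

end MatrixMultiplication

/-! ### Gradients of energy functions as a closed subspace of L². -/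

section EnergySpace

variable {n m : ℕ}

/-- The square integrable vector fields on the half-space. -/
abbrev FieldSpace (n m : ℕ) : Type := Lp ℂᴳ[m,n] 2 volℍ[n]

theorem classicalGrad_add {V ι κ : Type*} [NormedAddCommGroup V] [NormedSpace ℝ V]
    [Fintype ι] [Fintype κ] (e : κ → V) {φ ψ : V → EuclideanSpace ℂ ι} {z : V}
    (hφ : DifferentiableAt ℝ φ z) (hψ : DifferentiableAt ℝ ψ z) :
    classicalGrad e (φ + ψ) z = classicalGrad e φ z + classicalGrad e ψ z := by
  ext a
  simp [classicalGrad, fderiv_add hφ hψ]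

theorem classicalGrad_smul {V ι κ : Type*} [NormedAddCommGroup V] [NormedSpace ℝ V]
    [Fintype ι] [Fintype κ] (e : κ → V) (φ : V → EuclideanSpace ℂ ι) {z : V} (c : ℂ) 
    (hφ : DifferentiableAt ℝ φ z) : classicalGrad e (c • φ) z = c • classicalGrad e φ z := by
  ext a
  simp [classicalGrad, fderiv_const_smul hφ]

/-- The gradients of test functions on `ℝ^{1+n}`. -/
def testGradients (n m : ℕ) : Submodule ℂ (FieldSpace n m) where
  carrier := {f | ∃ φ : 𝓓((⊤ : Opens (Full n)), ℂᵛ[m]), f =ᵐ[volℍ[n]] classicalGrad (fullDir n) φ}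
  add_mem' := by
    rintro f g ⟨φ, hφ⟩ ⟨ψ, hψ⟩
    refine ⟨φ + ψ, ?_⟩
    filter_upwards [Lp.coeFn_add f g, hφ, hψ] with z h1 h2 h3
    rw [h1, Pi.add_apply, h2, h3]
    exact (classicalGrad_add _ (φ.contDiff.differentiable (by simp) z)
      (ψ.contDiff.differentiable (by simp) z)).symm
  zero_mem' := by
    refine ⟨0, ?_⟩
    filter_upwards [Lp.coeFn_zero (E := ℂᴳ[m,n]) (p := 2) (μ := volℍ[n])] with z hz
    rw [hz]
    ext a
    have : ⇑(0 : 𝓓((⊤ : Opens (Full n)), ℂᵛ[m])) = fun _ => 0 := rfl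
    simp [classicalGrad, this]
  smul_mem' := by
    rintro c f ⟨φ, hφ⟩
    refine ⟨c • φ, ?_⟩
    filter_upwards [Lp.coeFn_smul c f, hφ] with z h1 h2
    rw [h1, Pi.smul_apply, h2]
    exact (classicalGrad_smul _ _ c (φ.contDiff.differentiable (by simp) z)).symm

theorem memLp_classicalGrad (φ : 𝓓((⊤ : Opens (Full n)), ℂᵛ[m])) :
    MemLp (classicalGrad (fullDir n) φ) 2 volℍ[n] := by
  refine memLp_iff_coord.2 fun c => ?_
  have := (testFun_memLp (μ := volume) (testFun_fderiv (testFun_coord φ (c.1.1, c.2))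
    (fullDir n c.1.2)) 2).restrict ℍ[n]
  refine this.ae_eq (.of_forall fun z => ?_)
  exact (coord_classicalGrad _ (φ.contDiff.differentiable (by simp) z) c.1.1 c.1.2 c.2).symm

/-- The closed span of the gradients of test functions consists of gradients of energy
functions. -/
theorem exists_energy_of_mem_closure {f : FieldSpace n m}
    (hf : f ∈ (testGradients n m).topologicalClosure) : ∃ u, IsEnergyFunction u f := by
  rw [← SetLike.mem_coe, Submodule.topologicalClosure_coe, mem_closure_iff_seq_limit] at hf
  obtain ⟨F, hF, hlim⟩ := hf
  choose φ hφ using hF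
  have key : ∀ c : Fin m × Bool, ∃ u, IsScalarEnergy u fun i z => coord ((c.1, i), c.2) (f z) := by
    intro c
    refine exists_isScalarEnergy_of_tendsto (fun k => testFun_coord (φ k) c)
      (fun i => memLp_iff_coord.1 (Lp.memLp f) _) fun i => ?_
    have h1 : Tendsto (fun k => edist (F k) f) atTop (𝓝 0) := by
      rwa [tendsto_iff_edist_tendsto_0] at hlim
    refine tendsto_of_tendsto_of_tendsto_of_le_of_le tendsto_const_nhds h1 (fun _ => zero_le)
      fun k => ?_
    rw [Lp.edist_def]
    refine le_trans (le_of_eq ?_) (eLpNorm_coord_le _ _ ((c.1, i), c.2))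
    refine eLpNorm_congr_ae ?_
    filter_upwards [hφ k] with z hz
    rw [Pi.sub_apply, hz, map_sub,
      coord_classicalGrad _ ((φ k).contDiff.differentiable (by simp) z)]
  choose u hu using key
  refine ⟨fun z => ∑ c, u c z • realBasis c, isEnergyFunction_iff.2 fun c => ?_⟩
  simpa only [coord_sum_smul (fun c => u c _)] using hu c

theorem re_inner_field (f g : FieldSpace n m) :
    (inner ℂ f g).re = ∑ c : Fin m × Bool, ∑ i, ∫ z in ℍ[n],
      coord ((c.1, i), c.2) (f z) * coord ((c.1, i), c.2) (g z) := by
  have hi : ∀ d : (Fin m × Fin (n + 1)) × Bool, Integrable (fun z => coord d (f z) * coord d (g z))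
      volℍ[n] := fun d =>
    integrable_mul_two (memLp_iff_coord.1 (Lp.memLp f) d) (memLp_iff_coord.1 (Lp.memLp g) d)
  have h1 : (∫ z in ℍ[n], inner ℂ (f z) (g z)).re = ∫ z in ℍ[n], (inner ℂ (f z) (g z)).re :=
    (Complex.reCLM.integral_comp_comm (L2.integrable_inner f g)).symm
  rw [L2.inner_def, h1]
  simp only [re_inner_eq]
  rw [integral_finsetSum _ fun d _ => hi d, Fintype.sum_prod_type, Fintype.sum_prod_type,
    Fintype.sum_prod_type]
  refine Finset.sum_congr rfl fun a _ => ?_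
  rw [Finset.sum_comm]

/-- The gradients of energy functions belong to the closed span of the gradients of test
functions. -/
theorem IsEnergyFunction.toLp_mem_closure {u : Full n → ℂᵛ[m]}
    {G : Full n → ℂᴳ[m,n]} (h : IsEnergyFunction u G) (hn : 1 ≤ n) :
    h.memLp_grad.toLp G ∈ (testGradients n m).topologicalClosure := by
  -- Membership in the closure is shown through the double orthogonal complement. A field orthogonal
  -- to all test gradients is orthogonal to G, by the scalar density statement in each real
  -- coordinate.
  rw [← Submodule.orthogonal_orthogonal_eq_closure, Submodule.mem_orthogonal]
  have key : ∀ Ξ ∈ (testGradients n m)ᗮ, (inner ℂ Ξ (h.memLp_grad.toLp G)).re = 0 := by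
    intro Ξ hΞ
    rw [re_inner_field]
    refine Finset.sum_eq_zero fun c _ => ?_
    have h1 := (isEnergyFunction_iff.1 h c).sum_integral_eq_zero hn
      (Ξ := fun i z => coord ((c.1, i), c.2) (Ξ z))
      (fun i => memLp_iff_coord.1 (Lp.memLp Ξ) _) fun φ hφ => ?_
    · rw [← h1]
      refine Finset.sum_congr rfl fun i _ => integral_congr_ae ?_
      filter_upwards [h.memLp_grad.coeFn_toLp] with z hz
      rw [hz]
    -- A test function with one nonzero real coordinate isolates the scalar condition for the
    -- coordinate c.
    · have hψ : ∀ d : Fin m × Bool, (if d = c then φ else 0) ∈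
          testFun (((⊤ : Opens (Full n)) : Set (Full n))) := by
        intro d
        split_ifs
        · exact hφ
        · exact Submodule.zero_mem _
      have h2 : ((memLp_classicalGrad (testOfCoord hψ)).toLp _) ∈ testGradients n m :=
        ⟨testOfCoord hψ, MemLp.coeFn_toLp _⟩
      have h3 := congrArg Complex.re (Submodule.inner_left_of_mem_orthogonal h2 hΞ)
      rw [re_inner_field, Complex.zero_re, Finset.sum_eq_single c] at h3
      · rw [← h3]
        refine Finset.sum_congr rfl fun i _ => integral_congr_ae ?_
        filter_upwards [(memLp_classicalGrad (testOfCoord hψ)).coeFn_toLp] with z hz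
        rw [hz, coord_classicalGrad _ ((testOfCoord hψ).contDiff.differentiable (by simp) z)]
        simp only [coord_testOfCoord, if_true]
      · intro d _ hd
        refine Finset.sum_eq_zero fun i _ => integral_eq_zero_of_ae ?_
        filter_upwards [(memLp_classicalGrad (testOfCoord hψ)).coeFn_toLp] with z hz
        rw [hz, coord_classicalGrad _ ((testOfCoord hψ).contDiff.differentiable (by simp) z)]
        simp only [coord_testOfCoord, if_neg hd]
        simp
      · simp
  intro Ξ hΞ
  have h1 := key Ξ hΞ
  -- The orthogonal complement is a complex subspace, so the real part for iΞ supplies the imaginary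
  -- part for Ξ.
  have h2 := key (Complex.I • Ξ) (Submodule.smul_mem _ _ hΞ)
  rw [inner_smul_left] at h2
  apply Complex.ext
  · simpa using h1
  · simpa using h2

end EnergySpace

/-! ### Lax–Milgram in the energy space. -/

section Solvability

variable {n m : ℕ}

/-- The Lax–Milgram lemma for a coercive operator compressed to a closed subspace. -/
theorem exists_inner_eq_of_coercive {X : Type*} [NormedAddCommGroup X] [InnerProductSpace ℂ X]
    (V : Submodule ℂ X) [CompleteSpace V] [V.HasOrthogonalProjection] (T : X →L[ℂ] X) {c : ℝ}
    (hc : 0 < c) (hT : ∀ v ∈ V, c * ‖v‖ ^ 2 ≤ (inner ℂ v (T v)).re) (θ : X) :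
    ∃ v ∈ V, ∀ w ∈ V, inner ℂ w (T v) = inner ℂ w θ := by
  set S : V →L[ℂ] V := (V.orthogonalProjectionOnto.comp T).comp V.subtypeL with hS
  have hin : ∀ v w : V, inner ℂ w (S v) = inner ℂ (w : X) (T v) := fun v w =>
    Submodule.inner_orthogonalProjectionOnto_eq_of_mem_left w (T v)
  -- Coercivity bounds |⟨Sv, v⟩| from below by c‖v‖², which makes the compression of T to V
  -- invertible.
  have hu : IsUnit S := by
    refine ContinuousLinearMap.isUnit_of_forall_le_norm_inner_map S (c := ⟨c, hc.le⟩) hc fun v => ?_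
    rw [norm_inner_symm, hin]
    refine le_trans ?_ ((hT v v.2).trans ((le_abs_self _).trans (Complex.abs_re_le_norm _)))
    rw [mul_comm]
    exact le_rfl
  obtain ⟨v, hv⟩ := (ContinuousLinearMap.isUnit_iff_bijective.1 hu).2 (V.orthogonalProjectionOnto θ)
  refine ⟨v, v.2, fun w hw => ?_⟩
  have h1 := hin v ⟨w, hw⟩
  rw [hv] at h1
  rw [← h1]
  exact Submodule.inner_orthogonalProjectionOnto_eq_of_mem_left (⟨w, hw⟩ : V) θ

theorem IsBoundedMeasurable.conjTranspose {A : Coeff n m} (hA : IsBoundedMeasurable A) :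
    IsBoundedMeasurable fun z => (A z)ᴴ := by
  intro a b
  have := (hA b a).star
  exact this

/-- The two diagonal forms are conjugate, so their real parts agree and the constant is the same. -/
theorem StrongGarding.conjTranspose {A : Coeff n m} (hG : StrongGarding A) :
    StrongGarding fun z => (A z)ᴴ := by
  obtain ⟨c, hc, h⟩ := hG
  refine ⟨c, hc, fun g hg hgc => (h g hg hgc).trans_eq ?_⟩
  refine integral_congr_ae (.of_forall fun z => ?_)
  simp only [sesqForm_conjTranspose, Complex.conj_re]

theorem setIntegral_sesqForm_eq_inner {A : Coeff n m} {T : FieldSpace n m →L[ℂ] FieldSpace n m}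
    (hT : ∀ f : FieldSpace n m, T f =ᵐ[volℍ[n]]
      fun z => matApply (A z) (f z)) (f g : FieldSpace n m) :
    ∫ z in ℍ[n], sesqForm (A z) (f z) (g z) = inner ℂ g (T f) := by
  rw [L2.inner_def]
  refine integral_congr_ae ?_
  filter_upwards [hT f] with z hz
  rw [hz, sesqForm_eq_inner]

/-- The Gårding inequality is assumed for compactly supported functions only; both sides are
continuous in the L² norm of the gradient, so it persists on the closure. -/
theorem StrongGarding.exists_coercive {A : Coeff n m} (hG : StrongGarding A)
    {T : FieldSpace n m →L[ℂ] FieldSpace n m} (hT : ∀ f : FieldSpace n m, T f =ᵐ[volℍ[n]]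
      fun z => matApply (A z) (f z)) :
    ∃ c : ℝ, 0 < c ∧ ∀ f ∈ (testGradients n m).topologicalClosure,
      c * ‖f‖ ^ 2 ≤ (inner ℂ f (T f)).re := by
  obtain ⟨c, hc, h⟩ := hG
  refine ⟨c, hc, fun f hf => ?_⟩
  have hclosed : IsClosed {f : FieldSpace n m | c * ‖f‖ ^ 2 ≤ (inner ℂ f (T f)).re} :=
    isClosed_le (by fun_prop) (Complex.continuous_re.comp (by fun_prop))
  refine closure_minimal ?_ hclosed hf
  rintro f ⟨φ, hφ⟩
  have h1 := h φ (φ.contDiff.of_le (by exact_mod_cast le_top)) φ.hasCompactSupport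
  have hm := memLp_classicalGrad φ
  have e1 : ‖f‖ ^ 2 = ∑ a : Fin m × Fin (n + 1), ∫ z in ℍ[n],
      ‖classicalGrad (fullDir n) φ z a‖ ^ 2 := by
    have hi : ∀ a : Fin m × Fin (n + 1), Integrable (fun z => ‖classicalGrad (fullDir n) φ z a‖ ^ 2)
        volℍ[n] := fun a =>
      (((EuclideanSpace.proj a : ℂᴳ[m,n] →L[ℂ] ℂ).comp_memLp' hm).integrable_norm_pow two_ne_zero)
    rw [← integral_finsetSum _ fun a _ => hi a]
    have e2 : ‖f‖ ^ 2 = (inner ℂ f f).re := by rw [inner_self_eq_norm_sq_to_K]; norm_cast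
    have e3 : (∫ z in ℍ[n], inner ℂ (f z) (f z)).re = ∫ z in ℍ[n], (inner ℂ (f z) (f z)).re :=
      (Complex.reCLM.integral_comp_comm (L2.integrable_inner f f)).symm
    rw [e2, L2.inner_def, e3]
    refine integral_congr_ae ?_
    filter_upwards [hφ] with z hz
    rw [hz, ← EuclideanSpace.norm_sq_eq, inner_self_eq_norm_sq_to_K]
    norm_cast
  have e4 : (inner ℂ f (T f)).re = ∫ z in ℍ[n],
      (sesqForm (A z) (classicalGrad (fullDir n) φ z) (classicalGrad (fullDir n) φ z)).re := by
    have e5 : (∫ z in ℍ[n], inner ℂ (f z) (T f z)).re = ∫ z in ℍ[n], (inner ℂ (f z) (T f z)).re :=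
      (Complex.reCLM.integral_comp_comm (L2.integrable_inner f (T f))).symm
    rw [L2.inner_def, e5]
    refine integral_congr_ae ?_
    filter_upwards [hφ, hT f] with z h2 h3
    rw [h3, h2, sesqForm_eq_inner]
  rw [mem_ofPred_eq, e1, e4]
  exact h1

/-- Solvability of the variational problem in the energy space. -/
theorem exists_energy_variational (hn : 1 ≤ n) {A : Coeff n m} (hA : IsBoundedMeasurable A)
    (hG : StrongGarding A) {Θ : Full n → ℂᴳ[m,n]} (hΘ : MemLp Θ 2 volℍ[n]) :
    ∃ u G, IsEnergyFunction u G ∧ ∀ φ Φ, IsEnergyFunction φ Φ →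
      ∫ z in ℍ[n], sesqForm (A z) (G z) (Φ z) = ∫ z in ℍ[n], inner ℂ (Φ z) (Θ z) := by
  obtain ⟨T, hT⟩ := exists_mulOperator hA
  obtain ⟨c, hc, hco⟩ := hG.exists_coercive hT
  have : CompleteSpace (testGradients n m).topologicalClosure :=
    (testGradients n m).isClosed_topologicalClosure.completeSpace_coe
  obtain ⟨G, hGV, hG⟩ := exists_inner_eq_of_coercive _ T hc hco (hΘ.toLp Θ)
  obtain ⟨u, hu⟩ := exists_energy_of_mem_closure hGV
  refine ⟨u, G, hu, fun φ Φ hφ => ?_⟩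
  have h1 := hG _ (hφ.toLp_mem_closure hn)
  rw [← setIntegral_sesqForm_eq_inner hT, L2.inner_def] at h1
  have e1 : ∫ z in ℍ[n], sesqForm (A z) (G z) (Φ z) =
      ∫ z in ℍ[n], sesqForm (A z) (G z) (hφ.memLp_grad.toLp Φ z) := by
    refine integral_congr_ae ?_
    filter_upwards [hφ.memLp_grad.coeFn_toLp] with z hz
    rw [hz]
  rw [e1, h1]
  refine integral_congr_ae ?_
  filter_upwards [hφ.memLp_grad.coeFn_toLp, hΘ.coeFn_toLp] with z h2 h3
  rw [h2, h3]

end Solvability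

/-! ### Neumann data in divergence form. -/

section NeumannData

variable {n : ℕ}

/-- θ is 1 near 0, so θ' vanishes there and coincides for t > 0 with a test function supported away
from the boundary. Multiplication by a smooth step removes the part of θ' on the negative axis. -/
theorem exists_vertical_cutoff : ∃ θ ∈ 𝓣[ℝ], θ 0 = 1 ∧
    ∃ k ∈ testFun (Ioi (0 : ℝ)), ∀ t, 0 < t → deriv θ t = k t := by
  obtain ⟨θ, hθ, h1⟩ := exists_testFun_eq_one
  have hd : (fun t => deriv θ t) ∈ 𝓣[ℝ] := by
    have := testFun_fderiv hθ (1 : ℝ)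
    simpa only [fderiv_apply_one_eq_deriv] using this
  have h0 : ∀ t, |t| < 1 → deriv θ t = 0 := by
    intro t ht
    have : θ =ᶠ[𝓝 t] fun _ => 1 := by
      filter_upwards [(isOpen_lt continuous_abs continuous_const).mem_nhds ht] with s hs
        using h1 s (le_of_lt hs)
    rw [this.deriv_eq, deriv_const]
  refine ⟨θ, hθ, h1 0 (by simp), fun t => Real.smoothTransition t * deriv θ t,
    ⟨?_, ?_, ?_⟩, fun t ht => ?_⟩
  · exact Real.smoothTransition.contDiff.mul hd.1
  · exact hd.2.1.mul_left
  · have hsub : tsupport (fun t => Real.smoothTransition t * deriv θ t) ⊆ Ici 1 := by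
      refine closure_minimal (fun t ht => ?_) isClosed_Ici
      by_contra hlt
      rw [mem_Ici, not_le] at hlt
      refine ht ?_
      rcases le_or_gt t 0 with h | h
      · simp only [Real.smoothTransition.zero_of_nonpos h, zero_mul]
      · simp only [h0 t (by rw [abs_of_pos h]; exact hlt), mul_zero]
    exact fun t ht => mem_Ioi.2 (zero_lt_one.trans_le (mem_Ici.1 (hsub ht)))
  · rcases lt_or_ge t 1 with h | h
    · simp only [h0 t (by rw [abs_of_pos ht]; exact h), mul_zero]
    · simp only [Real.smoothTransition.one_of_one_le h, one_mul]

/-- Divergences of test fields act on the boundary values of energy functions as square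
integrable fields act on the gradients. -/
theorem exists_field_of_divergence {ψ : Fin n → Bdry n → ℝ} (hψ : ∀ j, ψ j ∈ 𝓣[Bdry n]) :
    ∃ Θ : Fin (n + 1) → Full n → ℝ, (∀ i, MemLp (Θ i) 2 volℍ[n]) ∧ ∀ u G f, IsTracedEnergy u G f →
        ∫ x, (∑ j, fderiv ℝ (ψ j) x (bdryDir n j)) * f x = ∑ i, ∫ z in ℍ[n], G i z * Θ i z := by
  obtain ⟨θ, hθ, hθ0, k, hk, hθk⟩ := exists_vertical_cutoff
  set h : Bdry n → ℝ := fun x => ∑ j, fderiv ℝ (ψ j) x (bdryDir n j) with hh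
  have hht : h ∈ 𝓣[Bdry n] := by
    have := Submodule.sum_mem 𝓣[Bdry n] (t := Finset.univ)
      (f := fun j x => fderiv ℝ (ψ j) x (bdryDir n j)) fun j _ => testFun_fderiv (hψ j) _
    convert this using 1
    ext x
    simp [hh]
  have hη := testFun_prod_mul hθ hht
  have hkj : ∀ j, (fun z : Full n => k z.1 * ψ j z.2) ∈ testFun ℍ[n] := by
    intro j
    have h1 := testFun_prod_mul (testFun_mono (subset_univ _) hk) (hψ j)
    refine ⟨h1.1, h1.2.1, ?_⟩
    have : tsupport (fun z : Full n => k z.1 * ψ j z.2) ⊆ Prod.fst ⁻¹' tsupport k := by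
      refine closure_minimal (fun z hz => ?_) ((isClosed_tsupport k).preimage continuous_fst)
      rw [mem_preimage]
      by_contra hc
      exact hz (by simp only [image_eq_zero_of_notMem_tsupport hc, zero_mul])
    exact fun z hz => hk.2.2 (this hz)
  -- With h = div ψ, Green's identity for θh gives -∫ h f = ∫ θ' h u + ∫ θ h G₀. Since θ' h = ∑ⱼ
  -- ∂ⱼ(k ψⱼ), the first term is integrated by parts and only gradients of u remain. The divergence
  -- form is what removes u itself.
  refine ⟨Fin.cons (fun z => - (θ z.1 * h z.2)) fun j z => k z.1 * ψ j z.2, fun i => ?_,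
    fun u G f hu => ?_⟩
  · refine Fin.cases ?_ (fun j => ?_) i
    · exact ((testFun_memLp hη 2).restrict _).neg
    · exact (testFun_memLp (hkj j) 2).restrict _
  · have h1 := hu.green _ hη
    have e1 : ∫ x, (θ (0 : ℝ) * h x) * f x = ∫ x, h x * f x := by simp only [hθ0, one_mul]
    have d1 : ∀ z : Full n, 0 < z.1 → fderiv ℝ (fun z : Full n => θ z.1 * h z.2) z (fullDir n 0) =
          ∑ j, fderiv ℝ (fun z : Full n => k z.1 * ψ j z.2) z (fullDir n j.succ) := by
      intro z hz
      have a1 := (hasDerivAt_section (testFun_differentiable hη) z.1 z.2).deriv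
      have a2 : deriv (fun t => θ t * h z.2) z.1 = deriv θ z.1 * h z.2 :=
        deriv_mul_const (testFun_differentiable hθ z.1) _
      rw [show fderiv ℝ (fun z : Full n => θ z.1 * h z.2) z (fullDir n 0) = deriv θ z.1 * h z.2
        from a1.symm.trans a2, hθk _ hz, hh, Finset.mul_sum]
      refine Finset.sum_congr rfl fun j _ => ?_
      have b1 : HasFDerivAt (fun z : Full n => k z.1 * ψ j z.2) _ z :=
        ((testFun_differentiable hk z.1).hasFDerivAt.comp z hasFDerivAt_fst).mul
          ((testFun_differentiable (hψ j) z.2).hasFDerivAt.comp z hasFDerivAt_snd)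
      rw [b1.fderiv]
      simp [fullDir, bdryDir]
    have e2 : ∫ z in ℍ[n], fderiv ℝ (fun z : Full n => θ z.1 * h z.2) z (fullDir n 0) * u z =
        - ∑ j : Fin n, ∫ z in ℍ[n], G j.succ z * (k z.1 * ψ j z.2) := by
      have e3 : ∫ z in ℍ[n], fderiv ℝ (fun z : Full n => θ z.1 * h z.2) z (fullDir n 0) * u z =
          ∫ z in ℍ[n],
            ∑ j : Fin n, fderiv ℝ (fun z : Full n => k z.1 * ψ j z.2) z (fullDir n j.succ) * u z := by
        refine setIntegral_congr_fun measurableSet_halfSpace fun z hz => ?_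
        simp only [d1 z hz, Finset.sum_mul]
      rw [e3, integral_finsetSum _ fun j _ =>
        (hu.1.integrable_mul (testFun_fderiv (hkj j) (fullDir n j.succ))).restrict,
        ← Finset.sum_neg_distrib]
      refine Finset.sum_congr rfl fun j _ => ?_
      rw [setIntegral_testFun_mul (testFun_fderiv (hkj j) (fullDir n j.succ)),
        hu.1.weak_grad _ _ (hkj j), ← setIntegral_testFun_mul (hkj j)]
      simp only [mul_comm]
    simp only [] at h1
    rw [e1, e2] at h1
    rw [Fin.sum_univ_succ]
    simp only [Fin.cons_zero, Fin.cons_succ, mul_neg, integral_neg]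
    have e4 : ∫ z in ℍ[n], G 0 z * (θ z.1 * h z.2) =
        ∫ z in ℍ[n], θ z.1 * h z.2 * G 0 z := by simp only [mul_comm]
    rw [e4]
    linarith

end NeumannData

/-! ### Complex pairings in real coordinates. -/

section InnerIntegrals

variable {ι : Type*} [Fintype ι] {α : Type*} [MeasurableSpace α] {μ : Measure α}
  {f g : α → EuclideanSpace ℂ ι}

theorem integrable_inner_of_coord
    (h : ∀ c d, Integrable (fun z => coord c (f z) * coord d (g z)) μ) :
    Integrable (fun z => inner ℂ (f z) (g z)) μ := by
  classical
  have e : ∀ z, inner ℂ (f z) (g z) = ∑ c, ∑ d, (coord c (f z) * coord d (g z)) •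
      inner ℂ (realBasis c : EuclideanSpace ℂ ι) (realBasis d) := by
    intro z
    conv_lhs => rw [← sum_coord (f z), ← sum_coord (g z)]
    simp only [sum_inner, inner_sum]
    rw [Finset.sum_comm]
    refine Finset.sum_congr rfl fun c _ => Finset.sum_congr rfl fun d _ => ?_
    rw [← Complex.coe_smul, ← Complex.coe_smul, inner_smul_left, inner_smul_right,
      ← Complex.coe_smul, Complex.conj_ofReal]
    push_cast
    rw [smul_eq_mul, mul_assoc]
  simp only [e]
  exact integrable_finsetSum _ fun c _ => integrable_finsetSum _ fun d _ => (h c d).smul_const _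

theorem re_integral_inner (h : ∀ c d, Integrable (fun z => coord c (f z) * coord d (g z)) μ) :
    (∫ z, inner ℂ (f z) (g z) ∂μ).re = ∑ c, ∫ z, coord c (f z) * coord c (g z) ∂μ := by
  have h1 : (∫ z, inner ℂ (f z) (g z) ∂μ).re = ∫ z, (inner ℂ (f z) (g z)).re ∂μ :=
    (Complex.reCLM.integral_comp_comm (integrable_inner_of_coord h)).symm
  rw [h1]
  simp only [re_inner_eq]
  exact integral_finsetSum _ fun c _ => h c c

theorem integrable_coord_mul (hf : MemLp f 2 μ) (hg : MemLp g 2 μ) (c d : ι × Bool) :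
    Integrable (fun z => coord c (f z) * coord d (g z)) μ :=
  integrable_mul_two ((coord c).comp_memLp' hf) ((coord d).comp_memLp' hg)

end InnerIntegrals

/-! ### The Neumann problem and approximation of the pairing. -/

section NeumannProblem

variable {n m : ℕ} {u : Full n → ℂᵛ[m]} {G : Full n → ℂᴳ[m,n]} {f : Bdry n → ℂᵛ[m]}

theorem sum_field {M : Type*} [AddCommMonoid M] (x : (Fin m × Fin (n + 1)) × Bool → M) :
    ∑ d, x d = ∑ c : Fin m × Bool, ∑ i, x ((c.1, i), c.2) := by
  rw [Fintype.sum_prod_type, Fintype.sum_prod_type, Fintype.sum_prod_type]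
  refine Finset.sum_congr rfl fun a _ => ?_
  rw [Finset.sum_comm]

theorem coord_divTest {ι : Type} [Fintype ι]
    (φ : 𝓓((⊤ : Opens (Bdry n)), EuclideanSpace ℂ (ι × Fin n))) (c : ι × Bool) (x : Bdry n) :
    coord c (divTest n ι φ x) =
      ∑ j, fderiv ℝ (fun x => coord ((c.1, j), c.2) (φ x)) x (bdryDir n j) := by
  have hd : DifferentiableAt ℝ φ x := φ.contDiff.differentiable (by simp) x
  have e : divTest n ι φ x = ∑ j, fderiv ℝ (fun x => columnCLM ι j (φ x)) x (bdryDir n j) := by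
    simp only [divTest, sum_apply]
    refine Finset.sum_congr rfl fun j _ => ?_
    have hd2 : DifferentiableAt ℝ (fun x => columnCLM ι j (φ x)) x :=
      ((columnCLM ι j).restrictScalars ℝ).differentiableAt.comp x hd
    exact (TestFunction.lineDerivCLM_apply_of_le (𝕜 := ℂ) (n := ⊤) (k := ⊤)
      (f := TestFunction.postcompCLM (columnCLM ι j) φ) (by simp)).trans hd2.lineDeriv_eq_fderiv
  rw [e, map_sum]
  refine Finset.sum_congr rfl fun j _ => ?_
  have h1 := (((columnCLM ι j).restrictScalars ℝ).hasFDerivAt (x := φ x)).comp x hd.hasFDerivAt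
  have h2 := ((coord ((c.1, j), c.2)).hasFDerivAt (x := φ x)).comp x hd.hasFDerivAt
  rw [show fderiv ℝ (fun x => columnCLM ι j (φ x)) x = _ from h1.fderiv,
    show fderiv ℝ (fun x => coord ((c.1, j), c.2) (φ x)) x = _ from h2.fderiv]
  rfl

theorem IsEnergyFunction.const_smul (h : IsEnergyFunction u G) (c : ℂ) :
    IsEnergyFunction (fun z => c • u z) fun z => c • G z := by
  refine ⟨fun K hK hKH => (h.memLp_loc K hK hKH).const_smul c, h.memLp_grad.const_smul c,
    fun φ α i => ?_⟩
  have h1 := h.weak_grad φ α i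
  have e1 : ∀ (r : ℝ) (w : ℂ), r • (c * w) = c * (r • w) := fun r w => mul_smul_comm _ _ _ |>.symm
  simp only [PiLp.smul_apply, smul_eq_mul, e1]
  rw [integral_const_mul, integral_const_mul, h1, mul_neg]

theorem IsTrace.const_smul (h : IsTrace u f) (c : ℂ) :
    IsTrace (fun z => c • u z) fun x => c • f x :=
  isTrace_iff.2 ((isTrace_iff.1 h).clm ((c • ContinuousLinearMap.id ℂ ℂᵛ[m]).restrictScalars ℝ))

theorem IsTrace.locallyIntegrable (h : IsTrace u f) : LocallyIntegrable f volume :=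
  locallyIntegrable_of_memLp_two fun _ hK => (isTrace_iff.1 h).memLp hK

theorem IsTrace.memLp_coord (h : IsTrace u f) (c : Fin m × Bool) (K : Set (Bdry n))
    (hK : IsCompact K) : MemLp (fun x => coord c (f x)) 2 (volume.restrict K) :=
  (hasBoundaryValue_iff.1 (isTrace_iff.1 h) c).memLp hK

theorem integrable_coord_mul_test {ι : Type} [Fintype ι] {f : Bdry n → EuclideanSpace ℂ ι}
    (hf : LocallyIntegrable f volume)
    (φ : 𝓓((⊤ : Opens (Bdry n)), EuclideanSpace ℂ ι)) (c d : ι × Bool) :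
    Integrable (fun x => coord c (φ x) * coord d (f x)) volume := by
  have h1 : LocallyIntegrable (fun x => coord d (f x)) volume := by
    rw [locallyIntegrable_iff]
    intro K hK
    exact (coord d).integrable_comp (hf.integrableOn_isCompact hK)
  exact testFun_integrable_mul (locallyIntegrableOn_univ.2 h1) (testFun_coord φ c)

/-- Test functions in the half-space are energy functions with vanishing trace. -/
theorem isEnergyFunction_test (φ : 𝓓(halfSpace n, ℂᵛ[m])) :
    IsEnergyFunction φ (classicalGrad (fullDir n) φ) ∧ IsTrace φ fun _ => 0 := by
  have key : ∀ c : Fin m × Bool, IsTracedEnergy (fun z => coord c (φ z))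
      (fun i z => fderiv ℝ (fun z => coord c (φ z)) z (fullDir n i)) fun _ => 0 := by
    intro c
    have hψ := testFun_coord φ c
    set ψ : Full n → ℝ := fun z => coord c (φ z) with hψd
    have hψu := testFun_mono (subset_univ _) hψ
    refine ⟨IsScalarEnergy.of_memLp ((testFun_memLp hψ 2).restrict _)
      (fun i => (testFun_memLp (testFun_fderiv hψ _) 2).restrict _)
      fun i η hη => integral_fderiv_mul_test (testFun_mono (subset_univ _) hη) hψu _,
      fun K _ => MemLp.zero, fun η hη => ?_, fun η hη => ?_⟩
    · exact integrable_mul_two ((testFun_memLp hη 2).restrict _) ((testFun_memLp hψ 2).restrict _)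
    · have e1 : ∫ z in ℍ[n], fderiv ℝ η z (fullDir n 0) * ψ z =
          ∫ z, fderiv ℝ η z (fullDir n 0) * ψ z :=
        setIntegral_eq_integral_of_forall_compl_eq_zero fun z hz => by
          rw [testFun_eq_zero hψ hz, mul_zero]
      have e2 : ∫ z in ℍ[n], η z * fderiv ℝ ψ z (fullDir n 0) =
          ∫ z, η z * fderiv ℝ ψ z (fullDir n 0) :=
        setIntegral_eq_integral_of_forall_compl_eq_zero fun z hz => by
          rw [testFun_eq_zero (testFun_fderiv hψ _) hz, mul_zero]
      rw [e1, e2, integral_fderiv_mul_test hη hψu]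
      simp
  have h := exists_energy_of_coord key
  simp only [sum_coord, zero_smul, Finset.sum_const_zero] at h
  refine ⟨?_, h.2⟩
  convert h.1 using 1
  ext1 z
  conv_lhs => rw [← sum_coord (classicalGrad (fullDir n) φ z)]
  refine Finset.sum_congr rfl fun d _ => ?_
  rw [show d = ((d.1.1, d.1.2), d.2) from rfl,
    coord_classicalGrad _ (φ.contDiff.differentiable (by simp) z)]

/-- This makes ⟨f, div φ⟩ a bounded functional of the gradient, as required for the right side of
the variational problem. The real fields of the components are assembled, and multiplying u by i
recovers the imaginary part. -/
theorem exists_field_of_divTest (φ : 𝓓((⊤ : Opens (Bdry n)), EuclideanSpace ℂ (Fin m × Fin n))) :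
    ∃ Θ : Full n → ℂᴳ[m,n], MemLp Θ 2 volℍ[n] ∧ ∀ u G f, IsEnergyFunction u G → IsTrace u f →
        ∫ z in ℍ[n], inner ℂ (G z) (Θ z) = ∫ x, inner ℂ (f x) (divTest n (Fin m) φ x) := by
  choose Θ hΘ hΘ' using fun c : Fin m × Bool =>
    exists_field_of_divergence (ψ := fun j x => coord ((c.1, j), c.2) (φ x))
      fun j => testFun_coord φ ((c.1, j), c.2)
  set Θv : Full n → ℂᴳ[m,n] := fun z =>
    ∑ d : (Fin m × Fin (n + 1)) × Bool, Θ (d.1.1, d.2) d.1.2 z • realBasis d with hΘv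
  have hco : ∀ d z, coord d (Θv z) = Θ (d.1.1, d.2) d.1.2 z := fun d z =>
    coord_sum_smul (fun d : (Fin m × Fin (n + 1)) × Bool => Θ (d.1.1, d.2) d.1.2 z) d
  have hm : MemLp Θv 2 volℍ[n] := by
    refine memLp_iff_coord.2 fun d => ?_
    simp only [hco]
    exact hΘ _ _
  have key : ∀ u G f, IsEnergyFunction u G → IsTrace u f → (∫ z in ℍ[n], inner ℂ (G z) (Θv z)).re =
        (∫ x, inner ℂ (f x) (divTest n (Fin m) φ x)).re := by
    intro u G f hu hf
    rw [re_integral_inner (integrable_coord_mul hu.memLp_grad hm), re_integral_inner, sum_field]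
    · refine Finset.sum_congr rfl fun c _ => ?_
      have h1 := hΘ' c _ _ _ (isTracedEnergy_coord hu hf c)
      simp only [coord_divTest, hco]
      rw [← h1]
      simp only [mul_comm]
    · intro c d
      have := integrable_coord_mul_test hf.locallyIntegrable (divTest n (Fin m) φ) d c
      simpa only [mul_comm] using this
  refine ⟨Θv, hm, fun u G f hu hf => ?_⟩
  have h1 := key u G f hu hf
  have h2 := key _ _ _ (hu.const_smul Complex.I) (hf.const_smul Complex.I)
  simp only [inner_smul_left, integral_const_mul] at h2
  apply Complex.ext h1
  simpa using h2

/-- The Neumann problem with boundary data in divergence form. -/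
theorem exists_neumann_solution (hn : 1 ≤ n) {A : Coeff n m} (hA : IsBoundedMeasurable A)
    (hG : StrongGarding A) (φ : 𝓓((⊤ : Opens (Bdry n)), EuclideanSpace ℂ (Fin m × Fin n))) :
    ∃ u G u₀, IsEnergySolution A u G ∧ IsTrace u u₀ ∧
      IsConormalDerivative A G (BdryDistribution.ofFun (divTest n (Fin m) φ)) ∧
      ∀ ψ Ψ g, IsEnergyFunction ψ Ψ → IsTrace ψ g → ∫ z in ℍ[n], sesqForm (A z) (G z) (Ψ z) =
          - ∫ x, inner ℂ (g x) (divTest n (Fin m) φ x) := by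
  obtain ⟨Θ, hΘ, hΘ'⟩ := exists_field_of_divTest φ
  -- The datum is -Θ because the conormal derivative carries a minus sign in the pairing.
  obtain ⟨u, G, hu, hsol⟩ := exists_energy_variational hn hA hG hΘ.neg
  obtain ⟨u₀, hu₀⟩ := hu.exists_trace
  have key : ∀ ψ Ψ g, IsEnergyFunction ψ Ψ → IsTrace ψ g → ∫ z in ℍ[n], sesqForm (A z) (G z) (Ψ z) =
        - ∫ x, inner ℂ (g x) (divTest n (Fin m) φ x) := by
    intro ψ Ψ g h1 h2
    rw [hsol ψ Ψ h1, ← hΘ' ψ Ψ g h1 h2]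
    simp only [Pi.neg_apply, inner_neg_right, integral_neg]
  refine ⟨u, G, u₀, ⟨hu, fun η => ?_⟩, hu₀, fun ψ Ψ g h1 h2 => ?_, key⟩
  -- Test functions in the open half-space have zero trace, so the variational identity contains the
  -- equation div A∇u = 0.
  · rw [key _ _ _ (isEnergyFunction_test η).1 (isEnergyFunction_test η).2]
    simp
  · rw [key ψ Ψ g h1 h2, BdryDistribution.ofFun_apply
      (divTest n (Fin m) φ).continuous.locallyIntegrable]

/-- Bounds for the approximations with test functions as traces imply bounds in the limit. -/
theorem norm_integral_inner_le_of_approx (hn : 1 ≤ n) (hu : IsEnergyFunction u G)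
    (hf : IsTrace u f) {Ξ : Full n → ℂᴳ[m,n]} (hΞ : MemLp Ξ 2 volℍ[n]) {B : ℝ} {E : ℕ → ℕ → ℝ}
    (hE : ∀ j, Tendsto (E j) atTop (𝓝 0))
    (hB : ∀ (j k : ℕ) (ρ : Bdry n → ℝ), ρ ∈ 𝓣[Bdry n] → (∀ y, 0 ≤ ρ y) →
      IsProbabilityMeasure (mollMeasure volume ρ) → ∀ φ Φ
      (g : 𝓓((⊤ : Opens (Bdry n)), ℂᵛ[m])),
      IsEnergyFunction φ Φ → IsTrace φ g → (∀ c, (fun x => coord c (g x)) =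
        approxTrace (mollMeasure volume ρ) (cutoff (Full n) k) (farPoint hn j).2
          fun x => coord c (f x)) →
      ‖∫ z in ℍ[n], inner ℂ (Φ z) (Ξ z)‖ ≤ B + E j k) :
    ‖∫ z in ℍ[n], inner ℂ (G z) (Ξ z)‖ ≤ B := by
  set z₀ := ∫ z in ℍ[n], inner ℂ (G z) (Ξ z) with hz₀
  -- A phase that makes the pairing real and nonnegative reduces the bound to real parts, where the
  -- scalar limits in each coordinate apply.
  obtain ⟨ω₀, hω, hωz⟩ : ∃ ω₀ : ℂ, ‖ω₀‖ ≤ 1 ∧ (ω₀ * z₀).re = ‖z₀‖ := by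
    rcases eq_or_ne z₀ 0 with h | h
    · exact ⟨0, by simp, by simp [h]⟩
    · refine ⟨conj z₀ / ‖z₀‖, ?_, ?_⟩
      · rw [norm_div, RCLike.norm_conj, Complex.norm_real, norm_norm, div_self (norm_ne_zero_iff.2 h)]
      · have : conj z₀ / ‖z₀‖ * z₀ = ((‖z₀‖ : ℝ) : ℂ) := by
          have hne : ((‖z₀‖ : ℝ) : ℂ) ≠ 0 := by exact_mod_cast norm_ne_zero_iff.2 h
          rw [div_mul_eq_mul_div, Complex.conj_mul', div_eq_iff hne]
          ring
        rw [this, Complex.ofReal_re]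
  have hΞ' : MemLp (fun z => ω₀ • Ξ z) 2 volℍ[n] := hΞ.const_smul ω₀
  have hrot : ∀ F : Full n → ℂᴳ[m,n], MemLp F 2 volℍ[n] → ∑ c : Fin m × Bool, ∑ i, ∫ z in ℍ[n],
        coord ((c.1, i), c.2) (ω₀ • Ξ z) * coord ((c.1, i), c.2) (F z) =
        (ω₀ * ∫ z in ℍ[n], inner ℂ (F z) (Ξ z)).re := by
    intro F hF
    rw [← integral_const_mul]
    have e : ∀ z, ω₀ * inner ℂ (F z) (Ξ z) = inner ℂ (F z) (ω₀ • Ξ z) := fun z => by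
      rw [inner_smul_right]
    simp only [e]
    rw [re_integral_inner (integrable_coord_mul hF hΞ'), sum_field]
    simp only [mul_comm]
  rw [← hωz, hz₀, ← hrot G hu.memLp_grad]
  have ht := fun c => isTracedEnergy_coord hu hf c
  have hlim := fun (c : Fin m × Bool) (i : Fin (n + 1)) => (ht c).1.tendsto_approx hn i
    (memLp_iff_coord.1 hΞ' ((c.1, i), c.2))
  obtain ⟨ρ, hρ, hρ0, hρp, hν⟩ := exists_isApproxIdentity_horizontal (n := n)
  -- Outermost is the translation j, then the cutoff k, innermost the mollification l. The error E j
  -- k may depend badly on j, since k tends to infinity first with j fixed.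
  refine le_of_tendsto (tendsto_finsetSum _ fun c _ => tendsto_finsetSum _ fun i _ =>
    (hlim c i).2.2) (.of_forall fun j => ?_)
  have hE' : Tendsto (fun k => B + E j k) atTop (𝓝 B) := by simpa using (hE j).const_add B
  refine le_of_tendsto_of_tendsto' (tendsto_finsetSum _ fun c _ => tendsto_finsetSum _ fun i _ =>
    (hlim c i).2.1 j) hE' fun k => ?_
  refine le_of_tendsto (tendsto_finsetSum _ fun c _ => tendsto_finsetSum _ fun i _ =>
    (hlim c i).1 _ hν j k) (.of_forall fun l => ?_)
  have := hρp l
  have happ := fun c => (ht c).approx (cutoff_mem (V := Full n) k) (farPoint hn j).2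
    (mollMeasure volume (ρ l))
  have hv := exists_energy_of_coord happ
  have hg := fun c => approxTrace_mem (hf.memLp_coord c) (cutoff_mem (V := Full n) k)
    (farPoint hn j).2 (hρ l) (hρ0 l)
  have h1 := hB j k (ρ l) (hρ l) (hρ0 l) this _ _ (testOfCoord (Ω := ⊤) hg) hv.1 hv.2
    fun c => funext fun x => coord_testOfCoord (Ω := ⊤) hg c x
  have h2 := hrot _ hv.1.memLp_grad
  simp only [coord_sum_smul (fun d : (Fin m × Fin (n + 1)) × Bool => approxGrad
    ((mollMeasure volume (ρ l)).map fun y => ((0, y) : Full n)) (cutoff (Full n) k)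
    (0, (farPoint hn j).2) (fun z => coord (d.1.1, d.2) (u z))
    (fun i z => coord ((d.1.1, i), d.2) (G z)) d.1.2 _)] at h2
  refine (le_of_eq h2).trans (le_trans ?_ h1)
  refine (Complex.re_le_norm _).trans ?_
  rw [norm_mul]
  exact mul_le_of_le_one_left (norm_nonneg _) hω

end NeumannProblem

/-! ### Boundary distributions, gradients and negative Sobolev norms. -/

section BoundaryDistributions

variable {n : ℕ} {ι : Type} [Fintype ι] [DecidableEq ι] {p q : ℝ}

theorem memLp_test (φ : 𝓓((⊤ : Opens (Bdry n)), EuclideanSpace ℂ ι)) (r : ℝ≥0∞) :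
    MemLp φ r volume :=
  memLp_iff_coord.2 fun c => testFun_memLp (testFun_coord φ c) r

theorem differentiable_test (φ : 𝓓((⊤ : Opens (Bdry n)), EuclideanSpace ℂ ι)) :
    Differentiable ℝ φ := φ.contDiff.differentiable (by simp)

theorem coord_boundaryGrad (φ : 𝓓((⊤ : Opens (Bdry n)), EuclideanSpace ℂ ι))
    (d : (ι × Fin n) × Bool) (x : Bdry n) : coord d (classicalGrad (bdryDir n) φ x) =
      fderiv ℝ (fun x => coord (d.1.1, d.2) (φ x)) x (bdryDir n d.1.2) :=
  coord_classicalGrad _ (differentiable_test φ x) d.1.1 d.1.2 d.2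

theorem memLp_boundaryGrad (φ : 𝓓((⊤ : Opens (Bdry n)), EuclideanSpace ℂ ι))
    (r : ℝ≥0∞) : MemLp (classicalGrad (bdryDir n) φ) r volume := by
  refine memLp_iff_coord.2 fun d => ?_
  simp only [coord_boundaryGrad]
  exact testFun_memLp (testFun_fderiv (testFun_coord φ _) _) r

theorem sum_boundaryField {M : Type*} [AddCommMonoid M] (x : (ι × Fin n) × Bool → M) :
    ∑ d, x d = ∑ c : ι × Bool, ∑ l, x ((c.1, l), c.2) := by
  rw [Fintype.sum_prod_type, Fintype.sum_prod_type, Fintype.sum_prod_type]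
  refine Finset.sum_congr rfl fun a _ => ?_
  rw [Finset.sum_comm]

theorem toReal_eLpNorm_boundaryGrad_le
    (φ : 𝓓((⊤ : Opens (Bdry n)), EuclideanSpace ℂ ι)) {r : ℝ≥0∞} (hr : 1 ≤ r) :
    (eLpNorm (classicalGrad (bdryDir n) φ) r volume).toReal ≤ ∑ c, ∑ l,
      (eLpNorm 𝐃[fun x => coord c (φ x),bdryDir n l] r volume).toReal := by
  have h1 := eLpNorm_le_sum_coord hr (memLp_boundaryGrad φ r)
  have hfin : ∀ d : (ι × Fin n) × Bool,
      eLpNorm (fun x => coord d (classicalGrad (bdryDir n) φ x)) r volume ≠ ⊤ :=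
    fun d => (memLp_iff_coord.1 (memLp_boundaryGrad φ r) d).eLpNorm_ne_top
  have h2 := ENNReal.toReal_mono (ENNReal.sum_ne_top.2 fun d _ => hfin d) h1
  rw [ENNReal.toReal_sum fun d _ => hfin d, sum_boundaryField] at h2
  simpa only [coord_boundaryGrad] using h2

/-- Every summand of the divergence is one real coordinate of the full gradient, and the constant
counts these coordinates. -/
theorem eLpNorm_divTest_le (φ : 𝓓((⊤ : Opens (Bdry n)), EuclideanSpace ℂ (ι × Fin n))) {r : ℝ≥0∞}
    (hr : 1 ≤ r) : eLpNorm (divTest n ι φ) r volume ≤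
      Fintype.card ((ι × Fin n) × Bool) • eLpNorm (classicalGrad (bdryDir n) φ) r volume := by
  refine (eLpNorm_le_sum_coord hr (memLp_test _ r)).trans ?_
  have h1 : ∀ c : ι × Bool, eLpNorm (fun x => coord c (divTest n ι φ x)) r volume ≤
      ∑ l : Fin n, eLpNorm (classicalGrad (bdryDir n) φ) r volume := by
    intro c
    simp only [coord_divTest]
    have e : (fun x => ∑ j, fderiv ℝ (fun x => coord ((c.1, j), c.2) (φ x)) x (bdryDir n j)) =
        ∑ j, fun x => fderiv ℝ (fun x => coord ((c.1, j), c.2) (φ x)) x (bdryDir n j) := by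
      ext x; simp
    rw [e]
    refine (eLpNorm_sum_le (fun j _ => (testFun_memLp (μ := (volume : Measure (Bdry n)))
      (testFun_fderiv (testFun_coord φ ((c.1, j), c.2)) (bdryDir n j)) r).1) hr).trans
      (Finset.sum_le_sum fun j _ => ?_)
    have h2 := eLpNorm_coord_le (μ := (volume : Measure (Bdry n)))
      (classicalGrad (bdryDir n) φ) r (((c.1, j), j), c.2)
    simpa only [coord_boundaryGrad] using h2
  refine (Finset.sum_le_sum fun c _ => h1 c).trans (le_of_eq ?_)
  simp only [Finset.sum_const, Finset.card_univ, smul_smul, Fintype.card_prod]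
  congr 1
  ring

/-- Hölder's inequality for the complex pairing. -/
theorem norm_integral_inner_le {κ : Type*} [Fintype κ] {α : Type*} [MeasurableSpace α]
    {μ : Measure α} (hpq : p.HolderConjugate q) {f g : α → EuclideanSpace ℂ κ}
    (hf : MemLp f (ofReal p) μ) (hg : MemLp g (ofReal q) μ) : ‖∫ x, inner ℂ (f x) (g x) ∂μ‖ ≤
      𝐍[f,p,μ] * 𝐍[g,q,μ] := by
  have h1 := abs_integral_mul_le hpq hf.norm hg.norm
  rw [eLpNorm_norm, eLpNorm_norm] at h1
  refine le_trans ?_ ((le_abs_self _).trans h1)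
  exact norm_integral_le_of_norm_le (integrable_mul_holder hpq hf.norm hg.norm)
    (.of_forall fun x => norm_inner_le_norm _ _)

theorem BdryDistribution.norm_apply_le {T : BdryDistribution n ι} (hpq : p.HolderConjugate q)
    (hT : T.negSobolevNorm q ≠ ⊤) (φ : 𝓓((⊤ : Opens (Bdry n)), EuclideanSpace ℂ ι)) :
    ‖T φ‖ ≤ (T.negSobolevNorm q).toReal * 𝐍[classicalGrad (bdryDir n) φ,p,volume] := by
  set a := 𝐍[classicalGrad (bdryDir n) φ,p,volume] with ha
  set N := (T.negSobolevNorm q).toReal with hN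
  have hafin := (memLp_boundaryGrad φ (ofReal p)).eLpNorm_ne_top
  -- Scaling φ by 1/(a + ε) makes it admissible in the supremum, also if its gradient norm a is
  -- zero.
  have key : ∀ ε : ℝ, 0 < ε → ‖T φ‖ ≤ N * (a + ε) := by
    intro ε hε
    have hpos : 0 < a + ε := add_pos_of_nonneg_of_pos ENNReal.toReal_nonneg hε
    set r : ℂ := (((a + ε)⁻¹ : ℝ) : ℂ) with hr
    have hrn : ‖r‖ₑ = ofReal (a + ε)⁻¹ := by
      rw [← ofReal_norm, hr, Complex.norm_real, Real.norm_of_nonneg (inv_nonneg.2 hpos.le)]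
    have e1 : classicalGrad (bdryDir n) (r • φ) = r • classicalGrad (bdryDir n) φ :=
      funext fun x => classicalGrad_smul _ _ r (differentiable_test φ x)
    have h1 : eLpNorm (classicalGrad (bdryDir n) (r • φ)) (ofReal q.conjExponent) volume ≤ 1 := by
      rw [hpq.symm.conjExponent_eq, e1, eLpNorm_const_smul, hrn, ← ENNReal.ofReal_toReal hafin,
        ← ha, ← ENNReal.ofReal_mul (inv_nonneg.2 hpos.le), ← ENNReal.ofReal_one]
      refine ENNReal.ofReal_le_ofReal ?_
      rw [inv_mul_le_one₀ hpos]
      linarith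
    have h2 : ‖T (r • φ)‖ₑ ≤ T.negSobolevNorm q :=
      le_iSup₂_of_le (f := fun (φ : 𝓓((⊤ : Opens (Bdry n)), EuclideanSpace ℂ ι))
        (_ : eLpNorm (classicalGrad (bdryDir n) φ) (ofReal q.conjExponent) volume ≤ 1) =>
        ‖T φ‖ₑ) (r • φ) h1 le_rfl
    have h3 := ENNReal.toReal_mono hT h2
    rw [toReal_enorm, map_smulₛₗ, norm_smul, RCLike.norm_conj, hr, Complex.norm_real,
      Real.norm_of_nonneg (inv_nonneg.2 hpos.le), ← hN, inv_mul_le_iff₀ hpos] at h3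
    linarith
  have hlim : Tendsto (fun ε : ℝ => N * (a + ε)) (𝓝[>] 0) (𝓝 (N * a)) := by
    have : Continuous fun ε : ℝ => N * (a + ε) := by fun_prop
    have h := (this.tendsto 0).mono_left (nhdsWithin_le_nhds (s := Ioi 0))
    simpa using h
  exact ge_of_tendsto hlim (by filter_upwards [self_mem_nhdsWithin] with ε hε using key ε hε)

theorem BdryDistribution.grad_ofFun_apply {f : Bdry n → EuclideanSpace ℂ ι}
    (hf : LocallyIntegrable f volume) (φ : 𝓓((⊤ : Opens (Bdry n)), EuclideanSpace ℂ (ι × Fin n))) :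
    (BdryDistribution.ofFun f).grad φ = - ∫ x, inner ℂ (divTest n ι φ x) (f x) := by
  rw [← BdryDistribution.ofFun_apply hf]
  rfl

theorem re_grad_ofFun_apply {f : Bdry n → EuclideanSpace ℂ ι} (hf : LocallyIntegrable f volume)
    (φ : 𝓓((⊤ : Opens (Bdry n)), EuclideanSpace ℂ (ι × Fin n))) :
    ((BdryDistribution.ofFun f).grad φ).re = - ∑ c, ∑ l, ∫ x,
      fderiv ℝ (fun x => coord ((c.1, l), c.2) (φ x)) x (bdryDir n l) * coord c (f x) := by
  rw [BdryDistribution.grad_ofFun_apply hf, Complex.neg_re,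
    re_integral_inner (integrable_coord_mul_test hf _)]
  congr 1
  refine Finset.sum_congr rfl fun c _ => ?_
  simp only [coord_divTest, Finset.sum_mul]
  refine integral_finsetSum _ fun l _ => ?_
  have h1 : LocallyIntegrable (fun x => coord c (f x)) volume := by
    rw [locallyIntegrable_iff]
    intro K hK
    exact (coord c).integrable_comp (hf.integrableOn_isCompact hK)
  exact testFun_integrable_mul (locallyIntegrableOn_univ.2 h1)
    (testFun_fderiv (testFun_coord φ ((c.1, l), c.2)) _)

/-- The test function with a single nonzero real coordinate. -/
noncomputable def singleTest (d : ι × Bool) {ψ : Bdry n → ℝ} (hψ : ψ ∈ 𝓣[Bdry n]) :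
    𝓓((⊤ : Opens (Bdry n)), EuclideanSpace ℂ ι) :=
  testOfCoord (Ω := ⊤) (ψ := fun c => if c = d then ψ else 0) fun c => by
    split_ifs
    · exact hψ
    · exact Submodule.zero_mem _

theorem coord_singleTest (d c : ι × Bool) {ψ : Bdry n → ℝ} (hψ : ψ ∈ 𝓣[Bdry n]) :
    (fun x => coord c (singleTest d hψ x)) = if c = d then ψ else 0 :=
  funext fun x => coord_testOfCoord (Ω := ⊤) _ c x

theorem eLpNorm_singleTest (d : ι × Bool) {ψ : Bdry n → ℝ} (hψ : ψ ∈ 𝓣[Bdry n]) (r : ℝ≥0∞) :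
    eLpNorm (singleTest d hψ) r volume = eLpNorm ψ r volume := by
  refine eLpNorm_congr_norm_ae (.of_forall fun x => ?_)
  have h : singleTest d hψ x = ψ x • realBasis d := by
    rw [← sum_coord (singleTest d hψ x), Finset.sum_eq_single d]
    · rw [show coord d (singleTest d hψ x) = ψ x by
        have := congrFun (coord_singleTest d d hψ) x
        simpa using this]
    · intro c _ hc
      have := congrFun (coord_singleTest d c hψ) x
      simp only [if_neg hc, Pi.zero_apply] at this
      rw [this, zero_smul]
    · simp
  rw [h, norm_smul, norm_realBasis, mul_one]

theorem toReal_eLpNorm_grad_singleTest_le (d : ι × Bool) {ψ : Bdry n → ℝ}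
    (hψ : ψ ∈ 𝓣[Bdry n]) {r : ℝ≥0∞} (hr : 1 ≤ r) :
    (eLpNorm (classicalGrad (bdryDir n) (singleTest d hψ)) r volume).toReal ≤
      ∑ l, (eLpNorm 𝐃[ψ,bdryDir n l] r volume).toReal := by
  refine (toReal_eLpNorm_boundaryGrad_le _ hr).trans (le_of_eq ?_)
  rw [Finset.sum_eq_single d]
  · simp only [coord_singleTest, if_true]
  · intro c _ hc
    simp only [coord_singleTest, if_neg hc]
    refine Finset.sum_eq_zero fun l _ => ?_
    have : (fun x : Bdry n => fderiv ℝ (0 : Bdry n → ℝ) x (bdryDir n l)) = 0 := by ext x; simp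
    rw [this]; simp
  · simp

theorem re_grad_ofFun_singleTest {f : Bdry n → EuclideanSpace ℂ ι}
    (hf : LocallyIntegrable f volume) (c : ι × Bool) (l : Fin n) {ψ : Bdry n → ℝ}
    (hψ : ψ ∈ 𝓣[Bdry n]) : ((BdryDistribution.ofFun f).grad (singleTest ((c.1, l), c.2) hψ)).re =
      - ∫ x, fderiv ℝ ψ x (bdryDir n l) * coord c (f x) := by
  rw [re_grad_ofFun_apply hf, Finset.sum_eq_single c, Finset.sum_eq_single l]
  · simp only [coord_singleTest, if_true]
  · intro j _ hj
    have : (((c.1, j), c.2) : (ι × Fin n) × Bool) ≠ ((c.1, l), c.2) := fun e => hj (by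
      simpa using e)
    simp only [coord_singleTest, if_neg this]
    simp
  · simp
  · intro d _ hd
    refine Finset.sum_eq_zero fun j _ => ?_
    have : (((d.1, j), d.2) : (ι × Fin n) × Bool) ≠ ((c.1, l), c.2) := fun e => hd (by
      simp only [Prod.mk.injEq] at e
      exact Prod.ext e.1.1 e.2)
    simp only [coord_singleTest, if_neg this]
    simp
  · simp

/-- A distributional gradient that is given by a function, in real coordinates. -/
theorem grad_ofFun_eq_iff {f : Bdry n → EuclideanSpace ℂ ι}
    {F : Bdry n → EuclideanSpace ℂ (ι × Fin n)} (hf : LocallyIntegrable f volume)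
    (hF : LocallyIntegrable F volume) : BdryDistribution.ofFun F = (BdryDistribution.ofFun f).grad ↔
      ∀ (c : ι × Bool) (l : Fin n), ∀ ψ ∈ 𝓣[Bdry n],
        ∫ x, fderiv ℝ ψ x (bdryDir n l) * coord c (f x) =
          - ∫ x, ψ x * coord ((c.1, l), c.2) (F x) := by
  have hre : ∀ φ, (BdryDistribution.ofFun F φ).re = ∑ c : ι × Bool, ∑ l,
      ∫ x, coord ((c.1, l), c.2) (φ x) * coord ((c.1, l), c.2) (F x) := fun φ => by
    rw [BdryDistribution.ofFun_apply hF, re_integral_inner (integrable_coord_mul_test hF φ),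
      sum_boundaryField]
  constructor
  · intro h c l ψ hψ
    have h1 := hre (singleTest ((c.1, l), c.2) hψ)
    rw [h, re_grad_ofFun_singleTest hf, ← sum_boundaryField
      (fun d => ∫ x, coord d (singleTest ((c.1, l), c.2) hψ x) * coord d (F x)),
      Finset.sum_eq_single ((c.1, l), c.2)] at h1
    · have e := congrFun (coord_singleTest ((c.1, l), c.2) ((c.1, l), c.2) hψ)
      simp only [if_true] at e
      simp only [e] at h1
      linarith
    · intro d _ hd
      have e := congrFun (coord_singleTest ((c.1, l), c.2) d hψ)
      simp only [if_neg hd] at e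
      simp [e]
    · simp
  · intro h
    have key : ∀ φ, (BdryDistribution.ofFun F φ).re = ((BdryDistribution.ofFun f).grad φ).re := by
      intro φ
      rw [hre, re_grad_ofFun_apply hf, ← Finset.sum_neg_distrib]
      refine Finset.sum_congr rfl fun c _ => ?_
      rw [← Finset.sum_neg_distrib]
      refine Finset.sum_congr rfl fun l _ => ?_
      rw [h c l _ (testFun_coord φ _), neg_neg]
    -- Real parts agree on every test function; applying this to iφ and using conjugate linearity
    -- gives the imaginary parts.
    ext φ
    have h2 := key (Complex.I • φ)
    rw [map_smulₛₗ, map_smulₛₗ] at h2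
    apply Complex.ext (key φ)
    simpa using h2

/-- Integration by parts on the boundary. -/
theorem integral_inner_divTest (g : 𝓓((⊤ : Opens (Bdry n)), EuclideanSpace ℂ ι))
    (φ : 𝓓((⊤ : Opens (Bdry n)), EuclideanSpace ℂ (ι × Fin n))) :
    ∫ x, inner ℂ (divTest n ι φ x) (g x) =
      - ∫ x, inner ℂ (φ x) (classicalGrad (bdryDir n) g x) := by
  have hF : LocallyIntegrable (classicalGrad (bdryDir n) g) volume :=
    (memLp_boundaryGrad g 1).locallyIntegrable le_rfl
  have h := (grad_ofFun_eq_iff g.continuous.locallyIntegrable hF).2 fun c l ψ hψ => by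
    simp only [coord_boundaryGrad]
    exact integral_fderiv_mul_test hψ (testFun_coord g c) _
  have h1 := DFunLike.congr_fun h φ
  rw [BdryDistribution.ofFun_apply hF,
    BdryDistribution.grad_ofFun_apply g.continuous.locallyIntegrable] at h1
  rw [h1, neg_neg]

/-- Integration by parts moves the divergence to the gradient of the test function; Hölder's
inequality then uses exactly the norm that defines Ẇ^{1,p}. -/
theorem BdryDistribution.negSobolevNorm_divTest_le (hpq : p.HolderConjugate q)
    (φ : 𝓓((⊤ : Opens (Bdry n)), EuclideanSpace ℂ (ι × Fin n))) :
    (BdryDistribution.ofFun (divTest n ι φ)).negSobolevNorm q ≤ eLpNorm φ (ofReal q) volume := by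
  refine iSup₂_le fun g hg => ?_
  rw [hpq.symm.conjExponent_eq] at hg
  have e : BdryDistribution.ofFun (divTest n ι φ) g =
      - ∫ x, inner ℂ (classicalGrad (bdryDir n) g x) (φ x) := by
    rw [BdryDistribution.ofFun_apply (divTest n ι φ).continuous.locallyIntegrable]
    have h1 := congrArg conj (integral_inner_divTest g φ)
    rw [map_neg, ← integral_conj, ← integral_conj] at h1
    simpa only [inner_conj_symm] using h1
  have h2 := norm_integral_inner_le hpq (memLp_boundaryGrad g (ofReal p)) (memLp_test φ (ofReal q))
  have hfin := (memLp_test φ (ofReal q)).eLpNorm_ne_top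
  rw [e, enorm_neg, ← ofReal_norm, ENNReal.ofReal_le_iff_le_toReal hfin]
  refine h2.trans (mul_le_of_le_one_left ENNReal.toReal_nonneg ?_)
  exact ENNReal.toReal_le_of_le_ofReal zero_le_one (by simpa using hg)

end BoundaryDistributions

/-! ### Bounds for the mutual energy of two functions. -/

section Duality

variable {n m : ℕ} {p p' : ℝ}

theorem one_le_ofReal (hp : p.HolderConjugate p') : (1 : ℝ≥0∞) ≤ ofReal p := by
  rw [← ENNReal.ofReal_one]
  exact ENNReal.ofReal_le_ofReal hp.lt.le

theorem setIntegral_sesqForm_conjTranspose (A : Coeff n m) (F G : Full n → ℂᴳ[m,n]) :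
    ∫ z in ℍ[n], sesqForm (A z)ᴴ (F z) (G z) = conj (∫ z in ℍ[n], sesqForm (A z) (G z) (F z)) := by
  rw [← integral_conj]
  simp only [sesqForm_conjTranspose]

/-- If the conormal derivative of `w` is in the negative Sobolev space and the trace of `u` has
its gradient in `L^p`, then the pairing of `w` and `u` is bounded by the product of the norms. -/
theorem norm_pairing_le_of_negSobolev (hn : 1 ≤ n) (hp : p.HolderConjugate p') {A : Coeff n m}
    (hA : IsBoundedMeasurable A) {w u : Full n → ℂᵛ[m]}
    {F G : Full n → ℂᴳ[m,n]} {T : BdryDistribution n (Fin m)}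
    (hw : IsEnergyFunction w F) (hT : IsConormalDerivative A F T)
    (hTn : T.negSobolevNorm p' ≠ ⊤) (hu : IsEnergyFunction u G)
    {u₀ : Bdry n → ℂᵛ[m]} (hu₀ : IsTrace u u₀)
    {f : Bdry n → EuclideanSpace ℂ (Fin m × Fin n)} (hf : MemLp f (ofReal p) volume)
    (hfu : BdryDistribution.ofFun f = (BdryDistribution.ofFun u₀).grad) :
    ‖∫ z in ℍ[n], sesqForm (A z) (F z) (G z)‖ ≤
      (T.negSobolevNorm p').toReal * ∑ _c : Fin m × Bool, ∑ _l : Fin n, 2 * 𝐍[f,p,volume] := by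
  set N := (T.negSobolevNorm p').toReal with hN
  have hfl : LocallyIntegrable f volume := hf.locallyIntegrable (one_le_ofReal hp)
  have hweak := (grad_ofFun_eq_iff hu₀.locallyIntegrable hfl).1 hfu
  have hfc : ∀ (c : Fin m × Bool) (l : Fin n),
      MemLp (fun x => coord ((c.1, l), c.2) (f x)) (ofReal p) volume :=
    fun c l => memLp_iff_coord.1 hf _
  -- The constants depend on the translation j but come with the factor 1/(k+1); they form the error
  -- that vanishes in the cutoff limit.
  choose C hC hCb using fun (j : ℕ) (c : Fin m × Bool) => exists_eLpNorm_fderiv_approxTrace_le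
    hp.symm (hu₀.memLp_coord c) (F := fun l x => coord ((c.1, l), c.2) (f x)) (hfc c) (hweak c)
    (farPoint hn j).2
  simp only [sesqForm_eq_inner]
  refine norm_integral_inner_le_of_approx hn hu hu₀ (memLp_matApply hA hw.memLp_grad)
    (E := fun j k => N * ∑ c : Fin m × Bool, ∑ _l : Fin n, (C j c).toReal * ((k : ℝ) + 1)⁻¹)
    (fun j => ?_) fun j k ρ hρ hρ0 hρp φ Φ g hφ hg hgc => ?_
  · have h1 : Tendsto (fun k : ℕ => ((k : ℝ) + 1)⁻¹) atTop (𝓝 0) := by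
      simpa [one_div] using tendsto_one_div_add_atTop_nhds_zero_nat (𝕜 := ℝ)
    have h2 := (tendsto_finsetSum (Finset.univ : Finset (Fin m × Bool)) fun c _ =>
      tendsto_finsetSum (Finset.univ : Finset (Fin n)) fun _ _ =>
        h1.const_mul (C j c).toReal).const_mul N
    simpa using h2
  · simp only [← sesqForm_eq_inner]
    -- The trace g is a test function, so the definition of the conormal derivative applies,
    -- followed by its bound on Ẇ^{1,p}.
    rw [hT φ Φ g hφ hg, norm_neg, ← mul_add, ← Finset.sum_add_distrib]
    refine (BdryDistribution.norm_apply_le hp hTn g).trans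
      (mul_le_mul_of_nonneg_left ?_ ENNReal.toReal_nonneg)
    refine (toReal_eLpNorm_boundaryGrad_le g (one_le_ofReal hp)).trans
      (Finset.sum_le_sum fun c _ => ?_)
    rw [← Finset.sum_add_distrib]
    refine Finset.sum_le_sum fun l _ => ?_
    have h1 := hCb j c k ρ hρ hρ0 hρp l
    rw [← hgc c] at h1
    have h2 : 2 * eLpNorm (fun x => coord ((c.1, l), c.2) (f x)) (ofReal p) volume +
        C j c * ofReal ((k : ℝ) + 1)⁻¹ ≤ 2 * eLpNorm f (ofReal p) volume +
        C j c * ofReal ((k : ℝ) + 1)⁻¹ := by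
      gcongr
      exact eLpNorm_coord_le f _ ((c.1, l), c.2)
    have hfin1 : 2 * eLpNorm f (ofReal p) volume ≠ ⊤ :=
      ENNReal.mul_ne_top (by simp) hf.eLpNorm_ne_top
    have hfin2 : C j c * ofReal ((k : ℝ) + 1)⁻¹ ≠ ⊤ :=
      ENNReal.mul_ne_top (hC j c) ENNReal.ofReal_ne_top
    have h3 := ENNReal.toReal_mono (ENNReal.add_ne_top.2 ⟨hfin1, hfin2⟩) (h1.trans h2)
    rw [ENNReal.toReal_add hfin1 hfin2, ENNReal.toReal_mul, ENNReal.toReal_mul,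
      ENNReal.toReal_ofReal (by positivity)] at h3
    simpa using h3

/-- If the conormal derivative of `u` is in `L^p` and the gradient of the trace of `w` is in the
negative Sobolev space, then the pairing of `u` and `w` is bounded by the product of the
norms. -/
theorem exists_norm_pairing_le_of_memLp (hn : 1 ≤ n) (m : ℕ) (hp : p.HolderConjugate p') :
    ∃ C : ℝ, 0 ≤ C ∧ ∀ (A : Coeff n m), IsBoundedMeasurable A → ∀ (w u : Full n → ℂᵛ[m])
      (F G : Full n → ℂᴳ[m,n])
      (f : Bdry n → ℂᵛ[m]) (w₀ : Bdry n → ℂᵛ[m]) (M : ℝ),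
      IsEnergyFunction u G → MemLp f (ofReal p) volume →
      IsConormalDerivative A G (BdryDistribution.ofFun f) → IsEnergyFunction w F → IsTrace w w₀ →
      (BdryDistribution.ofFun w₀).grad.negSobolevNorm p' ≤ ofReal M → 0 ≤ M →
      ‖∫ z in ℍ[n], sesqForm (A z) (G z) (F z)‖ ≤ C * M * 𝐍[f,p,volume] := by
  obtain ⟨C, hC0, hC⟩ := exists_memLp_of_abs_integral_fderiv hn hp
  refine ⟨∑ _c : Fin m × Bool, C * 2, by positivity, ?_⟩
  intro A hA w u F G f w₀ M hu hf hT hw hw₀ hM hM0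
  have hfl : LocallyIntegrable f volume := hf.locallyIntegrable (one_le_ofReal hp)
  have hNtop : (BdryDistribution.ofFun w₀).grad.negSobolevNorm p' ≠ ⊤ :=
    ne_top_of_le_ne_top ENNReal.ofReal_ne_top hM
  have hNM : ((BdryDistribution.ofFun w₀).grad.negSobolevNorm p').toReal ≤ M :=
    ENNReal.toReal_le_of_le_ofReal hM0 hM
  -- the bound for the gradient of the trace, in real coordinates
  have h1 : ∀ (c : Fin m × Bool) (j : Fin n), ∀ ψ ∈ 𝓣[Bdry n],
      |∫ x, fderiv ℝ ψ x (bdryDir n j) * coord c (w₀ x)| ≤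
        M * ∑ l, 𝐍[𝐃[ψ,bdryDir n l],p,volume] := by
    intro c j ψ hψ
    have e := re_grad_ofFun_singleTest hw₀.locallyIntegrable c j hψ
    rw [← abs_neg, ← e]
    refine (Complex.abs_re_le_norm _).trans ((BdryDistribution.norm_apply_le hp hNtop _).trans ?_)
    exact mul_le_mul hNM (toReal_eLpNorm_grad_singleTest_le _ hψ (one_le_ofReal hp))
      ENNReal.toReal_nonneg hM0
  -- The trace of w is only locally square integrable, so the negative order inequality is applied
  -- to differences w₀ - w₀(· + y), which are in L². Both terms obey the same bound by translation
  -- invariance, hence 2M, independently of y.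
  have h2 : ∀ (c : Fin m × Bool) (y : Bdry n),
      MemLp (fun x => coord c (w₀ x) - coord c (w₀ (x + y))) (ofReal p') volume ∧
      eLpNorm (fun x => coord c (w₀ x) - coord c (w₀ (x + y))) (ofReal p') volume ≤
        ofReal (C * (2 * M)) := by
    intro c y
    have ht := isTracedEnergy_coord hw hw₀ c
    have hl := ht.locallyIntegrable_trace
    refine hC _ (2 * M) ((ht.sub (ht.translate y)).memLp_two
      (ht.1.memLp_sub_translate (y := (0, y)) le_rfl)) (by linarith) fun j ψ hψ => ?_
    have hψ' := testFun_fderiv hψ (bdryDir n j)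
    have hψy : (fun x => ψ (x + -y)) ∈ 𝓣[Bdry n] :=
      testFun_mono (subset_univ _) (testFun_translate hψ (-y))
    have e1 : ∫ x, fderiv ℝ ψ x (bdryDir n j) * coord c (w₀ (x + y)) =
        ∫ x, fderiv ℝ (fun x => ψ (x + -y)) x (bdryDir n j) * coord c (w₀ x) := by
      simp only [IsScalarEnergy.fderiv_comp_add]
      rw [← integral_add_right_eq_self
        (fun x => fderiv ℝ ψ (x + -y) (bdryDir n j) * coord c (w₀ x)) y]
      simp only [add_neg_cancel_right]
    have e2 : ∀ l, eLpNorm 𝐃[fun x => ψ (x + -y),bdryDir n l] (ofReal p) volume =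
        eLpNorm 𝐃[ψ,bdryDir n l] (ofReal p) volume := by
      intro l
      simp only [IsScalarEnergy.fderiv_comp_add]
      exact eLpNorm_translate (f := 𝐃[ψ,bdryDir n l])
        (testFun_continuous (testFun_fderiv hψ (bdryDir n l))).aestronglyMeasurable (-y)
    have h3 := h1 c j ψ hψ
    have h4 := h1 c j _ hψy
    simp only [e2] at h4
    simp only [mul_sub]
    rw [integral_sub (testFun_integrable_mul (locallyIntegrableOn_univ.2 hl) hψ')
      (testFun_integrable_mul (locallyIntegrableOn_univ.2 (locallyIntegrable_translate hl y)) hψ'),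
      e1]
    refine (abs_sub _ _).trans ?_
    linarith
  simp only [sesqForm_eq_inner]
  refine norm_integral_inner_le_of_approx hn hw hw₀ (memLp_matApply hA hu.memLp_grad)
    (E := fun _ _ => 0) (fun _ => tendsto_const_nhds) fun j k ρ hρ hρ0 hρp φ Φ g hφ hg hgc => ?_
  simp only [← sesqForm_eq_inner]
  rw [hT φ Φ g hφ hg, norm_neg, add_zero, BdryDistribution.ofFun_apply hfl]
  refine (norm_integral_inner_le hp.symm (memLp_test g _) hf).trans
    (mul_le_mul_of_nonneg_right ?_ ENNReal.toReal_nonneg)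
  rw [Finset.sum_mul]
  have h5 : eLpNorm g (ofReal p') volume ≤ ∑ c : Fin m × Bool, ofReal (C * (2 * M)) := by
    refine (eLpNorm_le_sum_coord (one_le_ofReal hp.symm) (memLp_test g _)).trans
      (Finset.sum_le_sum fun c _ => ?_)
    rw [hgc c]
    exact (eLpNorm_approxTrace_le hp (h2 c _).1 k _).trans (h2 c _).2
  rw [← ENNReal.ofReal_sum_of_nonneg fun _ _ => by positivity] at h5
  refine (ENNReal.toReal_le_of_le_ofReal (by positivity) h5).trans (le_of_eq ?_)
  exact Finset.sum_congr rfl fun _ _ => by ring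

end Duality

/-! ### The two implications. -/

section Equivalence

variable {n m : ℕ} {p p' : ℝ} {A : Coeff n m}

theorem BdryDistribution.lpNorm_le {ι : Type} [Fintype ι] {F : Bdry n → EuclideanSpace ℂ ι}
    (hF : MemLp F (ofReal p) volume) :
    (BdryDistribution.ofFun F).lpNorm p ≤ eLpNorm F (ofReal p) volume :=
  iInf₂_le_of_le F ⟨hF, rfl⟩ le_rfl

/-- The Neumann estimate for `A` implies its dual estimate for the adjoint. -/
theorem dual_estimate_of_estimate (hn : 1 ≤ n) (hA : IsBoundedMeasurable A) (hG : StrongGarding A)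
    (hp : p.HolderConjugate p') {C : ℝ≥0} (h : ∀ (u : Full n → ℂᵛ[m]) (G : Full n → ℂᴳ[m,n])
        (u₀ : Bdry n → ℂᵛ[m]) (T : BdryDistribution n (Fin m)),
        IsEnergySolution A u G → IsTrace u u₀ → IsConormalDerivative A G T →
          (BdryDistribution.ofFun u₀).grad.lpNorm p ≤ C * T.lpNorm p) :
    ∃ C : ℝ≥0, ∀ (w : Full n → ℂᵛ[m]) (G : Full n → ℂᴳ[m,n])
        (w₀ : Bdry n → ℂᵛ[m]) (T : BdryDistribution n (Fin m)),
        IsEnergySolution (fun z => (A z)ᴴ) w G → IsTrace w w₀ →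
          IsConormalDerivative (fun z => (A z)ᴴ) G T →
          (BdryDistribution.ofFun w₀).grad.negSobolevNorm p' ≤ C * T.negSobolevNorm p' := by
  -- The summand 1 makes the bound on the Lᵖ norm of ∇u₀ strict, so that the infimum defining it is
  -- realised by a function with norm below D. The summand 1 in K below keeps K nonzero, so that K ·
  -- ∞ = ∞ when the right side is infinite.
  set D : ℝ≥0 := C * (Fintype.card ((Fin m × Fin n) × Bool) : ℝ≥0) + 1 with hD
  set K : ℝ≥0 := (∑ _c : Fin m × Bool, ∑ _l : Fin n, 2 * D) + 1 with hK
  refine ⟨K, fun w F w₀ T hw hw₀ hT => ?_⟩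
  rcases eq_or_ne (T.negSobolevNorm p') ⊤ with htop | htop
  · rw [htop, ENNReal.mul_top (by simp [hK])]
    exact le_top
  refine iSup₂_le fun φ hφ => ?_
  rw [hp.symm.conjExponent_eq] at hφ
  obtain ⟨u, G, u₀, hu, hu₀, hTu, hpair⟩ := exists_neumann_solution hn hA hG φ
  have h1 := h u G u₀ _ hu hu₀ hTu
  have h2 : (BdryDistribution.ofFun u₀).grad.lpNorm p < D := by
    refine lt_of_le_of_lt ?_ (show ((C * (Fintype.card ((Fin m × Fin n) × Bool) : ℝ≥0) : ℝ≥0) :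
      ℝ≥0∞) < D by rw [ENNReal.coe_lt_coe]; exact lt_add_one _)
    refine h1.trans ?_
    rw [ENNReal.coe_mul]
    gcongr
    refine (BdryDistribution.lpNorm_le (memLp_test _ _)).trans
      ((eLpNorm_divTest_le φ (one_le_ofReal hp)).trans ?_)
    rw [nsmul_eq_mul]
    exact (mul_le_mul_right hφ _).trans (by simp)
  obtain ⟨f, hf⟩ := iInf_lt_iff.1 h2
  obtain ⟨⟨hfm, hfu⟩, hfn⟩ := iInf_lt_iff.1 hf
  have hb := norm_pairing_le_of_negSobolev hn hp hA.conjTranspose hw.energy hT htop hu.energy hu₀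
    hfm hfu
  -- The mutual energy is evaluated a second time, now by the Neumann problem solved by u, which
  -- turns it into the pairing of w₀ with div φ.
  rw [setIntegral_sesqForm_conjTranspose, RCLike.norm_conj, hpair w F w₀ hw.energy hw₀,
    norm_neg] at hb
  have e : ‖(BdryDistribution.ofFun w₀).grad φ‖ =
      ‖∫ x, inner ℂ (w₀ x) (divTest n (Fin m) φ x)‖ := by
    rw [BdryDistribution.grad_ofFun_apply hw₀.locallyIntegrable, norm_neg, ← RCLike.norm_conj,
      ← integral_conj]
    simp only [inner_conj_symm]
  rw [← e] at hb
  have hfD : 𝐍[f,p,volume] ≤ D :=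
    ENNReal.toReal_le_of_le_ofReal D.coe_nonneg (by simpa using hfn.le)
  have hsum : ∑ _c : Fin m × Bool, ∑ _l : Fin n, 2 * 𝐍[f,p,volume] ≤ (K : ℝ) := by
    rw [hK]
    push_cast
    refine le_add_of_le_of_nonneg (Finset.sum_le_sum fun _ _ => Finset.sum_le_sum fun _ _ => ?_)
      zero_le_one
    gcongr
  have hfin := hb.trans (mul_le_mul_of_nonneg_left hsum ENNReal.toReal_nonneg)
  rw [← ofReal_norm]
  refine (ENNReal.ofReal_le_ofReal hfin).trans (le_of_eq ?_)
  rw [ENNReal.ofReal_mul ENNReal.toReal_nonneg, ENNReal.ofReal_toReal htop, mul_comm,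
    ENNReal.ofReal_coe_nnreal]

/-- The dual estimate for the adjoint of `A` implies the Neumann estimate for `A`. -/
theorem estimate_of_dual_estimate (hn : 1 ≤ n) (hA : IsBoundedMeasurable A) (hG : StrongGarding A)
    (hp : p.HolderConjugate p') {C : ℝ≥0} (h : ∀ (w : Full n → ℂᵛ[m]) (G : Full n → ℂᴳ[m,n])
        (w₀ : Bdry n → ℂᵛ[m]) (T : BdryDistribution n (Fin m)),
        IsEnergySolution (fun z => (A z)ᴴ) w G → IsTrace w w₀ →
          IsConormalDerivative (fun z => (A z)ᴴ) G T →
          (BdryDistribution.ofFun w₀).grad.negSobolevNorm p' ≤ C * T.negSobolevNorm p') :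
    ∃ C : ℝ≥0, ∀ (u : Full n → ℂᵛ[m]) (G : Full n → ℂᴳ[m,n])
        (u₀ : Bdry n → ℂᵛ[m]) (T : BdryDistribution n (Fin m)),
        IsEnergySolution A u G → IsTrace u u₀ → IsConormalDerivative A G T →
          (BdryDistribution.ofFun u₀).grad.lpNorm p ≤ C * T.lpNorm p := by
  obtain ⟨K, hK0, hK⟩ := exists_norm_pairing_le_of_memLp hn m hp
  set L : ℝ≥0 := Real.toNNReal K * C with hL
  have hLr : (L : ℝ) = K * C := by rw [hL, NNReal.coe_mul, Real.coe_toNNReal K hK0]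
  -- R must be nonzero and finite to be moved inside the infimum defining the Lᵖ norm of the
  -- conormal derivative; the summand 1 ensures this in all cases.
  set R : ℝ≥0 := (∑ _d : (Fin m × Fin n) × Bool, L) + 1 with hR
  have hR0 : (R : ℝ≥0∞) ≠ 0 := by simp [hR]
  refine ⟨R, fun u G u₀ T hu hu₀ hT => ?_⟩
  rw [BdryDistribution.lpNorm, BdryDistribution.lpNorm,
    ENNReal.mul_iInf_of_ne hR0 ENNReal.coe_ne_top]
  refine le_iInf fun f => ?_
  rw [ENNReal.mul_iInf_of_ne hR0 ENNReal.coe_ne_top]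
  refine le_iInf fun hf => ?_
  obtain ⟨hf, rfl⟩ := hf
  set a := 𝐍[f,p,volume] with ha
  have ha0 : 0 ≤ a := ENNReal.toReal_nonneg
  have hl := hu₀.locallyIntegrable
  have hlc : ∀ c, LocallyIntegrable (fun x => coord c (u₀ x)) volume := fun c =>
    (isTracedEnergy_coord hu.energy hu₀ c).locallyIntegrable_trace
  have key : ∀ (c : Fin m × Bool) (l : Fin n), ∀ ψ ∈ 𝓣[Bdry n],
      |∫ x, fderiv ℝ ψ x (bdryDir n l) * coord c (u₀ x)| ≤ (L * a) * 𝐍[ψ,p',volume] := by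
    intro c l ψ hψ
    set φ := singleTest ((c.1, l), c.2) hψ with hφ
    -- The dual problem: datum div φ, where φ carries ψ in one real coordinate. By assumption the
    -- gradient of its trace is bounded in Ẇ^{-1,p'} by C ‖ψ‖_{p'}.
    obtain ⟨w, F, w₀, hw, hw₀, hTw, hpair⟩ :=
      exists_neumann_solution hn hA.conjTranspose hG.conjTranspose φ
    have hψfin := (testFun_memLp (μ := (volume : Measure (Bdry n))) hψ (ofReal p')).eLpNorm_ne_top
    have h1 : (BdryDistribution.ofFun w₀).grad.negSobolevNorm p' ≤ ofReal (C * 𝐍[ψ,p',volume]) := by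
      refine (h w F w₀ _ hw hw₀ hTw).trans ?_
      rw [ENNReal.ofReal_mul C.coe_nonneg, ENNReal.ofReal_coe_nnreal, ENNReal.ofReal_toReal hψfin,
        ← eLpNorm_singleTest ((c.1, l), c.2) hψ]
      gcongr
      exact BdryDistribution.negSobolevNorm_divTest_le hp φ
    have h2 := hK A hA w u F G f w₀ _ hu.energy hf hT hw.energy hw₀ h1 (by positivity)
    have h3 := hpair u G u₀ hu.energy hu₀
    rw [setIntegral_sesqForm_conjTranspose] at h3
    rw [← RCLike.norm_conj, h3, norm_neg] at h2
    have e := re_grad_ofFun_singleTest hl c l hψ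
    have e2 : ‖(BdryDistribution.ofFun u₀).grad φ‖ =
        ‖∫ x, inner ℂ (u₀ x) (divTest n (Fin m) φ x)‖ := by
      rw [BdryDistribution.grad_ofFun_apply hl, norm_neg, ← RCLike.norm_conj, ← integral_conj]
      simp only [inner_conj_symm]
    rw [← abs_neg, ← e]
    refine (Complex.abs_re_le_norm _).trans ?_
    rw [← hφ, e2]
    refine h2.trans (le_of_eq ?_)
    rw [hLr]
    ring
  have hrep : ∀ d : (Fin m × Fin n) × Bool, ∃ g : Bdry n → ℝ, MemLp g (ofReal p) volume ∧
      eLpNorm g (ofReal p) volume ≤ ofReal (L * a) ∧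
      ∀ ψ ∈ 𝓣[Bdry n],
        ∫ x, fderiv ℝ ψ x (bdryDir n d.1.2) * coord (d.1.1, d.2) (u₀ x) = - ∫ x, ψ x * g x := by
    intro d
    have hint : ∀ ψ ∈ 𝓣[Bdry n], Integrable
        (fun x => fderiv ℝ ψ x (bdryDir n d.1.2) * coord (d.1.1, d.2) (u₀ x)) volume :=
      fun ψ hψ => testFun_integrable_mul (locallyIntegrableOn_univ.2 (hlc _)) (testFun_fderiv hψ _)
    -- The estimate `key` says that each coordinate of the distributional gradient of u₀ is a
    -- functional bounded in the L^{p'} norm on test functions. Riesz representation makes it a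
    -- function in Lᵖ with the same bound.
    let S : 𝓣[Bdry n] →ₗ[ℝ] ℝ :=
      { toFun := fun ψ =>
          - ∫ x, fderiv ℝ (ψ : Bdry n → ℝ) x (bdryDir n d.1.2) * coord (d.1.1, d.2) (u₀ x)
        map_add' := fun ψ η => by
          rw [← neg_add, ← integral_add (hint _ ψ.2) (hint _ η.2)]
          congr 1
          refine integral_congr_ae (.of_forall fun x => ?_)
          simp only [Submodule.coe_add]
          rw [fderiv_add (testFun_differentiable ψ.2 x) (testFun_differentiable η.2 x)]
          simp only [_root_.add_apply, add_mul]
        map_smul' := fun r ψ => by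
          rw [smul_eq_mul, RingHom.id_apply, mul_neg, ← integral_const_mul]
          congr 1
          refine integral_congr_ae (.of_forall fun x => ?_)
          simp only [Submodule.coe_smul]
          rw [fderiv_const_smul (testFun_differentiable ψ.2 x)]
          simp only [_root_.smul_apply, smul_eq_mul, mul_assoc] }
    obtain ⟨g, -, hg, hgn, hgS⟩ := exists_repr_of_test (μ := (volume : Measure (Bdry n))) hp.symm
      (mul_nonneg L.coe_nonneg ha0) S fun ψ => by
        have := key (d.1.1, d.2) d.1.2 ψ ψ.2
        rw [← abs_neg] at this
        exact this
    refine ⟨g, hg, hgn, fun ψ hψ => ?_⟩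
    have h4 := hgS ⟨ψ, hψ⟩
    have h5 : S ⟨ψ, hψ⟩ = - ∫ x, fderiv ℝ ψ x (bdryDir n d.1.2) * coord (d.1.1, d.2) (u₀ x) := rfl
    rw [h5] at h4
    linarith
  choose g hg hgn hgw using hrep
  set F : Bdry n → EuclideanSpace ℂ (Fin m × Fin n) := fun x => ∑ d, g d x • realBasis d with hF
  have hco : ∀ d x, coord d (F x) = g d x := fun d x => coord_sum_smul (fun d => g d x) d
  have hFm : MemLp F (ofReal p) volume := by
    refine memLp_iff_coord.2 fun d => ?_
    simp only [hco]
    exact hg d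
  have hFe : BdryDistribution.ofFun F = (BdryDistribution.ofFun u₀).grad := by
    refine (grad_ofFun_eq_iff hl (hFm.locallyIntegrable (one_le_ofReal hp))).2 fun c l ψ hψ => ?_
    simp only [hco]
    exact hgw ((c.1, l), c.2) ψ hψ
  refine iInf₂_le_of_le F ⟨hFm, hFe⟩ ?_
  refine (eLpNorm_le_sum_coord (one_le_ofReal hp) hFm).trans ?_
  simp only [hco]
  refine (Finset.sum_le_sum fun d _ => hgn d).trans ?_
  rw [ENNReal.ofReal_mul L.coe_nonneg, ENNReal.ofReal_coe_nnreal, ha,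
    ENNReal.ofReal_toReal hf.eLpNorm_ne_top, ← Finset.sum_mul]
  gcongr
  rw [hR]
  push_cast
  exact le_self_add

end Equivalence

theorem mainTheorem7 (n m : ℕ) (hn : 1 ≤ n) (A : Coeff n m)
    (hA : IsBoundedMeasurable A) (hG : StrongGarding A)
    (p p' : ℝ) (hp : p.HolderConjugate p') :
    (∃ C : ℝ≥0, ∀ (u : Full n → EuclideanSpace ℂ (Fin m))
        (G : Full n → EuclideanSpace ℂ (Fin m × Fin (n + 1)))
        (u₀ : Bdry n → EuclideanSpace ℂ (Fin m)) (T : BdryDistribution n (Fin m)),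
        IsEnergySolution A u G → IsTrace u u₀ → IsConormalDerivative A G T →
          (BdryDistribution.ofFun u₀).grad.lpNorm p ≤ C * T.lpNorm p) ↔
    (∃ C : ℝ≥0, ∀ (w : Full n → EuclideanSpace ℂ (Fin m))
        (G : Full n → EuclideanSpace ℂ (Fin m × Fin (n + 1)))
        (w₀ : Bdry n → EuclideanSpace ℂ (Fin m)) (T : BdryDistribution n (Fin m)),
        IsEnergySolution (fun z => (A z)ᴴ) w G → IsTrace w w₀ →
          IsConormalDerivative (fun z => (A z)ᴴ) G T →
          (BdryDistribution.ofFun w₀).grad.negSobolevNorm p' ≤ C * T.negSobolevNorm p') :=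
  ⟨fun ⟨_, h⟩ => dual_estimate_of_estimate hn hA hG hp h,
    fun ⟨_, h⟩ => estimate_of_dual_estimate hn hA hG hp h⟩
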